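/- Let $\mathcal R=\{R_1,\dots,R_n\}$, $n\ge 1$, be a set of $n$ distinct nonempty bounded intervals in $\mathbb R$, either all open or all closed, and let $x_i\in R_i$ be unknown true points, $X=\{x_1,\dots,x_n\}$ (as a labelled family; coinciding values are allowed). *Permutations and ambiguity.* For a permutation $\pi$ of $\mathcal R$, let $\Gamma^\pi_i$ be the set of all intervals that intersect $R_i$ and that precede or equal $R_i$ in $\pi$. $R_i$ is a *bottom interval* if $\Gamma_i^\pi=\{R_i\}$. The $\pi$-ambiguity is $A^\pi(\mathcal R)=\sum_i\log_2|\Gamma^\pi_i|$. The *depth* of $R_i$ is the length of a longest chain of intervals of $\mathcal R$ strictly containing $R_i$, and $m$ is one plus the maximal depth. The *level* of $R_i$ is $1$ if $R_i$ contains no other interval of $\mathcal R$, and $m-\mathrm{depth}(R_i)$ otherwise. The *level permutation* orders the intervals by increasing level, and within each level from right to left (by decreasing right endpoint). *The structure $\Xi$.* $\Xi$ consists of: a leaf-based Fibonacci tree $T$ (every inner node has a left subtree exactly one deeper than its right subtree, except that the lowest inner nodes have two leaves as children; this is an AVL-tree) whose leaves are, from left to right, the bottom intervals in sorted order followed by at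 most as many dummy leaves of value $\infty$, with decision keys, parent pointers, balances and a doubly linked list of the leaves; a pointer from each bottom interval to its leaf; an anchor pointer for each non-bottom interval $R$, namely to the interval preceding $R$ in $\pi$ if $R$ has level $1$, and to an arbitrary interval of $\mathcal R$ strictly contained in $R$ otherwise; and the list of the non-bottom intervals in the order $\pi$. *Model.* Time is counted on a comparison-based random access machine: a fixed finite program over integer variables and an integer memory, with addition, truncated subtraction, halving and integer comparison, in which the reals (endpoints of the intervals and, in the reconstruction phase only, the points) are kept in read-only arrays and can only be compared with each other; every elementary operation, assignment and test takes unit time. *An AVL-tree on $X$* is a leaf-based AVL-tree in memory whose leaves are, from left to right, all points of $X$ in sorted (nondecreasing) order, followed by at most $n$ dummy leaves of value $\infty$, and whose inner nodes store as key the largest leaf of their left subtree. **Theorem.** For any finite set of intervals as above (also for $n=0$), the level permutation exists and is unique. Moreover, for $n\ge 1$ and $\pi$ the level permutation of $\mathcal R$: 1. (Preprocessing.) There are a program and a constant $C$ such that for every $\mathcal R$, without access to $X$, the program constructs a structure $\Xi$ of size at most $Cn$ in time at most $C(n\log_2 n+1)$. 2. (Reconstruction.) There are a program and a constant $C$ such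 that for every $\mathcal R$, given any structure $\Xi$ of $\mathcal R$ as above, for all points $x_i\in R_i$ the program constructs an AVL-tree on $X$ in time at most $C\,(A^\pi(\mathcal R)+1)$. 3. (Tightness.) There is a constant $c>0$ such that the following holds for every $\mathcal R$; if the intervals are closed, assume in addition that no right endpoint of an interval is the left endpoint of a different interval. For every program and every initial memory contents that does not depend on $X$ (any auxiliary structure), if the program constructs an AVL-tree on $X$ for all choices of points $x_i\in R_i$, then for some choice of points it takes time at least $c\,A^\pi(\mathcal R)$. Since $A^\pi(\mathcal R)\ge 1$ whenever $A^\pi(\mathcal R)\ne 0$, the worst-case reconstruction time is thus $\Theta(A^\pi(\mathcal R))$, and it is $O(1)$ if $A^\pi(\mathcal R)=0$. (The consequence in this last sentence assumes, for closed intervals, the condition in 3.) -/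

import Mathlib

namespace ImpreciseSort

/-! ### Intervals, processing permutations, contact sets, ambiguity -/

/-- Whether the intervals under consideration are open or closed. -/
inductive IntervalKind where
  | isOpen
  | isClosed

/-- The interval of the given kind with endpoints `a` and `b`. -/
def IntervalKind.toSet : IntervalKind → ℝ → ℝ → Set ℝ
  | .isOpen, a, b => Set.Ioo a b
  | .isClosed, a, b => Set.Icc a b

/-- A set of `n` (pairwise distinct, nonempty) intervals, listed in arbitrary order. -/
structure IntervalSet (κ : IntervalKind) (n : ℕ) where
  left : Fin n → ℝ
  right : Fin n → ℝ
  nonempty : ∀ i, (κ.toSet (left i) (right i)).Nonempty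
  distinct : Function.Injective fun i => κ.toSet (left i) (right i)

variable {κ : IntervalKind} {n : ℕ}

/-- The `i`-th interval, as a set of reals. -/
def IntervalSet.region (R : IntervalSet κ n) (i : Fin n) : Set ℝ :=
  κ.toSet (R.left i) (R.right i)

/-- `x` is a possible set of true points: `x i` lies in the `i`-th interval. -/
def IntervalSet.Realizes (R : IntervalSet κ n) (x : Fin n → ℝ) : Prop :=
  ∀ i, x i ∈ R.region i

/-- If the intervals are closed, no right endpoint of an interval is the left endpoint of
another one (no condition on open intervals). -/
def IntervalSet.NoTouching (R : IntervalSet κ n) : Prop :=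
  κ = .isClosed → ∀ i j, i ≠ j → R.right i ≠ R.left j

/-- A processing permutation is given by `π : Equiv.Perm (Fin n)`, where `π i` is the position
of the `i`-th interval.  The contact set of an interval: the intervals that precede it in `π`,
or are equal to it, and that intersect it. -/
noncomputable def contactSet (R : IntervalSet κ n) (π : Equiv.Perm (Fin n)) (i : Fin n) :
    Finset (Fin n) :=
  open Classical in
  Finset.univ.filter fun j => π j ≤ π i ∧ (R.region j ∩ R.region i).Nonempty

/-- A bottom interval is alone in its contact set. -/
def IsBottom (R : IntervalSet κ n) (π : Equiv.Perm (Fin n)) (i : Fin n) : Prop :=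
  contactSet R π i = {i}

/-- The `π`-ambiguity. -/
noncomputable def ambiguity (R : IntervalSet κ n) (π : Equiv.Perm (Fin n)) : ℝ :=
  ∑ i, Real.logb 2 ((contactSet R π i).card : ℝ)

/-! ### The level permutation -/

/-- A leaf of the containment graph: an interval that contains no other interval. -/
def IsContainmentLeaf (R : IntervalSet κ n) (i : Fin n) : Prop :=
  ∀ j, ¬ R.region j ⊂ R.region i

/-- The depth of an interval in the containment graph: the length of a longest chain of
intervals that strictly contain it (so the inclusion-maximal intervals have depth `0`). -/
noncomputable def depth (R : IntervalSet κ n) (i : Fin n) : ℕ :=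
  open Classical in
  ((Finset.univ : Finset (Finset (Fin n))).filter fun C : Finset (Fin n) =>
    (∀ j ∈ C, R.region i ⊂ R.region j) ∧
      IsChain (fun a b => R.region a ⊂ R.region b) (C : Set (Fin n))).sup Finset.card

/-- The number `m` of levels of the depth partition. -/
noncomputable def numLevels (R : IntervalSet κ n) : ℕ :=
  Finset.univ.sup (depth R) + 1

/-- The index `j` of the level `L_j` of the level partition that contains the interval: leaves
of the containment graph are in `L_1`, any other interval of depth `m - j` is in `L_j`. -/
noncomputable def level (R : IntervalSet κ n) (i : Fin n) : ℕ :=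
  open Classical in
  if IsContainmentLeaf R i then 1 else numLevels R - depth R i

/-- The level permutation: lower levels come first, and each level is ordered from right to
left. -/
def IsLevelPermutation (R : IntervalSet κ n) (π : Equiv.Perm (Fin n)) : Prop :=
  ∀ i j, (level R i < level R j ∨ (level R i = level R j ∧ R.right j < R.right i)) → π i < π j

/-- `a` is a valid anchor of the non-bottom interval `i`: the interval preceding `i` in `π` if
`i` is in the first level, an arbitrary interval contained in `i` otherwise. -/
def IsAnchor (R : IntervalSet κ n) (π : Equiv.Perm (Fin n)) (i a : Fin n) : Prop :=
  (level R i = 1 → (π a : ℕ) + 1 = π i) ∧ (level R i ≠ 1 → R.region a ⊂ R.region i)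

/-! ### A comparison-based random access machine

Programs are finite texts of a structured language over natural-number variables and an
addressable memory of natural numbers.  The real input values (endpoints and points) are stored
in three read-only arrays and can only be compared with each other.  Every elementary
operation, every assignment and every test costs one unit of time. -/

/-- The arrays of real input values: left endpoints, right endpoints, true points. -/
inductive Src where
  | left
  | right
  | point

/-- The contents of the three read-only input arrays. -/
abbrev Input := Src → ℕ → ℝ

/-- Contents of the variables and of the memory. -/
structure Store where
  var : ℕ → ℕ
  mem : ℕ → ℕ

/-- Integer expressions. -/
inductive Expr where
  | lit (k : ℕ)
  | var (v : ℕ)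
  | load (a : Expr)
  | add (a b : Expr)
  | sub (a b : Expr)
  | half (a : Expr)

def Expr.eval (σ : Store) : Expr → ℕ
  | .lit k => k
  | .var v => σ.var v
  | .load a => σ.mem (a.eval σ)
  | .add a b => a.eval σ + b.eval σ
  | .sub a b => a.eval σ - b.eval σ
  | .half a => a.eval σ / 2

/-- The number of elementary operations in an expression. -/
def Expr.cost : Expr → ℕ
  | .lit _ => 0
  | .var _ => 0
  | .load a => a.cost + 1
  | .add a b => a.cost + b.cost + 1
  | .sub a b => a.cost + b.cost + 1
  | .half a => a.cost + 1

/-- A test compares two integers, or two entries of the arrays of real input values. -/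
inductive Test where
  | le (a b : Expr)
  | less (s : Src) (a : Expr) (s' : Src) (b : Expr)

def Test.Holds (inp : Input) (σ : Store) : Test → Prop
  | .le a b => a.eval σ ≤ b.eval σ
  | .less s a s' b => inp s (a.eval σ) < inp s' (b.eval σ)

def Test.cost : Test → ℕ
  | .le a b => a.cost + b.cost + 1
  | .less _ a _ b => a.cost + b.cost + 1

/-- Programs. -/
inductive Cmd where
  | skip
  | assign (v : ℕ) (e : Expr)
  | write (a e : Expr)
  | seq (c d : Cmd)
  | ite (b : Test) (c d : Cmd)
  | loop (b : Test) (c : Cmd)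

/-- `Exec inp c σ σ' t`: on the real input values `inp`, the program `c` started in `σ`
terminates in `σ'` after exactly `t` units of time. -/
inductive Exec (inp : Input) : Cmd → Store → Store → ℕ → Prop where
  | skip (σ : Store) : Exec inp .skip σ σ 0
  | assign (v : ℕ) (e : Expr) (σ : Store) :
      Exec inp (.assign v e) σ ⟨Function.update σ.var v (e.eval σ), σ.mem⟩ (e.cost + 1)
  | write (a e : Expr) (σ : Store) :
      Exec inp (.write a e) σ ⟨σ.var, Function.update σ.mem (a.eval σ) (e.eval σ)⟩
        (a.cost + e.cost + 1)
  | seq {c d : Cmd} {σ σ₁ σ₂ : Store} {t₁ t₂ : ℕ} :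
      Exec inp c σ σ₁ t₁ → Exec inp d σ₁ σ₂ t₂ → Exec inp (.seq c d) σ σ₂ (t₁ + t₂)
  | ite_true {b : Test} {c d : Cmd} {σ σ' : Store} {t : ℕ} :
      b.Holds inp σ → Exec inp c σ σ' t → Exec inp (.ite b c d) σ σ' (b.cost + t)
  | ite_false {b : Test} {c d : Cmd} {σ σ' : Store} {t : ℕ} :
      ¬ b.Holds inp σ → Exec inp d σ σ' t → Exec inp (.ite b c d) σ σ' (b.cost + t)
  | loop_true {b : Test} {c : Cmd} {σ σ₁ σ₂ : Store} {t₁ t₂ : ℕ} :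
      b.Holds inp σ → Exec inp c σ σ₁ t₁ → Exec inp (.loop b c) σ₁ σ₂ t₂ →
        Exec inp (.loop b c) σ σ₂ (b.cost + t₁ + t₂)
  | loop_false {b : Test} {c : Cmd} {σ : Store} :
      ¬ b.Holds inp σ → Exec inp (.loop b c) σ σ b.cost

/-- A finite family as a zero-padded array. -/
def toArray (f : Fin n → ℝ) (k : ℕ) : ℝ :=
  if h : k < n then f ⟨k, h⟩ else 0

/-- The input of the reconstruction phase: the intervals and the true points. -/
def IntervalSet.fullInput (R : IntervalSet κ n) (x : Fin n → ℝ) : Input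
  | .left => toArray R.left
  | .right => toArray R.right
  | .point => toArray x

/-- The input of the preprocessing phase: only the intervals; the array of points is blank. -/
def IntervalSet.preInput (R : IntervalSet κ n) : Input :=
  R.fullInput fun _ => 0

/-- The start of the preprocessing phase: variable `0` holds `n`, everything else is zero. -/
def initStore (n : ℕ) : Store :=
  ⟨fun v => if v = 0 then n else 0, fun _ => 0⟩

/-! ### Leaf-based search trees in memory -/

/-- A leaf-based binary tree together with the memory addresses of its nodes.  Values are in the
leaves; the label of a leaf is the index of a point, or `n` for a dummy leaf (value `∞`). -/
inductive PTree where
  | leaf (addr label : ℕ)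
  | node (addr : ℕ) (l r : PTree)

namespace PTree

def addr : PTree → ℕ
  | leaf p _ => p
  | node p _ _ => p

/-- Height, which is `0` for a leaf. -/
def height : PTree → ℕ
  | leaf _ _ => 0
  | node _ l r => max l.height r.height + 1

/-- Leaf labels from left to right. -/
def labels : PTree → List ℕ
  | leaf _ a => [a]
  | node _ l r => l.labels ++ r.labels

/-- Label of the rightmost leaf. -/
def lastLabel : PTree → ℕ
  | leaf _ a => a
  | node _ _ r => r.lastLabel

/-- Leaf addresses from left to right. -/
def leafAddrs : PTree → List ℕ
  | leaf p _ => [p]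
  | node _ l r => l.leafAddrs ++ r.leafAddrs

/-- Pairs (address, label) of all leaves. -/
def leafEntries : PTree → List (ℕ × ℕ)
  | leaf p a => [(p, a)]
  | node _ l r => l.leafEntries ++ r.leafEntries

/-- Addresses of all nodes. -/
def addrs : PTree → List ℕ
  | leaf p _ => [p]
  | node p l r => p :: (l.addrs ++ r.addrs)

/-- The AVL condition. -/
def IsAVL : PTree → Prop
  | leaf _ _ => True
  | node _ l r => l.height ≤ r.height + 1 ∧ r.height ≤ l.height + 1 ∧ l.IsAVL ∧ r.IsAVL

/-- Fibonacci trees: at every inner node the left subtree is deeper by exactly one than the right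
subtree, except at the lowest inner nodes, whose two children are leaves. -/
def IsFibonacci : PTree → Prop
  | leaf _ _ => True
  | node _ l r => (l.height = r.height + 1 ∨ (l.height = 0 ∧ r.height = 0)) ∧
      l.IsFibonacci ∧ r.IsFibonacci

/-- The memory holds the tree.  Each node is a record that starts with a tag.  A leaf is tagged
`0` and followed by its label.  An inner (decision) node is tagged `1` and followed by its key,
which is the label of the largest leaf of its left subtree, and the addresses of its two
children. -/
def Stored (m : ℕ → ℕ) : PTree → Prop
  | leaf p a => m p = 0 ∧ m (p + 1) = a
  | node p l r => m p = 1 ∧ m (p + 1) = l.lastLabel ∧ m (p + 2) = l.addr ∧ m (p + 3) = r.addr ∧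
      l.Stored m ∧ r.Stored m

/-- Code of the balance of an inner node with the given subtrees: `0` for equal heights, `1` if
the left subtree is deeper, `2` if the right subtree is deeper. -/
def balanceCode (l r : PTree) : ℕ :=
  if l.height = r.height then 0 else if r.height < l.height then 1 else 2

/-- The parent pointers (field `4`) and the balances of the inner nodes (field `5`) are stored;
`q` is the address of the parent of the root. -/
def ParentsStored (m : ℕ → ℕ) : ℕ → PTree → Prop
  | q, leaf p _ => m (p + 4) = q
  | q, node p l r => m (p + 4) = q ∧ m (p + 5) = balanceCode l r ∧
      l.ParentsStored m p ∧ r.ParentsStored m p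

end PTree

/-- The leaves with the given addresses form a doubly linked list, with the address of the
predecessor in field `2` and the address of the successor in field `3` (`0` if there is none);
`q` is the predecessor of the first leaf. -/
def LinkedLeaves (m : ℕ → ℕ) : ℕ → List ℕ → Prop
  | _, [] => True
  | q, p :: ps => m (p + 2) = q ∧ m (p + 3) = ps.headD 0 ∧ LinkedLeaves m p ps

/-- Blocks `(start, length)` of memory are disjoint. -/
def DisjointBlocks (b c : ℕ × ℕ) : Prop :=
  b.1 + b.2 ≤ c.1 ∨ c.1 + c.2 ≤ b.1

/-- The memory blocks of the nodes of a tree: six cells each. -/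
def PTree.blocks (T : PTree) : List (ℕ × ℕ) :=
  T.addrs.map fun p => (p, 6)

/-- The root pointer (variable `1`) points to a leaf-based AVL-tree on the points `x`: its leaves
are, from left to right, all points in sorted order, and possibly (at most `n`) dummy leaves with
value `∞`. -/
def HoldsAVLTree (x : Fin n → ℝ) (σ : Store) : Prop :=
  ∃ (T : PTree) (ps : List (Fin n)) (d : ℕ),
    σ.var 1 = T.addr ∧ T.Stored σ.mem ∧ T.blocks.Pairwise DisjointBlocks ∧ T.IsAVL ∧
    T.labels = ps.map Fin.val ++ List.replicate d n ∧
    ps.Perm (List.finRange n) ∧ ps.Pairwise (fun i j => x i ≤ x j) ∧ d ≤ n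

/-- The store contains the auxiliary structure `Ξ` of the intervals for the permutation `π`.
Variables: `0` holds `n`, `1` the root of `T`, `2` the array of pointers from the bottom
intervals to their leaves, `3` the array of anchor pointers, `4` the array that lists the
non-bottom intervals in the order `π`, `5` the number of non-bottom intervals, `6` the first
address behind the structure. -/
def HoldsXi (R : IntervalSet κ n) (π : Equiv.Perm (Fin n)) (σ : Store) : Prop :=
  ∃ (T : PTree) (bs os : List (Fin n)) (d : ℕ),
    -- `bs` are the bottom intervals from left to right, `os` the others in the order `π`
    (∀ i, i ∈ bs ↔ IsBottom R π i) ∧ bs.Pairwise (fun i j => R.left i < R.left j) ∧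
    (∀ i, i ∈ os ↔ ¬ IsBottom R π i) ∧ os.Pairwise (fun i j => π i < π j) ∧
    -- `T` is a Fibonacci tree on the bottom intervals and at most as many dummies
    T.IsFibonacci ∧ T.labels = bs.map Fin.val ++ List.replicate d n ∧ d ≤ bs.length ∧
    -- `T` is in memory, with parent pointers, balances and linked leaves
    σ.var 0 = n ∧ σ.var 1 = T.addr ∧ T.Stored σ.mem ∧ T.ParentsStored σ.mem 0 ∧
    LinkedLeaves σ.mem 0 T.leafAddrs ∧
    -- each bottom interval has a pointer to its leaf
    (∀ i ∈ bs, (σ.mem (σ.var 2 + i), (i : ℕ)) ∈ T.leafEntries) ∧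
    -- each non-bottom interval has a pointer to its anchor
    (∀ i ∈ os, ∃ a, IsAnchor R π i a ∧ σ.mem (σ.var 3 + i) = a) ∧
    -- the non-bottom intervals are listed in the order `π`
    σ.var 5 = os.length ∧ (∀ (k : ℕ) (h : k < os.length), σ.mem (σ.var 4 + k) = os[k]) ∧
    -- all parts are disjoint, avoid the null address, and lie below the address in variable `6`
    (T.blocks ++ [(σ.var 2, n), (σ.var 3, n), (σ.var 4, os.length)]).Pairwise DisjointBlocks ∧
    (∀ b ∈ T.blocks ++ [(σ.var 2, n), (σ.var 3, n), (σ.var 4, os.length)],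
      0 < b.1 ∧ b.1 + b.2 ≤ σ.var 6)

end ImpreciseSort

set_option linter.unusedSimpArgs false
set_option linter.unnecessarySeqFocus false

namespace ImpreciseSort

variable {κ : IntervalKind} {n : ℕ}

/-! ### Sequential reasoning about programs -/

/-! Lower bound. The points influence a run only through the outcomes of its tests, so within time
`t` at most `2 ^ t` final stores are reachable (`card_le_two_pow_of_exec`), and a final store that
holds a tree fixes the order of its leaves. It therefore suffices to find many choices of points no
two of which have a common sorted order (`logb_card_le_of_exec`). In the level permutation no
interval is preceded by one that strictly contains it, so every other member of the contact set of
an interval has an endpoint inside that interval. Colour every interval as "fixed near its left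
endpoint", "fixed near its right endpoint" or "moving". For an interval `i` and another member `j`
of its contact set, one ninth of all colourings make `i` moving and fix the point of `j` inside `i`.
A moving point with `s` fixed points in its interval has `1 + s` choices of rank among them
(`exists_many_orders`), and concavity of the logarithm together with averaging over the colourings
gives total entropy at least one ninth of the ambiguity (`exists_good_assignment`).

Reconstruction. The points of the non-bottom intervals are inserted in the order `π`, each by a
finger search that starts at the leaf of its anchor. The points already in the tree between the
anchor and the target all belong to one contact set: that of the interval itself, or that of its
anchor if the interval has level one (`mem_contactSet_of_between`). A level-one anchor is the
predecessor in `π`, so no contact set is charged twice in this second way, and the logarithms of the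
distances sum to at most twice the ambiguity (`sum_log_card_le`). A non-bottom interval contributes
at least one to the ambiguity, which pays for constant terms. The finger search takes time
logarithmic in the distance: it climbs exponentially growing numbers of levels, and each successful
jump passes exponentially many leaves (`finger_loop_runs`). Rebalancing takes amortized constant
time (`rebalance_loop_runs`): the potential counts balanced inner nodes of height at least two, each
step upwards destroys one, and only the last step creates some. A Fibonacci tree has potential zero,
hence there is no initial debt.

Preprocessing. The intervals are sorted by insertion into an AVL-tree. A scan from right to left
recognizes the intervals containing no other one, the bottom intervals and the anchors by comparison
with the last such leaf of the containment order. A scan from left to right computes depths by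
binary search, since the largest right endpoints at each depth are antitone in the depth
(`exists_heads`). Concatenating the depth classes, deepest first, gives the order `π`, and a stack
machine writes the Fibonacci tree (`build_reaches`). -/

/-- The program terminates within `t` units of time in a store that satisfies `Q`. -/
def Runs (inp : Input) (c : Cmd) (σ : Store) (t : ℕ) (Q : Store → Prop) : Prop :=
  ∃ (σ' : Store) (t' : ℕ), Exec inp c σ σ' t' ∧ t' ≤ t ∧ Q σ'

variable {inp : Input} {c d : Cmd} {b : Test} {σ : Store} {t t₁ t₂ : ℕ} {Q Q' : Store → Prop}

theorem Runs.mono (h : Runs inp c σ t₁ Q) (ht : t₁ ≤ t₂) (hQ : ∀ σ', Q σ' → Q' σ') :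
    Runs inp c σ t₂ Q' := by
  obtain ⟨σ', t', h1, h2, h3⟩ := h
  exact ⟨σ', t', h1, h2.trans ht, hQ _ h3⟩

theorem Runs.imp (h : Runs inp c σ t Q) (hQ : ∀ σ', Q σ' → Q' σ') : Runs inp c σ t Q' :=
  h.mono le_rfl hQ

theorem Runs.seq (h : Runs inp c σ t₁ fun σ' => Runs inp d σ' t₂ Q) :
    Runs inp (.seq c d) σ (t₁ + t₂) Q := by
  obtain ⟨σ', t', h1, h2, σ'', t'', h3, h4, h5⟩ := h
  exact ⟨σ'', _, .seq h1 h3, by omega, h5⟩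

theorem Runs.seq' (h : Runs inp c σ t₁ fun σ' => Runs inp d σ' t₂ Q) (ht : t₁ + t₂ ≤ t) :
    Runs inp (.seq c d) σ t Q :=
  (Runs.seq h).mono ht fun _ => id

theorem Runs.loop_done (hb : ¬ b.Holds inp σ) (ht : b.cost ≤ t) (hQ : Q σ) :
    Runs inp (.loop b c) σ t Q :=
  ⟨σ, _, .loop_false hb, ht, hQ⟩

theorem Runs.loop_step (hb : b.Holds inp σ)
    (h : Runs inp c σ t₁ fun σ' => Runs inp (.loop b c) σ' t₂ Q)
    (ht : b.cost + t₁ + t₂ ≤ t) : Runs inp (.loop b c) σ t Q := by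
  obtain ⟨σ', t', h1, h2, σ'', t'', h3, h4, h5⟩ := h
  exact ⟨σ'', _, .loop_true hb h1 h3, by omega, h5⟩

/-! #### Loop-free programs -/

def Cmd.LoopFree : Cmd → Prop
  | .seq c d => c.LoopFree ∧ d.LoopFree
  | .ite _ c d => c.LoopFree ∧ d.LoopFree
  | .loop _ _ => False
  | _ => True

/-- An upper bound for the running time of a loop-free program. -/
def Cmd.bound : Cmd → ℕ
  | .skip => 0
  | .assign _ e => e.cost + 1
  | .write a e => a.cost + e.cost + 1
  | .seq c d => c.bound + d.bound
  | .ite b c d => b.cost + max c.bound d.bound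
  | .loop _ _ => 0

open Classical in
/-- The result of a loop-free program. -/
noncomputable def Cmd.eval (inp : Input) : Cmd → Store → Store
  | .skip, σ => σ
  | .assign v e, σ => ⟨Function.update σ.var v (e.eval σ), σ.mem⟩
  | .write a e, σ => ⟨σ.var, Function.update σ.mem (a.eval σ) (e.eval σ)⟩
  | .seq c d, σ => d.eval inp (c.eval inp σ)
  | .ite b c d, σ => if b.Holds inp σ then c.eval inp σ else d.eval inp σ
  | .loop _ _, σ => σ

theorem Cmd.exec_eval (inp : Input) (c : Cmd) (hc : c.LoopFree) (σ : Store) :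
    ∃ t ≤ c.bound, Exec inp c σ (c.eval inp σ) t := by
  induction c generalizing σ with
  | skip => exact ⟨_, le_rfl, .skip σ⟩
  | assign v e => exact ⟨_, le_rfl, .assign v e σ⟩
  | write a e => exact ⟨_, le_rfl, .write a e σ⟩
  | seq c d ihc ihd =>
    obtain ⟨t, ht, h⟩ := ihc hc.1 σ
    obtain ⟨t', ht', h'⟩ := ihd hc.2 (c.eval inp σ)
    exact ⟨_, Nat.add_le_add ht ht', .seq h h'⟩
  | ite b c d ihc ihd =>
    obtain ⟨t, ht, h⟩ := ihc hc.1 σ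
    obtain ⟨t', ht', h'⟩ := ihd hc.2 σ
    by_cases hb : b.Holds inp σ
    · refine ⟨b.cost + t, Nat.add_le_add le_rfl (ht.trans (le_max_left _ _)), ?_⟩
      simpa only [Cmd.eval, if_pos hb] using Exec.ite_true hb h
    · refine ⟨b.cost + t', Nat.add_le_add le_rfl (ht'.trans (le_max_right _ _)), ?_⟩
      simpa only [Cmd.eval, if_neg hb] using Exec.ite_false hb h'
  | loop => exact hc.elim

/-- Straight-line blocks are executed symbolically: loop-freeness and the time bound are closed
computations, and only a statement about `Cmd.eval` remains, which `simp` can unfold. -/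
theorem Runs.eval (hc : c.LoopFree) (ht : c.bound ≤ t) (hQ : Q (c.eval inp σ)) :
    Runs inp c σ t Q := by
  obtain ⟨t', h1, h2⟩ := c.exec_eval inp hc σ
  exact ⟨_, t', h2, h1.trans ht, hQ⟩

/-! #### Frames -/

/-- The variables that a program may assign. -/
def Cmd.assigned : Cmd → List ℕ
  | .assign v _ => [v]
  | .seq c d => c.assigned ++ d.assigned
  | .ite _ c d => c.assigned ++ d.assigned
  | .loop _ c => c.assigned
  | _ => []

/-- The program never writes to the memory. -/
def Cmd.ReadOnly : Cmd → Prop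
  | .write _ _ => False
  | .seq c d => c.ReadOnly ∧ d.ReadOnly
  | .ite _ c d => c.ReadOnly ∧ d.ReadOnly
  | .loop _ c => c.ReadOnly
  | _ => True

theorem Exec.var_eq {σ σ' : Store} {t : ℕ} (h : Exec inp c σ σ' t) (v : ℕ)
    (hv : v ∉ c.assigned) : σ'.var v = σ.var v := by
  induction h with
  | skip | write | loop_false => rfl
  | assign w e σ =>
    simp only [Cmd.assigned, List.mem_singleton] at hv
    exact Function.update_of_ne hv _ _
  | seq _ _ ih1 ih2 =>
    simp only [Cmd.assigned, List.mem_append, not_or] at hv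
    rw [ih2 hv.2, ih1 hv.1]
  | ite_true _ _ ih =>
    simp only [Cmd.assigned, List.mem_append, not_or] at hv
    exact ih hv.1
  | ite_false _ _ ih =>
    simp only [Cmd.assigned, List.mem_append, not_or] at hv
    exact ih hv.2
  | loop_true _ _ _ ih1 ih2 =>
    rw [ih2 hv, ih1 hv]

theorem Exec.mem_eq {σ σ' : Store} {t : ℕ} (h : Exec inp c σ σ' t) (hc : c.ReadOnly) :
    σ'.mem = σ.mem := by
  induction h with
  | skip | assign | loop_false => rfl
  | write => exact hc.elim
  | seq _ _ ih1 ih2 => rw [ih2 hc.2, ih1 hc.1]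
  | ite_true _ _ ih => exact ih hc.1
  | ite_false _ _ ih => exact ih hc.2
  | loop_true _ _ _ ih1 ih2 => rw [ih2 hc, ih1 hc]

theorem Runs.frame (h : Runs inp c σ t Q) :
    Runs inp c σ t fun σ' => Q σ' ∧ ∀ v, v ∉ c.assigned → σ'.var v = σ.var v := by
  obtain ⟨σ', t', h1, h2, h3⟩ := h
  exact ⟨σ', t', h1, h2, h3, fun v hv => h1.var_eq v hv⟩

theorem Runs.frame_mem (h : Runs inp c σ t Q) (hc : c.ReadOnly) :
    Runs inp c σ t fun σ' => Q σ' ∧ (∀ v, v ∉ c.assigned → σ'.var v = σ.var v) ∧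
      σ'.mem = σ.mem := by
  obtain ⟨σ', t', h1, h2, h3⟩ := h
  exact ⟨σ', t', h1, h2, h3, fun v hv => h1.var_eq v hv, h1.mem_eq hc⟩

/-! #### Determinism and decision sequences -/

/-- `Follows c σ bs σ'`: the program `c`, started in `σ`, terminates in `σ'` when its tests have
the outcomes `bs`. -/
inductive Follows : Cmd → Store → List Bool → Store → Prop where
  | skip (σ : Store) : Follows .skip σ [] σ
  | assign (v : ℕ) (e : Expr) (σ : Store) :
      Follows (.assign v e) σ [] ⟨Function.update σ.var v (e.eval σ), σ.mem⟩
  | write (a e : Expr) (σ : Store) :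
      Follows (.write a e) σ [] ⟨σ.var, Function.update σ.mem (a.eval σ) (e.eval σ)⟩
  | seq {c d : Cmd} {σ σ₁ σ₂ : Store} {l₁ l₂ : List Bool} :
      Follows c σ l₁ σ₁ → Follows d σ₁ l₂ σ₂ → Follows (.seq c d) σ (l₁ ++ l₂) σ₂
  | ite_true {b : Test} {c d : Cmd} {σ σ' : Store} {l : List Bool} :
      Follows c σ l σ' → Follows (.ite b c d) σ (true :: l) σ'
  | ite_false {b : Test} {c d : Cmd} {σ σ' : Store} {l : List Bool} :
      Follows d σ l σ' → Follows (.ite b c d) σ (false :: l) σ'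
  | loop_true {b : Test} {c : Cmd} {σ σ₁ σ₂ : Store} {l₁ l₂ : List Bool} :
      Follows c σ l₁ σ₁ → Follows (.loop b c) σ₁ l₂ σ₂ →
        Follows (.loop b c) σ (true :: (l₁ ++ l₂)) σ₂
  | loop_false {b : Test} {c : Cmd} {σ : Store} : Follows (.loop b c) σ [false] σ

theorem Test.one_le_cost (b : Test) : 1 ≤ b.cost := by
  cases b <;> simp [Test.cost]

/-- Each test costs at least one unit of time, so the running time bounds the number of bits that a
run receives from the input. -/
theorem Exec.exists_follows {σ σ' : Store} {t : ℕ} (h : Exec inp c σ σ' t) :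
    ∃ l : List Bool, l.length ≤ t ∧ Follows c σ l σ' := by
  induction h with
  | skip σ => exact ⟨_, by simp, .skip σ⟩
  | assign v e σ => exact ⟨_, by simp, .assign v e σ⟩
  | write a e σ => exact ⟨_, by simp, .write a e σ⟩
  | seq _ _ ih1 ih2 =>
    obtain ⟨l, h1, h2⟩ := ih1
    obtain ⟨l', h3, h4⟩ := ih2
    exact ⟨_, by simp; omega, .seq h2 h4⟩
  | @ite_true b _ _ _ _ _ _ _ ih =>
    obtain ⟨l, h1, h2⟩ := ih
    have := b.one_le_cost
    exact ⟨_, by simp; omega, .ite_true h2⟩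
  | @ite_false b _ _ _ _ _ _ _ ih =>
    obtain ⟨l, h1, h2⟩ := ih
    have := b.one_le_cost
    exact ⟨_, by simp; omega, .ite_false h2⟩
  | @loop_true b _ _ _ _ _ _ _ _ _ ih1 ih2 =>
    obtain ⟨l, h1, h2⟩ := ih1
    obtain ⟨l', h3, h4⟩ := ih2
    have := b.one_le_cost
    exact ⟨_, by simp; omega, .loop_true h2 h4⟩
  | @loop_false b _ _ _ => exact ⟨_, by simpa using b.one_le_cost, .loop_false⟩

/-- The outcome sequences of terminating runs from a fixed store form a prefix code. The arbitrary
continuations `r` and `r'` carry the induction through sequential composition, and make the result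
applicable to padded sequences. -/
theorem Follows.unique {σ σ' σ'' : Store} {l l' r r' : List Bool} (h : Follows c σ l σ')
    (h' : Follows c σ l' σ'') (e : l ++ r = l' ++ r') : σ' = σ'' ∧ r = r' := by
  induction h generalizing l' σ'' r r' with
  | skip | assign | write => cases h'; exact ⟨rfl, by simpa using e⟩
  | seq _ _ ih1 ih2 =>
    cases h' with
    | seq h1 h2 =>
      simp only [List.append_assoc] at e
      obtain ⟨rfl, e'⟩ := ih1 h1 e
      exact ih2 h2 e'
  | ite_true _ ih =>
    cases h' with
    | ite_true h1 => exact ih h1 (by simpa using e)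
    | ite_false h1 => simp at e
  | ite_false _ ih =>
    cases h' with
    | ite_true h1 => simp at e
    | ite_false h1 => exact ih h1 (by simpa using e)
  | loop_true _ _ ih1 ih2 =>
    cases h' with
    | loop_true h1 h2 =>
      simp only [List.cons_append, List.append_assoc, List.cons.injEq, true_and] at e
      obtain ⟨rfl, e'⟩ := ih1 h1 e
      exact ih2 h2 e'
    | loop_false => simp at e
  | loop_false =>
    cases h' with
    | loop_true h1 h2 => simp at e
    | loop_false => exact ⟨rfl, by simpa using e⟩

/-- Within time `t`, at most `2 ^ t` different final stores can be reached from a given store. -/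
theorem card_le_two_pow_of_exec {ι : Type*} [Fintype ι] (inp : ι → Input) (alg : Cmd) (σ : Store)
    (fin : ι → Store) (hfin : Function.Injective fin) (t : ℕ)
    (h : ∀ i, ∃ t' ≤ t, Exec (inp i) alg σ (fin i) t') : Fintype.card ι ≤ 2 ^ t := by
  have h' : ∀ i, ∃ l : List Bool, l.length ≤ t ∧ Follows alg σ l (fin i) := fun i => by
    obtain ⟨t', ht', he⟩ := h i
    obtain ⟨l, hl, hf⟩ := he.exists_follows
    exact ⟨l, hl.trans ht', hf⟩
  choose l hl hf using h'
  -- Padding to the common length `t` loses no information because the outcome sequences form a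
  -- prefix code.
  let code : ι → List.Vector Bool t := fun i =>
    ⟨l i ++ List.replicate (t - (l i).length) false, by simp [hl i]⟩
  have hcode : Function.Injective code := fun i j hij => by
    have := congrArg Subtype.val hij
    exact hfin ((hf i).unique (hf j) this).1
  simpa using Fintype.card_le_of_injective code hcode

/-! ### The final store determines the sorted order -/

/-- The tag of a record tells leaves from inner nodes, and the child pointers determine the rest, so
memory and root address decode to a single tree. -/
theorem PTree.eq_of_stored {m : ℕ → ℕ} (T T' : PTree) (h : T.Stored m) (h' : T'.Stored m)
    (e : T.addr = T'.addr) : T = T' := by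
  induction T generalizing T' with
  | leaf p a =>
    cases T' with
    | leaf p' a' =>
      simp only [PTree.addr] at e
      subst e
      simp only [PTree.Stored] at h h'
      rw [← h.2, ← h'.2]
    | node p' l r =>
      simp only [PTree.addr] at e
      subst e
      simp only [PTree.Stored] at h h'
      omega
  | node p l r ihl ihr =>
    cases T' with
    | leaf p' a' =>
      simp only [PTree.addr] at e
      subst e
      simp only [PTree.Stored] at h h'
      omega
    | node p' l' r' =>
      simp only [PTree.addr] at e
      subst e
      obtain ⟨-, -, h1, h2, h3, h4⟩ := h
      obtain ⟨-, -, h1', h2', h3', h4'⟩ := h'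
      rw [ihl l' h3 h3' (h1.symm.trans h1'), ihr r' h4 h4' (h2.symm.trans h2')]

/-- Two families of points that lead to the same final store have a common sorted order. -/
theorem HoldsAVLTree.exists_common_order {x y : Fin n → ℝ} {σ : Store} (hx : HoldsAVLTree x σ)
    (hy : HoldsAVLTree y σ) : ∃ ps : List (Fin n), ps.Perm (List.finRange n) ∧
      ps.Pairwise (fun i j => x i ≤ x j) ∧ ps.Pairwise (fun i j => y i ≤ y j) := by
  obtain ⟨T, ps, d, h1, h2, -, -, h5, h6, h7, -⟩ := hx
  obtain ⟨T', ps', d', h1', h2', -, -, h5', h6', h7', -⟩ := hy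
  obtain rfl := PTree.eq_of_stored T T' h2 h2' (h1.symm.trans h1')
  have e : ps = ps' := by
    have hl : (ps.map Fin.val).length = (ps'.map Fin.val).length := by
      simp [h6.length_eq, h6'.length_eq]
    have := List.append_inj_left (h5.symm.trans h5') hl
    exact List.map_injective_iff.mpr Fin.val_injective this
  subst e
  exact ⟨ps, h6, h7, h7'⟩

end ImpreciseSort

namespace ImpreciseSort

variable {κ : IntervalKind} {n : ℕ}

/-! ### Intervals -/

namespace IntervalSet

variable (R : IntervalSet κ n)

theorem left_le_right (i : Fin n) : R.left i ≤ R.right i := by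
  obtain ⟨x, hx⟩ := R.nonempty i
  cases κ
  · exact (hx.1.trans hx.2).le
  · exact hx.1.trans hx.2

theorem region_subset_iff (i j : Fin n) :
    R.region i ⊆ R.region j ↔ R.left j ≤ R.left i ∧ R.right i ≤ R.right j := by
  cases κ
  · obtain ⟨x, hx⟩ := R.nonempty i
    exact Set.Ioo_subset_Ioo_iff (hx.1.trans hx.2)
  · exact Set.Icc_subset_Icc_iff (R.left_le_right i)

theorem region_injective : Function.Injective R.region := R.distinct

theorem eq_of_endpoints {i j : Fin n} (hl : R.left i = R.left j) (hr : R.right i = R.right j) :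
    i = j :=
  R.region_injective (by simp [region, hl, hr])

theorem region_ssubset_iff (i j : Fin n) :
    R.region i ⊂ R.region j ↔ i ≠ j ∧ R.left j ≤ R.left i ∧ R.right i ≤ R.right j := by
  rw [Set.ssubset_iff_subset_ne, R.region_subset_iff, R.region_injective.ne_iff]
  tauto

theorem ordConnected_region (i : Fin n) : (R.region i).OrdConnected := by
  cases κ
  · exact Set.ordConnected_Ioo
  · exact Set.ordConnected_Icc

end IntervalSet

/-! ### Depth, levels, and the level permutation -/

section Level

variable (R : IntervalSet κ n)

/-- A longest chain above the outer interval, together with the outer interval itself, is a chain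
above the inner one. -/
theorem depth_lt_of_ssubset {i j : Fin n} (h : R.region i ⊂ R.region j) :
    depth R j < depth R i := by
  classical
  have hne : ((Finset.univ : Finset (Finset (Fin n))).filter fun C : Finset (Fin n) =>
    (∀ k ∈ C, R.region j ⊂ R.region k) ∧
      IsChain (fun a b => R.region a ⊂ R.region b) (C : Set (Fin n))).Nonempty :=
    ⟨∅, by simp⟩
  obtain ⟨C, hC, hd⟩ := Finset.exists_mem_eq_sup _ hne Finset.card
  simp only [Finset.mem_filter, Finset.mem_univ, true_and] at hC
  have hj : j ∉ C := fun hj => (hC.1 j hj).ne rfl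
  have hins : (insert j C).card ≤ depth R i := by
    unfold depth
    refine Finset.le_sup (f := Finset.card) ?_
    simp only [Finset.mem_filter, Finset.mem_univ, true_and, Finset.mem_insert,
      forall_eq_or_imp, Finset.coe_insert]
    refine ⟨⟨h, fun k hk => h.trans (hC.1 k hk)⟩, hC.2.insert fun k hk _ => ?_⟩
    exact Or.inl (hC.1 k hk)
  rw [Finset.card_insert_of_notMem hj] at hins
  have : depth R j = C.card := by
    unfold depth
    convert hd
  omega

/-- The innermost member of a longest chain above `i` has the rest of the chain above it, hence
depth at least `d`; its depth is at most `d` because it strictly contains `i`. -/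
theorem exists_depth_of_depth_eq_succ {i : Fin n} {d : ℕ} (h : depth R i = d + 1) :
    ∃ j, R.region i ⊂ R.region j ∧ depth R j = d := by
  classical
  have hne : ((Finset.univ : Finset (Finset (Fin n))).filter fun C : Finset (Fin n) =>
    (∀ k ∈ C, R.region i ⊂ R.region k) ∧
      IsChain (fun a b => R.region a ⊂ R.region b) (C : Set (Fin n))).Nonempty :=
    ⟨∅, by simp⟩
  obtain ⟨C, hC, hd⟩ := Finset.exists_mem_eq_sup _ hne Finset.card
  simp only [Finset.mem_filter, Finset.mem_univ, true_and] at hC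
  have hcard : C.card = d + 1 := by
    rw [← h]
    unfold depth
    convert hd.symm
  have hCne : C.Nonempty := Finset.card_pos.mp (by omega)
  obtain ⟨j, hjC, hj⟩ := C.exists_minimalFor R.region hCne
  refine ⟨j, hC.1 j hjC, le_antisymm ?_ ?_⟩
  · have := depth_lt_of_ssubset R (hC.1 j hjC)
    omega
  · have : (C.erase j).card ≤ depth R j := by
      unfold depth
      refine Finset.le_sup (f := Finset.card) ?_
      simp only [Finset.mem_filter, Finset.mem_univ, true_and, Finset.mem_erase]
      refine ⟨fun k hk => ?_, hC.2.mono (by simp)⟩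
      rcases hC.2 hjC hk.2 hk.1.symm with h' | h'
      · exact h'
      · exact absurd (hj hk.2 h'.subset) h'.not_subset
    rw [Finset.card_erase_of_mem hjC] at this
    omega

theorem depth_lt_numLevels (i : Fin n) : depth R i < numLevels R :=
  Nat.lt_succ_of_le (Finset.le_sup (f := depth R) (Finset.mem_univ i))

theorem one_le_level (i : Fin n) : 1 ≤ level R i := by
  have := depth_lt_numLevels R i
  unfold level
  split_ifs <;> omega

/-- The outer interval is not a containment leaf, so its level is `numLevels` minus its depth. This
exceeds the same difference for the inner interval, and it exceeds `1`, which covers an inner leaf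
whose level is not given by its depth. -/
theorem level_lt_of_ssubset {i j : Fin n} (h : R.region i ⊂ R.region j) :
    level R i < level R j := by
  have h1 := depth_lt_of_ssubset R h
  have h2 := depth_lt_numLevels R i
  have hj : ¬ IsContainmentLeaf R j := fun hj => hj i h
  unfold level
  rw [if_neg hj]
  split_ifs <;> omega

theorem level_eq_one_iff (i : Fin n) : level R i = 1 ↔ IsContainmentLeaf R i := by
  constructor
  · intro h j hj
    have := level_lt_of_ssubset R hj
    have := one_le_level R j
    omega
  · intro h
    simp [level, h]

theorem level_eq_of_not_leaf {i : Fin n} (h : ¬ IsContainmentLeaf R i) :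
    level R i = numLevels R - depth R i := by
  simp [level, h]

/-- Two intervals with a common right endpoint are nested, and nested intervals lie in different
levels. Hence the order from right to left within a level has no ties, which gives uniqueness of the
level permutation. -/
theorem right_ne_of_level_eq {i j : Fin n} (hij : i ≠ j) (h : level R i = level R j) :
    R.right i ≠ R.right j := by
  intro e
  rcases le_total (R.left i) (R.left j) with h' | h'
  · exact (level_lt_of_ssubset R ((R.region_ssubset_iff j i).2 ⟨hij.symm, h', e.ge⟩)).ne' h
  · exact (level_lt_of_ssubset R ((R.region_ssubset_iff i j).2 ⟨hij, h', e.le⟩)).ne h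

/-- In one level, the left endpoints are ordered as the right endpoints. -/
theorem left_lt_of_level_eq {i j : Fin n} (h : level R i = level R j)
    (hr : R.right i < R.right j) : R.left i < R.left j := by
  by_contra hl
  have hij : i ≠ j := fun e => by simp [e] at hr
  exact (level_lt_of_ssubset R ((R.region_ssubset_iff i j).2 ⟨hij, not_lt.1 hl, hr.le⟩)).ne h

/-- The sorting key of the level permutation. -/
noncomputable def levelKey (i : Fin n) : ℕ ×ₗ ℝᵒᵈ := toLex (level R i, OrderDual.toDual (R.right i))

theorem levelKey_lt_iff (i j : Fin n) : levelKey R i < levelKey R j ↔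
    level R i < level R j ∨ level R i = level R j ∧ R.right j < R.right i := by
  simp [levelKey, Prod.Lex.toLex_lt_toLex]

theorem levelKey_injective : Function.Injective (levelKey R) := by
  intro i j h
  have h' := toLex.injective h
  simp only [Prod.mk.injEq, OrderDual.toDual_inj] at h'
  by_contra hij
  exact right_ne_of_level_eq R hij h'.1 h'.2

theorem isLevelPermutation_iff (π : Equiv.Perm (Fin n)) :
    IsLevelPermutation R π ↔ ∀ i j, levelKey R i < levelKey R j → π i < π j := by
  simp only [IsLevelPermutation, levelKey_lt_iff]

theorem existsUnique_isLevelPermutation :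
    ∃! π : Equiv.Perm (Fin n), IsLevelPermutation R π := by
  refine ⟨(Tuple.sort (levelKey R)).symm, ?_, ?_⟩
  · simp only [isLevelPermutation_iff]
    intro i j hij
    by_contra h
    have := Tuple.monotone_sort (levelKey R) (not_lt.1 h)
    simp at this
    exact absurd hij this.not_gt
  · intro π hπ
    simp only [isLevelPermutation_iff] at hπ
    have hmono : StrictMono fun k => π (Tuple.sort (levelKey R) k) := by
      intro k l hkl
      refine hπ _ _ (lt_of_le_of_ne (Tuple.monotone_sort (levelKey R) hkl.le) ?_)
      intro e
      exact hkl.ne ((Tuple.sort (levelKey R)).injective (levelKey_injective R e))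
    -- A strictly monotone permutation of `Fin n` is an order automorphism, and the identity is the
    -- only one.
    have hid : ∀ k, π (Tuple.sort (levelKey R) k) = k := by
      have := Subsingleton.elim
        (hmono.orderIsoOfSurjective _ (π.surjective.comp (Tuple.sort (levelKey R)).surjective))
        (OrderIso.refl (Fin n))
      intro k
      exact congrArg (fun e : Fin n ≃o Fin n => e k) this
    ext i
    have := hid ((Tuple.sort (levelKey R)).symm i)
    simp only [Equiv.apply_symm_apply] at this
    rw [this]

variable {R} {π : Equiv.Perm (Fin n)}

theorem IsLevelPermutation.lt_iff (hπ : IsLevelPermutation R π) (i j : Fin n) :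
    π i < π j ↔ level R i < level R j ∨ level R i = level R j ∧ R.right j < R.right i := by
  rw [← levelKey_lt_iff]
  refine ⟨fun h => ?_, (isLevelPermutation_iff R π).1 hπ i j⟩
  by_contra h'
  rcases (not_lt.1 h').lt_or_eq with h'' | h''
  · exact absurd ((isLevelPermutation_iff R π).1 hπ j i h'') h.asymm
  · rw [levelKey_injective R h''] at h
    exact lt_irrefl _ h

theorem IsLevelPermutation.lt_of_ssubset (hπ : IsLevelPermutation R π) {i j : Fin n}
    (h : R.region i ⊂ R.region j) : π i < π j :=
  hπ i j (Or.inl (level_lt_of_ssubset R h))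

theorem self_mem_contactSet (R : IntervalSet κ n) (π : Equiv.Perm (Fin n)) (i : Fin n) :
    i ∈ contactSet R π i := by
  simp only [contactSet, Finset.mem_filter, Finset.mem_univ, le_refl, Set.inter_self, true_and]
  exact R.nonempty i

theorem mem_contactSet {i j : Fin n} : j ∈ contactSet R π i ↔
    π j ≤ π i ∧ (R.region j ∩ R.region i).Nonempty := by
  simp [contactSet]

theorem one_le_card_contactSet (R : IntervalSet κ n) (π : Equiv.Perm (Fin n)) (i : Fin n) :
    1 ≤ (contactSet R π i).card :=
  Finset.card_pos.2 ⟨i, self_mem_contactSet R π i⟩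

theorem two_le_card_contactSet {i : Fin n} (h : ¬ IsBottom R π i) :
    2 ≤ (contactSet R π i).card := by
  by_contra h'
  have h1 := one_le_card_contactSet R π i
  obtain ⟨a, ha⟩ := Finset.card_eq_one.1 (show (contactSet R π i).card = 1 by omega)
  have := self_mem_contactSet R π i
  rw [ha, Finset.mem_singleton] at this
  exact h (by rw [IsBottom, ha, this])

/-- A member of the contact set has an endpoint inside the interval or meets it in a boundary
point only. -/
theorem endpoint_of_mem_contactSet (hπ : IsLevelPermutation R π) {i j : Fin n}
    (h : j ∈ contactSet R π i) (hij : j ≠ i) : R.left i < R.left j ∨ R.right j < R.right i := by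
  by_contra! hc
  have hs : R.region i ⊂ R.region j := (R.region_ssubset_iff i j).2 ⟨hij.symm, hc.1, hc.2⟩
  exact absurd (hπ.lt_of_ssubset hs) (mem_contactSet.1 h).1.not_gt

end Level

end ImpreciseSort

namespace ImpreciseSort

variable {κ : IntervalKind} {n : ℕ}

/-! ### The lower bound -/

theorem Exec.deterministic {inp : Input} {c : Cmd} {σ σ₁ σ₂ : Store} {t₁ t₂ : ℕ}
    (h₁ : Exec inp c σ σ₁ t₁) (h₂ : Exec inp c σ σ₂ t₂) : σ₁ = σ₂ := by
  induction h₁ generalizing σ₂ t₂ with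
  | skip | assign | write => cases h₂; rfl
  | seq _ _ ih1 ih2 =>
    cases h₂ with
    | seq h h' => obtain rfl := ih1 h; exact ih2 h'
  | ite_true hb _ ih =>
    cases h₂ with
    | ite_true _ h => exact ih h
    | ite_false hb' _ => exact absurd hb hb'
  | ite_false hb _ ih =>
    cases h₂ with
    | ite_true hb' _ => exact absurd hb' hb
    | ite_false _ h => exact ih h
  | loop_true hb _ _ ih1 ih2 =>
    cases h₂ with
    | loop_true _ h h' => obtain rfl := ih1 h; exact ih2 h'
    | loop_false hb' => exact absurd hb hb'
  | loop_false hb =>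
    cases h₂ with
    | loop_true hb' _ _ => exact absurd hb' hb
    | loop_false _ => rfl

theorem no_common_order {x y : Fin n → ℝ} {i j : Fin n} (hx : x i < x j) (hy : y j < y i)
    (ps : List (Fin n)) (hp : ps.Perm (List.finRange n)) (h : ps.Pairwise fun i j => x i ≤ x j)
    (h' : ps.Pairwise fun i j => y i ≤ y j) : False := by
  have hmem : ∀ k, k ∈ ps := fun k => hp.mem_iff.2 (List.mem_finRange k)
  -- The relation is symmetrized, so that it can be applied to `i` and `j` without knowing which of
  -- them comes first in the list.
  have hpw : ps.Pairwise fun a b => (x a ≤ x b ∧ y a ≤ y b) ∨ (x b ≤ x a ∧ y b ≤ y a) :=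
    (h.and h').imp fun h => Or.inl h
  have : Std.Symm fun a b => (x a ≤ x b ∧ y a ≤ y b) ∨ (x b ≤ x a ∧ y b ≤ y a) :=
    ⟨fun a b h => h.symm⟩
  have hij : i ≠ j := fun h => by simp [h] at hx
  rcases hpw.forall (hmem i) (hmem j) hij with h | h
  · exact absurd h.2 hy.not_ge
  · exact absurd h.1 hx.not_ge

/-- If the points can be chosen in `card ι` ways such that any two choices order some pair of
points differently, then some choice needs time `log₂ (card ι)`. -/
theorem logb_card_le_of_exec {ι : Type*} [Fintype ι] [Nonempty ι] (R : IntervalSet κ n)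
    (x : ι → Fin n → ℝ) (hx : ∀ a, R.Realizes (x a))
    (hne : ∀ a b, a ≠ b → ∃ i j, x a i < x a j ∧ x b j < x b i) (alg : Cmd) (σ : Store)
    (halg : ∀ x, R.Realizes x → ∃ σ' t, Exec (R.fullInput x) alg σ σ' t ∧ HoldsAVLTree x σ')
    (s : ℝ) (hs : ∀ x, R.Realizes x → ∃ σ' t, Exec (R.fullInput x) alg σ σ' t ∧ (t : ℝ) < s) :
    Real.logb 2 (Fintype.card ι) ≤ s := by
  have : Nonempty Store := ⟨σ⟩
  choose! fin t hex ht using hs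
  have hinj : Function.Injective fun a => fin (x a) := by
    intro a b hab
    by_contra hne'
    have hA : ∀ a, HoldsAVLTree (x a) (fin (x a)) := fun a => by
      obtain ⟨σ', t', h1, h2⟩ := halg (x a) (hx a)
      rwa [(hex _ (hx a)).deterministic h1]
    obtain ⟨i, j, h1, h2⟩ := hne a b hne'
    have hb := hA b
    rw [← show fin (x a) = fin (x b) from hab] at hb
    obtain ⟨ps, h3, h4, h5⟩ := (hA a).exists_common_order hb
    exact no_common_order h1 h2 ps h3 h4 h5
  have hs0 : 0 ≤ s := by
    obtain ⟨a⟩ := ‹Nonempty ι›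
    exact (Nat.cast_nonneg _).trans (ht _ (hx a)).le
  have hcard := card_le_two_pow_of_exec (fun a => R.fullInput (x a)) alg σ (fun a => fin (x a))
    hinj ⌊s⌋₊ fun a => ⟨_, Nat.le_floor (ht _ (hx a)).le, hex _ (hx a)⟩
  have hpos : (0 : ℝ) < Fintype.card ι := by exact_mod_cast Fintype.card_pos
  calc Real.logb 2 (Fintype.card ι) ≤ Real.logb 2 ((2 : ℝ) ^ ⌊s⌋₊) :=
        Real.logb_le_logb_of_le one_lt_two hpos (by exact_mod_cast hcard)
    _ = ⌊s⌋₊ := by rw [Real.logb_pow, Real.logb_self_eq_one one_lt_two, mul_one]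
    _ ≤ s := Nat.floor_le hs0

/-- Distinct points near the endpoints of the intervals. -/
theorem exists_endpoint_samples (R : IntervalSet κ n) (hR : R.NoTouching) :
    ∃ v : Bool → Fin n → ℝ, (∀ a i, v a i ∈ R.region i) ∧
      (∀ a b i j, v a i = v b j → i = j) ∧
      (∀ i j, R.left i < R.left j → R.left j < R.right i →
        R.left i < v false j ∧ v false j < R.right i) ∧
      (∀ i j, R.left i < R.right j → R.right j < R.right i →
        R.left i < v true j ∧ v true j < R.right i) := by
  classical
  let E : Finset ℝ := Finset.univ.image R.left ∪ Finset.univ.image R.right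
  have hl : ∀ i, R.left i ∈ E := fun i => by simp [E]
  have hr : ∀ i, R.right i ∈ E := fun i => by simp [E]
  -- `δ` is the smallest gap between distinct endpoints. Offsets below `δ / 3` never cross an
  -- endpoint, and samples attached to different endpoint values stay apart.
  obtain ⟨δ, hδ, hgap⟩ : ∃ δ : ℝ, 0 < δ ∧ ∀ a ∈ E, ∀ b ∈ E, a < b → a + δ ≤ b := by
    by_cases hD : ((E ×ˢ E).filter fun p => p.1 < p.2).Nonempty
    · obtain ⟨p, hp, hmin⟩ := Finset.exists_min_image _ (fun p : ℝ × ℝ => p.2 - p.1) hD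
      simp only [Finset.mem_filter, Finset.mem_product] at hp
      refine ⟨p.2 - p.1, sub_pos.2 hp.2, fun a ha b hb hab => ?_⟩
      have := hmin (a, b) (by simp [ha, hb, hab])
      simp only at this
      linarith
    · refine ⟨1, one_pos, fun a ha b hb hab => absurd ⟨(a, b), ?_⟩ hD⟩
      simp [ha, hb, hab]
  -- Every interval has an offset of its own, which separates the samples of intervals that share an
  -- endpoint.
  let ε : Fin n → ℝ := fun i => δ / 3 * ((i : ℝ) + 1) / (n + 1)
  have hε0 : ∀ i, 0 < ε i := fun i => by positivity
  have hε1 : ∀ i, ε i < δ / 3 := fun i => by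
    have hi : (i : ℝ) < n := by exact_mod_cast i.2
    rw [div_lt_iff₀ (by positivity)]
    exact mul_lt_mul_of_pos_left (by linarith) (by positivity)
  have hεinj : ∀ i j, ε i = ε j → i = j := fun i j h => by
    have h1 : (n : ℝ) + 1 ≠ 0 := by positivity
    have h2 : δ / 3 ≠ 0 := by positivity
    simp only [ε] at h
    rw [div_left_inj' h1, mul_right_inj' h2, add_left_inj] at h
    exact Fin.ext (by exact_mod_cast h)
  let v : Bool → Fin n → ℝ := fun a i =>
    if R.left i < R.right i then (if a then R.right i - ε i else R.left i + ε i) else R.left i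
  have hdeg : ∀ i, ¬ R.left i < R.right i → R.left i = R.right i ∧ κ = .isClosed := fun i hi => by
    refine ⟨le_antisymm (R.left_le_right i) (not_lt.1 hi), ?_⟩
    cases hκ : κ
    · subst hκ
      obtain ⟨x, hx⟩ := R.nonempty i
      exact absurd (hx.1.trans hx.2) hi
    · rfl
  refine ⟨v, ?_, ?_, ?_, ?_⟩
  · intro a i
    by_cases hi : R.left i < R.right i
    · have := hgap _ (hl i) _ (hr i) hi
      have h1 := hε0 i
      have h2 := hε1 i
      have : R.left i < v a i ∧ v a i < R.right i := by
        simp only [v, hi, if_true]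
        split_ifs <;> constructor <;> linarith
      cases κ
      · exact this
      · exact ⟨this.1.le, this.2.le⟩
    · obtain ⟨h1, rfl⟩ := hdeg i hi
      simp only [v, hi, if_false]
      exact ⟨le_rfl, h1.le⟩
  · intro a b i j h
    by_contra hij
    have key : ∀ e ∈ E, ∀ e' ∈ E, ∀ o o' : ℝ, |o| < δ / 3 → |o'| < δ / 3 → e + o = e' + o' →
        e = e' ∧ o = o' := by
      intro e he e' he' o o' ho ho' heq
      rw [abs_lt] at ho ho'
      have : e = e' := by
        rcases lt_trichotomy e e' with h | h | h
        · have := hgap _ he _ he' h; linarith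
        · exact h
        · have := hgap _ he' _ he h; linarith
      exact ⟨this, by linarith⟩
    have hv : ∀ a i, ∃ e ∈ E, ∃ o : ℝ, v a i = e + o ∧ |o| < δ / 3 ∧
        ((e = R.left i ∧ o = ε i) ∨ (e = R.right i ∧ o = - ε i) ∨
          (e = R.left i ∧ e = R.right i ∧ κ = .isClosed)) := by
      intro a i
      have h1 := hε0 i
      have h2 := hε1 i
      by_cases hi : R.left i < R.right i
      · cases a
        · exact ⟨_, hl i, ε i, by simp [v, hi], by rwa [abs_of_pos h1], .inl ⟨rfl, rfl⟩⟩
        · exact ⟨_, hr i, -ε i, by simp [v, hi]; ring, by rwa [abs_neg, abs_of_pos h1],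
            .inr (.inl ⟨rfl, rfl⟩)⟩
      · exact ⟨_, hl i, 0, by simp [v, hi], by simpa using hδ,
          .inr (.inr ⟨rfl, (hdeg i hi).1, (hdeg i hi).2⟩)⟩
    obtain ⟨e, he, o, h1, h2, h3⟩ := hv a i
    obtain ⟨e', he', o', h1', h2', h3'⟩ := hv b j
    obtain ⟨rfl, rfl⟩ := key e he e' he' o o' h2 h2' (by rw [← h1, ← h1', h])
    have hi0 := hε0 i
    have hj0 := hε0 j
    have ht1 := fun hk => hR hk i j hij
    have ht2 := fun hk => hR hk j i (Ne.symm hij)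
    -- Both samples come from one endpoint value with one offset. Offsets of equal sign identify the
    -- intervals, opposite signs are impossible, and a one-point closed interval would touch the
    -- other interval.
    rcases h3 with ⟨h3, h4⟩ | ⟨h3, h4⟩ | ⟨h3, h4, h5⟩ <;>
      rcases h3' with ⟨h3', h4'⟩ | ⟨h3', h4'⟩ | ⟨h3', h4', h5'⟩
    · exact hij (hεinj i j (by linarith))
    · linarith
    · exact ht2 h5' (by rw [← h4', h3])
    · linarith
    · exact hij (hεinj i j (by linarith))
    · exact ht1 h5' (by rw [← h3', h3])
    · exact ht1 h5 (by rw [← h3', h4])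
    · exact ht2 h5 (by rw [← h3', h3])
    · exact ht1 h5 (by rw [← h3', h4])
  · intro i j h1 h2
    have h3 := hgap _ (hl i) _ (hl j) h1
    have h4 := hgap _ (hl j) _ (hr i) h2
    have h5 := hε0 j
    have h6 := hε1 j
    simp only [v, Bool.false_eq_true, if_false]
    split_ifs <;> constructor <;> linarith
  · intro i j h1 h2
    have h3 := hgap _ (hl i) _ (hr j) h1
    have h4 := hgap _ (hr j) _ (hr i) h2
    have h5 := hε0 j
    have h6 := hε1 j
    simp only [v, if_true]
    split_ifs with h
    · constructor <;> linarith
    · rw [(hdeg j h).1]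
      exact ⟨h1, h2⟩

/-- Points that are free to choose their rank among fixed points inside their intervals give many
different orders. -/
theorem exists_many_orders (R : IntervalSet κ n) (v : Fin n → ℝ) (hv : ∀ i, v i ∈ R.region i)
    (hinj : Function.Injective v) (M : Finset (Fin n)) (S : Fin n → Finset (Fin n))
    (hS : ∀ i ∈ M, ∀ j ∈ S i, j ∉ M ∧ R.left i < v j ∧ v j < R.right i) (hS' : ∀ i ∉ M, S i = ∅) :
    ∃ x : (∀ i, Option (S i)) → Fin n → ℝ, (∀ a, R.Realizes (x a)) ∧
      ∀ a b, a ≠ b → ∃ i j, x a i < x a j ∧ x b j < x b i := by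
  classical
  have hint : ∀ i y, R.left i < y → y < R.right i → y ∈ R.region i := fun i y h1 h2 => by
    cases κ
    · exact ⟨h1, h2⟩
    · exact ⟨h1.le, h2.le⟩
  -- The ranks are encoded by `Option`: `some j` puts the moving point directly to the left of the
  -- fixed point of `j`, with no other fixed point of `S i` in between, and `none` puts it to the
  -- right of all of them.
  have hy : ∀ i ∈ M, ∀ o : Option (S i), ∃ y ∈ R.region i, ∀ k ∈ S i,
      (∀ j, o = some j → (v j ≤ v k → y < v k) ∧ (v k < v j → v k < y)) ∧
      (o = none → v k < y) := by
    intro i hi o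
    rcases o with _ | j
    · by_cases hne : (S i).Nonempty
      · obtain ⟨m, hm, hmax⟩ := Finset.exists_max_image (S i) v hne
        obtain ⟨y, hy1, hy2⟩ := exists_between (hS i hi m hm).2.2
        refine ⟨y, hint i y ((hS i hi m hm).2.1.trans hy1) hy2, fun k hk => ⟨by simp, fun _ => ?_⟩⟩
        exact (hmax k hk).trans_lt hy1
      · refine ⟨v i, hv i, fun k hk => absurd ⟨k, hk⟩ hne⟩
    · have hlt : R.left i < v j := (hS i hi j j.2).2.1
      -- The left endpoint and the fixed points below `v j`; any number between the maximum of these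
      -- and `v j` has the required rank.
      let F : Finset ℝ := insert (R.left i) (((S i).filter fun k => v k < v j).image v)
      have hFne : F.Nonempty := ⟨_, Finset.mem_insert_self _ _⟩
      have hmax : F.max' hFne < v j := by
        rw [Finset.max'_lt_iff]
        intro y hy
        simp only [F, Finset.mem_insert, Finset.mem_image, Finset.mem_filter] at hy
        rcases hy with rfl | ⟨k, hk, rfl⟩
        · exact hlt
        · exact hk.2
      obtain ⟨y, hy1, hy2⟩ := exists_between hmax
      refine ⟨y, hint i y ((Finset.le_max' F _ (Finset.mem_insert_self _ _)).trans_lt hy1)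
        (hy2.trans (hS i hi j j.2).2.2), fun k hk => ⟨?_, by simp⟩⟩
      intro j' hj'
      obtain rfl := Option.some.inj hj'
      refine ⟨fun h => hy2.trans_le h, fun h => lt_of_le_of_lt (Finset.le_max' F _ ?_) hy1⟩
      simp only [F, Finset.mem_insert, Finset.mem_image, Finset.mem_filter]
      exact Or.inr ⟨k, ⟨hk, h⟩, rfl⟩
  choose! y hy1 hy2 using hy
  refine ⟨fun a i => if i ∈ M then y i (a i) else v i, fun a i => ?_, fun a b hab => ?_⟩
  · simp only
    split_ifs with h
    · exact hy1 i h (a i)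
    · exact hv i
  · obtain ⟨i, hi⟩ := Function.ne_iff.1 hab
    have hiM : i ∈ M := by
      by_contra h
      have : IsEmpty (S i) := by rw [hS' i h]; infer_instance
      exact hi (Subsingleton.elim _ _)
    have hjM : ∀ j ∈ S i, j ∉ M := fun j hj => (hS i hiM j hj).1
    -- Different ranks of the moving point of `i` are separated by a fixed point, and the two orders
    -- disagree on this pair. Since fixed points never move, the other coordinates of `a` and `b`
    -- play no role.
    rcases ha : a i with _ | j <;> rcases hb : b i with _ | j'
    · exact absurd (ha.trans hb.symm) hi
    · refine ⟨j', i, ?_⟩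
      simp only [hiM, hjM _ j'.2, if_true, if_false]
      exact ⟨(hy2 i hiM (a i) j' j'.2).2 ha, ((hy2 i hiM (b i) j' j'.2).1 _ hb).1 le_rfl⟩
    · refine ⟨i, j, ?_⟩
      simp only [hiM, hjM _ j.2, if_true, if_false]
      exact ⟨((hy2 i hiM (a i) j j.2).1 _ ha).1 le_rfl, (hy2 i hiM (b i) j j.2).2 hb⟩
    · have hne : v j ≠ v j' := fun h => hi (by rw [ha, hb, Subtype.ext (hinj h)])
      rcases hne.lt_or_gt with h | h
      · refine ⟨i, j, ?_⟩
        simp only [hiM, hjM _ j.2, if_true, if_false]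
        exact ⟨((hy2 i hiM (a i) j j.2).1 _ ha).1 le_rfl, ((hy2 i hiM (b i) j j.2).1 _ hb).2 h⟩
      · refine ⟨j', i, ?_⟩
        simp only [hiM, hjM _ j'.2, if_true, if_false]
        exact ⟨((hy2 i hiM (a i) j' j'.2).1 _ ha).2 h, ((hy2 i hiM (b i) j' j'.2).1 _ hb).1 le_rfl⟩

/-- In a uniformly random colouring with three colours, two prescribed values at different places
have probability one ninth. -/
theorem card_filter_two_values {i j : Fin n} (hij : i ≠ j) (a b : Fin 3) :
    9 * ((Finset.univ : Finset (Fin n → Fin 3)).filter fun f => f i = a ∧ f j = b).card = 3 ^ n := by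
  classical
  have h : ((Finset.univ : Finset (Fin n → Fin 3)).filter fun f => f i = a ∧ f j = b) =
      Fintype.piFinset fun k => if k = i then {a} else if k = j then {b} else Finset.univ := by
    ext f
    simp only [Finset.mem_filter, Finset.mem_univ, true_and, Fintype.mem_piFinset]
    constructor
    · rintro ⟨h1, h2⟩ k
      split_ifs with h3 h4
      · simp [h3, h1]
      · simp [h4, h2]
      · simp
    · intro h
      have h1 := h i
      have h2 := h j
      simp only [if_true, hij.symm, if_false, Finset.mem_singleton] at h1 h2
      exact ⟨h1, h2⟩
  rw [h, Fintype.card_piFinset]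
  have h2 : ∀ k, (if k = i then {a} else if k = j then {b} else Finset.univ : Finset (Fin 3)).card =
      if k ∈ ({i, j} : Finset (Fin n)) then 1 else 3 := by
    intro k
    by_cases h3 : k = i
    · simp [h3]
    · by_cases h4 : k = j
      · subst h4; simp [h3]
      · simp [h3, h4]
  simp only [h2]
  rw [Finset.prod_ite]
  simp only [Finset.prod_const_one, one_mul, Finset.prod_const]
  have h3 : (Finset.univ.filter fun k => k ∉ ({i, j} : Finset (Fin n))) = {i, j}ᶜ := by
    ext; simp
  rw [h3, Finset.card_compl, Finset.card_pair hij, Fintype.card_fin]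
  have hn : 2 ≤ n := by
    have := Finset.card_le_univ ({i, j} : Finset (Fin n))
    rwa [Finset.card_pair hij, Fintype.card_fin] at this
  obtain ⟨m, rfl⟩ := Nat.exists_eq_add_of_le hn
  rw [Nat.add_sub_cancel_left, pow_add]
  norm_num

/-- A concave function lies above its chord, here between `0` and `G`. The chord is linear in `s`,
which lets an average of logarithms be bounded below by an average of counts. -/
theorem logb_one_add_ge_chord {G s : ℕ} (h : s ≤ G) (hG : 0 < G) :
    (s : ℝ) / G * Real.logb 2 (1 + G) ≤ Real.logb 2 (1 + s) := by
  have hG' : (0 : ℝ) < G := by exact_mod_cast hG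
  have hs : (s : ℝ) ≤ G := by exact_mod_cast h
  have hconc := strictConcaveOn_log_Ioi.concaveOn
  have hw : (0 : ℝ) ≤ (s : ℝ) / G := by positivity
  have hw' : (s : ℝ) / G ≤ 1 := (div_le_one hG').2 hs
  have := hconc.2 (show (1 : ℝ) ∈ Set.Ioi 0 by simp)
    (show (1 + G : ℝ) ∈ Set.Ioi 0 by simp; positivity)
    (show 0 ≤ 1 - (s : ℝ) / G by linarith) hw (by ring)
  simp only [smul_eq_mul, Real.log_one, mul_zero, zero_add, mul_one] at this
  have he : 1 - (s : ℝ) / G + (s : ℝ) / G * (1 + G) = 1 + s := by field_simp; ring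
  rw [he] at this
  have h2 : 0 < Real.log 2 := Real.log_pos one_lt_two
  simp only [Real.logb]
  rw [← mul_div_assoc]
  exact div_le_div_of_nonneg_right this h2.le

/-- Some choice of fixed and moving points gives a constant fraction of the ambiguity. -/
theorem exists_good_assignment (R : IntervalSet κ n) (π : Equiv.Perm (Fin n))
    (e : Fin n → Fin n → Fin 3) : ∃ f : Fin n → Fin 3, ambiguity R π / 9 ≤
      ∑ i, if f i = 2 then Real.logb 2 (1 + (((contactSet R π i).erase i).filter
        fun j => f j = e i j).card) else 0 := by
  classical
  -- The bound is proved for the sum over all `3 ^ n` colourings; some colouring is then at least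
  -- average.
  suffices h : ∑ _f : Fin n → Fin 3, ambiguity R π / 9 ≤ ∑ f : Fin n → Fin 3,
      ∑ i, if f i = 2 then Real.logb 2 (1 + (((contactSet R π i).erase i).filter
        fun j => f j = e i j).card) else 0 by
    obtain ⟨f, -, hf⟩ := Finset.exists_le_of_sum_le ⟨fun _ => 0, Finset.mem_univ _⟩ h
    exact ⟨f, hf⟩
  · rw [Finset.sum_comm, Finset.sum_const, ambiguity, Finset.sum_div, Finset.smul_sum]
    refine Finset.sum_le_sum fun i _ => ?_
    set Γ := (contactSet R π i).erase i with hΓ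
    have hcard : (contactSet R π i).card = Γ.card + 1 :=
      (Finset.card_erase_add_one (self_mem_contactSet R π i)).symm
    rw [hcard]
    simp only [Finset.card_univ, Fintype.card_fun, Fintype.card_fin, nsmul_eq_mul, Nat.cast_pow,
      Nat.cast_ofNat, Nat.cast_add, Nat.cast_one]
    rcases Nat.eq_zero_or_pos Γ.card with h0 | h0
    · rw [h0]
      simp only [CharP.cast_eq_zero, zero_add, Real.logb_one, zero_div, mul_zero]
      refine Finset.sum_nonneg fun f _ => ?_
      split_ifs
      · exact Real.logb_nonneg one_lt_two (by simp)
      · exact le_rfl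
    -- With the chord bound, the contribution of `i` becomes a sum over the members `j` of `Γ` of
    -- indicators, each of mean one ninth.
    · have hstep : ∀ f : Fin n → Fin 3, (∑ j ∈ Γ, if f i = 2 ∧ f j = e i j then (1 : ℝ) else 0) *
          (Real.logb 2 (1 + Γ.card) / Γ.card) ≤
          if f i = 2 then Real.logb 2 (1 + (Γ.filter fun j => f j = e i j).card) else 0 := by
        intro f
        split_ifs with h
        · simp only [h, true_and, Finset.sum_boole]
          have := logb_one_add_ge_chord (Finset.card_filter_le Γ fun j => f j = e i j) h0
          calc _ = _ := by ring
            _ ≤ _ := this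
        · simp [h]
      refine le_trans ?_ (Finset.sum_le_sum fun f _ => hstep f)
      rw [← Finset.sum_mul, Finset.sum_comm]
      have hsum : ∀ j ∈ Γ, (∑ f : Fin n → Fin 3, if f i = 2 ∧ f j = e i j then (1 : ℝ) else 0) =
          3 ^ n / 9 := by
        intro j hj
        have := card_filter_two_values (Finset.ne_of_mem_erase hj).symm 2 (e i j)
        rw [Finset.sum_boole, eq_div_iff (by norm_num), mul_comm]
        exact_mod_cast this
      rw [Finset.sum_congr rfl hsum, Finset.sum_const, nsmul_eq_mul]
      have : (0 : ℝ) < Γ.card := by exact_mod_cast h0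
      apply le_of_eq
      rw [add_comm (Γ.card : ℝ) 1]
      field_simp

theorem exists_slow_input (R : IntervalSet κ n) (hR : R.NoTouching) (π : Equiv.Perm (Fin n))
    (hπ : IsLevelPermutation R π) (alg : Cmd) (σ : Store)
    (halg : ∀ x, R.Realizes x → ∃ σ' t, Exec (R.fullInput x) alg σ σ' t ∧ HoldsAVLTree x σ') :
    ∃ x, R.Realizes x ∧ ∀ σ' t, Exec (R.fullInput x) alg σ σ' t →
      1 / 18 * ambiguity R π ≤ (t : ℝ) := by
  classical
  by_contra! hcon
  obtain ⟨v, hv1, hv2, hv3, hv4⟩ := exists_endpoint_samples R hR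
  -- Colour `0` fixes a point near the left endpoint, colour `1` near the right endpoint, and colour
  -- `2` lets it move. `e i j` is the colour that brings the point of `j` into the interior of `i`:
  -- the left endpoint of `j` if it lies to the right of that of `i`, and otherwise the right
  -- endpoint, which then lies inside.
  let e : Fin n → Fin n → Fin 3 := fun i j => if R.left i < R.left j then 0 else 1
  obtain ⟨f, hf⟩ := exists_good_assignment R π e
  let w : Fin n → ℝ := fun i => v (decide (f i = 1)) i
  let M : Finset (Fin n) := Finset.univ.filter fun i => f i = 2
  let S : Fin n → Finset (Fin n) := fun i =>
    if f i = 2 then ((contactSet R π i).erase i).filter fun j => f j = e i j else ∅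
  obtain ⟨x, hx1, hx2⟩ := exists_many_orders R w (fun i => hv1 _ i) (fun i j h => hv2 _ _ i j h) M S
    (by
      intro i hi j hj
      simp only [M, Finset.mem_filter, Finset.mem_univ, true_and] at hi
      simp only [S, hi, if_true, Finset.mem_filter, Finset.mem_erase] at hj
      obtain ⟨⟨hji, hjΓ⟩, hfj⟩ := hj
      obtain ⟨y, hyj, hyi⟩ := (mem_contactSet.1 hjΓ).2
      -- The intervals overlap in more than a boundary point: automatic for open intervals, and due
      -- to the absence of touching for closed ones.
      have hov : R.left i < R.right j ∧ R.left j < R.right i := by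
        cases κ
        · exact ⟨hyi.1.trans hyj.2, hyj.1.trans hyi.2⟩
        · exact ⟨lt_of_le_of_ne (hyi.1.trans hyj.2) (hR rfl j i hji).symm,
            lt_of_le_of_ne (hyj.1.trans hyi.2) (hR rfl i j hji.symm).symm⟩
      have hend := endpoint_of_mem_contactSet hπ hjΓ hji
      by_cases hl : R.left i < R.left j
      · have : f j = 0 := by simp [hfj, e, hl]
        refine ⟨by simp [M, this], ?_⟩
        simp only [w, this]
        exact hv3 i j hl hov.2
      · have : f j = 1 := by simp [hfj, e, hl]
        refine ⟨by simp [M, this], ?_⟩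
        simp only [w, this]
        exact hv4 i j hov.1 (hend.resolve_left hl))
    (by
      intro i hi
      simp only [M, Finset.mem_filter, Finset.mem_univ, true_and] at hi
      simp [S, hi])
  have hlog := logb_card_le_of_exec R x hx1 hx2 alg σ halg (1 / 18 * ambiguity R π)
    fun x hx => hcon x hx
  have hcard : Real.logb 2 (Fintype.card (∀ i, Option (S i))) =
      ∑ i, if f i = 2 then Real.logb 2 (1 + (((contactSet R π i).erase i).filter
        fun j => f j = e i j).card) else 0 := by
    rw [Fintype.card_pi, Nat.cast_prod, Real.logb_prod]
    · refine Finset.sum_congr rfl fun i _ => ?_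
      simp only [Fintype.card_option, Fintype.card_coe, S]
      split_ifs
      · push_cast; rw [add_comm]
      · simp
    · intro i _
      simp [Fintype.card_option]
      positivity
  rw [hcard] at hlog
  -- Entropy `A / 9` against time `A / 18` is contradictory only for positive ambiguity `A`;
  -- positivity follows because some run takes time less than `A / 18`.
  obtain ⟨σ', t, -, ht⟩ := hcon (x fun _ => none) (hx1 _)
  have : 0 ≤ (t : ℝ) := Nat.cast_nonneg t
  linarith

end ImpreciseSort

namespace ImpreciseSort

/-! ### Trees with a hole -/

namespace PTree

/-- An inner node whose subtree on the given side (`true` is left) is `t`, the other one is `u`. -/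
def mk : Bool → ℕ → PTree → PTree → PTree
  | true, p, t, u => node p t u
  | false, p, t, u => node p u t

/-- One inner node on the path from a subtree to the root: the side on which the subtree hangs,
the address of the node, and the other subtree. -/
structure Frame where
  side : Bool
  addr : ℕ
  sib : PTree

/-- The frames are listed from the hole up to the root, in the order in which rebalancing and finger
search follow parent pointers. -/
def plug : PTree → List Frame → PTree
  | t, [] => t
  | t, f :: c => plug (mk f.side f.addr t f.sib) c

variable {m m' : ℕ → ℕ}

@[simp] theorem addr_mk (s : Bool) (p : ℕ) (t u : PTree) : (mk s p t u).addr = p := by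
  cases s <;> rfl

@[simp] theorem height_mk (s : Bool) (p : ℕ) (t u : PTree) :
    (mk s p t u).height = max t.height u.height + 1 := by
  cases s
  · simp [mk, height, max_comm]
  · rfl

@[simp] theorem lastLabel_mk (s : Bool) (p : ℕ) (t u : PTree) :
    (mk s p t u).lastLabel = if s then u.lastLabel else t.lastLabel := by
  cases s <;> rfl

theorem leafEntries_mk (s : Bool) (p : ℕ) (t u : PTree) : (mk s p t u).leafEntries =
    if s then t.leafEntries ++ u.leafEntries else u.leafEntries ++ t.leafEntries := by
  cases s <;> rfl

theorem addrs_mk_perm (s : Bool) (p : ℕ) (t u : PTree) :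
    (mk s p t u).addrs.Perm (p :: (t.addrs ++ u.addrs)) := by
  cases s
  · exact List.Perm.cons _ List.perm_append_comm
  · exact List.Perm.refl _

theorem isAVL_mk (s : Bool) (p : ℕ) (t u : PTree) : (mk s p t u).IsAVL ↔
    t.height ≤ u.height + 1 ∧ u.height ≤ t.height + 1 ∧ t.IsAVL ∧ u.IsAVL := by
  cases s <;> simp only [mk, IsAVL] <;> tauto

theorem exists_eq_mk (s : Bool) (t : PTree) (h : t.height ≠ 0) : ∃ q a b, t = mk s q a b := by
  cases t with
  | leaf => simp [height] at h
  | node q l r =>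
    cases s
    · exact ⟨q, r, l, rfl⟩
    · exact ⟨q, l, r, rfl⟩

theorem labels_eq (t : PTree) : t.labels = t.leafEntries.map Prod.snd := by
  induction t with
  | leaf => rfl
  | node p l r ihl ihr => simp [labels, leafEntries, ihl, ihr]

theorem leafAddrs_eq (t : PTree) : t.leafAddrs = t.leafEntries.map Prod.fst := by
  induction t with
  | leaf => rfl
  | node p l r ihl ihr => simp [leafAddrs, leafEntries, ihl, ihr]

theorem leafEntries_ne_nil (t : PTree) : t.leafEntries ≠ [] := by
  induction t with
  | leaf => simp [leafEntries]
  | node p l r ihl ihr => simp [leafEntries, ihl]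

theorem lastLabel_eq (t : PTree) :
    t.lastLabel = (t.leafEntries.getLast t.leafEntries_ne_nil).2 := by
  induction t with
  | leaf => rfl
  | node p l r ihl ihr => simp [lastLabel, leafEntries, ihr, List.getLast_append_of_ne_nil,
      leafEntries_ne_nil]

theorem exists_leafEntries_eq_concat (t : PTree) :
    ∃ L p, t.leafEntries = L ++ [(p, t.lastLabel)] := by
  refine ⟨t.leafEntries.dropLast, (t.leafEntries.getLast t.leafEntries_ne_nil).1, ?_⟩
  rw [lastLabel_eq]
  exact (List.dropLast_append_getLast _).symm

theorem addr_mem_addrs (t : PTree) : t.addr ∈ t.addrs := by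
  cases t <;> simp [addr, addrs]

theorem leafAddrs_subset_addrs (t : PTree) : t.leafAddrs ⊆ t.addrs := by
  induction t with
  | leaf => simp [leafAddrs, addrs]
  | node p l r ihl ihr =>
    intro z hz
    simp only [leafAddrs, List.mem_append, addrs, List.mem_cons] at hz ⊢
    rcases hz with hz | hz
    · exact .inr (.inl (ihl hz))
    · exact .inr (.inr (ihr hz))

/-- Both children of a node of an AVL-tree have height at least two less than the node, so the
number of leaves doubles with every two levels. -/
theorem two_pow_half_height_le (t : PTree) (h : t.IsAVL) :
    2 ^ (t.height / 2) ≤ t.leafEntries.length := by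
  suffices H : ∀ k (t : PTree), t.IsAVL → 2 * k ≤ t.height → 2 ^ k ≤ t.leafEntries.length from
    H _ t h (Nat.mul_div_le _ _)
  intro k
  induction k with
  | zero => intro t _ _; exact List.length_pos_of_ne_nil t.leafEntries_ne_nil
  | succ k ih =>
    intro t ht hk
    cases t with
    | leaf => simp [height] at hk
    | node p l r =>
      obtain ⟨h1, h2, h3, h4⟩ := ht
      simp only [height] at hk
      have hl := ih l h3 (by omega)
      have hr := ih r h4 (by omega)
      simp only [leafEntries, List.length_append, pow_succ]
      omega

/-! #### Contexts -/

/-- Addresses in a context. -/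
def ctxAddrs : List Frame → List ℕ
  | [] => []
  | f :: c => f.addr :: (f.sib.addrs ++ ctxAddrs c)

theorem addrs_plug_perm (t : PTree) (c : List Frame) :
    (plug t c).addrs.Perm (t.addrs ++ ctxAddrs c) := by
  induction c generalizing t with
  | nil => simp [plug, ctxAddrs]
  | cons f c ih =>
    refine (ih _).trans (((addrs_mk_perm _ _ _ _).append_right _).trans ?_)
    simp only [ctxAddrs, List.cons_append, List.append_assoc]
    exact List.perm_middle.symm

/-- Leaves left of the hole. -/
def ctxBefore : List Frame → List (ℕ × ℕ)
  | [] => []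
  | f :: c => ctxBefore c ++ if f.side then [] else f.sib.leafEntries

/-- Leaves right of the hole. -/
def ctxAfter : List Frame → List (ℕ × ℕ)
  | [] => []
  | f :: c => (if f.side then f.sib.leafEntries else []) ++ ctxAfter c

theorem leafEntries_plug (t : PTree) (c : List Frame) :
    (plug t c).leafEntries = ctxBefore c ++ t.leafEntries ++ ctxAfter c := by
  induction c generalizing t with
  | nil => simp [plug, ctxBefore, ctxAfter]
  | cons f c ih =>
    rw [plug, ih, leafEntries_mk]
    cases h : f.side <;> simp [ctxBefore, ctxAfter, h]

/-- Address of the parent of the hole. -/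
def ctxParent : List Frame → ℕ
  | [] => 0
  | f :: _ => f.addr

/-- The first argument is a nominal height of the subtree in the hole. It need not be the actual
one: during rebalancing the context is still the one for the height before the insertion. -/
def CtxAVL : ℕ → List Frame → Prop
  | _, [] => True
  | h, f :: c => h ≤ f.sib.height + 1 ∧ f.sib.height ≤ h + 1 ∧ f.sib.IsAVL ∧
      CtxAVL (max h f.sib.height + 1) c

theorem isAVL_plug (t : PTree) (c : List Frame) :
    (plug t c).IsAVL ↔ t.IsAVL ∧ CtxAVL t.height c := by
  induction c generalizing t with
  | nil => simp [plug, CtxAVL]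
  | cons f c ih =>
    rw [plug, ih, isAVL_mk, height_mk, CtxAVL]
    tauto

theorem addr_plug_congr {t t' : PTree} (h : t.addr = t'.addr) (c : List Frame) :
    (plug t c).addr = (plug t' c).addr := by
  cases c with
  | nil => exact h
  | cons f c =>
    have : ∀ (c : List Frame) (t t' : PTree), t.addr = t'.addr →
        (plug t c).addr = (plug t' c).addr := by
      intro c
      induction c with
      | nil => intro t t' h; exact h
      | cons f c ih => intro t t' _; exact ih _ _ (by simp)
    exact this _ _ _ h

/-- The number of balanced inner nodes of height at least two. -/
def potential : PTree → ℕ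
  | leaf _ _ => 0
  | node _ l r => l.potential + r.potential + if l.height = r.height ∧ 1 ≤ l.height then 1 else 0

theorem potential_mk (s : Bool) (p : ℕ) (t u : PTree) : (mk s p t u).potential =
    t.potential + u.potential + if t.height = u.height ∧ 1 ≤ t.height then 1 else 0 := by
  cases s
  · simp only [mk, potential]
    rw [Nat.add_comm u.potential]
    congr 1
    by_cases h : t.height = u.height
    · simp [h]
    · simp [h, Ne.symm h]
  · rfl

def ctxPotential : ℕ → List Frame → ℕ
  | _, [] => 0
  | h, f :: c => f.sib.potential + (if h = f.sib.height ∧ 1 ≤ h then 1 else 0) +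
      ctxPotential (max h f.sib.height + 1) c

theorem potential_plug (t : PTree) (c : List Frame) :
    (plug t c).potential = t.potential + ctxPotential t.height c := by
  induction c generalizing t with
  | nil => simp [plug, ctxPotential]
  | cons f c ih =>
    rw [plug, ih, potential_mk, height_mk, ctxPotential]
    omega

/-- The only balanced inner nodes of a Fibonacci tree have two leaves as children, and these have
height one and are not counted. -/
theorem IsFibonacci.potential_eq_zero {t : PTree} (h : t.IsFibonacci) : t.potential = 0 := by
  induction t with
  | leaf => rfl
  | node p l r ihl ihr =>
    obtain ⟨h1, h2, h3⟩ := h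
    simp only [potential, ihl h2, ihr h3]
    rw [if_neg (by omega)]

theorem IsFibonacci.isAVL {t : PTree} (h : t.IsFibonacci) : t.IsAVL := by
  induction t with
  | leaf => trivial
  | node p l r ihl ihr =>
    obtain ⟨h1, h2, h3⟩ := h
    exact ⟨by omega, by omega, ihl h2, ihr h3⟩

/-! #### Trees in memory -/

/-- Number code of a side, the offset of the child pointer. -/
def sideCode (s : Bool) : ℕ := if s then 0 else 1

/-- The balance of a node in terms of the heights of the subtree on the given side and the
other one. -/
def sideBalance (s : Bool) (h h' : ℕ) : ℕ :=
  if h = h' then 0 else if h' < h then 1 + sideCode s else 2 - sideCode s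

theorem balanceCode_mk (l r : PTree) : balanceCode l r = sideBalance true l.height r.height := rfl

theorem balanceCode_mk' (l r : PTree) : balanceCode l r = sideBalance false r.height l.height := by
  simp only [balanceCode, sideBalance, sideCode]
  split_ifs <;> simp_all <;> omega

/-- The memory holds the tree with parent pointers and balances. -/
def Rep (m : ℕ → ℕ) : ℕ → PTree → Prop
  | q, leaf p a => m p = 0 ∧ m (p + 1) = a ∧ m (p + 4) = q
  | q, node p l r => m p = 1 ∧ m (p + 1) = l.lastLabel ∧ m (p + 2) = l.addr ∧ m (p + 3) = r.addr ∧
      m (p + 4) = q ∧ m (p + 5) = balanceCode l r ∧ l.Rep m p ∧ r.Rep m p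

theorem rep_iff (q : ℕ) (t : PTree) : t.Rep m q ↔ t.Stored m ∧ t.ParentsStored m q := by
  induction t generalizing q with
  | leaf => simp only [Rep, Stored, ParentsStored]; tauto
  | node p l r ihl ihr => simp only [Rep, Stored, ParentsStored, ihl, ihr]; tauto

theorem rep_mk (s : Bool) (q p : ℕ) (t u : PTree) : (mk s p t u).Rep m q ↔
    m p = 1 ∧ m (p + 1) = (if s then t.lastLabel else u.lastLabel) ∧
      m (p + 2 + sideCode s) = t.addr ∧ m (p + 3 - sideCode s) = u.addr ∧
      m (p + 4) = q ∧ m (p + 5) = sideBalance s t.height u.height ∧ t.Rep m p ∧ u.Rep m p := by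
  cases s
  · simp only [mk, Rep, balanceCode_mk', sideCode]
    simp only [Bool.false_eq_true, if_false, show p + 2 + 1 = p + 3 from rfl,
      show p + 3 - 1 = p + 2 from rfl]
    tauto
  · simp only [mk, Rep, balanceCode_mk, sideCode]
    simp

theorem Rep.parent {q : ℕ} {t : PTree} (h : t.Rep m q) : m (t.addr + 4) = q := by
  cases t with
  | leaf => exact h.2.2
  | node => exact h.2.2.2.2.1

/-- The cell `z` belongs to one of the records at the given addresses. -/
def InCells (l : List ℕ) (z : ℕ) : Prop := ∃ p ∈ l, p ≤ z ∧ z < p + 6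

theorem inCells_add {l : List ℕ} {p : ℕ} (h : p ∈ l) {j : ℕ} (hj : j < 6) : InCells l (p + j) :=
  ⟨p, h, by omega, by omega⟩

theorem Rep.congr {q : ℕ} {t : PTree} (h : t.Rep m q)
    (hm : ∀ z, InCells t.addrs z → m' z = m z) : t.Rep m' q := by
  induction t generalizing q with
  | leaf p a =>
    have h' : ∀ j < 6, m' (p + j) = m (p + j) := fun j hj => hm _ (inCells_add (by simp [addrs]) hj)
    have h0 := h' 0 (by omega)
    simp only [add_zero] at h0
    simpa only [Rep, h0, h' 1 (by omega), h' 4 (by omega)] using h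
  | node p l r ihl ihr =>
    have h' : ∀ j < 6, m' (p + j) = m (p + j) := fun j hj => hm _ (inCells_add (by simp [addrs]) hj)
    have h0 := h' 0 (by omega)
    simp only [add_zero] at h0
    obtain ⟨h1, h2, h3, h4, h5, h6, h7, h8⟩ := h
    refine ⟨h0.trans h1, (h' 1 (by omega)).trans h2, (h' 2 (by omega)).trans h3,
      (h' 3 (by omega)).trans h4, (h' 4 (by omega)).trans h5, (h' 5 (by omega)).trans h6,
      ihl h7 fun z hz => hm z ?_, ihr h8 fun z hz => hm z ?_⟩
    · obtain ⟨p', h1, h2⟩ := hz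
      exact ⟨p', by simp [addrs, h1], h2⟩
    · obtain ⟨p', h1, h2⟩ := hz
      exact ⟨p', by simp [addrs, h1], h2⟩

/-- The records at the given addresses do not overlap. -/
def Sep (l : List ℕ) : Prop := l.Pairwise fun p q => p + 6 ≤ q ∨ q + 6 ≤ p

theorem sep_cons {p : ℕ} {l : List ℕ} :
    Sep (p :: l) ↔ (∀ q ∈ l, p + 6 ≤ q ∨ q + 6 ≤ p) ∧ Sep l := List.pairwise_cons

theorem sep_append {l l' : List ℕ} :
    Sep (l ++ l') ↔ Sep l ∧ Sep l' ∧ ∀ p ∈ l, ∀ q ∈ l', p + 6 ≤ q ∨ q + 6 ≤ p :=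
  List.pairwise_append

theorem Sep.perm {l l' : List ℕ} (h : Sep l) (hp : l.Perm l') : Sep l' :=
  (hp.pairwise_iff (fun h => h.symm)).1 h

theorem sep_iff_blocks (t : PTree) : t.blocks.Pairwise DisjointBlocks ↔ Sep t.addrs := by
  rw [blocks, List.pairwise_map]
  rfl

/-- The tree stays in memory when the parent pointer of its root is changed. -/
theorem Rep.reparent {q q' : ℕ} {t : PTree} (h : t.Rep m q) (hs : Sep t.addrs)
    (hm : ∀ z, InCells t.addrs z → z ≠ t.addr + 4 → m' z = m z) (hq : m' (t.addr + 4) = q') :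
    t.Rep m' q' := by
  cases t with
  | leaf p a =>
    have h' : ∀ j < 6, j ≠ 4 → m' (p + j) = m (p + j) := fun j hj hj' =>
      hm _ (inCells_add (by simp [addrs]) hj) (by simp [addr, hj'])
    have h0 := h' 0 (by omega) (by omega)
    simp only [add_zero] at h0
    exact ⟨h0.trans h.1, (h' 1 (by omega) (by omega)).trans h.2.1, hq⟩
  | node p l r =>
    have h' : ∀ j < 6, j ≠ 4 → m' (p + j) = m (p + j) := fun j hj hj' =>
      hm _ (inCells_add (by simp [addrs]) hj) (by simp [addr, hj'])
    have h0 := h' 0 (by omega) (by omega)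
    simp only [add_zero] at h0
    obtain ⟨h1, h2, h3, h4, -, h6, h7, h8⟩ := h
    simp only [addrs, sep_cons, List.mem_append] at hs
    refine ⟨h0.trans h1, (h' 1 (by omega) (by omega)).trans h2,
      (h' 2 (by omega) (by omega)).trans h3, (h' 3 (by omega) (by omega)).trans h4, hq,
      (h' 5 (by omega) (by omega)).trans h6,
      h7.congr fun z hz => ?_, h8.congr fun z hz => ?_⟩
    · obtain ⟨p', h1, h2⟩ := hz
      have := hs.1 p' (.inl h1)
      exact hm z ⟨p', by simp [addrs, h1], h2⟩ (by simp only [addr]; omega)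
    · obtain ⟨p', h1, h2⟩ := hz
      have := hs.1 p' (.inr h1)
      exact hm z ⟨p', by simp [addrs, h1], h2⟩ (by simp only [addr]; omega)

/-- The memory holds the context of a hole of the given address, height and last label. -/
def CtxRep (m : ℕ → ℕ) : ℕ → ℕ → ℕ → List Frame → Prop
  | _, _, _, [] => True
  | a, h, k, f :: c => m f.addr = 1 ∧ m (f.addr + 1) = (if f.side then k else f.sib.lastLabel) ∧
      m (f.addr + 2 + sideCode f.side) = a ∧ m (f.addr + 3 - sideCode f.side) = f.sib.addr ∧
      m (f.addr + 4) = ctxParent c ∧ m (f.addr + 5) = sideBalance f.side h f.sib.height ∧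
      f.sib.Rep m f.addr ∧
      CtxRep m f.addr (max h f.sib.height + 1) (if f.side then f.sib.lastLabel else k) c

theorem rep_plug (t : PTree) (c : List Frame) : (plug t c).Rep m 0 ↔
    t.Rep m (ctxParent c) ∧ CtxRep m t.addr t.height t.lastLabel c := by
  induction c generalizing t with
  | nil => simp [plug, CtxRep, ctxParent]
  | cons f c ih =>
    rw [plug, ih, rep_mk, CtxRep, addr_mk, height_mk, lastLabel_mk]
    simp only [ctxParent]
    tauto

theorem CtxRep.congr {a h k : ℕ} {c : List Frame} (H : CtxRep m a h k c)
    (hm : ∀ z, InCells (ctxAddrs c) z → m' z = m z) : CtxRep m' a h k c := by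
  induction c generalizing a h k with
  | nil => trivial
  | cons f c ih =>
    have h' : ∀ j < 6, m' (f.addr + j) = m (f.addr + j) := fun j hj =>
      hm _ (inCells_add (by simp [ctxAddrs]) hj)
    have h0 := h' 0 (by omega)
    simp only [add_zero] at h0
    obtain ⟨h1, h2, h3, h4, h5, h6, h7, h8⟩ := H
    refine ⟨h0.trans h1, (h' 1 (by omega)).trans h2, ?_, ?_,
      (h' 4 (by omega)).trans h5, (h' 5 (by omega)).trans h6,
      h7.congr fun z hz => hm z ?_, ih h8 fun z hz => hm z ?_⟩
    · rw [← h3, add_assoc]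
      exact h' _ (by simp only [sideCode]; split_ifs <;> omega)
    · rw [← h4, Nat.add_sub_assoc (by simp only [sideCode]; split_ifs <;> omega)]
      exact h' _ (by simp only [sideCode]; split_ifs <;> omega)
    · obtain ⟨p', h1, h2⟩ := hz
      exact ⟨p', by simp [ctxAddrs, h1], h2⟩
    · obtain ⟨p', h1, h2⟩ := hz
      exact ⟨p', by simp [ctxAddrs, h1], h2⟩

/-- The key stored for the hole matters only if there is a leaf on its right. -/
theorem CtxRep.change_key {a h k : ℕ} {c : List Frame} (H : CtxRep m a h k c) (k' : ℕ)
    (hc : ctxAfter c = []) : CtxRep m a h k' c := by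
  induction c generalizing a h k with
  | nil => trivial
  | cons f c ih =>
    simp only [ctxAfter, List.append_eq_nil_iff] at hc
    have hs : f.side = false := by
      by_contra hs
      simp only [Bool.not_eq_false] at hs
      simp [hs, leafEntries_ne_nil] at hc
    obtain ⟨h1, h2, h3, h4, h5, h6, h7, h8⟩ := H
    simp only [hs, Bool.false_eq_true, if_false] at h2 h8
    refine ⟨h1, ?_, h3, h4, h5, h6, h7, ?_⟩
    · simpa [hs] using h2
    · simpa [hs] using ih h8 hc.2

theorem exists_plug_aux (t : PTree) {A B : List (ℕ × ℕ)} {e : ℕ × ℕ}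
    (h : t.leafEntries = A ++ e :: B) (c₀ : List Frame) :
    ∃ c, plug t c₀ = plug (leaf e.1 e.2) c ∧ ctxBefore c = ctxBefore c₀ ++ A ∧
      ctxAfter c = B ++ ctxAfter c₀ := by
  induction t generalizing A B c₀ with
  | leaf p a =>
    have h' : A = [] ∧ e = (p, a) ∧ B = [] := by
      cases A with
      | nil => simp [leafEntries] at h; simp [h]
      | cons => simp [leafEntries] at h
    obtain ⟨rfl, rfl, rfl⟩ := h'
    exact ⟨c₀, rfl, by simp, by simp⟩
  | node p l r ihl ihr =>
    rcases List.append_eq_append_iff.1 h with ⟨A', hA, hr⟩ | ⟨B', hl, hB⟩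
    · obtain ⟨c, h1, h2, h3⟩ := ihr hr (⟨false, p, l⟩ :: c₀)
      exact ⟨c, h1, by simp [h2, ctxBefore, hA], by simp [h3, ctxAfter]⟩
    · cases B' with
      | nil =>
        simp only [List.append_nil, List.nil_append] at hl hB
        obtain ⟨c, h1, h2, h3⟩ := ihr (A := []) hB.symm (⟨false, p, l⟩ :: c₀)
        exact ⟨c, h1, by simp [h2, ctxBefore, hl], by simp [h3, ctxAfter]⟩
      | cons e' B' =>
        simp only [List.cons_append, List.cons.injEq] at hB
        obtain ⟨rfl, rfl⟩ := hB
        obtain ⟨c, h1, h2, h3⟩ := ihl hl (⟨true, p, r⟩ :: c₀)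
        exact ⟨c, h1, by simp [h2, ctxBefore], by simp [h3, ctxAfter]⟩

/-- Every leaf is the hole of some context. -/
theorem exists_plug {t : PTree} {A B : List (ℕ × ℕ)} {e : ℕ × ℕ}
    (h : t.leafEntries = A ++ e :: B) :
    ∃ c, t = plug (leaf e.1 e.2) c ∧ ctxBefore c = A ∧ ctxAfter c = B := by
  obtain ⟨c, h1, h2, h3⟩ := exists_plug_aux t h []
  exact ⟨c, h1, by simpa [ctxBefore] using h2, by simpa [ctxAfter] using h3⟩

end PTree

end ImpreciseSort

namespace ImpreciseSort

/-! ### Notation for programs -/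

instance : Add Expr := ⟨Expr.add⟩
instance : Sub Expr := ⟨Expr.sub⟩
instance (k : ℕ) : OfNat Expr k := ⟨Expr.lit k⟩

local notation:max "v#" k:max => Expr.var k
local notation:max "M[" e "]" => Expr.load e
local infix:50 " ≔ " => Cmd.assign
local infix:50 " ⇐ " => Cmd.write
local infixr:40 " ;; " => Cmd.seq

@[simp] theorem Expr.eval_plus (a b : Expr) (σ : Store) : (a + b).eval σ = a.eval σ + b.eval σ := rfl
@[simp] theorem Expr.eval_minus (a b : Expr) (σ : Store) : (a - b).eval σ = a.eval σ - b.eval σ := rfl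
@[simp] theorem Expr.eval_ofNat (k : ℕ) (σ : Store) :
    (no_index (OfNat.ofNat k) : Expr).eval σ = OfNat.ofNat k := rfl
@[simp] theorem Expr.cost_plus (a b : Expr) : (a + b).cost = a.cost + b.cost + 1 := rfl
@[simp] theorem Expr.cost_minus (a b : Expr) : (a - b).cost = a.cost + b.cost + 1 := rfl
@[simp] theorem Expr.cost_ofNat (k : ℕ) : (no_index (OfNat.ofNat k) : Expr).cost = 0 := rfl

/-- The test whether two expressions are equal. -/
def Test.eq (a b : Expr) : Test := .le ((a - b) + (b - a)) 0

@[simp] theorem Test.holds_eq (a b : Expr) (inp : Input) (σ : Store) :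
    (Test.eq a b).Holds inp σ ↔ a.eval σ = b.eval σ := by
  simp only [Test.eq, Test.Holds, Expr.eval_plus, Expr.eval_minus, Expr.eval_ofNat]
  omega

theorem Test.holds_le (a b : Expr) (inp : Input) (σ : Store) :
    (Test.le a b).Holds inp σ ↔ a.eval σ ≤ b.eval σ := Iff.rfl

theorem Test.holds_less (s s' : Src) (a b : Expr) (inp : Input) (σ : Store) :
    (Test.less s a s' b).Holds inp σ ↔ inp s (a.eval σ) < inp s' (b.eval σ) := Iff.rfl

attribute [simp] Test.holds_le Test.holds_less Cmd.eval Expr.eval Cmd.LoopFree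

namespace PTree

/-! ### Rebalancing

Variables: `10` is the current node, whose height has grown; `21` its parent; `22` its side;
`24` and `25` to `27` are auxiliary; `16` tells whether to continue. -/

/-- Child fields are addressed as `2 + s` and `3 - s` with the side code `s`, so one text serves
both mirror images. The record of the parent stays the root of the rotated subtree and only contents
are exchanged, so that nothing above it has to change. -/
def rotateSingle : Cmd :=
  24 ≔ M[v#21 + 1] ;;
  25 ≔ M[(v#10 + 2) + v#22] ;;
  (v#21 + 1) ⇐ M[v#10 + 1] ;;
  (v#10 + 1) ⇐ v#24 ;;
  ((v#21 + 2) + v#22) ⇐ v#25 ;;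
  ((v#21 + 3) - v#22) ⇐ v#10 ;;
  (v#25 + 4) ⇐ v#21 ;;
  ((v#10 + 2) + v#22) ⇐ v#26 ;;
  ((v#10 + 3) - v#22) ⇐ v#27 ;;
  (v#27 + 4) ⇐ v#10 ;;
  (v#21 + 5) ⇐ 0 ;;
  (v#10 + 5) ⇐ 0

/-- The parent again keeps its address at the top; the inner grandchild moves to the opposite side
as its second child. The old balance of the grandchild, saved in `29`, decides the new balances of
the two lower nodes. -/
def rotateDouble : Cmd :=
  24 ≔ M[v#21 + 1] ;;
  25 ≔ M[(v#26 + 2) + v#22] ;;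
  28 ≔ M[(v#26 + 3) - v#22] ;;
  29 ≔ M[v#26 + 5] ;;
  (v#21 + 1) ⇐ M[v#26 + 1] ;;
  (v#26 + 1) ⇐ v#24 ;;
  ((v#21 + 3) - v#22) ⇐ v#26 ;;
  ((v#10 + 3) - v#22) ⇐ v#25 ;;
  (v#25 + 4) ⇐ v#10 ;;
  ((v#26 + 2) + v#22) ⇐ v#28 ;;
  ((v#26 + 3) - v#22) ⇐ v#27 ;;
  (v#27 + 4) ⇐ v#26 ;;
  (v#26 + 4) ⇐ v#21 ;;
  (v#21 + 5) ⇐ 0 ;;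
  .ite (.eq v#29 (2 - v#22)) ((v#10 + 5) ⇐ (1 + v#22)) ((v#10 + 5) ⇐ 0) ;;
  .ite (.eq v#29 (1 + v#22)) ((v#26 + 5) ⇐ (2 - v#22)) ((v#26 + 5) ⇐ 0)

/-- The balance of the parent before the growth distinguishes three cases: a balanced parent grows
and the process moves up; a parent leaning to the other side becomes balanced and absorbs the
growth; a parent already leaning to this side is rotated. -/
def rebalanceStep : Cmd :=
  21 ≔ M[v#10 + 4] ;;
  .ite (.le v#21 0) (16 ≔ 0)
    (.ite (.eq M[v#21 + 2] v#10) (22 ≔ 0) (22 ≔ 1) ;;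
     .ite (.le M[v#21 + 5] 0) ((v#21 + 5) ⇐ (1 + v#22) ;; 10 ≔ v#21)
      (16 ≔ 0 ;;
       .ite (.eq M[v#21 + 5] (1 + v#22))
        (27 ≔ M[(v#21 + 3) - v#22] ;;
         26 ≔ M[(v#10 + 3) - v#22] ;;
         .ite (.eq M[v#10 + 5] (1 + v#22)) rotateSingle rotateDouble)
        ((v#21 + 5) ⇐ 0)))

def rebalance : Cmd :=
  16 ≔ 1 ;; .loop (.le 1 v#16) rebalanceStep

theorem sideCode_le (s : Bool) : sideCode s ≤ 1 := by cases s <;> simp [sideCode]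

variable {inp : Input} {σ : Store}

theorem rebalanceStep_root (h : σ.mem (σ.var 10 + 4) = 0) :
    Runs inp rebalanceStep σ 150 fun σ' => σ'.var 16 = 0 ∧ σ'.mem = σ.mem := by
  refine Runs.eval (by simp [rebalanceStep, rotateSingle, rotateDouble]) (by decide) ?_
  simp [rebalanceStep, h]

theorem rebalanceStep_up {p s : ℕ} (h : σ.mem (σ.var 10 + 4) = p) (hp : p ≠ 0)
    (hs : s = if σ.mem (p + 2) = σ.var 10 then 0 else 1) (hb : σ.mem (p + 5) = 0) :
    Runs inp rebalanceStep σ 150 fun σ' => σ'.var 16 = σ.var 16 ∧ σ'.var 10 = p ∧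
      σ'.mem = Function.update σ.mem (p + 5) (1 + s) := by
  refine Runs.eval (by simp [rebalanceStep, rotateSingle, rotateDouble]) (by decide) ?_
  by_cases h' : σ.mem (p + 2) = σ.var 10 <;>
  simp [rebalanceStep, h, hp, hs, hb, h']

theorem rebalanceStep_done {p s : ℕ} (h : σ.mem (σ.var 10 + 4) = p) (hp : p ≠ 0)
    (hs : s = if σ.mem (p + 2) = σ.var 10 then 0 else 1) (hb : σ.mem (p + 5) = 2 - s) :
    Runs inp rebalanceStep σ 150 fun σ' => σ'.var 16 = 0 ∧
      σ'.mem = Function.update σ.mem (p + 5) 0 := by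
  refine Runs.eval (by simp [rebalanceStep, rotateSingle, rotateDouble]) (by decide) ?_
  by_cases h' : σ.mem (p + 2) = σ.var 10 <;>
  simp [rebalanceStep, h, hp, hs, hb, h'] at *

open Function in
theorem rebalanceStep_single {p s : ℕ} (h : σ.mem (σ.var 10 + 4) = p) (hp : p ≠ 0)
    (hs : s = if σ.mem (p + 2) = σ.var 10 then 0 else 1) (hb : σ.mem (p + 5) = 1 + s)
    {q a b u kp kq : ℕ} (hq : σ.var 10 = q) (hb' : σ.mem (q + 5) = 1 + s)
    (ha : σ.mem (q + 2 + s) = a) (hbq : σ.mem (q + 3 - s) = b) (hu : σ.mem (p + 3 - s) = u)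
    (hkp : σ.mem (p + 1) = kp) (hkq : σ.mem (q + 1) = kq) :
    Runs inp rebalanceStep σ 150 fun σ' => σ'.var 16 = 0 ∧
      σ'.mem = update (update (update (update (update (update (update (update (update (update σ.mem
        (p + 1) kq) (q + 1) kp) (p + 2 + s) a) (p + 3 - s) q) (a + 4) p) (q + 2 + s) b)
        (q + 3 - s) u) (u + 4) q) (p + 5) 0) (q + 5) 0 := by
  refine Runs.eval (by simp [rebalanceStep, rotateSingle, rotateDouble]) (by decide) ?_
  subst hq
  by_cases h' : σ.mem (p + 2) = σ.var 10 <;> simp only [h', if_true, if_false] at hs <;> subst hs <;>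
  simp [rebalanceStep, rotateSingle, h, hp, hb, h', hb', ← ha,
    ← hbq, ← hu, ← hkp, ← hkq] at *

open Function in
theorem rebalanceStep_double {p s : ℕ} (h : σ.mem (σ.var 10 + 4) = p) (hp : p ≠ 0)
    (hs : s = if σ.mem (p + 2) = σ.var 10 then 0 else 1) (hb : σ.mem (p + 5) = 1 + s)
    {q r b₁ b₂ u kp kr bal : ℕ} (hq : σ.var 10 = q) (hb' : σ.mem (q + 5) ≠ 1 + s)
    (hr : σ.mem (q + 3 - s) = r) (hu : σ.mem (p + 3 - s) = u) (hkp : σ.mem (p + 1) = kp)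
    (hkr : σ.mem (r + 1) = kr) (hb₁ : σ.mem (r + 2 + s) = b₁) (hb₂ : σ.mem (r + 3 - s) = b₂)
    (hbal : σ.mem (r + 5) = bal) :
    Runs inp rebalanceStep σ 150 fun σ' => σ'.var 16 = 0 ∧
      σ'.mem = update (update (update (update (update (update (update (update (update (update
        (update (update σ.mem (p + 1) kr) (r + 1) kp) (p + 3 - s) r) (q + 3 - s) b₁) (b₁ + 4) q)
        (r + 2 + s) b₂) (r + 3 - s) u) (u + 4) r) (r + 4) p) (p + 5) 0)
        (q + 5) (if bal = 2 - s then 1 + s else 0)) (r + 5) (if bal = 1 + s then 2 - s else 0) := by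
  refine Runs.eval (by simp [rebalanceStep, rotateSingle, rotateDouble]) (by decide) ?_
  subst hq
  by_cases h' : σ.mem (p + 2) = σ.var 10 <;> simp only [h', if_true, if_false] at hs <;> subst hs <;>
  norm_num at hb hb' hr hu hb₁ hb₂ hp h'
  · by_cases h1 : bal = 1 <;> by_cases h2 : bal = 2 <;>
    simp [rebalanceStep, rotateDouble, h, hp, hb, h', hb', hr, hu, hkp, hkr, hb₁, hb₂, hbal, h1, h2]
  · rw [hu] at h'
    by_cases h1 : bal = 1 <;> by_cases h2 : bal = 2 <;>
    simp [rebalanceStep, rotateDouble, h, hp, hb, h', hb', hr, hu, hkp, hkr, hb₁, hb₂, hbal, h1, h2]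

theorem Sep.disj {l : List ℕ} (h : Sep l) {x y : ℕ} (hx : x ∈ l) (hy : y ∈ l) :
    x = y ∨ x + 6 ≤ y ∨ y + 6 ≤ x := by
  by_cases hxy : x = y
  · exact .inl hxy
  · have : Std.Symm fun p q : ℕ => p + 6 ≤ q ∨ q + 6 ≤ p := ⟨fun _ _ h => h.symm⟩
    exact .inr (List.Pairwise.forall h hx hy hxy)

open Function in
-- Pure address arithmetic: records of six cells that do not overlap keep the ten writes independent
-- of each other.
theorem rotateSingle_mem {m m' : ℕ → ℕ} {p q a b u s : ℕ} (hs : s ≤ 1)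
    (pq : p + 6 ≤ q ∨ q + 6 ≤ p) (pa : p + 6 ≤ a ∨ a + 6 ≤ p) (pu : p + 6 ≤ u ∨ u + 6 ≤ p)
    (qa : q + 6 ≤ a ∨ a + 6 ≤ q) (qu : q + 6 ≤ u ∨ u + 6 ≤ q) (au : a + 6 ≤ u ∨ u + 6 ≤ a)
    (hm : m' = update (update (update (update (update (update (update (update (update (update m
        (p + 1) (m (q + 1))) (q + 1) (m (p + 1))) (p + 2 + s) a) (p + 3 - s) q) (a + 4) p)
        (q + 2 + s) b) (q + 3 - s) u) (u + 4) q) (p + 5) 0) (q + 5) 0) :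
    (m' p = m p ∧ m' (p + 1) = m (q + 1) ∧ m' (p + 2 + s) = a ∧ m' (p + 3 - s) = q ∧
      m' (p + 4) = m (p + 4) ∧ m' (p + 5) = 0) ∧
    (m' q = m q ∧ m' (q + 1) = m (p + 1) ∧ m' (q + 2 + s) = b ∧ m' (q + 3 - s) = u ∧
      m' (q + 4) = m (q + 4) ∧ m' (q + 5) = 0) ∧ m' (a + 4) = p ∧ m' (u + 4) = q ∧
    ∀ z, (z < p ∨ p + 6 ≤ z) → (z < q ∨ q + 6 ≤ z) → z ≠ a + 4 → z ≠ u + 4 → m' z = m z := by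
  subst hm
  obtain rfl | rfl : s = 0 ∨ s = 1 := by omega
  all_goals
    refine ⟨?_, ?_, ?_, ?_, ?_⟩
    · refine ⟨?_, ?_, ?_, ?_, ?_, ?_⟩ <;> simp (disch := omega) only [update_self, update_of_ne]
    · refine ⟨?_, ?_, ?_, ?_, ?_, ?_⟩ <;> simp (disch := omega) only [update_self, update_of_ne]
    · simp (disch := omega) only [update_self, update_of_ne]
    · simp (disch := omega) only [update_self, update_of_ne]
    · intro z h1 h2 h3 h4
      clear pq pa pu qa qu au
      simp (disch := omega) only [update_of_ne]

open Function in
theorem rotateDouble_mem {m m' : ℕ → ℕ} {p q r b₁ b₂ u s c d : ℕ} (hs : s ≤ 1)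
    (pq : p + 6 ≤ q ∨ q + 6 ≤ p) (pr : p + 6 ≤ r ∨ r + 6 ≤ p) (qr : q + 6 ≤ r ∨ r + 6 ≤ q)
    (pb : p + 6 ≤ b₁ ∨ b₁ + 6 ≤ p) (qb : q + 6 ≤ b₁ ∨ b₁ + 6 ≤ q) (rb : r + 6 ≤ b₁ ∨ b₁ + 6 ≤ r)
    (pu : p + 6 ≤ u ∨ u + 6 ≤ p) (qu : q + 6 ≤ u ∨ u + 6 ≤ q) (ru : r + 6 ≤ u ∨ u + 6 ≤ r)
    (bu : b₁ + 6 ≤ u ∨ u + 6 ≤ b₁)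
    (hm : m' = update (update (update (update (update (update (update (update (update (update
        (update (update m (p + 1) (m (r + 1))) (r + 1) (m (p + 1))) (p + 3 - s) r) (q + 3 - s) b₁)
        (b₁ + 4) q) (r + 2 + s) b₂) (r + 3 - s) u) (u + 4) r) (r + 4) p) (p + 5) 0)
        (q + 5) c) (r + 5) d) :
    (m' p = m p ∧ m' (p + 1) = m (r + 1) ∧ m' (p + 2 + s) = m (p + 2 + s) ∧ m' (p + 3 - s) = r ∧
      m' (p + 4) = m (p + 4) ∧ m' (p + 5) = 0) ∧
    (m' q = m q ∧ m' (q + 1) = m (q + 1) ∧ m' (q + 2 + s) = m (q + 2 + s) ∧ m' (q + 3 - s) = b₁ ∧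
      m' (q + 4) = m (q + 4) ∧ m' (q + 5) = c) ∧
    (m' r = m r ∧ m' (r + 1) = m (p + 1) ∧ m' (r + 2 + s) = b₂ ∧ m' (r + 3 - s) = u ∧
      m' (r + 4) = p ∧ m' (r + 5) = d) ∧ m' (b₁ + 4) = q ∧ m' (u + 4) = r ∧
    ∀ z, (z < p ∨ p + 6 ≤ z) → (z < q ∨ q + 6 ≤ z) → (z < r ∨ r + 6 ≤ z) → z ≠ b₁ + 4 →
      z ≠ u + 4 → m' z = m z := by
  subst hm
  obtain rfl | rfl : s = 0 ∨ s = 1 := by omega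
  all_goals
    refine ⟨?_, ?_, ?_, ?_, ?_, ?_⟩
    · clear bu qb rb qu ru
      refine ⟨?_, ?_, ?_, ?_, ?_, ?_⟩ <;> simp (disch := omega) only [update_self, update_of_ne]
    · clear bu pb rb pu ru
      refine ⟨?_, ?_, ?_, ?_, ?_, ?_⟩ <;> simp (disch := omega) only [update_self, update_of_ne]
    · clear bu pb qb pu qu
      refine ⟨?_, ?_, ?_, ?_, ?_, ?_⟩ <;> simp (disch := omega) only [update_self, update_of_ne]
    · clear pq pr qr pu qu ru
      simp (disch := omega) only [update_self, update_of_ne]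
    · clear pq pr qr pb qb rb
      simp (disch := omega) only [update_self, update_of_ne]
    · intro z h1 h2 h3 h4 h5
      clear pq pr qr pb qb rb pu qu ru bu
      simp (disch := omega) only [update_of_ne]

end PTree

/-! ### Rotations of trees in memory -/

namespace PTree

theorem not_inCells {l : List ℕ} {z : ℕ} (h : ¬ InCells l z) {x : ℕ} (hx : x ∈ l) :
    z < x ∨ x + 6 ≤ z := by
  by_contra! hc
  exact h ⟨x, hx, hc.1, hc.2⟩

open Function in
-- The height assumptions say that the outer grandchild carries the excess, which makes both rotated
-- nodes balanced. The last conclusion keeps the linked list of leaves intact: the fields `2` and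
-- `3` are the links if the record is a leaf.
theorem rep_rotateSingle {m m' : ℕ → ℕ} {s : Bool} {p q par : ℕ} {a b u : PTree}
    (ht : (mk s q a b).Rep m p) (hu : u.Rep m p) (hp : m p = 1)
    (hkp : m (p + 1) = if s then b.lastLabel else u.lastLabel) (hpar : m (p + 4) = par)
    (sep : Sep (p :: q :: (a.addrs ++ (b.addrs ++ u.addrs))))
    (h1 : a.height = u.height + 1) (h2 : b.height = u.height)
    (hm : m' = update (update (update (update (update (update (update (update (update (update m
        (p + 1) (m (q + 1))) (q + 1) (m (p + 1))) (p + 2 + sideCode s) a.addr)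
        (p + 3 - sideCode s) q) (a.addr + 4) p) (q + 2 + sideCode s) b.addr)
        (q + 3 - sideCode s) u.addr) (u.addr + 4) q) (p + 5) 0) (q + 5) 0) :
    (mk s p a (mk s q b u)).Rep m' par ∧
      (∀ z, ¬ InCells (p :: q :: (a.addrs ++ (b.addrs ++ u.addrs))) z → m' z = m z) ∧
      ∀ l ∈ a.addrs ++ (b.addrs ++ u.addrs), m' (l + 2) = m (l + 2) ∧ m' (l + 3) = m (l + 3) := by
  have hpa := a.addr_mem_addrs
  have hpu := u.addr_mem_addrs
  have sep' := sep
  simp only [sep_cons, sep_append, List.mem_cons, List.mem_append] at sep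
  obtain ⟨sp, sq, sa, ⟨sb, su, sbu⟩, sabu⟩ := sep
  obtain ⟨⟨p0, p1, p2, p3, p4, p5⟩, ⟨q0, q1, q2, q3, q4, q5⟩, ha4, hu4, hfr⟩ :=
    rotateSingle_mem (sideCode_le s) (sp q (.inl rfl)) (sp _ (.inr (.inl hpa)))
      (sp _ (.inr (.inr (.inr hpu)))) (sq _ (.inl hpa)) (sq _ (.inr (.inr hpu)))
      (sabu _ hpa _ (.inr hpu)) hm
  rw [rep_mk] at ht
  obtain ⟨t1, t2, t3, t4, t5, t6, t7, t8⟩ := ht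
  refine ⟨?_, ?_, ?_⟩
  · rw [rep_mk, rep_mk]
    simp only [addr_mk, height_mk, lastLabel_mk]
    refine ⟨p0.trans hp, ?_, p2, p3, p4.trans hpar, ?_, ?_, q0.trans t1, ?_, q2, q3, q4.trans t5,
      ?_, ?_, ?_⟩
    · rw [p1, t2]
      cases s <;> simp_all
    · rw [p5, sideBalance, if_pos (by omega)]
    · refine t7.reparent sa (fun z hz hz' => ?_) ha4
      obtain ⟨x, hx, hx1, hx2⟩ := hz
      have e1 := sp x (.inr (.inl hx))
      have e2 := sq x (.inl hx)
      have e3 := sabu x hx _ (.inr hpu)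
      exact hfr z (by omega) (by omega) hz' (by omega)
    · rw [q1, hkp]
    · rw [q5, sideBalance, if_pos (by omega)]
    · refine t8.congr fun z hz => ?_
      obtain ⟨x, hx, hx1, hx2⟩ := hz
      have e1 := sp x (.inr (.inr (.inl hx)))
      have e2 := sq x (.inr (.inl hx))
      have e3 := sbu x hx _ hpu
      have e4 := sabu _ hpa x (.inl hx)
      exact hfr z (by omega) (by omega) (by omega) (by omega)
    · refine hu.reparent su (fun z hz hz' => ?_) hu4
      obtain ⟨x, hx, hx1, hx2⟩ := hz
      have e1 := sp x (.inr (.inr (.inr hx)))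
      have e2 := sq x (.inr (.inr hx))
      have e3 := sabu _ hpa x (.inr hx)
      exact hfr z (by omega) (by omega) (by omega) hz'
  · intro z hz
    have e1 := not_inCells hz (x := p) (by simp)
    have e2 := not_inCells hz (x := q) (by simp)
    have e3 := not_inCells hz (x := a.addr) (by simp [hpa])
    have e4 := not_inCells hz (x := u.addr) (by simp [hpu])
    exact hfr z (by omega) (by omega) (by omega) (by omega)
  · intro l hl
    have hl' : l ∈ p :: q :: (a.addrs ++ (b.addrs ++ u.addrs)) := by
      simpa using .inr (.inr (by simpa using hl))
    have e1 := sep'.disj hl' (y := a.addr) (by simp [hpa])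
    have e2 := sep'.disj hl' (y := u.addr) (by simp [hpu])
    have e3 := sp l (by simpa using Or.inr hl)
    have e4 := sq l (by simpa using hl)
    exact ⟨hfr _ (by omega) (by omega) (by omega) (by omega),
      hfr _ (by omega) (by omega) (by omega) (by omega)⟩

theorem sideBalance_eq (s : Bool) {h h' : ℕ} (e : h = h') : sideBalance s h h' = 0 := by
  simp [sideBalance, e]

theorem sideBalance_gt (s : Bool) {h h' : ℕ} (e : h' < h) :
    sideBalance s h h' = 1 + sideCode s := by
  simp [sideBalance, e, e.ne']

theorem sideBalance_lt (s : Bool) {h h' : ℕ} (e : h < h') :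
    sideBalance s h h' = 2 - sideCode s := by
  simp [sideBalance, e.ne, e.not_gt]

/-- The inner grandchild's subtrees are distributed to the two lower nodes of a double rotation; the
node that receives the shorter one leans away from it. Here this is the node that keeps the outer
subtree. -/
theorem sideBalance_outer (s : Bool) {a b₁ b₂ u : ℕ} (h1 : a = u) (h2 : max b₁ b₂ = u) :
    (if sideBalance s b₁ b₂ = 2 - sideCode s then 1 + sideCode s else 0) = sideBalance s a b₁ := by
  have sc := sideCode_le s
  rcases lt_trichotomy b₁ b₂ with h | h | h
  · rw [sideBalance_lt s h, if_pos rfl, sideBalance_gt s (by omega)]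
  · rw [sideBalance_eq s h, if_neg (by omega), sideBalance_eq s (by omega)]
  · rw [sideBalance_gt s h, if_neg (by omega), sideBalance_eq s (by omega)]

theorem sideBalance_inner (s : Bool) {b₁ b₂ u : ℕ} (h2 : max b₁ b₂ = u) :
    (if sideBalance s b₁ b₂ = 1 + sideCode s then 2 - sideCode s else 0) = sideBalance s b₂ u := by
  have sc := sideCode_le s
  rcases lt_trichotomy b₁ b₂ with h | h | h
  · rw [sideBalance_lt s h, if_neg (by omega), sideBalance_eq s (by omega)]
  · rw [sideBalance_eq s h, if_neg (by omega), sideBalance_eq s (by omega)]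
  · rw [sideBalance_gt s h, if_pos rfl, sideBalance_lt s (by omega)]

set_option maxHeartbeats 1000000 in
open Function in
theorem rep_rotateDouble {m m' : ℕ → ℕ} {s : Bool} {p q r par : ℕ} {a b₁ b₂ u : PTree}
    (ht : (mk s q a (mk s r b₁ b₂)).Rep m p) (hu : u.Rep m p) (hp : m p = 1)
    (hpq : m (p + 2 + sideCode s) = q)
    (hkp : m (p + 1) = if s then b₂.lastLabel else u.lastLabel) (hpar : m (p + 4) = par)
    (sep : Sep (p :: q :: r :: (a.addrs ++ (b₁.addrs ++ (b₂.addrs ++ u.addrs)))))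
    (h1 : a.height = u.height) (h2 : max b₁.height b₂.height = u.height)
    (hm : m' = update (update (update (update (update (update (update (update (update (update
        (update (update m (p + 1) (m (r + 1))) (r + 1) (m (p + 1))) (p + 3 - sideCode s) r)
        (q + 3 - sideCode s) b₁.addr) (b₁.addr + 4) q) (r + 2 + sideCode s) b₂.addr)
        (r + 3 - sideCode s) u.addr) (u.addr + 4) r) (r + 4) p) (p + 5) 0)
        (q + 5) (if m (r + 5) = 2 - sideCode s then 1 + sideCode s else 0))
        (r + 5) (if m (r + 5) = 1 + sideCode s then 2 - sideCode s else 0)) :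
    (mk s p (mk s q a b₁) (mk s r b₂ u)).Rep m' par ∧
      (∀ z, ¬ InCells (p :: q :: r :: (a.addrs ++ (b₁.addrs ++ (b₂.addrs ++ u.addrs)))) z →
        m' z = m z) ∧
      ∀ l ∈ a.addrs ++ (b₁.addrs ++ (b₂.addrs ++ u.addrs)),
        m' (l + 2) = m (l + 2) ∧ m' (l + 3) = m (l + 3) := by
  have hpa := b₁.addr_mem_addrs
  have hpu := u.addr_mem_addrs
  have sep' := sep
  simp only [sep_cons, sep_append, List.mem_cons, List.mem_append] at sep
  obtain ⟨sp, sq, sr, sa, ⟨sb, ⟨sc, su, scu⟩, sbcu⟩, sabcu⟩ := sep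
  obtain ⟨⟨p0, p1, p2, p3, p4, p5⟩, ⟨q0, q1, q2, q3, q4, q5⟩, ⟨r0, r1, r2, r3, r4, r5⟩, ha4, hu4,
      hfr⟩ :=
    rotateDouble_mem (sideCode_le s) (sp q (.inl rfl)) (sp r (.inr (.inl rfl)))
      (sq r (.inl rfl)) (sp _ (.inr (.inr (.inr (.inl hpa))))) (sq _ (.inr (.inr (.inl hpa))))
      (sr _ (.inr (.inl hpa))) (sp _ (.inr (.inr (.inr (.inr (.inr hpu))))))
      (sq _ (.inr (.inr (.inr (.inr hpu))))) (sr _ (.inr (.inr (.inr hpu)))) (sbcu _ hpa _ (.inr hpu)) hm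
  rw [rep_mk, rep_mk] at ht
  obtain ⟨t1, t2, t3, t4, t5, t6, t7, s1, s2, s3, s4, s5, s6, s7, s8⟩ := ht
  simp only [addr_mk, height_mk, lastLabel_mk] at *
  refine ⟨?_, ?_, ?_⟩
  · rw [rep_mk, rep_mk, rep_mk]
    simp only [addr_mk, height_mk, lastLabel_mk]
    refine ⟨p0.trans hp, ?_, p2.trans hpq, p3, p4.trans hpar, ?_, ⟨q0.trans t1, ?_, q2.trans t3, q3,
      q4.trans t5, ?_, ?_, ?_⟩, r0.trans s1, ?_, r2, r3, r4, ?_, ?_, ?_⟩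
    · rw [p1, s2]
      cases s <;> simp
    · rw [p5, sideBalance, if_pos (by omega)]
    · rw [q1, t2]
      cases s <;> simp
    · rw [q5, s6, sideBalance_outer s h1 h2]
    · refine t7.congr fun z hz => ?_
      obtain ⟨x, hx, hx1, hx2⟩ := hz
      have e1 := sp x (by simp only [hx, true_or, or_true])
      have e2 := sq x (by simp only [hx, true_or, or_true])
      have e3 := sr x (by simp only [hx, true_or, or_true])
      have e4 := sabcu x hx _ (.inl hpa)
      have e5 := sabcu x hx _ (.inr (.inr hpu))
      exact hfr z (by omega) (by omega) (by omega) (by omega) (by omega)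
    · refine s7.reparent sb (fun z hz hz' => ?_) ha4
      obtain ⟨x, hx, hx1, hx2⟩ := hz
      have e1 := sp x (by simp only [hx, true_or, or_true])
      have e2 := sq x (by simp only [hx, true_or, or_true])
      have e3 := sr x (by simp only [hx, true_or, or_true])
      have e5 := sbcu x hx _ (.inr hpu)
      exact hfr z (by omega) (by omega) (by omega) hz' (by omega)
    · rw [r1, hkp]
    · rw [r5, s6, sideBalance_inner s h2]
    · refine s8.congr fun z hz => ?_
      obtain ⟨x, hx, hx1, hx2⟩ := hz
      have e1 := sp x (by simp only [hx, true_or, or_true])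
      have e2 := sq x (by simp only [hx, true_or, or_true])
      have e3 := sr x (by simp only [hx, true_or, or_true])
      have e4 := sbcu _ hpa x (.inl hx)
      have e5 := scu x hx _ hpu
      exact hfr z (by omega) (by omega) (by omega) (by omega) (by omega)
    · refine hu.reparent su (fun z hz hz' => ?_) hu4
      obtain ⟨x, hx, hx1, hx2⟩ := hz
      have e1 := sp x (by simp only [hx, true_or, or_true])
      have e2 := sq x (by simp only [hx, true_or, or_true])
      have e3 := sr x (by simp only [hx, true_or, or_true])
      have e4 := sbcu _ hpa x (.inr hx)
      exact hfr z (by omega) (by omega) (by omega) (by omega) hz'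
  · intro z hz
    have e1 := not_inCells hz (x := p) (by simp)
    have e2 := not_inCells hz (x := q) (by simp)
    have e3 := not_inCells hz (x := r) (by simp)
    have e4 := not_inCells hz (x := b₁.addr) (by simp [hpa])
    have e5 := not_inCells hz (x := u.addr) (by simp [hpu])
    exact hfr z (by omega) (by omega) (by omega) (by omega) (by omega)
  · intro l hl
    have hl' : l ∈ p :: q :: r :: (a.addrs ++ (b₁.addrs ++ (b₂.addrs ++ u.addrs))) := by
      simpa using .inr (.inr (.inr (by simpa using hl)))
    have e1 := sep'.disj hl' (y := b₁.addr) (by simp [hpa])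
    have e2 := sep'.disj hl' (y := u.addr) (by simp [hpu])
    simp only [List.mem_append] at hl
    have e3 := sp l (by tauto)
    have e4 := sq l (by tauto)
    have e5 := sr l (by tauto)
    exact ⟨hfr _ (by omega) (by omega) (by omega) (by omega) (by omega),
      hfr _ (by omega) (by omega) (by omega) (by omega) (by omega)⟩

end PTree

/-! ### The rebalancing loop and its amortized cost -/

namespace PTree

theorem fst_mem_addrs {t : PTree} {e : ℕ × ℕ} (h : e ∈ t.leafEntries) : e.1 ∈ t.addrs :=
  t.leafAddrs_subset_addrs (by rw [leafAddrs_eq]; exact List.mem_map_of_mem h)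

theorem fst_mem_ctxAddrs {c : List Frame} {e : ℕ × ℕ} (h : e ∈ ctxBefore c ∨ e ∈ ctxAfter c) :
    e.1 ∈ ctxAddrs c := by
  induction c with
  | nil => simp [ctxBefore, ctxAfter] at h
  | cons f c ih =>
    simp only [ctxBefore, ctxAfter, List.mem_append] at h
    simp only [ctxAddrs, List.mem_cons, List.mem_append]
    rcases h with (h | h) | (h | h)
    · exact .inr (.inr (ih (.inl h)))
    · split_ifs at h
      · simp at h
      · exact .inr (.inl (fst_mem_addrs h))
    · split_ifs at h
      · exact .inr (.inl (fst_mem_addrs h))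
      · simp at h
    · exact .inr (.inr (ih (.inr h)))

theorem inCells_of_subset {l l' : List ℕ} {z : ℕ} (h : InCells l z) (hs : ∀ x ∈ l, x ∈ l') :
    InCells l' z := by
  obtain ⟨x, hx, h⟩ := h
  exact ⟨x, hs x hx, h⟩

variable {inp : Input}

/-- What rebalancing does to a tree in memory. -/
structure Rebalanced (m m' : ℕ → ℕ) (T T' : PTree) : Prop where
  rep : T'.Rep m' 0
  frame : ∀ z, ¬ InCells T.addrs z → m' z = m z
  links : ∀ e ∈ T.leafEntries, m' (e.1 + 2) = m (e.1 + 2) ∧ m' (e.1 + 3) = m (e.1 + 3)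
  entries : T'.leafEntries = T.leafEntries
  addrs : T'.addrs.Perm T.addrs
  addr : T'.addr = T.addr
  avl : T'.IsAVL

set_option maxHeartbeats 1600000 in
-- The subtree `t` has just grown by one, so the memory describes its context for height `t.height -
-- 1`. By `unb`, a grown subtree of height at least two leans to one side, so that a rotation
-- restores the old height of the parent. In the potential estimate every step upwards turns a
-- balanced parent into a leaning one and is paid by it; only the last step may create balanced
-- nodes, boundedly many.
theorem rebalance_loop_runs (c : List Frame) (t : PTree) (σ : Store) (hv : σ.var 10 = t.addr)
    (hgo : σ.var 16 = 1) (ht : t.Rep σ.mem (ctxParent c))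
    (hc : CtxRep σ.mem t.addr (t.height - 1) t.lastLabel c) (sep : Sep (t.addrs ++ ctxAddrs c))
    (hpos : ∀ p ∈ ctxAddrs c, p ≠ 0) (avl : t.IsAVL) (cavl : CtxAVL (t.height - 1) c)
    (hh : 1 ≤ t.height)
    (unb : t.height = 1 ∨ ∀ s q a b, t = mk s q a b → a.height ≠ b.height) :
    ∃ T' k, k + T'.potential ≤ t.potential + ctxPotential (t.height - 1) c + 4 +
        (if t.height = 1 then 1 else 0) ∧
      Runs inp (.loop (.le 1 v#16) rebalanceStep) σ (152 * k + 152)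
        fun σ' => Rebalanced σ.mem σ'.mem (plug t c) T' := by
  induction c generalizing t σ with
  | nil =>
    refine ⟨t, 1, ?_, ?_⟩
    · simp only [ctxPotential]; omega
    · refine Runs.loop_step (t₂ := 1) (by simp [hgo])
        ((rebalanceStep_root (by rw [hv]; exact ht.parent)).imp ?_) (by simp [Test.cost, Expr.cost])
      rintro σ' ⟨h1, h2⟩
      refine Runs.loop_done (by simp [h1]) (by simp [Test.cost, Expr.cost]) ?_
      rw [h2]
      exact ⟨ht, fun _ _ => rfl, fun _ _ => ⟨rfl, rfl⟩, rfl, List.Perm.refl _, rfl, avl⟩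
  | cons f c ih =>
    obtain ⟨s, p, u⟩ := f
    obtain ⟨c1, c2, c3, c4, c5, c6, c7, c8⟩ := hc
    obtain ⟨a1, a2, a3, a4⟩ := cavl
    change t.Rep σ.mem p at ht
    dsimp only at c1 c2 c3 c4 c5 c6 c7 c8 a1 a2 a3 a4
    have hp : p ≠ 0 := hpos p (by simp [ctxAddrs])
    have hpar : σ.mem (σ.var 10 + 4) = p := by rw [hv]; exact ht.parent
    have sep0 := sep
    have hta := t.addr_mem_addrs
    have hua := u.addr_mem_addrs
    simp only [ctxAddrs, sep_append, sep_cons, List.mem_cons, List.mem_append] at sep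
    obtain ⟨st, ⟨sp, su, sc, suc⟩, stc⟩ := sep
    have hs : sideCode s = if σ.mem (p + 2) = σ.var 10 then 0 else 1 := by
      cases s
      · have : u.addr ≠ t.addr := by have := stc _ hta _ (.inr (.inl hua)); omega
        simp only [sideCode, Bool.false_eq_true, if_false, show p + 3 - 1 = p + 2 by omega] at c4
        rw [if_neg (by rw [c4, hv]; exact this)]
        rfl
      · simp only [sideCode, if_true, add_zero] at c3
        rw [if_pos (by rw [c3, hv])]
        rfl
    have hsc := sideCode_le s
    -- a step that changes only the balance of the parent
    have step : ∀ b : ℕ, b = sideBalance s t.height u.height →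
        (∀ q, q = ctxParent c → (mk s p t u).Rep (Function.update σ.mem (p + 5) b) q) ∧
        CtxRep (Function.update σ.mem (p + 5) b) p (max (t.height - 1) u.height + 1)
          (mk s p t u).lastLabel c ∧
        (∀ z, ¬ InCells (plug t (⟨s, p, u⟩ :: c)).addrs z →
          Function.update σ.mem (p + 5) b z = σ.mem z) ∧
        (∀ e ∈ (plug t (⟨s, p, u⟩ :: c)).leafEntries,
          Function.update σ.mem (p + 5) b (e.1 + 2) = σ.mem (e.1 + 2) ∧
          Function.update σ.mem (p + 5) b (e.1 + 3) = σ.mem (e.1 + 3)) := by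
      intro b hb
      have hmem : ∀ z, z ≠ p + 5 → Function.update σ.mem (p + 5) b z = σ.mem z :=
        fun z hz => Function.update_of_ne hz _ _
      refine ⟨?_, ?_, ?_, ?_⟩
      · rintro q rfl
        rw [rep_mk]
        refine ⟨by rw [hmem _ (by omega), c1], by rw [hmem _ (by omega), c2],
          by rw [hmem _ (by omega), c3], by rw [hmem _ (by omega), c4],
          by rw [hmem _ (by omega), c5], by rw [Function.update_self, hb],
          ht.congr fun z hz => ?_, c7.congr fun z hz => ?_⟩
        · obtain ⟨x, hx, hx1, hx2⟩ := hz
          have := stc x hx p (.inl rfl)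
          exact hmem z (by omega)
        · obtain ⟨x, hx, hx1, hx2⟩ := hz
          have := sp x (.inl hx)
          exact hmem z (by omega)
      · rw [lastLabel_mk]
        refine c8.congr fun z hz => ?_
        obtain ⟨x, hx, hx1, hx2⟩ := hz
        have := sp x (.inr hx)
        exact hmem z (by omega)
      · intro z hz
        have := not_inCells hz (x := p) ((addrs_plug_perm _ _).mem_iff.2 (by simp [ctxAddrs]))
        exact hmem z (by omega)
      · intro e he
        have := sep0.disj (x := e.1) (y := p)
          ((addrs_plug_perm t (⟨s, p, u⟩ :: c)).mem_iff.1 (fst_mem_addrs he)) (by simp [ctxAddrs])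
        exact ⟨hmem _ (by omega), hmem _ (by omega)⟩
    -- the conclusion when the height of the parent has not changed
    have finish : ∀ (t' : PTree) (m' : ℕ → ℕ), t'.Rep m' (ctxParent c) →
        (∀ z, ¬ InCells (p :: (t.addrs ++ u.addrs)) z → m' z = σ.mem z) →
        (∀ e ∈ (mk s p t u).leafEntries, m' (e.1 + 2) = σ.mem (e.1 + 2) ∧
          m' (e.1 + 3) = σ.mem (e.1 + 3)) →
        t'.leafEntries = (mk s p t u).leafEntries → t'.addrs.Perm (mk s p t u).addrs →
        t'.addr = p → t'.IsAVL → t'.height = max (t.height - 1) u.height + 1 →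
        Rebalanced σ.mem m' (plug t (⟨s, p, u⟩ :: c)) (plug t' c) := by
      intro t' m' r1 r2 r3 r4 r5 r6 r7 r8
      have hlast : t'.lastLabel = (mk s p t u).lastLabel := by
        simp only [lastLabel_eq, r4]
      have hdis : ∀ x ∈ ctxAddrs c, ∀ j < 6, m' (x + j) = σ.mem (x + j) := by
        intro x hx j hj
        refine r2 _ fun ⟨y, hy, hy1, hy2⟩ => ?_
        have : y + 6 ≤ x ∨ x + 6 ≤ y := by
          simp only [List.mem_cons, List.mem_append] at hy
          rcases hy with rfl | hy | hy
          · exact sp x (.inr hx)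
          · exact stc y hy x (.inr (.inr hx))
          · exact suc y hy x hx
        omega
      refine ⟨?_, ?_, ?_, ?_, ?_, ?_, ?_⟩
      · rw [rep_plug]
        refine ⟨r1, ?_⟩
        rw [r6, r8, hlast, lastLabel_mk]
        refine c8.congr fun z hz => ?_
        obtain ⟨x, hx, hx1, hx2⟩ := hz
        have := hdis x hx (z - x) (by omega)
        rwa [Nat.add_sub_cancel' hx1] at this
      · intro z hz
        refine r2 z fun hz' => hz (inCells_of_subset hz' fun x hx => ?_)
        refine (addrs_plug_perm _ _).mem_iff.2 ?_
        simp only [ctxAddrs, List.mem_cons, List.mem_append] at hx ⊢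
        tauto
      · intro e he
        rw [plug, leafEntries_plug, List.mem_append, List.mem_append] at he
        rcases he with (he | he) | he
        · have := fst_mem_ctxAddrs (.inl he)
          exact ⟨hdis _ this 2 (by omega), hdis _ this 3 (by omega)⟩
        · exact r3 e he
        · have := fst_mem_ctxAddrs (.inr he)
          exact ⟨hdis _ this 2 (by omega), hdis _ this 3 (by omega)⟩
      · rw [plug, leafEntries_plug, leafEntries_plug, r4]
      · exact (addrs_plug_perm _ _).trans ((r5.append_right _).trans (addrs_plug_perm _ _).symm)
      · exact addr_plug_congr (by simp [r6]) c
      · rw [isAVL_plug, r8]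
        exact ⟨r7, a4⟩
    by_cases hbal : t.height - 1 = u.height
    · -- the parent was balanced and grows
      have hb : sideBalance s t.height u.height = 1 + sideCode s := sideBalance_gt s (by omega)
      obtain ⟨s1, s2, s3, s4⟩ := step _ hb.symm
      rw [sideBalance_eq s hbal] at c6
      have hmax : max (t.height - 1) u.height = t.height - 1 := by omega
      have hmax' : max t.height u.height = t.height := by omega
      have key : ∀ σ' : Store, σ'.var 16 = 1 → σ'.var 10 = p →
          σ'.mem = Function.update σ.mem (p + 5) (1 + sideCode s) → _ := fun σ' e1 e2 e3 =>
        ih (mk s p t u) σ' (by rw [e2, addr_mk]) e1 (by rw [e3]; exact s1 _ rfl)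
        (by
          rw [e3, addr_mk, height_mk, hmax', Nat.add_sub_cancel]
          rw [hmax, Nat.sub_add_cancel hh] at s2
          exact s2)
        (sep0.perm (by
          refine List.Perm.trans ?_ ((addrs_mk_perm s p t u).symm.append_right _)
          simp only [ctxAddrs, List.cons_append, List.append_assoc]
          exact List.perm_middle))
        (fun x hx => hpos x (by simp [ctxAddrs, hx]))
        (by rw [isAVL_mk]; exact ⟨by omega, by omega, avl, a3⟩)
        (by
          rw [height_mk, hmax', Nat.add_sub_cancel]
          rw [hmax, Nat.sub_add_cancel hh] at a4
          exact a4)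
        (by simp)
        (.inr (by
          intro s' q a b e
          have : t.height ≠ u.height := by omega
          cases s <;> cases s' <;> simp only [mk, node.injEq] at e <;>
            obtain ⟨-, rfl, rfl⟩ := e <;> first | exact this | exact this.symm))
      obtain ⟨T', k, hk, -⟩ := key ⟨Function.update (Function.update σ.var 16 1) 10 p,
        Function.update σ.mem (p + 5) (1 + sideCode s)⟩ (by simp) (by simp) rfl
      have key' : ∀ σ' : Store, σ'.var 16 = 1 → σ'.var 10 = p →
          σ'.mem = Function.update σ.mem (p + 5) (1 + sideCode s) →
          ∃ T' k, (k + T'.potential ≤ (mk s p t u).potential +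
            ctxPotential ((mk s p t u).height - 1) c + 4) ∧
          Runs inp (.loop (.le 1 v#16) rebalanceStep) σ' (152 * k + 152)
            fun σ'' => Rebalanced σ'.mem σ''.mem (plug (mk s p t u) c) T' := by
        intro σ' e1 e2 e3
        obtain ⟨T', k, hk, hr⟩ := key σ' e1 e2 e3
        rw [if_neg (by rw [height_mk]; omega), add_zero] at hk
        exact ⟨T', k, hk, hr⟩
      clear hk T' k key
      have hstep := rebalanceStep_up (inp := inp) hpar hp hs c6
      obtain ⟨σ₁, t₁, hex, ht₁, e1, e2, e3⟩ := hstep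
      obtain ⟨T', k, hk, hr⟩ := key' σ₁ (e1.trans hgo) e2 e3
      refine ⟨T', k + 1, ?_, ?_⟩
      · rw [potential_mk, if_neg (by omega), height_mk, hmax', Nat.add_sub_cancel] at hk
        simp only [ctxPotential, hmax]
        rw [Nat.sub_add_cancel hh]
        -- The first step up, from height one, may find a balanced parent whose former height was
        -- one; such a node is not counted by the potential, which is why the bound has an extra
        -- unit for `t.height = 1`.
        by_cases h1 : t.height = 1
        · rw [if_pos h1]; omega
        · rw [if_pos (show t.height - 1 = u.height ∧ 1 ≤ t.height - 1 by omega), if_neg h1]; omega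
      · refine Runs.loop_step (t₁ := 150) (t₂ := 152 * k + 152) (by simp [hgo])
          ⟨σ₁, t₁, hex, ht₁, hr.imp fun σ'' hσ'' => ?_⟩ (by simp [Test.cost, Expr.cost]; omega)
        obtain ⟨r1, r2, r3, r4, r5, r6, r7⟩ := hσ''
        refine ⟨r1, fun z hz => ?_, fun e he => ?_, r4, r5, r6, r7⟩
        · rw [r2 z hz, e3, s3 z hz]
        · rw [(r3 e he).1, (r3 e he).2, e3]
          exact s4 e he
    · by_cases hlow : t.height = u.height
      · -- the parent becomes balanced
        have hb : sideBalance s t.height u.height = 0 := sideBalance_eq s hlow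
        obtain ⟨s1, s2, s3, s4⟩ := step _ hb.symm
        rw [sideBalance_lt s (by omega)] at c6
        refine ⟨plug (mk s p t u) c, 1, ?_, ?_⟩
        · rw [potential_plug, potential_mk, height_mk, ctxPotential]
          simp only [show max t.height u.height = max (t.height - 1) u.height by omega]
          rw [if_pos (by omega), if_neg (by omega)]
          omega
        · refine Runs.loop_step (t₁ := 150) (t₂ := 1) (by simp [hgo])
            ((rebalanceStep_done hpar hp hs c6).imp ?_) (by simp [Test.cost, Expr.cost])
          rintro σ' ⟨h1, h2⟩
          refine Runs.loop_done (by simp [h1]) (by simp [Test.cost, Expr.cost]) ?_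
          rw [h2]
          refine ⟨?_, s3, s4, rfl, List.Perm.refl _, rfl, ?_⟩
          · rw [rep_plug, height_mk, addr_mk,
              show max t.height u.height = max (t.height - 1) u.height by omega]
            exact ⟨s1 _ rfl, s2⟩
          · rw [isAVL_plug, isAVL_mk, height_mk,
              show max t.height u.height = max (t.height - 1) u.height by omega]
            exact ⟨⟨by omega, by omega, avl, a3⟩, a4⟩
      · -- rotation
        have hhigh : t.height = u.height + 2 := by omega
        rw [sideBalance_gt s (by omega)] at c6
        obtain ⟨q, a, b, rfl⟩ := exists_eq_mk s t (by omega)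
        rw [height_mk] at hhigh unb
        -- The excess lies either in the outer grandchild, which calls for a single rotation, or in
        -- the inner one, which calls for a double rotation.
        have hne := unb.resolve_left (by omega) s q a b rfl
        rw [isAVL_mk] at avl
        obtain ⟨v1, v2, v3, v4⟩ := avl
        have htr := ht
        rw [rep_mk] at htr
        obtain ⟨t1, t2, t3, t4, t5, t6, t7, t8⟩ := htr
        rw [addr_mk] at hv
        rw [lastLabel_mk] at c2 c8
        simp only [addr_mk] at c3
        by_cases hab : b.height < a.height
        · rw [sideBalance_gt s hab] at t6
          refine ⟨plug (mk s p a (mk s q b u)) c, 1, ?_, ?_⟩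
          · rw [potential_plug, potential_mk, potential_mk, ctxPotential, potential_mk]
            simp only [height_mk]
            rw [show max a.height (max b.height u.height + 1) + 1 =
              max (max a.height b.height + 1 - 1) u.height + 1 by omega]
            split_ifs <;> omega
          · refine Runs.loop_step (t₁ := 150) (t₂ := 1) (by simp [hgo])
              ((rebalanceStep_single hpar hp hs c6 hv t6 t3 t4 c4 rfl rfl).imp ?_)
              (by simp [Test.cost, Expr.cost])
            rintro σ' ⟨h1, h2⟩
            refine Runs.loop_done (by simp [h1]) (by simp [Test.cost, Expr.cost]) ?_
            have hperm : (p :: ((mk s q a b).addrs ++ u.addrs)).Perm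
                (p :: q :: (a.addrs ++ (b.addrs ++ u.addrs))) := by
              refine List.Perm.cons p (((addrs_mk_perm s q a b).append_right _).trans ?_)
              simp
            have hsep : Sep (p :: q :: (a.addrs ++ (b.addrs ++ u.addrs))) := by
              refine Sep.perm ?_ hperm
              rw [sep_cons, sep_append]
              refine ⟨fun x hx => ?_, st, su, fun x hx y hy => stc x hx y (.inr (.inl hy))⟩
              rcases List.mem_append.1 hx with hx | hx
              · exact (stc x hx p (.inl rfl)).symm
              · exact sp x (.inl hx)
            obtain ⟨w1, w2, w3⟩ := rep_rotateSingle ht c7 c1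
              (by rw [c2]; cases s <;> rfl) c5 hsep (by omega) (by omega) h2
            refine finish _ _ w1 (fun z hz => w2 z fun hz' => hz
              (inCells_of_subset hz' fun x hx => hperm.mem_iff.2 hx)) (fun e he => ?_) ?_ ?_ ?_ ?_ ?_
            · refine w3 _ ?_
              simp only [leafEntries_mk] at he
              simp only [List.mem_append]
              have : e ∈ a.leafEntries ∨ e ∈ b.leafEntries ∨ e ∈ u.leafEntries := by
                revert he; cases s <;> simp <;> tauto
              rcases this with h | h | h
              · exact .inl (fst_mem_addrs h)
              · exact .inr (.inl (fst_mem_addrs h))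
              · exact .inr (.inr (fst_mem_addrs h))
            · simp only [leafEntries_mk]; cases s <;> simp
            · refine (addrs_mk_perm _ _ _ _).trans
                (List.Perm.trans ?_ (hperm.symm.trans (addrs_mk_perm _ _ _ _).symm))
              refine List.Perm.cons p (((addrs_mk_perm s q b u).append_left _).trans ?_)
              exact List.perm_middle
            · simp
            · simp only [isAVL_mk, height_mk]
              exact ⟨by omega, by omega, v3, by omega, by omega, v4, a3⟩
            · simp only [height_mk]; omega
        · obtain ⟨r, b₁, b₂, rfl⟩ := exists_eq_mk s b (by omega)
          rw [sideBalance_lt s (by omega)] at t6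
          rw [isAVL_mk] at v4
          simp only [height_mk] at *
          have tr := t8
          rw [rep_mk] at tr
          obtain ⟨x1, x2, x3, x4, x5, x6, x7, x8⟩ := tr
          simp only [addr_mk] at t4
          refine ⟨plug (mk s p (mk s q a b₁) (mk s r b₂ u)) c, 1, ?_, ?_⟩
          · rw [potential_plug, ctxPotential]
            simp only [potential_mk, height_mk]
            rw [show max (max a.height b₁.height + 1) (max b₂.height u.height + 1) + 1 =
              max (max a.height (max b₁.height b₂.height + 1) + 1 - 1) u.height + 1 by omega]
            split_ifs <;> omega
          · refine Runs.loop_step (t₁ := 150) (t₂ := 1) (by simp [hgo])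
              ((rebalanceStep_double hpar hp hs c6 hv (by rw [t6]; omega) t4 c4 rfl rfl x3 x4
                rfl).imp ?_) (by simp [Test.cost, Expr.cost])
            rintro σ' ⟨h1, h2⟩
            refine Runs.loop_done (by simp [h1]) (by simp [Test.cost, Expr.cost]) ?_
            have hperm : (p :: ((mk s q a (mk s r b₁ b₂)).addrs ++ u.addrs)).Perm
                (p :: q :: r :: (a.addrs ++ (b₁.addrs ++ (b₂.addrs ++ u.addrs)))) := by
              refine List.Perm.cons p (((addrs_mk_perm s q a _).append_right _).trans ?_)
              refine List.Perm.cons q ?_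
              refine (((addrs_mk_perm s r b₁ b₂).append_left _).append_right _).trans ?_
              refine (List.perm_middle.append_right _).trans ?_
              simp
            have hsep : Sep (p :: q :: r :: (a.addrs ++ (b₁.addrs ++ (b₂.addrs ++ u.addrs)))) := by
              refine Sep.perm ?_ hperm
              rw [sep_cons, sep_append]
              refine ⟨fun x hx => ?_, st, su, fun x hx y hy => stc x hx y (.inr (.inl hy))⟩
              rcases List.mem_append.1 hx with hx | hx
              · exact (stc x hx p (.inl rfl)).symm
              · exact sp x (.inl hx)
            obtain ⟨w1, w2, w3⟩ := rep_rotateDouble ht c7 c1 c3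
              (by rw [c2]; cases s <;> simp) c5 hsep (by omega) (by omega) h2
            refine finish _ _ w1 (fun z hz => w2 z fun hz' => hz
              (inCells_of_subset hz' fun x hx => hperm.mem_iff.2 hx)) (fun e he => ?_) ?_ ?_ ?_ ?_ ?_
            · refine w3 _ ?_
              simp only [leafEntries_mk] at he
              simp only [List.mem_append]
              have : e ∈ a.leafEntries ∨ e ∈ b₁.leafEntries ∨ e ∈ b₂.leafEntries ∨
                  e ∈ u.leafEntries := by
                revert he; cases s <;> simp <;> tauto
              rcases this with h | h | h | h
              · exact .inl (fst_mem_addrs h)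
              · exact .inr (.inl (fst_mem_addrs h))
              · exact .inr (.inr (.inl (fst_mem_addrs h)))
              · exact .inr (.inr (.inr (fst_mem_addrs h)))
            · simp only [leafEntries_mk]; cases s <;> simp
            · refine (addrs_mk_perm _ _ _ _).trans
                (List.Perm.trans ?_ (hperm.symm.trans (addrs_mk_perm _ _ _ _).symm))
              refine List.Perm.cons p ?_
              refine ((addrs_mk_perm s q a b₁).append (addrs_mk_perm s r b₂ u)).trans ?_
              refine List.Perm.cons q (List.perm_middle.trans ?_)
              simp
            · simp
            · simp only [isAVL_mk, height_mk]
              exact ⟨by omega, by omega, ⟨by omega, by omega, v3, v4.2.2.1⟩, by omega, by omega,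
                v4.2.2.2, a3⟩
            · simp only [height_mk]; omega

end PTree

/-! ### Conditional writes and the doubly linked list of leaves -/

/-- Write unless the test succeeds. -/
def Cmd.writeUnless (b : Test) (a e : Expr) : Cmd := .ite b .skip (a ⇐ e)

open Classical in
/-- Update unless the condition holds. -/
noncomputable def updateUnless (c : Prop) (m : ℕ → ℕ) (a e : ℕ) : ℕ → ℕ :=
  if c then m else Function.update m a e

theorem updateUnless_self {c : Prop} (hc : ¬ c) (m : ℕ → ℕ) (a e : ℕ) :
    updateUnless c m a e a = e := by
  simp [updateUnless, hc]

theorem updateUnless_of_ne {c : Prop} {z a : ℕ} (h : c ∨ z ≠ a) (m : ℕ → ℕ) (e : ℕ) :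
    updateUnless c m a e z = m z := by
  unfold updateUnless
  split_ifs with hc
  · rfl
  · exact Function.update_of_ne (h.resolve_left hc) _ _

@[simp] theorem Cmd.eval_writeUnless (inp : Input) (b : Test) (a e : Expr) (σ : Store) :
    (Cmd.writeUnless b a e).eval inp σ =
      ⟨σ.var, updateUnless (b.Holds inp σ) σ.mem (a.eval σ) (e.eval σ)⟩ := by
  simp only [Cmd.writeUnless, Cmd.eval, updateUnless]
  split_ifs <;> rfl

@[simp] theorem Cmd.loopFree_writeUnless (b : Test) (a e : Expr) :
    (Cmd.writeUnless b a e).LoopFree := ⟨trivial, trivial⟩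

/-- A segment of the list of leaves, between the leaves at the addresses `q` and `r`. -/
def LinkSeg (m : ℕ → ℕ) : ℕ → ℕ → List ℕ → Prop
  | _, _, [] => True
  | q, r, p :: ps => m (p + 2) = q ∧ m (p + 3) = ps.headD r ∧ LinkSeg m p r ps

theorem linkedLeaves_iff (m : ℕ → ℕ) (q : ℕ) (l : List ℕ) :
    LinkedLeaves m q l ↔ LinkSeg m q 0 l := by
  induction l generalizing q with
  | nil => rfl
  | cons p ps ih => simp only [LinkedLeaves, LinkSeg, ih]

theorem linkSeg_append (m : ℕ → ℕ) (q r : ℕ) (l l' : List ℕ) :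
    LinkSeg m q r (l ++ l') ↔ LinkSeg m q (l'.headD r) l ∧ LinkSeg m (l.getLastD q) r l' := by
  induction l generalizing q with
  | nil => simp [LinkSeg]
  | cons p ps ih =>
    simp only [List.cons_append, LinkSeg, ih, List.getLastD_cons]
    have : (ps ++ l').headD r = ps.headD (l'.headD r) := by cases ps <;> simp
    rw [this]
    tauto

theorem LinkSeg.congr {m m' : ℕ → ℕ} {q r : ℕ} {l : List ℕ} (h : LinkSeg m q r l)
    (hm : ∀ x ∈ l, m' (x + 2) = m (x + 2) ∧ m' (x + 3) = m (x + 3)) : LinkSeg m' q r l := by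
  induction l generalizing q with
  | nil => trivial
  | cons p ps ih =>
    obtain ⟨h1, h2, h3⟩ := h
    have hp := hm p (by simp)
    exact ⟨hp.1.trans h1, hp.2.trans h2, ih h3 fun x hx => hm x (by simp [hx])⟩

/-- Replacing an element of a doubly linked list by two elements. -/
theorem LinkSeg.split {m m' : ℕ → ℕ} {A B : List ℕ} {p f g : ℕ} (h : LinkSeg m 0 0 (A ++ p :: B))
    (hd : (A ++ p :: B).Nodup) (h0 : 0 ∉ A ++ p :: B)
    (hf : m' (f + 2) = A.getLastD 0 ∧ m' (f + 3) = g)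
    (hg : m' (g + 2) = f ∧ m' (g + 3) = B.headD 0)
    (hl : A.getLastD 0 ≠ 0 → m' (A.getLastD 0 + 3) = f)
    (hr : B.headD 0 ≠ 0 → m' (B.headD 0 + 2) = g)
    (h2 : ∀ y, y ∈ A ∨ y ∈ B → B.headD 0 = 0 ∨ y ≠ B.headD 0 → m' (y + 2) = m (y + 2))
    (h3 : ∀ y, y ∈ A ∨ y ∈ B → A.getLastD 0 = 0 ∨ y ≠ A.getLastD 0 → m' (y + 3) = m (y + 3)) :
    LinkSeg m' 0 0 (A ++ f :: g :: B) := by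
  rw [linkSeg_append] at h ⊢
  obtain ⟨lA, lp2, lp3, lB⟩ := h
  rw [List.nodup_append, List.nodup_cons] at hd
  obtain ⟨nA, ⟨-, nB⟩, nAB⟩ := hd
  have nAB' : ∀ a ∈ A, ∀ b ∈ B, a ≠ b := fun a ha b hb => nAB a ha b (List.mem_cons_of_mem _ hb)
  simp only [List.mem_append, List.mem_cons, not_or] at h0
  simp only [List.headD_cons] at lA ⊢
  refine ⟨?_, hf.1, hf.2, hg.1, hg.2, ?_⟩
  · rcases List.eq_nil_or_concat A with rfl | ⟨A₀, a, rfl⟩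
    · trivial
    · simp only [List.concat_eq_append] at *
      have hlast : (A₀ ++ [a]).getLastD 0 = a := by simp
      rw [hlast] at hl h3
      rw [linkSeg_append] at lA ⊢
      rw [List.nodup_append] at nA
      have ha0 : a ≠ 0 := fun h => h0.1 (by simp [h])
      have hB : ∀ y ∈ A₀ ++ [a], B.headD 0 = 0 ∨ y ≠ B.headD 0 := by
        intro y hy
        rcases B with _ | ⟨b, B⟩
        · exact .inl rfl
        · exact .inr (nAB' y hy b (by simp))
      refine ⟨lA.1.congr fun y hy => ?_, ?_, hl ha0, trivial⟩
      · have hy' : y ∈ A₀ ++ [a] := List.mem_append_left _ hy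
        exact ⟨h2 y (.inl hy') (hB y hy'), h3 y (.inl hy') (.inr (nA.2.2 y hy a (by simp)))⟩
      · rw [h2 a (.inl (by simp)) (hB a (by simp))]; exact lA.2.1
  · rcases B with _ | ⟨b, B⟩
    · trivial
    · simp only [List.headD_cons] at *
      obtain ⟨l1, l2, l3⟩ := lB
      have hA : ∀ y ∈ b :: B, A.getLastD 0 = 0 ∨ y ≠ A.getLastD 0 := by
        intro y hy
        rcases List.eq_nil_or_concat A with rfl | ⟨A₀, a, rfl⟩
        · exact .inl rfl
        · right
          simp only [List.concat_eq_append] at *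
          simpa using (nAB' a (by simp) y hy).symm
      have hb0 : b ≠ 0 := fun h => h0.2.2 (by simp [h])
      refine ⟨hr hb0, ?_, l3.congr fun y hy => ?_⟩
      · rw [h3 b (.inr (by simp)) (hA b (by simp))]; exact l2
      · have hy' : y ∈ b :: B := List.mem_cons_of_mem _ hy
        refine ⟨h2 y (.inr hy') (.inr ?_), h3 y (.inr hy') (hA y hy')⟩
        rintro rfl
        exact (List.nodup_cons.1 nB).1 hy

namespace PTree

/-! ### Insertion of a leaf -/

/-- Splits the leaf at the address in variable `10`: it becomes an inner node whose children are
new leaves with the labels in the variables `17` and `18`. -/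
def splitLeaf : Cmd :=
  19 ≔ M[v#10 + 2] ;;
  30 ≔ M[v#10 + 3] ;;
  v#10 ⇐ 1 ;;
  (v#10 + 1) ⇐ v#17 ;;
  (v#10 + 2) ⇐ v#6 ;;
  (v#10 + 3) ⇐ (v#6 + 6) ;;
  (v#10 + 5) ⇐ 0 ;;
  v#6 ⇐ 0 ;;
  (v#6 + 1) ⇐ v#17 ;;
  (v#6 + 2) ⇐ v#19 ;;
  (v#6 + 3) ⇐ (v#6 + 6) ;;
  (v#6 + 4) ⇐ v#10 ;;
  (v#6 + 6) ⇐ 0 ;;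
  (v#6 + 7) ⇐ v#18 ;;
  (v#6 + 8) ⇐ v#6 ;;
  (v#6 + 9) ⇐ v#30 ;;
  (v#6 + 10) ⇐ v#10 ;;
  .writeUnless (.le v#19 0) (v#19 + 3) v#6 ;;
  .writeUnless (.le v#30 0) (v#30 + 2) (v#6 + 6) ;;
  .writeUnless (.le v#0 v#17) (v#2 + v#17) v#6 ;;
  .writeUnless (.le v#0 v#18) (v#2 + v#18) (v#6 + 6) ;;
  6 ≔ v#6 + 12

def insertLeaf : Cmd := splitLeaf ;; rebalance

open Function in
theorem splitLeaf_mem {m m' : ℕ → ℕ} {p f pl nx P n l₁ l₂ : ℕ} (hp : p + 6 ≤ f)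
    (hpl : pl = 0 ∨ pl + 6 ≤ f ∧ (pl + 6 ≤ p ∨ p + 6 ≤ pl) ∧ (pl + 6 ≤ P ∨ P + n ≤ pl))
    (hnx : nx = 0 ∨ nx + 6 ≤ f ∧ (nx + 6 ≤ p ∨ p + 6 ≤ nx) ∧ (nx + 6 ≤ P ∨ P + n ≤ nx))
    (hP : P + n ≤ f) (hpP : p + 6 ≤ P ∨ P + n ≤ p) (hpn : pl = 0 ∨ nx = 0 ∨ pl ≠ nx)
    (hpn' : pl = 0 ∨ nx = 0 ∨ pl + 6 ≤ nx ∨ nx + 6 ≤ pl) (hl : l₁ ≠ l₂)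
    (hm : m' = updateUnless (n ≤ l₂) (updateUnless (n ≤ l₁) (updateUnless (nx ≤ 0) (updateUnless
      (pl ≤ 0) (update (update (update (update (update (update (update (update (update (update
      (update (update (update (update (update m p 1) (p + 1) l₁) (p + 2) f) (p + 3) (f + 6))
      (p + 5) 0) f 0) (f + 1) l₁) (f + 2) pl) (f + 3) (f + 6)) (f + 4) p) (f + 6) 0) (f + 7) l₂)
      (f + 8) f) (f + 9) nx) (f + 10) p) (pl + 3) f) (nx + 2) (f + 6)) (P + l₁) f)
      (P + l₂) (f + 6)) :
    (m' p = 1 ∧ m' (p + 1) = l₁ ∧ m' (p + 2) = f ∧ m' (p + 3) = f + 6 ∧ m' (p + 4) = m (p + 4) ∧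
      m' (p + 5) = 0) ∧
    (m' f = 0 ∧ m' (f + 1) = l₁ ∧ m' (f + 2) = pl ∧ m' (f + 3) = f + 6 ∧ m' (f + 4) = p) ∧
    (m' (f + 6) = 0 ∧ m' (f + 6 + 1) = l₂ ∧ m' (f + 6 + 2) = f ∧ m' (f + 6 + 3) = nx ∧
      m' (f + 6 + 4) = p) ∧
    (pl ≠ 0 → m' (pl + 3) = f) ∧ (nx ≠ 0 → m' (nx + 2) = f + 6) ∧
    (l₁ < n → m' (P + l₁) = f) ∧ (l₂ < n → m' (P + l₂) = f + 6) ∧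
    ∀ z < f, (z < p ∨ p + 6 ≤ z) → (pl = 0 ∨ z ≠ pl + 3) → (nx = 0 ∨ z ≠ nx + 2) →
      (n ≤ l₁ ∨ z ≠ P + l₁) → (n ≤ l₂ ∨ z ≠ P + l₂) → m' z = m z := by
  subst hm
  refine ⟨?_, ?_, ?_, ?_, ?_, ?_, ?_, ?_⟩
  · clear hpn hpn'
    refine ⟨?_, ?_, ?_, ?_, ?_, ?_⟩ <;>
      simp (disch := omega) only [update_self, update_of_ne, updateUnless_of_ne]
  · clear hpn hpn'
    refine ⟨?_, ?_, ?_, ?_, ?_⟩ <;>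
      simp (disch := omega) only [update_self, update_of_ne, updateUnless_of_ne]
  · clear hpn hpn'
    refine ⟨?_, ?_, ?_, ?_, ?_⟩ <;>
      simp (disch := omega) only [update_self, update_of_ne, updateUnless_of_ne]
  · intro h
    simp (disch := omega) only [updateUnless_self, updateUnless_of_ne]
  · intro h
    simp (disch := omega) only [updateUnless_self, updateUnless_of_ne]
  · intro h
    simp (disch := omega) only [updateUnless_self, updateUnless_of_ne]
  · intro h
    simp (disch := omega) only [updateUnless_self, updateUnless_of_ne]
  · intro z h1 h2 h3 h4 h5 h6
    clear hpn hpn' hpl hnx hP hpP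
    simp (disch := omega) only [update_of_ne, updateUnless_of_ne]

theorem splitLeaf_runs (inp : Input) (σ : Store) {p f pl nx P n l₁ l₂ : ℕ} (h0 : σ.var 0 = n)
    (h2 : σ.var 2 = P) (h6 : σ.var 6 = f) (h10 : σ.var 10 = p) (h17 : σ.var 17 = l₁)
    (h18 : σ.var 18 = l₂) (hpl : σ.mem (p + 2) = pl) (hnx : σ.mem (p + 3) = nx) :
    Runs inp splitLeaf σ 100 fun σ' => σ'.mem =
      updateUnless (n ≤ l₂) (updateUnless (n ≤ l₁) (updateUnless (nx ≤ 0) (updateUnless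
      (pl ≤ 0) (Function.update (Function.update (Function.update (Function.update
      (Function.update (Function.update (Function.update (Function.update (Function.update
      (Function.update (Function.update (Function.update (Function.update (Function.update
      (Function.update σ.mem p 1) (p + 1) l₁) (p + 2) f) (p + 3) (f + 6))
      (p + 5) 0) f 0) (f + 1) l₁) (f + 2) pl) (f + 3) (f + 6)) (f + 4) p) (f + 6) 0) (f + 7) l₂)
      (f + 8) f) (f + 9) nx) (f + 10) p) (pl + 3) f) (nx + 2) (f + 6)) (P + l₁) f)
      (P + l₂) (f + 6) ∧ σ'.var 6 = f + 12 := by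
  refine Runs.eval (by simp [splitLeaf]) (by decide) ?_
  subst h10
  simp [splitLeaf, h0, h2, h6, h17, h18, hpl, hnx]

/-- The links of the leaf list are kept in the leaf records, in two fields that `Rep` does not read.
-/
theorem Rep.congr_links {m m' : ℕ → ℕ} {q : ℕ} {t : PTree} (h : t.Rep m q) (sep : Sep t.addrs)
    (hm : ∀ z, InCells t.addrs z → (∀ e ∈ t.leafEntries, z ≠ e.1 + 2 ∧ z ≠ e.1 + 3) →
      m' z = m z) : t.Rep m' q := by
  induction t generalizing q with
  | leaf p a =>
    have h' : ∀ j < 6, j ≠ 2 → j ≠ 3 → m' (p + j) = m (p + j) := fun j hj h2 h3 =>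
      hm _ (inCells_add (by simp [addrs]) hj) (by simp [leafEntries, h2, h3])
    have h0 := h' 0 (by omega) (by omega) (by omega)
    simp only [add_zero] at h0
    exact ⟨h0.trans h.1, (h' 1 (by omega) (by omega) (by omega)).trans h.2.1,
      (h' 4 (by omega) (by omega) (by omega)).trans h.2.2⟩
  | node p l r ihl ihr =>
    simp only [addrs, sep_cons, sep_append, List.mem_append] at sep
    obtain ⟨sp, sl, sr, slr⟩ := sep
    have h' : ∀ j < 6, m' (p + j) = m (p + j) := fun j hj => by
      refine hm _ (inCells_add (by simp [addrs]) hj) fun e he => ?_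
      have := sp e.1 (by
        rcases List.mem_append.1 he with he | he
        · exact .inl (fst_mem_addrs he)
        · exact .inr (fst_mem_addrs he))
      omega
    have h0 := h' 0 (by omega)
    simp only [add_zero] at h0
    obtain ⟨h1, h2, h3, h4, h5, h6, h7, h8⟩ := h
    refine ⟨h0.trans h1, (h' 1 (by omega)).trans h2, (h' 2 (by omega)).trans h3,
      (h' 3 (by omega)).trans h4, (h' 4 (by omega)).trans h5, (h' 5 (by omega)).trans h6,
      ihl h7 sl fun z hz he => hm z ?_ ?_, ihr h8 sr fun z hz he => hm z ?_ ?_⟩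
    · exact inCells_of_subset hz fun x hx => by simp [addrs, hx]
    · intro e he'
      rcases List.mem_append.1 he' with he' | he'
      · exact he e he'
      · obtain ⟨x, hx, hx'⟩ := hz
        have := slr x hx _ (fst_mem_addrs he')
        omega
    · exact inCells_of_subset hz fun x hx => by simp [addrs, hx]
    · intro e he'
      rcases List.mem_append.1 he' with he' | he'
      · obtain ⟨x, hx, hx'⟩ := hz
        have := slr _ (fst_mem_addrs he') x hx
        omega
      · exact he e he'

theorem nodup_leafAddrs {T : PTree} (h : Sep T.addrs) : T.leafAddrs.Nodup := by
  have h2 : T.addrs.Nodup := h.imp fun h => by omega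
  clear h
  induction T with
  | leaf => simp [leafAddrs]
  | node p l r ihl ihr =>
    simp only [addrs, List.nodup_cons, List.nodup_append] at h2
    simp only [leafAddrs, List.nodup_append]
    exact ⟨ihl h2.2.1, ihr h2.2.2.1, fun a ha b hb =>
      h2.2.2.2 a (l.leafAddrs_subset_addrs ha) b (r.leafAddrs_subset_addrs hb)⟩

/-- A search tree in memory, with linked leaves and with pointers from the labels below `n` to
their leaves in an array at `P`; the cells from `top` on are free. -/
structure TreeIn (m : ℕ → ℕ) (P n top : ℕ) (T : PTree) : Prop where
  rep : T.Rep m 0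
  links : LinkSeg m 0 0 (T.leafEntries.map Prod.fst)
  ptr : ∀ a < n, a ∈ T.leafEntries.map Prod.snd → (m (P + a), a) ∈ T.leafEntries
  sep : Sep T.addrs
  bounds : ∀ p ∈ T.addrs, 0 < p ∧ p + 6 ≤ top ∧ (p + 6 ≤ P ∨ P + n ≤ p)
  avl : T.IsAVL
  ptr_top : P + n ≤ top

theorem headD_mem_or (l : List ℕ) : l.headD 0 = 0 ∨ l.headD 0 ∈ l := by
  cases l <;> simp

theorem getLastD_mem_or (l : List ℕ) : l.getLastD 0 = 0 ∨ l.getLastD 0 ∈ l := by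
  rcases List.eq_nil_or_concat l with rfl | ⟨L, a, rfl⟩ <;> simp

set_option maxHeartbeats 1000000 in
-- The key of an inner node is the largest leaf of its left subtree, so the last label below the
-- split leaf must not change unless no ancestor records it. Hence `hcase`: the new label goes to
-- the left of the old one, or to the right only at the very end of the tree. The constant `5` is
-- the `4` of the rebalancing loop plus its unit for a subtree of height one.
theorem insertLeaf_runs {inp : Input} {σ : Store} {T : PTree} {A B : List (ℕ × ℕ)} {n P f p b : ℕ}
    (h0 : σ.var 0 = n) (h2 : σ.var 2 = P) (h6 : σ.var 6 = f) (h10 : σ.var 10 = p)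
    (hT : TreeIn σ.mem P n f T) (hAB : T.leafEntries = A ++ (p, b) :: B) {x l₁ l₂ : ℕ}
    (hx : x ∉ T.leafEntries.map Prod.snd)
    (h17 : σ.var 17 = l₁) (h18 : σ.var 18 = l₂)
    (hcase : l₁ = x ∧ l₂ = b ∨ l₁ = b ∧ l₂ = x ∧ B = []) :
    ∃ T' k, k + T'.potential ≤ T.potential + 5 ∧ T'.addr = T.addr ∧
      T'.leafEntries.map Prod.snd = A.map Prod.snd ++ l₁ :: l₂ :: B.map Prod.snd ∧
      (∀ q ∈ T'.addrs, q ∈ T.addrs ∨ f ≤ q) ∧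
      Runs inp insertLeaf σ (152 * k + 300) fun σ' =>
        TreeIn σ'.mem P n (f + 12) T' ∧ σ'.var 6 = f + 12 ∧
        ∀ z < f, ¬ InCells T.addrs z → (z < P ∨ P + n ≤ z) → σ'.mem z = σ.mem z := by
  obtain ⟨c, hc, hcA, hcB⟩ := exists_plug hAB
  simp only at hc
  have hperm : T.addrs.Perm (p :: ctxAddrs c) := by
    rw [hc]; exact addrs_plug_perm _ _
  have hb : b ∈ T.leafEntries.map Prod.snd := by rw [hAB]; simp
  have hl : l₁ ≠ l₂ := by
    rcases hcase with ⟨rfl, rfl⟩ | ⟨rfl, rfl, -⟩ <;> rintro rfl <;> exact hx hb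
  have hbd := hT.bounds
  have hsep := hT.sep.perm hperm
  have hpT : p ∈ T.addrs := hperm.mem_iff.2 (by simp)
  have hAm : ∀ e ∈ A, e.1 ∈ ctxAddrs c := fun e he =>
    fst_mem_ctxAddrs (.inl (by rw [hcA]; exact he))
  have hBm : ∀ e ∈ B, e.1 ∈ ctxAddrs c := fun e he =>
    fst_mem_ctxAddrs (.inr (by rw [hcB]; exact he))
  have hcT : ∀ q ∈ ctxAddrs c, q ∈ T.addrs := fun q hq => hperm.mem_iff.2 (by simp [hq])
  rw [sep_cons] at hsep
  obtain ⟨sp, sc⟩ := hsep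
  -- neighbours in the list of leaves
  have hlinks := hT.links
  rw [hAB, List.map_append, List.map_cons] at hlinks
  obtain ⟨-, lp2, lp3, -⟩ := (linkSeg_append _ _ _ _ _).1 hlinks
  set pl := (A.map Prod.fst).getLastD 0 with hpl
  set nx := (B.map Prod.fst).headD 0 with hnx
  have hpl' : pl = 0 ∨ pl ∈ ctxAddrs c := by
    rcases getLastD_mem_or (A.map Prod.fst) with h | h
    · exact .inl h
    · obtain ⟨e, he, he'⟩ := List.mem_map.1 h
      right; rw [hpl, ← he']; exact hAm e he
  have hnx' : nx = 0 ∨ nx ∈ ctxAddrs c := by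
    rcases headD_mem_or (B.map Prod.fst) with h | h
    · exact .inl h
    · obtain ⟨e, he, he'⟩ := List.mem_map.1 h
      right; rw [hnx, ← he']; exact hBm e he
  have hnodup : (A.map Prod.fst ++ p :: B.map Prod.fst).Nodup := by
    have h1 := nodup_leafAddrs hT.sep
    rw [leafAddrs_eq, hAB] at h1
    simpa using h1
  obtain ⟨-, -, hdisjAB⟩ := List.nodup_append.1 hnodup
  have hpn : pl = 0 ∨ nx = 0 ∨ pl ≠ nx := by
    rcases getLastD_mem_or (A.map Prod.fst) with h | h
    · exact .inl h
    · rcases headD_mem_or (B.map Prod.fst) with h' | h'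
      · exact .inr (.inl h')
      · exact .inr (.inr (hdisjAB _ h _ (List.mem_cons_of_mem _ h')))
  have hfld : ∀ q, (q = 0 ∨ q ∈ ctxAddrs c) → q = 0 ∨ q + 6 ≤ f ∧ (q + 6 ≤ p ∨ p + 6 ≤ q) ∧
      (q + 6 ≤ P ∨ P + n ≤ q) := by
    rintro q (h | h)
    · exact .inl h
    · have h1 := hbd q (hcT q h)
      have h2 := sp q h
      exact .inr ⟨h1.2.1, h2.symm, h1.2.2⟩
  have hpbd := hbd p hpT
  obtain ⟨σ₁, t₁, hex, ht₁, hmem, hv6⟩ :=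
    splitLeaf_runs inp σ h0 h2 h6 h10 h17 h18 lp2 lp3
  have hvar : ∀ v, v ∉ splitLeaf.assigned → σ₁.var v = σ.var v := fun v => hex.var_eq v
  obtain ⟨⟨p0, p1, p2, p3, p4, p5⟩, ⟨f0, f1, f2, f3, f4⟩, ⟨g0, g1, g2, g3, g4⟩, hpl3, hnx2, hP1,
    hP2, hfr⟩ := splitLeaf_mem hpbd.2.1 (hfld pl hpl') (hfld nx hnx') hT.ptr_top hpbd.2.2 hpn
      (by
        rcases hpl' with h | h
        · exact .inl h
        rcases hnx' with h' | h'
        · exact .inr (.inl h')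
        rcases hpn with h'' | h'' | h''
        · exact .inl h''
        · exact .inr (.inl h'')
        · have := sc.disj h h'; omega) hl hmem
  have hfr' : ∀ z < f, (z < p ∨ p + 6 ≤ z) → (pl = 0 ∨ z ≠ pl + 3) → (nx = 0 ∨ z ≠ nx + 2) →
      (z < P ∨ P + n ≤ z) → σ₁.mem z = σ.mem z := fun z h1 h2 h3 h4 h5 =>
    hfr z h1 h2 h3 h4 (by omega) (by omega)
  have hrep := hT.rep
  rw [hc, rep_plug] at hrep
  -- the context in the new memory
  have hctx : CtxRep σ₁.mem p 0 l₂ c := by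
    classical
    -- This auxiliary memory is new on the context and old elsewhere. It still represents the whole
    -- old tree, since on the context only links have changed; the representation of the context is
    -- then read off.
    let m₁ : ℕ → ℕ := fun z => if InCells (ctxAddrs c) z then σ₁.mem z else σ.mem z
    have hrep₁ : T.Rep m₁ 0 := by
      refine hT.rep.congr_links hT.sep fun z hz he => ?_
      simp only [m₁]
      split_ifs with hz'
      · obtain ⟨y, hy, hy1, hy2⟩ := hz'
        have h1 := hbd y (hcT y hy)
        have h2 := sp y hy
        refine hfr' z (by omega) (by omega) ?_ ?_ (by omega)
        · rcases getLastD_mem_or (A.map Prod.fst) with h | h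
          · exact .inl h
          · obtain ⟨e, he1, he2⟩ := List.mem_map.1 h
            have := (he e (by rw [hAB]; simp [he1])).2
            rw [he2] at this
            exact .inr this
        · rcases headD_mem_or (B.map Prod.fst) with h | h
          · exact .inl h
          · obtain ⟨e, he1, he2⟩ := List.mem_map.1 h
            have := (he e (by rw [hAB]; simp [he1])).1
            rw [he2] at this
            exact .inr this
      · rfl
    rw [hc, rep_plug] at hrep₁
    have h1 : CtxRep σ₁.mem p 0 b c := CtxRep.congr (m := m₁) hrep₁.2 fun z hz => by
      simp only [m₁]; rw [if_pos hz]
    rcases hcase with ⟨-, rfl⟩ | ⟨-, -, hB⟩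
    · exact h1
    · exact h1.change_key _ (by rw [hcB, hB])
  set t : PTree := node p (leaf f l₁) (leaf (f + 6) l₂) with ht
  have htrep : t.Rep σ₁.mem (ctxParent c) := by
    refine ⟨p0, p1, p2, p3, ?_, by simp [p5, balanceCode, height], ⟨f0, f1, f4⟩, ⟨g0, g1, g4⟩⟩
    rw [p4]
    exact hrep.1.2.2
  have hfresh : ∀ q ∈ ctxAddrs c, q + 6 ≤ f := fun q hq => (hbd q (hcT q hq)).2.1
  have hsep' : Sep (t.addrs ++ ctxAddrs c) := by
    rw [sep_append]
    refine ⟨?_, sc, ?_⟩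
    · simp only [ht, addrs, sep_cons, List.mem_append, List.mem_singleton]
      simp [Sep]
      omega
    · intro q hq r hr
      have := hfresh r hr
      have := sp r hr
      simp only [ht, addrs, List.mem_cons, List.mem_append, List.not_mem_nil, or_false] at hq
      rcases hq with rfl | rfl | rfl <;> omega
  have hcavl : T.IsAVL := hT.avl
  rw [hc, isAVL_plug] at hcavl
  have key : ∀ σ₂ : Store, σ₂.var 10 = p → σ₂.var 16 = 1 → σ₂.mem = σ₁.mem → _ :=
    fun σ₂ e1 e2 e3 => rebalance_loop_runs (inp := inp) c t σ₂ e1 e2 (by rw [e3]; exact htrep)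
      (by rw [e3]; exact hctx) hsep' (fun q hq => (hbd q (hcT q hq)).1.ne') (by simp [ht, IsAVL, height])
      hcavl.2 (by simp [ht, height]) (.inl (by simp [ht, height]))
  obtain ⟨T', k, hk, hr⟩ := key ⟨Function.update σ₁.var 16 1, σ₁.mem⟩
    (by simp [hvar 10 (by decide), h10]) (by simp) rfl
  have hent : (plug t c).leafEntries = A ++ (f, l₁) :: (f + 6, l₂) :: B := by
    rw [leafEntries_plug, hcA, hcB]; simp [ht, leafEntries]
  have hpermt : (plug t c).addrs.Perm (f :: (f + 6) :: T.addrs) := by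
    refine (addrs_plug_perm _ _).trans ?_
    refine List.Perm.trans ?_ ((hperm.symm.cons _).cons _)
    simp only [ht, addrs, List.cons_append, List.nil_append]
    exact (List.Perm.swap _ _ _).trans ((List.Perm.swap _ _ _).cons _)
  have hptr₁ : ∀ (m' : ℕ → ℕ) (T' : PTree), T'.leafEntries = (plug t c).leafEntries →
      (∀ a < n, m' (P + a) = σ₁.mem (P + a)) →
      ∀ a < n, a ∈ T'.leafEntries.map Prod.snd → (m' (P + a), a) ∈ T'.leafEntries := by
    intro m' T' r4 hm' a ha hmem'
    rw [r4, hent] at hmem' ⊢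
    rw [hm' a ha]
    by_cases ha1 : a = l₁
    · subst ha1; rw [hP1 ha]; simp
    · by_cases ha2 : a = l₂
      · subst ha2; rw [hP2 ha]; simp
      · have h1 : σ₁.mem (P + a) = σ.mem (P + a) := by
          have g1 := hfld pl hpl'
          have g2 := hfld nx hnx'
          have g3 := hT.ptr_top
          have g4 := hpbd.2.2
          clear * - g1 g2 g3 g4 ha ha1 ha2 hfr
          refine hfr _ (by omega) (by omega) ?_ ?_ (by omega) (by omega)
          · omega
          · omega
        rw [h1]
        simp only [List.map_append, List.map_cons, List.mem_append, List.mem_cons, ha1, ha2,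
          false_or] at hmem'
        have h2 := hT.ptr a ha (by
          rw [hAB]
          simp only [List.map_append, List.map_cons, List.mem_append, List.mem_cons]
          exact hmem'.imp_right .inr)
        rw [hAB] at h2
        simp only [List.mem_append, List.mem_cons] at h2 ⊢
        rcases h2 with h2 | h2 | h2
        · exact .inl h2
        · simp only [Prod.mk.injEq] at h2
          rcases hcase with ⟨-, h⟩ | ⟨h, -⟩
          · exact absurd (h2.2.trans h.symm) ha2
          · exact absurd (h2.2.trans h.symm) ha1
        · exact .inr (.inr (.inr h2))
  have hlinks₁ : LinkSeg σ₁.mem 0 0 (A.map Prod.fst ++ f :: (f + 6) :: B.map Prod.fst) := by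
    have hmemAB : ∀ y, y ∈ A.map Prod.fst ∨ y ∈ B.map Prod.fst → y ∈ ctxAddrs c := by
      rintro y (h | h) <;> obtain ⟨e, he, rfl⟩ := List.mem_map.1 h
      · exact hAm e he
      · exact hBm e he
    refine LinkSeg.split hlinks hnodup ?_ ⟨f2, f3⟩ ⟨g2, g3⟩ hpl3 hnx2 ?_ ?_
    · simp only [List.mem_append, List.mem_cons, not_or]
      exact ⟨fun h => (hbd _ (hcT _ (hmemAB _ (.inl h)))).1.ne' rfl, hpbd.1.ne,
        fun h => (hbd _ (hcT _ (hmemAB _ (.inr h)))).1.ne' rfl⟩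
    · intro y hy hy'
      have h1 := hbd y (hcT y (hmemAB y hy))
      have h2 := sp y (hmemAB y hy)
      have h4 : pl = 0 ∨ y + 2 ≠ pl + 3 := by
        rcases hpl' with h | h
        · exact .inl h
        · have := sc.disj h (hmemAB y hy)
          clear * - this; omega
      clear * - h1 h2 h4 hfr' hy'
      exact hfr' _ (by omega) (by omega) h4 (by omega) (by omega)
    · intro y hy hy'
      have h1 := hbd y (hcT y (hmemAB y hy))
      have h2 := sp y (hmemAB y hy)
      have h4 : nx = 0 ∨ y + 3 ≠ nx + 2 := by
        rcases hnx' with h | h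
        · exact .inl h
        · have := sc.disj h (hmemAB y hy)
          clear * - this; omega
      clear * - h1 h2 h4 hfr' hy'
      exact hfr' _ (by omega) (by omega) (by omega) h4 (by omega)
  obtain ⟨σ₃, t₃, hex₃, ht₃, r1, r2, r3, r4, r5, r6, r7⟩ := hr
  refine ⟨T', k, ?_, ?_, ?_, ?_, σ₃, t₁ + (1 + t₃), ?_, ?_, ?_, ?_, ?_⟩
  · have h1 : t.potential = 0 := by simp [ht, potential, height]
    have h2 : T.potential = ctxPotential 0 c := by rw [hc, potential_plug]; simp [potential, height]
    have h3 : t.height = 1 := by simp [ht, height]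
    rw [h1, h3] at hk
    simp only [if_true] at hk
    rw [h2]
    simpa [add_assoc] using hk
  · rw [r6, hc]
    exact addr_plug_congr (t := t) (t' := leaf p b) rfl c
  · rw [r4, hent]; simp
  · intro q hq
    have := hpermt.mem_iff.1 (r5.mem_iff.1 hq)
    simp only [List.mem_cons] at this
    rcases this with rfl | rfl | h
    · exact .inr le_rfl
    · exact .inr (by omega)
    · exact .inl h
  · exact .seq hex (.seq (.assign 16 1 σ₁) hex₃)
  · omega
  · have hcells : ∀ z, z < f → ¬ InCells T.addrs z → σ₃.mem z = σ₁.mem z := by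
      intro z hz hz'
      refine r2 z fun ⟨y, hy, hy1, hy2⟩ => ?_
      have := hpermt.mem_iff.1 hy
      simp only [List.mem_cons] at this
      rcases this with rfl | rfl | h
      · omega
      · omega
      · exact hz' ⟨y, h, hy1, hy2⟩
    have hPcells : ∀ a < n, ¬ InCells T.addrs (P + a) := by
      rintro a ha ⟨y, hy, hy1, hy2⟩
      have := (hbd y hy).2.2
      omega
    refine ⟨r1, ?_, ?_, ?_, ?_, r7, by have := hT.ptr_top; omega⟩
    · rw [r4]
      refine LinkSeg.congr (m := σ₁.mem) ?_ (fun y hy => ?_)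
      · rw [hent, List.map_append, List.map_cons, List.map_cons]
        exact hlinks₁
      · obtain ⟨e, he, rfl⟩ := List.mem_map.1 hy
        exact r3 e he
    · exact hptr₁ σ₃.mem T' r4 fun a ha =>
        hcells _ (by have := hT.ptr_top; omega) (hPcells a ha)
    · exact Sep.perm (hsep'.perm (addrs_plug_perm _ _).symm) r5.symm
    · intro q hq
      have := hpermt.mem_iff.1 (r5.mem_iff.1 hq)
      have hpt := hT.ptr_top
      simp only [List.mem_cons] at this
      rcases this with rfl | rfl | h
      · omega
      · omega
      · have := hbd q h; omega
  · rw [hex₃.var_eq 6 (by decide)]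
    simp [hv6]
  · intro z hz hz' hzP
    have h1 : σ₃.mem z = σ₁.mem z := by
      refine r2 z fun ⟨y, hy, hy1, hy2⟩ => ?_
      have := hpermt.mem_iff.1 hy
      simp only [List.mem_cons] at this
      rcases this with rfl | rfl | h
      · omega
      · omega
      · exact hz' ⟨y, h, hy1, hy2⟩
    rw [h1]
    refine hfr' z hz ?_ ?_ ?_ hzP
    · exact not_inCells hz' hpT
    · rcases hpl' with h | h
      · exact .inl h
      · have := not_inCells hz' (hcT _ h); omega
    · rcases hnx' with h | h
      · exact .inl h
      · have := not_inCells hz' (hcT _ h); omega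

end PTree

open Classical in
/-- The program sets variable `9` to `1` if the label in variable `8` satisfies `fl`, and to `0`
otherwise, provided that the variables `0` and `7` hold `n` and `x`. -/
def Compares (inp : Input) (cmp : Cmd) (n x : ℕ) (fl : ℕ → Prop) : Prop :=
  ∀ σ : Store, σ.var 0 = n → σ.var 7 = x → Runs inp cmp σ 20 fun σ' =>
    σ' = ⟨Function.update σ.var 9 (if fl (σ.var 8) then 1 else 0), σ.mem⟩

namespace PTree

/-! ### Search and insertion of a label -/

/-- Compares the label of the node at `e`. -/
def loadCompare (e : Expr) (cmp : Cmd) : Cmd := 8 ≔ M[e + 1] ;; cmp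

open Classical in
theorem loadCompare_runs {inp : Input} {cmp : Cmd} {n x : ℕ} {fl : ℕ → Prop}
    (hcmp : Compares inp cmp n x fl) (σ : Store) (e : Expr) (he : e.cost ≤ 10) (h0 : σ.var 0 = n)
    (h7 : σ.var 7 = x) : Runs inp (loadCompare e cmp) σ 33 fun σ' =>
      σ' = ⟨Function.update (Function.update σ.var 8 (σ.mem (e.eval σ + 1))) 9
        (if fl (σ.mem (e.eval σ + 1)) then 1 else 0), σ.mem⟩ := by
  obtain ⟨σ', t', h1, h2, h3⟩ := hcmp ⟨Function.update σ.var 8 (σ.mem (e.eval σ + 1)), σ.mem⟩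
    (by simpa using h0) (by simpa using h7)
  refine ⟨σ', _, .seq (.assign 8 _ σ) h1, ?_, by simpa using h3⟩
  simp [Expr.cost]
  omega

/-- Variable `9` is `1` if the key satisfies the flag, that is, if the place sought is not to the
right of the left subtree's last leaf; then `3 - 1` is the field of the left child. -/
def descend (cmp : Cmd) : Cmd :=
  .loop (.le 1 M[v#10]) (loadCompare v#10 cmp ;; 10 ≔ M[(v#10 + 3) - v#9])

/-- The flag is monotone along the leaves, so a key with the flag settles all leaves to its right
and a key without it those to its left. The flag of the leaf that is reached remains open and is
tested afterwards. -/
theorem descend_runs {inp : Input} {cmp : Cmd} {n x : ℕ} {fl : ℕ → Prop}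
    (hcmp : Compares inp cmp n x fl) (D : PTree) (q : ℕ) (σ : Store) (h0 : σ.var 0 = n)
    (h7 : σ.var 7 = x) (h10 : σ.var 10 = D.addr) (hD : D.Rep σ.mem q)
    (hmono : (D.leafEntries.map Prod.snd).Pairwise fun a b => fl a → fl b) :
    Runs inp (descend cmp) σ (45 * D.height + 2) fun σ' =>
      σ'.mem = σ.mem ∧ (∀ v, v ≠ 8 → v ≠ 9 → v ≠ 10 → σ'.var v = σ.var v) ∧
      ∃ A p b B, D.leafEntries = A ++ (p, b) :: B ∧ σ'.var 10 = p ∧ (∀ e ∈ A, ¬ fl e.2) ∧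
        ∀ e ∈ B, fl e.2 := by
  classical
  induction D generalizing q σ with
  | leaf p b =>
    refine .loop_done ?_ (by simp [Test.cost, Expr.cost]) ⟨rfl, fun _ _ _ _ => rfl, [], p, b, [],
      rfl, h10, by simp, by simp⟩
    simp [h10, addr, hD.1]
  | node p l r ihl ihr =>
    obtain ⟨d0, d1, d2, d3, -, -, dl, dr⟩ := hD
    simp only [addr] at h10
    simp only [leafEntries, List.map_append, List.pairwise_append] at hmono
    obtain ⟨ml, mr, mlr⟩ := hmono
    have hlast : ∃ e ∈ l.leafEntries, e.2 = l.lastLabel := by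
      obtain ⟨L, p', h⟩ := l.exists_leafEntries_eq_concat
      exact ⟨(p', l.lastLabel), by simp [h], rfl⟩
    obtain ⟨e₀, he₀, he₀'⟩ := hlast
    obtain ⟨σ₁, t₁, hx₁, ht₁, hs₁⟩ := loadCompare_runs hcmp σ v#10 (by simp [Expr.cost]) h0 h7
    have h8 : σ.mem ((v#10).eval σ + 1) = l.lastLabel := by simp [h10, d1]
    rw [h8] at hs₁
    by_cases hfl : fl l.lastLabel
    · rw [if_pos hfl] at hs₁
      obtain ⟨σ₂, t₂, hx₂, ht₂, e1, e2, A, p', b, B, e3, e4, e5, e6⟩ :=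
        ihl p ⟨Function.update σ₁.var 10 l.addr, σ₁.mem⟩ (by simp [hs₁, h0]) (by simp [hs₁, h7])
          (by simp) (by simpa [hs₁] using dl) ml
      refine .loop_step (t₁ := 37) (t₂ := 45 * l.height + 2) ?_
        ⟨⟨Function.update σ₁.var 10 l.addr, σ₁.mem⟩, t₁ + 4, .seq hx₁ ?_, by omega, ?_⟩ ?_
      · simp [h10, d0]
      · have := Exec.assign (inp := inp) 10 M[(v#10 + 3) - v#9] σ₁
        have he : (M[(v#10 + 3) - v#9] : Expr).eval σ₁ = l.addr := by simp [hs₁, h10, d2]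
        rw [he] at this
        exact this
      · refine ⟨σ₂, t₂, hx₂, ht₂, by simpa [hs₁] using e1, ?_, A, p', b, B ++ r.leafEntries, ?_, e4,
          e5, ?_⟩
        · intro v h1 h2 h3
          rw [e2 v h1 h2 h3]
          simp [hs₁, h1, h2, h3]
        · simp [leafEntries, e3]
        · intro e he
          rcases List.mem_append.1 he with he | he
          · exact e6 e he
          · exact mlr _ (List.mem_map_of_mem he₀) _ (List.mem_map_of_mem he) (he₀' ▸ hfl)
      · simp [Test.cost, Expr.cost, height]; omega
    · rw [if_neg hfl] at hs₁
      obtain ⟨σ₂, t₂, hx₂, ht₂, e1, e2, A, p', b, B, e3, e4, e5, e6⟩ :=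
        ihr p ⟨Function.update σ₁.var 10 r.addr, σ₁.mem⟩ (by simp [hs₁, h0]) (by simp [hs₁, h7])
          (by simp) (by simpa [hs₁] using dr) mr
      refine .loop_step (t₁ := 37) (t₂ := 45 * r.height + 2) ?_
        ⟨⟨Function.update σ₁.var 10 r.addr, σ₁.mem⟩, t₁ + 4, .seq hx₁ ?_, by omega, ?_⟩ ?_
      · simp [h10, d0]
      · have := Exec.assign (inp := inp) 10 M[(v#10 + 3) - v#9] σ₁
        have he : (M[(v#10 + 3) - v#9] : Expr).eval σ₁ = r.addr := by simp [hs₁, h10, d3]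
        rw [he] at this
        exact this
      · refine ⟨σ₂, t₂, hx₂, ht₂, by simpa [hs₁] using e1, ?_, l.leafEntries ++ A, p', b, B, ?_, e4,
          ?_, e6⟩
        · intro v h1 h2 h3
          rw [e2 v h1 h2 h3]
          simp [hs₁, h1, h2, h3]
        · simp [leafEntries, e3]
        · intro e he
          rcases List.mem_append.1 he with he | he
          · obtain ⟨L, p'', h⟩ := l.exists_leafEntries_eq_concat
            rw [h] at he ml
            rcases List.mem_append.1 he with he | he
            · rw [List.map_append, List.pairwise_append] at ml
              exact fun hc => hfl (ml.2.2 _ (List.mem_map_of_mem he) l.lastLabel (by simp) hc)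
            · simp only [List.mem_singleton] at he
              rw [he]; exact hfl
          · exact e5 e he
      · simp [Test.cost, Expr.cost, height]; omega

theorem stored_of_mem_leafEntries {T : PTree} {m : ℕ → ℕ} {q : ℕ} (h : T.Rep m q) {e : ℕ × ℕ}
    (he : e ∈ T.leafEntries) : m e.1 = 0 ∧ m (e.1 + 1) = e.2 := by
  induction T generalizing q with
  | leaf p a =>
    simp only [leafEntries, List.mem_singleton] at he
    subst he
    exact ⟨h.1, h.2.1⟩
  | node p l r ihl ihr =>
    rcases List.mem_append.1 he with he | he
    · exact ihl h.2.2.2.2.2.2.1 he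
    · exact ihr h.2.2.2.2.2.2.2 he

/-- Finds the leaf to be split, and the order of the two labels. -/
def chooseSplit (cmp : Cmd) : Cmd :=
  loadCompare v#10 cmp ;;
  .ite (.le 1 v#9) (17 ≔ v#7 ;; 18 ≔ v#8)
    (30 ≔ M[v#10 + 3] ;;
     .ite (.le v#30 0) (17 ≔ v#8 ;; 18 ≔ v#7)
      (10 ≔ v#30 ;; 17 ≔ v#7 ;; 18 ≔ M[v#30 + 1]))

/-- Inserts the label in variable `7` next to the leaf at the address in variable `10`. -/
def insertLabel (cmp : Cmd) : Cmd := chooseSplit cmp ;; insertLeaf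

/-- If the leaf that was found still precedes the new label, its successor is split instead, so that
the new label is always the left half. Only if there is no successor is the new label put on the
right. -/
theorem chooseSplit_runs {inp : Input} {cmp : Cmd} {n x : ℕ} {fl : ℕ → Prop}
    (hcmp : Compares inp cmp n x fl) {σ : Store} {T : PTree} {A B : List (ℕ × ℕ)} {P f p b : ℕ}
    (h0 : σ.var 0 = n) (h7 : σ.var 7 = x) (h10 : σ.var 10 = p) (hT : TreeIn σ.mem P n f T)
    (hAB : T.leafEntries = A ++ (p, b) :: B) (hA : ∀ e ∈ A, ¬ fl e.2) (hB : ∀ e ∈ B, fl e.2) :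
    ∃ A' p' b' B' l₁ l₂ L₁ L₂, T.leafEntries = A' ++ (p', b') :: B' ∧
      (l₁ = x ∧ l₂ = b' ∨ l₁ = b' ∧ l₂ = x ∧ B' = []) ∧
      T.leafEntries.map Prod.snd = L₁ ++ L₂ ∧
      A'.map Prod.snd ++ l₁ :: l₂ :: B'.map Prod.snd = L₁ ++ x :: L₂ ∧
      (∀ a ∈ L₁, ¬ fl a) ∧ (∀ a ∈ L₂, fl a) ∧
      Runs inp (chooseSplit cmp) σ 60 fun σ' => σ'.mem = σ.mem ∧ σ'.var 10 = p' ∧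
        σ'.var 17 = l₁ ∧ σ'.var 18 = l₂ ∧ (∀ v < 8, σ'.var v = σ.var v) := by
  classical
  obtain ⟨σ₁, t₁, hx₁, ht₁, hs₁⟩ := loadCompare_runs hcmp σ v#10 (by simp [Expr.cost]) h0 h7
  have hb := stored_of_mem_leafEntries (e := (p, b)) hT.rep (by rw [hAB]; simp)
  have h8 : σ.mem ((v#10).eval σ + 1) = b := by simp [h10, hb.2]
  rw [h8] at hs₁
  have hrun : ∀ {Q : Store → Prop}, Q (Cmd.eval inp (.ite (.le 1 v#9) (17 ≔ v#7 ;; 18 ≔ v#8)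
      (30 ≔ M[v#10 + 3] ;; .ite (.le v#30 0) (17 ≔ v#8 ;; 18 ≔ v#7)
      (10 ≔ v#30 ;; 17 ≔ v#7 ;; 18 ≔ M[v#30 + 1]))) σ₁) → Runs inp (chooseSplit cmp) σ 60 Q := by
    intro Q hQ
    exact Runs.seq' (t₁ := 33) (t₂ := 27) ⟨σ₁, t₁, hx₁, ht₁, Runs.eval (by simp) (by decide) hQ⟩
      (by omega)
  have hlinks := hT.links
  rw [hAB, List.map_append, List.map_cons] at hlinks
  obtain ⟨-, -, lp3, -⟩ := (linkSeg_append _ _ _ _ _).1 hlinks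
  simp only at lp3
  by_cases hfl : fl b
  · rw [if_pos hfl] at hs₁
    refine ⟨A, p, b, B, x, b, A.map Prod.snd, b :: B.map Prod.snd, hAB, .inl ⟨rfl, rfl⟩,
      by simp [hAB], by simp, ?_, ?_, hrun ?_⟩
    · intro a ha
      obtain ⟨e, he, rfl⟩ := List.mem_map.1 ha
      exact hA e he
    · intro a ha
      rcases List.mem_cons.1 ha with rfl | ha
      · exact hfl
      · obtain ⟨e, he, rfl⟩ := List.mem_map.1 ha
        exact hB e he
    · subst hs₁
      simp [h10, h7]
      intro v hv
      simp [show v ≠ 18 by omega, show v ≠ 17 by omega, show v ≠ 9 by omega, show v ≠ 8 by omega]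
  · rw [if_neg hfl] at hs₁
    have hA' : ∀ a ∈ A.map Prod.snd ++ [b], ¬ fl a := by
      intro a ha
      rcases List.mem_append.1 ha with ha | ha
      · obtain ⟨e, he, rfl⟩ := List.mem_map.1 ha
        exact hA e he
      · rw [List.mem_singleton.1 ha]; exact hfl
    rcases B with _ | ⟨⟨p', b'⟩, B⟩
    · refine ⟨A, p, b, [], b, x, A.map Prod.snd ++ [b], [], hAB, .inr ⟨rfl, rfl, rfl⟩,
        by simp [hAB], by simp, hA', by simp, hrun ?_⟩
      subst hs₁
      simp at lp3
      simp [h10, h7, lp3]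
      intro v hv
      simp [show v ≠ 18 by omega, show v ≠ 17 by omega, show v ≠ 9 by omega, show v ≠ 8 by omega,
        show v ≠ 30 by omega]
    · refine ⟨A ++ [(p, b)], p', b', B, x, b', A.map Prod.snd ++ [b], b' :: B.map Prod.snd,
        by simp [hAB], .inl ⟨rfl, rfl⟩, by simp [hAB], by simp, hA', ?_, hrun ?_⟩
      · intro a ha
        have : a ∈ ((p', b') :: B).map Prod.snd := ha
        obtain ⟨e, he, rfl⟩ := List.mem_map.1 this
        exact hB e he
      · subst hs₁
        simp only [List.map_cons, List.headD_cons] at lp3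
        have hp' : p' ∈ T.addrs := by
          have : (p', b') ∈ T.leafEntries := by rw [hAB]; simp
          exact fst_mem_addrs this
        have h0' := (hT.bounds p' hp').1.ne'
        have hb' := (stored_of_mem_leafEntries (e := (p', b')) hT.rep (by rw [hAB]; simp)).2
        simp only at hb'
        simp [h10, h7, lp3, h0', hb']
        intro v hv
        simp [show v ≠ 18 by omega, show v ≠ 17 by omega, show v ≠ 9 by omega,
          show v ≠ 8 by omega, show v ≠ 30 by omega, show v ≠ 10 by omega]

/-- The store after the insertion of a label into a search tree. -/
structure Inserted (σ σ' : Store) (P n f x : ℕ) (fl : ℕ → Prop) (T T' : PTree) : Prop where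
  treeIn : TreeIn σ'.mem P n (f + 12) T'
  top : σ'.var 6 = f + 12
  addr : T'.addr = T.addr
  labels : ∃ L₁ L₂, T.leafEntries.map Prod.snd = L₁ ++ L₂ ∧
    T'.leafEntries.map Prod.snd = L₁ ++ x :: L₂ ∧ (∀ a ∈ L₁, ¬ fl a) ∧ ∀ a ∈ L₂, fl a
  addrs : ∀ q ∈ T'.addrs, q ∈ T.addrs ∨ f ≤ q
  frame : ∀ z < f, ¬ InCells T.addrs z → (z < P ∨ P + n ≤ z) → σ'.mem z = σ.mem z

theorem insertLabel_runs {inp : Input} {cmp : Cmd} {n x : ℕ} {fl : ℕ → Prop}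
    (hcmp : Compares inp cmp n x fl) {σ : Store} {T : PTree} {A B : List (ℕ × ℕ)} {P f p b : ℕ}
    (h0 : σ.var 0 = n) (h2 : σ.var 2 = P) (h6 : σ.var 6 = f) (h7 : σ.var 7 = x)
    (h10 : σ.var 10 = p) (hT : TreeIn σ.mem P n f T) (hx : x ∉ T.leafEntries.map Prod.snd)
    (hAB : T.leafEntries = A ++ (p, b) :: B) (hA : ∀ e ∈ A, ¬ fl e.2) (hB : ∀ e ∈ B, fl e.2) :
    ∃ T' k, k + T'.potential ≤ T.potential + 5 ∧
      Runs inp (insertLabel cmp) σ (152 * k + 360) fun σ' => Inserted σ σ' P n f x fl T T' := by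
  obtain ⟨A', p', b', B', l₁, l₂, L₁, L₂, e1, e2, e3, e4, e5, e6, σ₁, t₁, hx₁, ht₁, r1, r2, r3, r4,
    r5⟩ := chooseSplit_runs hcmp h0 h7 h10 hT hAB hA hB
  obtain ⟨T', k, hk, g1, g2, g3, σ₂, t₂, hx₂, ht₂, g5, g6, g7⟩ := insertLeaf_runs (inp := inp)
    (σ := σ₁) (T := T) (n := n) (P := P) (f := f) (by rw [r5 0 (by omega), h0])
    (by rw [r5 2 (by omega), h2]) (by rw [r5 6 (by omega), h6]) r2 (by rw [r1]; exact hT) e1 hx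
    r3 r4 e2
  refine ⟨T', k, hk, σ₂, _, .seq hx₁ hx₂, by omega, g5, g6, g1, ⟨L₁, L₂, e3, ?_, e5, e6⟩, g3, ?_⟩
  · rw [g2, e4]
  · intro z h1 h2 h3
    rw [g7 z h1 h2 h3, r1]

end PTree

theorem Runs.ite_true {inp : Input} {b : Test} {c d : Cmd} {σ : Store} {t t₁ : ℕ}
    {Q : Store → Prop} (hb : b.Holds inp σ) (h : Runs inp c σ t₁ Q) (ht : b.cost + t₁ ≤ t) :
    Runs inp (.ite b c d) σ t Q := by
  obtain ⟨σ', t', h1, h2, h3⟩ := h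
  exact ⟨σ', _, .ite_true hb h1, by omega, h3⟩

theorem Runs.ite_false {inp : Input} {b : Test} {c d : Cmd} {σ : Store} {t t₁ : ℕ}
    {Q : Store → Prop} (hb : ¬ b.Holds inp σ) (h : Runs inp d σ t₁ Q) (ht : b.cost + t₁ ≤ t) :
    Runs inp (.ite b c d) σ t Q := by
  obtain ⟨σ', t', h1, h2, h3⟩ := h
  exact ⟨σ', _, .ite_false hb h1, by omega, h3⟩

namespace PTree

/-! ### Finger search -/

/-- The leaves in the order in which they are met in the given direction (`true` is left). -/
def towards (d : Bool) (t : PTree) : List (ℕ × ℕ) :=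
  if d then t.leafEntries.reverse else t.leafEntries

def ahead (d : Bool) (c : List Frame) : List (ℕ × ℕ) :=
  if d then (ctxBefore c).reverse else ctxAfter c

def behind (d : Bool) (c : List Frame) : List (ℕ × ℕ) :=
  if d then (ctxAfter c).reverse else ctxBefore c

theorem towards_leaf (d : Bool) (p a : ℕ) : towards d (leaf p a) = [(p, a)] := by
  cases d <;> rfl

theorem towards_mk (d s : Bool) (p : ℕ) (t u : PTree) : towards d (mk s p t u) =
    if s = d then towards d u ++ towards d t else towards d t ++ towards d u := by
  cases d <;> cases s <;> simp [towards, mk, leafEntries]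

theorem length_towards (d : Bool) (t : PTree) : (towards d t).length = t.leafEntries.length := by
  cases d <;> simp [towards]

theorem towards_plug (d : Bool) (t : PTree) (c : List Frame) :
    towards d (plug t c) = behind d c ++ towards d t ++ ahead d c := by
  cases d <;> simp [towards, behind, ahead, leafEntries_plug]

theorem ahead_cons (d : Bool) (f : Frame) (c : List Frame) :
    ahead d (f :: c) = (if f.side = d then [] else towards d f.sib) ++ ahead d c := by
  rcases f with ⟨s, p, u⟩
  cases d <;> cases s <;> simp [ahead, towards, ctxBefore, ctxAfter]

theorem behind_cons (d : Bool) (f : Frame) (c : List Frame) :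
    behind d (f :: c) = behind d c ++ (if f.side = d then towards d f.sib else []) := by
  rcases f with ⟨s, p, u⟩
  cases d <;> cases s <;> simp [behind, towards, ctxBefore, ctxAfter]

theorem ahead_append (d : Bool) (c c' : List Frame) :
    ahead d (c ++ c') = ahead d c ++ ahead d c' := by
  induction c with
  | nil => cases d <;> simp [ahead, ctxBefore, ctxAfter]
  | cons f c ih => rw [List.cons_append, ahead_cons, ih, ahead_cons, List.append_assoc]

theorem behind_append (d : Bool) (c c' : List Frame) :
    behind d (c ++ c') = behind d c' ++ behind d c := by
  induction c with
  | nil => cases d <;> simp [behind, ctxBefore, ctxAfter]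
  | cons f c ih => rw [List.cons_append, behind_cons, ih, behind_cons, List.append_assoc]

theorem plug_append (t : PTree) (c c' : List Frame) : plug t (c ++ c') = plug (plug t c) c' := by
  induction c generalizing t with
  | nil => rfl
  | cons f c ih => exact ih _

theorem mk_not (s : Bool) (p : ℕ) (t u : PTree) : mk (!s) p u t = mk s p t u := by
  cases s <;> rfl

theorem add_length_le_height_plug (t : PTree) (c : List Frame) :
    t.height + c.length ≤ (plug t c).height := by
  induction c generalizing t with
  | nil => simp [plug]
  | cons f c ih =>
    refine le_trans ?_ (ih _)
    simp only [List.length_cons, height_mk]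
    omega

/-- Each ancestor is at most two higher than its child. Climbing `B` levels from a leaf thus gives a
subtree of height at most `2 * B`, and walking down again costs no more than a constant times the
climb. -/
theorem height_plug_le (t : PTree) (c c' : List Frame) (h : CtxAVL t.height (c ++ c')) :
    (plug t c).height ≤ t.height + 2 * c.length := by
  induction c generalizing t with
  | nil => simp [plug]
  | cons f c ih =>
    obtain ⟨h1, h2, -, h4⟩ := h
    have := ih (mk f.side f.addr t f.sib) (by rw [height_mk]; exact h4)
    simp only [height_mk] at this
    simp only [plug, List.length_cons]
    omega

/-- The first leaf in the given direction, as the hole of a context. -/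
theorem exists_plug_first (d : Bool) (t : PTree) {e : ℕ × ℕ} {l : List (ℕ × ℕ)}
    (h : towards d t = e :: l) :
    ∃ c, t = plug (leaf e.1 e.2) c ∧ behind d c = [] ∧ ahead d c = l := by
  cases d
  · obtain ⟨c, h1, h2, h3⟩ := exists_plug (t := t) (A := []) (e := e) (B := l) (by simpa [towards] using h)
    exact ⟨c, h1, by simpa [behind] using h2, by simpa [ahead] using h3⟩
  · have h' : t.leafEntries = l.reverse ++ [e] := by
      rw [← List.reverse_reverse t.leafEntries]
      simp only [towards, if_true] at h
      rw [h]; simp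
    obtain ⟨c, h1, h2, h3⟩ := exists_plug (t := t) h'
    exact ⟨c, h1, by simp [behind, h3], by simp [ahead, h2]⟩

/-- The next leaf behind a subtree is the first leaf of the sibling of some ancestor. -/
theorem exists_sibling (d : Bool) (D : PTree) (c : List Frame) {e : ℕ × ℕ} {l : List (ℕ × ℕ)}
    (h : ahead d c = e :: l) (hc : CtxAVL D.height c) :
    ∃ cl cR, plug D c = plug (leaf e.1 e.2) (cl ++ cR) ∧ behind d cl = [] ∧
      D.height ≤ (plug (leaf e.1 e.2) cl).height + 1 ∧ ahead d (cl ++ cR) = l := by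
  induction c generalizing D with
  | nil => cases d <;> simp [ahead, ctxAfter, ctxBefore] at h
  | cons f c ih =>
    obtain ⟨h1, h2, -, h4⟩ := hc
    rw [ahead_cons] at h
    by_cases hs : f.side = d
    · rw [if_pos hs, List.nil_append] at h
      obtain ⟨cl, cR, e1, e2, e3, e4⟩ := ih (mk f.side f.addr D f.sib) h (by rwa [height_mk])
      refine ⟨cl, cR, e1, e2, ?_, e4⟩
      rw [height_mk] at e3
      omega
    · rw [if_neg hs] at h
      rcases ht : towards d f.sib with _ | ⟨e', l'⟩
      · have := congrArg List.length ht
        rw [length_towards] at this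
        exact absurd (List.length_eq_zero_iff.1 this) (leafEntries_ne_nil _)
      · rw [ht, List.cons_append, List.cons.injEq] at h
        obtain ⟨rfl, rfl⟩ := h
        obtain ⟨cl, g1, g2, g3⟩ := exists_plug_first d f.sib ht
        refine ⟨cl, ⟨!f.side, f.addr, D⟩ :: c, ?_, g2, ?_, ?_⟩
        · rw [plug_append, ← g1]
          simp only [plug]
          rw [mk_not]
        · rw [← g1]; exact h1
        · rw [ahead_append, ahead_cons, g3, if_pos, List.nil_append]
          revert hs
          cases f.side <;> cases d <;> simp

def climb : Cmd :=
  14 ≔ v#13 ;; 10 ≔ v#11 ;;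
  .loop (.le 1 v#14)
    (19 ≔ M[v#10 + 4] ;; .ite (.le v#19 0) (14 ≔ 0) (10 ≔ v#19 ;; 14 ≔ v#14 - 1))

def walk : Cmd := 15 ≔ v#10 ;; .loop (.le 1 M[v#15]) (15 ≔ M[(v#15 + 2) + v#12])

/-- Follows the link out of the subtree. The search stops, with `20` set to `0`, at the end of the
list or if the flag agrees with the side code of the direction; otherwise the new leaf becomes the
finger and the number of levels to climb doubles. -/
def hop (cmp : Cmd) : Cmd :=
  15 ≔ M[(v#15 + 2) + v#12] ;;
  .ite (.le v#15 0) (20 ≔ 0)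
    (loadCompare v#15 cmp ;; .ite (.eq v#9 v#12) (20 ≔ 0) (11 ≔ v#15 ;; 13 ≔ v#13 + v#13))

theorem climb_loop_runs {inp : Input} (k : ℕ) (t : PTree) (c : List Frame) (σ : Store)
    (h10 : σ.var 10 = t.addr) (h14 : σ.var 14 = k) (hrep : (plug t c).Rep σ.mem 0)
    (hpos : ∀ q ∈ ctxAddrs c, 0 < q) :
    Runs inp (.loop (.le 1 v#14)
      (19 ≔ M[v#10 + 4] ;; .ite (.le v#19 0) (14 ≔ 0) (10 ≔ v#19 ;; 14 ≔ v#14 - 1))) σ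
      (12 * k + 1) fun σ' => σ'.var 10 = (plug t (c.take k)).addr := by
  induction k generalizing t c σ with
  | zero => exact .loop_done (by simp [h14]) (by simp [Test.cost, Expr.cost]) (by simpa [plug] using h10)
  | succ k ih =>
    have hpar : σ.mem (t.addr + 4) = ctxParent c := ((rep_plug t c).1 hrep).1.parent
    refine .loop_step (t₁ := 10) (t₂ := 12 * k + 1) (by simp [h14])
      (Runs.eval (by simp) (by decide) ?_) (by simp [Test.cost, Expr.cost]; omega)
    cases c with
    | nil =>
      simp [h10, hpar, ctxParent]
      refine .loop_done (by simp) (by simp [Test.cost, Expr.cost]) ?_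
      simp [plug, h10]
    | cons f c =>
      have hf := (hpos f.addr (by simp [ctxAddrs])).ne'
      simp [h10, hpar, ctxParent, hf]
      refine ih (mk f.side f.addr t f.sib) c _ (by simp) (by simp [h14]) hrep
        fun q hq => hpos q (by simp [ctxAddrs, hq])

/-- The side code of the direction is the offset of the child to follow, so the same loop finds the
leftmost or the rightmost leaf. The sorting phase uses it to find the head of the leaf list. -/
theorem walk_loop_runs {inp : Input} (d : Bool) (h : ℕ) (t : PTree) (q : ℕ) (σ : Store)
    (hh : t.height ≤ h) (h15 : σ.var 15 = t.addr) (h12 : σ.var 12 = sideCode d)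
    (hrep : t.Rep σ.mem q) :
    Runs inp (.loop (.le 1 M[v#15]) (15 ≔ M[(v#15 + 2) + v#12])) σ (6 * h + 2)
      fun σ' => ∃ L e, towards d t = L ++ [e] ∧ σ'.var 15 = e.1 := by
  induction h generalizing t q σ with
  | zero =>
    cases t with
    | leaf p a =>
      refine .loop_done ?_ (by simp [Test.cost, Expr.cost]) ⟨[], (p, a), towards_leaf _ _ _, h15⟩
      simp [h15, addr, hrep.1]
    | node => simp [height] at hh
  | succ k ih =>
    by_cases h0 : t.height = 0
    · cases t with
      | leaf p a =>
        refine .loop_done ?_ (by simp [Test.cost, Expr.cost]) ⟨[], (p, a), towards_leaf _ _ _, h15⟩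
        simp [h15, addr, hrep.1]
      | node => simp [height] at h0
    · obtain ⟨p, a, b, rfl⟩ := exists_eq_mk d t h0
      rw [rep_mk] at hrep
      rw [addr_mk] at h15
      rw [height_mk] at hh
      refine .loop_step (t₁ := 4) (t₂ := 6 * k + 2) (by simp [h15, hrep.1])
        (Runs.eval (by simp) (by decide) ?_) (by simp [Test.cost, Expr.cost]; omega)
      refine (ih a p _ (by omega) ?_ ?_ ?_).imp ?_
      · simp [h15, h12, hrep.2.2.1]
      · simp [h12]
      · simpa using hrep.2.2.2.2.2.2.1
      · rintro σ' ⟨L, e, h1, h2⟩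
        exact ⟨towards d b ++ L, e, by rw [towards_mk, if_pos rfl, h1, List.append_assoc], h2⟩

/-- The link from the last leaf of a subtree in the given direction. -/
theorem link_of_towards {m : ℕ → ℕ} (d : Bool) {t : PTree} {c : List Frame} {L : List (ℕ × ℕ)}
    {e : ℕ × ℕ} (h : towards d t = L ++ [e])
    (hl : LinkSeg m 0 0 ((plug t c).leafEntries.map Prod.fst)) :
    m (e.1 + 2 + sideCode d) = ((ahead d c).map Prod.fst).headD 0 := by
  rw [leafEntries_plug] at hl
  cases d
  · simp only [towards, Bool.false_eq_true, if_false] at h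
    rw [h] at hl
    simp only [List.map_append, List.map_cons, List.map_nil, List.append_assoc,
      List.cons_append, List.nil_append] at hl
    rw [← List.append_assoc] at hl
    obtain ⟨-, -, h1, -⟩ := (linkSeg_append _ _ _ _ _).1 hl
    simpa [sideCode, ahead] using h1
  · have h' : t.leafEntries = e :: L.reverse := by
      rw [← List.reverse_reverse t.leafEntries]
      simp only [towards, if_true] at h
      rw [h]; simp
    rw [h'] at hl
    simp only [List.map_append, List.map_cons, List.append_assoc,
      List.cons_append] at hl
    obtain ⟨-, h1, -⟩ := (linkSeg_append _ _ _ _ _).1 hl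
    simp only [sideCode, if_true, ahead, add_zero, h1]
    rcases List.eq_nil_or_concat (ctxBefore c) with hA | ⟨A, a, hA⟩ <;> simp [hA]

/-- The leaf can be skipped in a search in the given direction. -/
def Skips (fl : ℕ → Prop) (d : Bool) (e : ℕ × ℕ) : Prop := fl e.2 ↔ d = true

def fingerStep (cmp : Cmd) : Cmd := climb ;; walk ;; hop cmp

theorem fingerStep_runs {inp : Input} {cmp : Cmd} {n x : ℕ} {fl : ℕ → Prop}
    (hcmp : Compares inp cmp n x fl) {σ : Store} {P f p b B : ℕ} {d : Bool} {c : List Frame}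
    (h0 : σ.var 0 = n) (h7 : σ.var 7 = x) (h11 : σ.var 11 = p) (h12 : σ.var 12 = sideCode d)
    (h13 : σ.var 13 = B) (hT : TreeIn σ.mem P n f (plug (leaf p b) c)) :
    Runs inp (fingerStep cmp) σ (24 * B + 70) fun σ' =>
      σ'.var 10 = (plug (leaf p b) (c.take B)).addr ∧
      (((∀ e ∈ (ahead d (c.drop B)).head?, ¬ Skips fl d e) ∧ σ'.var 20 = 0) ∨
        ∃ e l, ahead d (c.drop B) = e :: l ∧ Skips fl d e ∧ σ'.var 20 = σ.var 20 ∧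
          σ'.var 11 = e.1 ∧ σ'.var 13 = B + B) ∧
      (∀ v, v < 8 ∨ v = 12 ∨ 20 < v → σ'.var v = σ.var v) ∧ σ'.mem = σ.mem := by
  classical
  have hposT := fun q hq => (hT.bounds q hq).1
  have hpos : ∀ q ∈ ctxAddrs c, 0 < q := fun q hq =>
    hposT q ((addrs_plug_perm _ _).mem_iff.2 (by simp [hq]))
  set D := plug (leaf p b) (c.take B) with hD
  have hTD : plug (leaf p b) c = plug D (c.drop B) := by
    rw [hD, ← plug_append, List.take_append_drop]
  have hDh : D.height ≤ 2 * B := by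
    have h1 : CtxAVL (leaf p b).height (c.take B ++ c.drop B) := by
      rw [List.take_append_drop]
      exact ((isAVL_plug _ _).1 hT.avl).2
    have := height_plug_le _ _ _ h1
    rw [← hD] at this
    simp only [height, List.length_take] at this
    omega
  -- climbing
  have hclimb : Runs inp climb σ (12 * B + 3) fun σ' => σ'.var 10 = D.addr := by
    refine Runs.seq' (t₁ := 1) (t₂ := 12 * B + 2) (Runs.eval (by simp) (by decide) ?_) (by omega)
    refine Runs.seq' (t₁ := 1) (t₂ := 12 * B + 1) (Runs.eval (by simp) (by decide) ?_) (by omega)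
    exact climb_loop_runs B (leaf p b) c _ (by simp [h11, addr]) (by simp [h13])
      (by simpa using hT.rep) hpos
  obtain ⟨σ₁, t₁, hx₁, ht₁, ⟨a1, a2, a3⟩⟩ := hclimb.frame_mem (by simp [climb, Cmd.ReadOnly])
  have hrepD : D.Rep σ.mem (ctxParent (c.drop B)) := by
    have := hT.rep
    rw [hTD, rep_plug] at this
    exact this.1
  -- walking
  have hwalk : Runs inp walk σ₁ (12 * B + 3) fun σ' =>
      ∃ L e, towards d D = L ++ [e] ∧ σ'.var 15 = e.1 := by
    refine Runs.seq' (t₁ := 1) (t₂ := 6 * (2 * B) + 2) (Runs.eval (by simp) (by decide) ?_)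
      (by omega)
    exact walk_loop_runs d (2 * B) D _ _ hDh (by simp [a1])
      (by simp [a2 12 (by decide), h12]) (by simpa [a3] using hrepD)
  obtain ⟨σ₂, t₂, hx₂, ht₂, ⟨⟨L, e₀, b0, b1⟩, b2, b3⟩⟩ :=
    hwalk.frame_mem (by simp [walk, Cmd.ReadOnly])
  have hv : ∀ v, v ∉ climb.assigned → v ∉ walk.assigned → σ₂.var v = σ.var v := fun v h h' =>
    (b2 v h').trans (a2 v h)
  have hlink : σ.mem (e₀.1 + 2 + sideCode d) = ((ahead d (c.drop B)).map Prod.fst).headD 0 := by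
    have := hT.links
    rw [hTD] at this
    exact link_of_towards d b0 this
  have h15e : (M[(v#15 + 2) + v#12] : Expr).eval σ₂ = ((ahead d (c.drop B)).map Prod.fst).headD 0 := by
    simp [b1, hv 12 (by decide) (by decide), h12, b3, a3, hlink]
  have hassign := Exec.assign (inp := inp) 15 M[(v#15 + 2) + v#12] σ₂
  rw [h15e] at hassign
  have hvar : ∀ v, v < 8 ∨ v = 12 ∨ 20 < v → σ₂.var v = σ.var v := by
    intro v hv'
    refine hv v ?_ ?_ <;> simp [climb, walk, Cmd.assigned] <;> omega
  suffices H : Runs inp (.ite (.le v#15 0) (20 ≔ 0)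
      (loadCompare v#15 cmp ;; .ite (.eq v#9 v#12) (20 ≔ 0) (11 ≔ v#15 ;; 13 ≔ v#13 + v#13)))
      ⟨Function.update σ₂.var 15 (((ahead d (c.drop B)).map Prod.fst).headD 0), σ₂.mem⟩ 60
      fun σ' => σ'.var 10 = D.addr ∧
      (((∀ e ∈ (ahead d (c.drop B)).head?, ¬ Skips fl d e) ∧ σ'.var 20 = 0) ∨
        ∃ e l, ahead d (c.drop B) = e :: l ∧ Skips fl d e ∧ σ'.var 20 = σ.var 20 ∧
          σ'.var 11 = e.1 ∧ σ'.var 13 = B + B) ∧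
      (∀ v, v < 8 ∨ v = 12 ∨ 20 < v → σ'.var v = σ.var v) ∧ σ'.mem = σ.mem by
    obtain ⟨σ₄, t₄, hx₄, ht₄, H⟩ := H
    exact ⟨σ₄, _, .seq hx₁ (.seq hx₂ (.seq hassign hx₄)), by simp [Expr.cost]; omega, H⟩
  rcases hah : ahead d (c.drop B) with _ | ⟨e, l⟩
  · refine Runs.ite_true (t₁ := 1) (by simp) (Runs.eval (by simp) (by decide) ?_)
      (by simp [Test.cost, Expr.cost])
    refine ⟨?_, .inl ⟨by simp, by simp⟩, fun v hv' => ?_, by simp [b3, a3]⟩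
    · simp [b2 10 (by decide), a1]
    · simp [show v ≠ 20 by omega, show v ≠ 15 by omega, hvar v hv']
  · have heT : e ∈ (plug (leaf p b) c).leafEntries := by
      have h1 : e ∈ towards d (plug (leaf p b) c) := by
        rw [hTD, towards_plug, hah]; simp
      cases d
      · simpa [towards] using h1
      · simpa [towards] using h1
    have he0 := (hposT e.1 (fst_mem_addrs heT)).ne'
    have heb := (stored_of_mem_leafEntries hT.rep heT).2
    set σ₃ : Store := ⟨Function.update σ₂.var 15 (((e :: l).map Prod.fst).headD 0), σ₂.mem⟩
      with hσ₃
    obtain ⟨σ₄, t₄, hx₄, ht₄, hs₄⟩ := loadCompare_runs hcmp σ₃ v#15 (by simp [Expr.cost])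
      (by simp [hσ₃, hv 0 (by decide) (by decide), h0])
      (by simp [hσ₃, hv 7 (by decide) (by decide), h7])
    have h8 : σ₃.mem ((v#15).eval σ₃ + 1) = e.2 := by simp [hσ₃, b3, a3, heb]
    rw [h8] at hs₄
    refine Runs.ite_false (t₁ := 50) (by simp [hσ₃, he0]) ?_ (by simp [Test.cost, Expr.cost])
    refine Runs.seq' (t₁ := 33) (t₂ := 17) ⟨σ₄, t₄, hx₄, ht₄, ?_⟩ (by omega)
    refine Runs.eval (by simp) (by decide) ?_
    have h20 := hv 20 (by decide) (by decide)
    have h12' := hv 12 (by decide) (by decide)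
    have h13' := hv 13 (by decide) (by decide)
    have h10' := b2 10 (by decide)
    rw [h12] at h12'
    rw [h13] at h13'
    rw [a1] at h10'
    have hx12 : (if fl e.2 then 1 else 0) = sideCode d ↔ ¬ Skips fl d e := by
      unfold Skips
      cases d <;> by_cases hfl : fl e.2 <;> simp [sideCode, hfl]
    by_cases hsk : Skips fl d e
    · have hx : (if fl e.2 then 1 else 0) ≠ sideCode d := fun h => hx12.1 h hsk
      subst hs₄
      refine ⟨?_, .inr ⟨e, l, rfl, hsk, ?_, ?_, ?_⟩, fun v hv' => ?_, ?_⟩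
      on_goal 5 => rw [← hvar v hv']
      on_goal 5 => have hv'' : v ≠ 8 ∧ v ≠ 9 ∧ v ≠ 11 ∧ v ≠ 13 ∧ v ≠ 15 := by omega
      on_goal 5 => simp [hσ₃, h12', h13', h10', h20, hx, hv'']
      all_goals simp [hσ₃, h12', h13', h10', h20, hx, b3, a3]
    · have hx := hx12.2 hsk
      subst hs₄
      refine ⟨?_, .inl ⟨by simpa using hsk, ?_⟩, fun v hv' => ?_, ?_⟩
      on_goal 3 => rw [← hvar v hv']
      on_goal 3 => have hv'' : v ≠ 8 ∧ v ≠ 9 ∧ v ≠ 20 ∧ v ≠ 15 := by omega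
      on_goal 3 => simp [hσ₃, h12', h13', h10', h20, hx, hv'']
      all_goals simp [hσ₃, h12', h13', h10', h20, hx, b3, a3]

end PTree

/-! ### The cost of the finger search -/

namespace PTree

/-- By `hbeh` the finger is the first leaf, in the direction of the search, of the subtree with path
`cl`. If the climb stays inside this subtree, all leaves below its end are at or ahead of the finger
and that end has height at least `B`. If the climb leaves it, the whole subtree is passed, whose
height is at least about `B / 2`. In both cases exponentially many leaves are passed. -/
theorem two_pow_le_length_skipped (d : Bool) {p b B : ℕ} (cl cR : List Frame)
    (havl : (plug (leaf p b) (cl ++ cR)).IsAVL) (hbeh : behind d cl = [])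
    (hB : B ≤ 2 * ((plug (leaf p b) cl).height + 1)) :
    2 ^ ((B / 2 - 1) / 2) ≤ ((p, b) :: ahead d ((cl ++ cR).take B)).length := by
  rcases le_total B cl.length with h | h
  · have h1 : (cl ++ cR).take B = cl.take B := List.take_append_of_le_length h
    have h2 : behind d (cl.take B) = [] := by
      have : behind d (cl.take B ++ cl.drop B) = [] := by rwa [List.take_append_drop]
      rw [behind_append, List.append_eq_nil_iff] at this
      exact this.2
    have h3 : ((p, b) :: ahead d (cl.take B)).length =
        (plug (leaf p b) (cl.take B)).leafEntries.length := by
      rw [← length_towards d, towards_plug, h2, towards_leaf]; rfl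
    have h4 : (plug (leaf p b) (cl.take B)).IsAVL := by
      have : plug (leaf p b) (cl ++ cR) =
          plug (plug (leaf p b) (cl.take B)) (cl.drop B ++ cR) := by
        rw [← plug_append, ← List.append_assoc, List.take_append_drop]
      rw [this, isAVL_plug] at havl
      exact havl.1
    have h5 := add_length_le_height_plug (leaf p b) (cl.take B)
    simp only [List.length_take] at h5
    rw [h1, h3]
    exact (Nat.pow_le_pow_right (by omega) (by omega)).trans (two_pow_half_height_le _ h4)
  · have h1 : (cl ++ cR).take B = cl ++ cR.take (B - cl.length) := by
      rw [List.take_append, List.take_of_length_le h]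
    have h3 : ((p, b) :: ahead d cl).length = (plug (leaf p b) cl).leafEntries.length := by
      rw [← length_towards d, towards_plug, hbeh, towards_leaf]; rfl
    have h4 : (plug (leaf p b) cl).IsAVL := by
      rw [plug_append, isAVL_plug] at havl
      exact havl.1
    rw [h1, ahead_append, ← List.cons_append, List.length_append, h3]
    refine le_trans ?_ (Nat.le_add_right _ _)
    exact (Nat.pow_le_pow_right (by omega) (by omega)).trans (two_pow_half_height_le _ h4)

/-- The finger is kept as the first leaf of a subtree of height at least about `B / 2`, and fewer
than `2 ^ β` leaves can be skipped, so `B` stays linear in `β`. The time bound falls by `96 * B`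
when `B` doubles to `2 * B`, which pays for the step; this is the geometric sum in closed form. -/
theorem finger_loop_runs {inp : Input} {cmp : Cmd} {n x : ℕ} {fl : ℕ → Prop}
    (hcmp : Compares inp cmp n x fl) {P f β : ℕ} {d : Bool} (T : PTree)
    (hmono : (towards d T).Pairwise fun a b => Skips fl d b → Skips fl d a) (k : ℕ)
    (cl cR : List Frame) (p b B : ℕ) (σ : Store)
    (h0 : σ.var 0 = n) (h7 : σ.var 7 = x) (h11 : σ.var 11 = p) (h12 : σ.var 12 = sideCode d)
    (h13 : σ.var 13 = B) (h20 : σ.var 20 = 1) (hT : TreeIn σ.mem P n f T)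
    (hTc : T = plug (leaf p b) (cl ++ cR)) (hbeh : behind d cl = [])
    (hB : B ≤ 2 * ((plug (leaf p b) cl).height + 1)) (hB1 : 1 ≤ B) (hBβ : B ≤ 2 * (4 * β + 1))
    (hk : 4 * (4 * β + 1) - B ≤ k) (hp : Skips fl d (p, b))
    (hcount : ∀ l : List (ℕ × ℕ), l.Sublist ((p, b) :: ahead d (cl ++ cR)) → (∀ e ∈ l, Skips fl d e) →
      l.length < 2 ^ β) :
    Runs inp (.loop (.le 1 v#20) (fingerStep cmp)) σ (96 * (4 * (4 * β + 1) - B) + 1) fun σ' =>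
      ∃ D c', T = plug D c' ∧ σ'.var 10 = D.addr ∧ D.height ≤ 4 * (4 * β + 1) ∧
        (∀ e ∈ (ahead d c').head?, ¬ Skips fl d e) ∧ (∃ e ∈ D.leafEntries, Skips fl d e) ∧
        (∀ v, v < 8 ∨ v = 12 ∨ 20 < v → σ'.var v = σ.var v) ∧ σ'.mem = σ.mem := by
  induction k generalizing cl cR p b B σ with
  | zero => omega
  | succ k ih =>
    subst hTc
    set c := cl ++ cR with hc
    obtain ⟨σ₁, t₁, hx₁, ht₁, a1, a2, hvar, hmem⟩ := fingerStep_runs hcmp h0 h7 h11 h12 h13 hT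
    have hTD : plug (leaf p b) c = plug (plug (leaf p b) (c.take B)) (c.drop B) := by
      rw [← plug_append, List.take_append_drop]
    set D := plug (leaf p b) (c.take B) with hD
    have hDh : D.height ≤ 2 * B := by
      have h1 : CtxAVL (leaf p b).height (c.take B ++ c.drop B) := by
        rw [List.take_append_drop]
        exact ((isAVL_plug _ _).1 hT.avl).2
      have := height_plug_le _ _ _ h1
      rw [← hD] at this
      simp only [height, List.length_take] at this
      omega
    rcases a2 with ⟨a2, a3⟩ | ⟨e, l, a2, a3, a4, a5, a6⟩
    · refine .loop_step (t₁ := 24 * B + 70) (t₂ := 1) (by simp [h20]) ⟨σ₁, t₁, hx₁, ht₁,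
        .loop_done (by simp [a3]) (by simp [Test.cost, Expr.cost])
          ⟨D, c.drop B, hTD, a1, by omega, a2, ⟨(p, b), ?_, hp⟩, hvar, hmem⟩⟩
          (by simp [Test.cost, Expr.cost]; omega)
      rw [hD, leafEntries_plug]
      simp [leafEntries]
    · have hcd : ahead d c = ahead d (c.take B) ++ e :: l := by
        rw [← a2, ← ahead_append, List.take_append_drop]
      rw [towards_plug, towards_leaf, hcd] at hmono
      have hskip : ∀ e' ∈ (p, b) :: ahead d (c.take B), Skips fl d e' := by
        intro e' he'
        rw [List.append_assoc, List.pairwise_append] at hmono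
        have h1 := hmono.2.1
        rw [← List.append_assoc, List.pairwise_append] at h1
        exact h1.2.2 e' (by simpa using he') e (by simp) a3
      have hlen := hcount ((p, b) :: ahead d (c.take B))
        (by rw [hcd]; exact List.Sublist.cons_cons _ (List.sublist_append_left _ _)) hskip
      have hlen' := two_pow_le_length_skipped d cl cR hT.avl hbeh hB
      -- Exponentially many leaves have been passed, all of them skippable by monotonicity, against
      -- the bound `2 ^ β`; hence `B ≤ 4 * β + 1`.
      have hβ := (Nat.pow_lt_pow_iff_right (by omega : 1 < 2)).1 (hlen'.trans_lt hlen)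
      have hBN : B ≤ 4 * β + 1 := by omega
      have hdrop : c.drop B ≠ [] := by
        intro h
        rw [h] at a2
        cases d <;> simp [ahead, ctxAfter, ctxBefore] at a2
      have hBc : B < c.length := by
        by_contra h
        exact hdrop (List.drop_of_length_le (by omega))
      have hDB : B ≤ D.height := by
        have := add_length_le_height_plug (leaf p b) (c.take B)
        rw [← hD] at this
        simp only [List.length_take] at this
        omega
      have havl := hT.avl
      rw [hTD, isAVL_plug] at havl
      -- The next leaf starts a subtree whose height is at least that of `D` minus one, hence at
      -- least `B - 1`. This restores the invariant for the doubled value.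
      obtain ⟨cl', cR', g1, g2, g3, g4⟩ := exists_sibling d D (c.drop B) a2 havl.2
      refine .loop_step (t₁ := 24 * B + 70) (t₂ := 96 * (4 * (4 * β + 1) - (B + B)) + 1)
        (by simp [h20]) ⟨σ₁, t₁, hx₁, ht₁, ?_⟩ ?_
      · refine Runs.imp (ih cl' cR' e.1 e.2 (B + B) σ₁ (by rw [hvar 0 (by omega), h0])
          (by rw [hvar 7 (by omega), h7]) a5 (by rw [hvar 12 (by omega), h12]) a6 (by rw [a4, h20])
          (by rw [hmem]; exact hT) (hTD.trans g1) g2 (by omega) (by omega) (by omega) (by omega) a3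
          ?_) ?_
        · intro l' hl' hs
          refine hcount l' (hl'.trans ?_) hs
          rw [g4, hcd]
          exact (List.sublist_append_right _ _).cons _
        · rintro σ' ⟨D', c', e1, e2, e3, e4, e5, e6, e7⟩
          exact ⟨D', c', e1, e2, e3, e4, e5, fun v hv => (e6 v hv).trans (hvar v hv),
            e7.trans hmem⟩
      · simp [Test.cost, Expr.cost]; omega

/-- Finds the place of the label in variable `7`, starting from the leaf at the address in
variable `11`, and inserts it. -/
def fingerInsert (cmp : Cmd) : Cmd :=
  loadCompare v#11 cmp ;; 12 ≔ 1 - v#9 ;; 13 ≔ 1 ;; 20 ≔ 1 ;;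
  .loop (.le 1 v#20) (fingerStep cmp) ;; descend cmp ;; insertLabel cmp

/-- On the side of the search the first leaf beyond the subtree cannot be skipped, and some leaf in
the subtree can be; monotonicity extends both facts outwards. The insertion place is therefore at
the subtree. -/
theorem flags_of_skips {fl : ℕ → Prop} {d : Bool} {D : PTree} {c : List Frame}
    (hmono : ((plug D c).leafEntries).Pairwise fun a b => fl a.2 → fl b.2)
    (hah : ∀ e ∈ (ahead d c).head?, ¬ Skips fl d e) (hD : ∃ e ∈ D.leafEntries, Skips fl d e) :
    (∀ e ∈ ctxBefore c, ¬ fl e.2) ∧ ∀ e ∈ ctxAfter c, fl e.2 := by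
  rw [leafEntries_plug, List.pairwise_append, List.pairwise_append] at hmono
  obtain ⟨⟨m1, m2, m3⟩, m4, m5⟩ := hmono
  obtain ⟨e₀, he₀, hs₀⟩ := hD
  cases d
  · simp only [Skips, Bool.false_eq_true, iff_false, not_not] at hs₀ hah
    refine ⟨fun e he hfl => hs₀ (m3 e he e₀ he₀ hfl), fun e he => ?_⟩
    simp only [ahead, Bool.false_eq_true, if_false] at hah
    rcases hc : ctxAfter c with _ | ⟨e₁, l⟩
    · rw [hc] at he; simp at he
    · rw [hc] at hah he m4
      have h1 := hah e₁ (by simp)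
      rcases List.mem_cons.1 he with rfl | he
      · exact h1
      · exact (List.pairwise_cons.1 m4).1 e he h1
  · simp only [Skips, iff_true] at hs₀ hah
    refine ⟨fun e he => ?_, fun e he => m5 e₀ (List.mem_append_right _ he₀) e he hs₀⟩
    simp only [ahead, if_true] at hah
    rcases List.eq_nil_or_concat (ctxBefore c) with hc | ⟨l, e₁, hc⟩
    · rw [hc] at he; simp at he
    · rw [List.concat_eq_append] at hc
      rw [hc] at hah he m1
      have h1 := hah e₁ (by simp)
      rcases List.mem_append.1 he with he | he
      · exact fun hfl => h1 ((List.pairwise_append.1 m1).2.2 e he e₁ (by simp) hfl)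
      · rw [List.mem_singleton.1 he]; exact h1

/-- Only leaves between the finger and the place of the new label count as distance. The two
hypotheses on sublists express this for both directions, and the first comparison decides which of
them is used. -/
theorem fingerInsert_runs {inp : Input} {cmp : Cmd} {n x : ℕ} {fl : ℕ → Prop}
    (hcmp : Compares inp cmp n x fl) {σ : Store} {T : PTree} {A B : List (ℕ × ℕ)} {P f p b β : ℕ}
    (h0 : σ.var 0 = n) (h2 : σ.var 2 = P) (h6 : σ.var 6 = f) (h7 : σ.var 7 = x)
    (h11 : σ.var 11 = p) (hT : TreeIn σ.mem P n f T) (hx : x ∉ T.leafEntries.map Prod.snd)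
    (hmono : (T.leafEntries).Pairwise fun a b => fl a.2 → fl b.2)
    (hAB : T.leafEntries = A ++ (p, b) :: B)
    (hr : ∀ l : List (ℕ × ℕ), l.Sublist ((p, b) :: B) → (∀ e ∈ l, ¬ fl e.2) → l.length < 2 ^ β)
    (hl : ∀ l : List (ℕ × ℕ), l.Sublist (A ++ [(p, b)]) → (∀ e ∈ l, fl e.2) → l.length < 2 ^ β) :
    ∃ T' k, k + T'.potential ≤ T.potential + 5 ∧
      Runs inp (fingerInsert cmp) σ (152 * k + 3000 * (β + 1)) fun σ' =>
        Inserted σ σ' P n f x fl T T' := by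
  classical
  obtain ⟨c, hc, hcA, hcB⟩ := exists_plug hAB
  simp only at hc
  obtain ⟨σ₁, t₁, hx₁, ht₁, hs₁⟩ := loadCompare_runs hcmp σ v#11 (by simp [Expr.cost]) h0 h7
  have hb := stored_of_mem_leafEntries (e := (p, b)) hT.rep (by rw [hAB]; simp)
  have h8 : σ.mem ((v#11).eval σ + 1) = b := by simp [h11, hb.2]
  rw [h8] at hs₁
  let d : Bool := decide (fl b)
  have hd : 1 - (if fl b then 1 else 0) = sideCode d := by
    simp only [d, sideCode]
    split_ifs <;> simp_all
  have hskip : Skips fl d (p, b) := by simp [Skips, d]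
  -- the search
  obtain ⟨σ₂, t₂, hx₂, ht₂, hv12, hv13, hv20, hv, hm₂⟩ :
      Runs inp (12 ≔ 1 - v#9 ;; 13 ≔ 1 ;; 20 ≔ 1) σ₁ 10 fun σ' => σ'.var 12 = sideCode d ∧
        σ'.var 13 = 1 ∧ σ'.var 20 = 1 ∧
        (∀ v, v < 8 ∨ v = 11 ∨ 20 < v → σ'.var v = σ.var v) ∧ σ'.mem = σ.mem := by
    refine Runs.eval (by simp) (by decide) ?_
    subst hs₁
    simp [hd]
    intro v hv
    simp [show v ≠ 20 by omega, show v ≠ 13 by omega, show v ≠ 12 by omega, show v ≠ 9 by omega,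
      show v ≠ 8 by omega]
  have hmono' : (towards d T).Pairwise fun a b => Skips fl d b → Skips fl d a := by
    have hgen : ∀ d, (towards d T).Pairwise fun a b => Skips fl d b → Skips fl d a := by
      intro d
      cases d
      · simp only [towards, Bool.false_eq_true, if_false, Skips, iff_false]
        exact hmono.imp fun h hb ha => hb (h ha)
      · simp only [towards, if_true, Skips, iff_true]
        exact List.pairwise_reverse.2 hmono
    exact hgen d
  have hcount : ∀ l : List (ℕ × ℕ), l.Sublist ((p, b) :: ahead d ([] ++ c)) →
      (∀ e ∈ l, Skips fl d e) → l.length < 2 ^ β := by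
    rw [List.nil_append]
    intro l hl1 hl2
    rcases hdv : d with _ | _
    · rw [hdv] at hl1 hl2
      simp only [ahead, Bool.false_eq_true, if_false, hcB] at hl1
      exact hr l hl1 fun e he => by simpa [Skips] using hl2 e he
    · rw [hdv] at hl1 hl2
      simp only [ahead, if_true, hcA] at hl1
      have h1 := List.reverse_sublist.2 hl1
      simp only [List.reverse_cons, List.reverse_reverse] at h1
      have := hl l.reverse h1 fun e he => by simpa [Skips] using hl2 e (List.mem_reverse.1 he)
      simpa using this
  obtain ⟨σ₃, t₃, hx₃, ht₃, D, c', e1, e2, e3, e4, e5, e6, e7⟩ :=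
    finger_loop_runs hcmp (P := P) (f := f) (β := β) T hmono' (4 * (4 * β + 1)) [] c p b 1 σ₂
      (by rw [hv 0 (by omega), h0]) (by rw [hv 7 (by omega), h7]) (by rw [hv 11 (by omega), h11])
      hv12 hv13 hv20 (by rw [hm₂]; exact hT) hc
      (by cases d <;> simp [behind, ctxAfter, ctxBefore]) (by simp [plug, height]) le_rfl (by omega)
      (by omega) hskip hcount
  obtain ⟨hbef, haft⟩ := flags_of_skips (d := d) (by rw [← e1]; exact hmono) e4 e5
  have hv' : ∀ v, v < 8 → σ₃.var v = σ.var v := fun v h =>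
    (e6 v (.inl h)).trans (hv v (.inl h))
  have hm₃ : σ₃.mem = σ.mem := e7.trans hm₂
  have hrepD : D.Rep σ₃.mem (ctxParent c') := by
    have := hT.rep
    rw [e1, rep_plug] at this
    rw [hm₃]
    exact this.1
  have hmonoD : (D.leafEntries.map Prod.snd).Pairwise fun a b => fl a → fl b := by
    rw [e1, leafEntries_plug, List.pairwise_append, List.pairwise_append] at hmono
    exact List.pairwise_map.2 hmono.1.2.1
  obtain ⟨σ₄, t₄, hx₄, ht₄, g1, g2, A', p', b', B', g3, g4, g5, g6⟩ :=
    descend_runs hcmp D _ σ₃ (by rw [hv' 0 (by omega), h0]) (by rw [hv' 7 (by omega), h7]) e2 hrepD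
      hmonoD
  have hv4 : ∀ v, v < 8 → σ₄.var v = σ.var v := fun v h =>
    (g2 v (by omega) (by omega) (by omega)).trans (hv' v h)
  have hm₄ : σ₄.mem = σ.mem := g1.trans hm₃
  obtain ⟨T', k, hk, σ₅, t₅, hx₅, ht₅, hins⟩ := insertLabel_runs hcmp (σ := σ₄) (T := T)
    (A := ctxBefore c' ++ A') (B := B' ++ ctxAfter c') (P := P) (f := f) (p := p') (b := b')
    (by rw [hv4 0 (by omega), h0]) (by rw [hv4 2 (by omega), h2]) (by rw [hv4 6 (by omega), h6])
    (by rw [hv4 7 (by omega), h7]) g4 (by rw [hm₄]; exact hT) hx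
    (by rw [e1, leafEntries_plug, g3]; simp)
    (fun e he => (List.mem_append.1 he).elim (hbef e) (g5 e))
    (fun e he => (List.mem_append.1 he).elim (g6 e) (haft e))
  refine ⟨T', k, hk, σ₅, t₁ + (t₂ + (t₃ + (t₄ + t₅))), ?_, ?_, ?_⟩
  · refine .seq hx₁ ?_
    cases hx₂ with
    | seq h1 h2 =>
      cases h2 with
      | seq h2 h3 =>
        have := Exec.seq h1 (.seq h2 (.seq h3 (.seq hx₃ (.seq hx₄ hx₅))))
        convert this using 1
        omega
  · have : 45 * D.height ≤ 45 * (4 * (4 * β + 1)) := Nat.mul_le_mul_left _ e3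
    omega
  · exact ⟨hins.treeIn, hins.top, hins.addr, hins.labels, hins.addrs, fun z h1 h2 h3 =>
      (hins.frame z h1 h2 h3).trans (by rw [hm₄])⟩

end PTree

/-! ### Distances in the sorted order -/

section Distance

variable {κ : IntervalKind} {n : ℕ} {R : IntervalSet κ n} {π : Equiv.Perm (Fin n)}

theorem IsBottom.not_nonempty_inter {b c : Fin n} (hb : IsBottom R π b) (h : π c < π b) :
    ¬ (R.region c ∩ R.region b).Nonempty := by
  intro hne
  have : c ∈ contactSet R π b := mem_contactSet.2 ⟨h.le, hne⟩
  rw [hb, Finset.mem_singleton] at this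
  exact h.ne (by rw [this])

theorem IsBottom.level_eq_one (hπ : IsLevelPermutation R π) {b : Fin n} (hb : IsBottom R π b) :
    level R b = 1 := by
  rw [level_eq_one_iff]
  intro c hc
  refine hb.not_nonempty_inter (hπ.lt_of_ssubset hc) ?_
  rw [Set.inter_eq_left.2 hc.subset]
  exact R.nonempty c

theorem IntervalSet.mem_region_of_between {i : Fin n} {y z w : ℝ} (hy : y ∈ R.region i)
    (hz : z ∈ R.region i) (h1 : y ≤ w) (h2 : w ≤ z) : w ∈ R.region i :=
  (R.ordConnected_region i).out hy hz ⟨h1, h2⟩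

/-- A point of an interval that does not lie below another interval, and lies below one of its
points, lies in it. -/
theorem IntervalSet.mem_region_of_left_le {i j : Fin n} {y z : ℝ} (hy : y ∈ R.region j)
    (h : R.left i ≤ R.left j) (hz : z ∈ R.region i) (hyz : y ≤ z) : y ∈ R.region i := by
  cases κ
  · exact ⟨h.trans_lt hy.1, hyz.trans_lt hz.2⟩
  · exact ⟨h.trans hy.1, hyz.trans hz.2⟩

theorem IntervalSet.mem_region_of_right_le {i j : Fin n} {y z : ℝ} (hy : y ∈ R.region j)
    (h : R.right j ≤ R.right i) (hz : z ∈ R.region i) (hyz : z ≤ y) : y ∈ R.region i := by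
  cases κ
  · exact ⟨hz.1.trans_le hyz, hy.2.trans_le h⟩
  · exact ⟨hz.1.trans hyz, hy.2.trans h⟩

theorem IsAnchor.lt (hπ : IsLevelPermutation R π) {i a : Fin n} (ha : IsAnchor R π i a) :
    π a < π i := by
  by_cases h : level R i = 1
  · have := ha.1 h
    exact Fin.lt_def.2 (by omega)
  · exact hπ.lt_of_ssubset (ha.2 h)

theorem le_of_lt_of_isAnchor {i a b : Fin n} (ha : IsAnchor R π i a) (h : level R i = 1)
    (hb : π b < π i) : π b ≤ π a := by
  have := ha.1 h
  have := Fin.lt_def.1 hb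
  exact Fin.le_def.2 (by omega)

/-- The intervals whose points lie between the points of an interval and its anchor. -/
theorem mem_contactSet_of_between (hπ : IsLevelPermutation R π) {x : Fin n → ℝ}
    (hx : R.Realizes x) {i a b : Fin n} (hi : ¬ IsBottom R π i) (ha : IsAnchor R π i a)
    (hb : π b < π i ∨ IsBottom R π b)
    (hbet : x a ≤ x b ∧ x b ≤ x i ∨ x i < x b ∧ x b ≤ x a) :
    b ∈ contactSet R π (if level R i = 1 then a else i) := by
  have hai := ha.lt hπ
  have hbi : b ≠ i → π b ≠ π i := fun h h' => h (π.injective h')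
  by_cases hl : level R i = 1
  -- In level one the anchor is the predecessor of `i`: it reaches further to the right, and no
  -- interval before it in `π` starts further to the left. Hence the points in question lie in the
  -- interval of the anchor.
  · rw [if_pos hl]
    have hla : level R a = 1 := by
      have h1 := one_le_level R a
      rcases (hπ.lt_iff a i).1 hai with h | h <;> omega
    have hra : R.right i < R.right a := by
      rcases (hπ.lt_iff a i).1 hai with h | h
      · omega
      · exact h.2
    have hlevel : ∀ c, π c ≤ π a → R.left a ≤ R.left c := by
      intro c hc
      rcases hc.lt_or_eq with hc | hc
      · have h1 := one_le_level R c
        rcases (hπ.lt_iff c a).1 hc with h | h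
        · omega
        · exact (left_lt_of_level_eq R h.1.symm h.2).le
      · rw [π.injective hc]
    have key : x b ∈ R.region a → b ∈ contactSet R π a := by
      intro hmem
      rcases hb with hb | hb
      · exact mem_contactSet.2 ⟨le_of_lt_of_isAnchor ha hl hb, x b, hx b, hmem⟩
      · by_cases hba : π b ≤ π a
        · exact mem_contactSet.2 ⟨hba, x b, hx b, hmem⟩
        · exact absurd ⟨x b, hmem, hx b⟩ (hb.not_nonempty_inter (not_le.1 hba))
    apply key
    rcases hbet with ⟨h1, h2⟩ | ⟨h1, h2⟩
    · have : x i ∈ R.region a := IntervalSet.mem_region_of_right_le (hx i) hra.le (hx a) (h1.trans h2)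
      exact IntervalSet.mem_region_of_between (hx a) this h1 h2
    · by_cases hbi' : π b < π i
      · exact IntervalSet.mem_region_of_left_le (hx b)
          (hlevel b (le_of_lt_of_isAnchor ha hl hbi')) (hx a) h2
      -- A bottom interval after `i` in `π` ends to the left of `i`. Its point, being larger than
      -- that of `i`, would lie in the interval of `i`, although a bottom interval meets no interval
      -- before it.
      · have hbot := hb.resolve_left hbi'
        have hne : b ≠ i := fun h => hi (h ▸ hbot)
        have hlt : π i < π b := lt_of_le_of_ne (not_lt.1 hbi') (hbi hne).symm
        have hr : R.right b < R.right i := by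
          have := hbot.level_eq_one hπ
          rcases (hπ.lt_iff i b).1 hlt with h | h
          · omega
          · exact h.2
        exact absurd ⟨x b, IntervalSet.mem_region_of_right_le (hx b) hr.le (hx i) h1.le, hx b⟩
          (hbot.not_nonempty_inter hlt)
  -- In higher levels the anchor is contained in `i`, so everything between the two points lies in
  -- `i` by convexity.
  · rw [if_neg hl]
    have hxa : x a ∈ R.region i := (ha.2 hl).subset (hx a)
    have hmem : x b ∈ R.region i := by
      rcases hbet with ⟨h1, h2⟩ | ⟨h1, h2⟩
      · exact IntervalSet.mem_region_of_between hxa (hx i) h1 h2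
      · exact IntervalSet.mem_region_of_between (hx i) hxa h1.le h2
    rcases hb with hb | hb
    · exact mem_contactSet.2 ⟨hb.le, x b, hx b, hmem⟩
    · by_cases hlt : π i < π b
      · exact absurd ⟨x b, hmem, hx b⟩ (hb.not_nonempty_inter hlt)
      · exact mem_contactSet.2 ⟨not_lt.1 hlt, x b, hx b, hmem⟩

theorem le_of_isBottom {x : Fin n → ℝ} (hx : R.Realizes x) {i j : Fin n} (hi : IsBottom R π i)
    (hj : IsBottom R π j) (h : R.left i < R.left j) : x i ≤ x j := by
  by_contra hlt
  have hne : i ≠ j := fun e => by simp [e] at h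
  have hmem : x j ∈ R.region i :=
    IntervalSet.mem_region_of_left_le (hx j) h.le (hx i) (not_le.1 hlt).le
  rcases lt_trichotomy (π i) (π j) with h' | h' | h'
  · exact hj.not_nonempty_inter h' ⟨x j, hmem, hx j⟩
  · exact hne (π.injective h')
  · exact hi.not_nonempty_inter h' ⟨x j, hx j, hmem⟩

/-- The amortized cost of all insertions. -/
theorem sum_log_card_le {os : List (Fin n)} (hos : os.Nodup) (hb : ∀ i ∈ os, ¬ IsBottom R π i)
    (a : Fin n → Fin n) (ha : ∀ i ∈ os, IsAnchor R π i (a i)) :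
    (((os.map fun i => Nat.log 2 (contactSet R π (if level R i = 1 then a i else i)).card).sum : ℕ)
      : ℝ) ≤ 2 * ambiguity R π ∧ (os.length : ℝ) ≤ ambiguity R π := by
  classical
  have hlog : ∀ i, 0 ≤ Real.logb 2 ((contactSet R π i).card : ℝ) := fun i =>
    Real.logb_nonneg (by norm_num) (by exact_mod_cast one_le_card_contactSet R π i)
  have hnat : ∀ i, ((Nat.log 2 (contactSet R π i).card : ℕ) : ℝ) ≤
      Real.logb 2 ((contactSet R π i).card : ℝ) := fun i => Real.natLog_le_logb _ _
  constructor
  · rw [← List.sum_toFinset _ hos, Nat.cast_sum]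
    have h1 : ∀ i ∈ os.toFinset,
        ((Nat.log 2 (contactSet R π (if level R i = 1 then a i else i)).card : ℕ) : ℝ) ≤
        Real.logb 2 ((contactSet R π i).card : ℝ) +
          if level R i = 1 then Real.logb 2 ((contactSet R π (a i)).card : ℝ) else 0 := by
      intro i _
      split_ifs with h
      · have := hlog i
        have := hnat (a i)
        linarith
      · simpa using hnat i
    refine (Finset.sum_le_sum h1).trans ?_
    rw [Finset.sum_add_distrib, ← Finset.sum_filter, two_mul]
    refine add_le_add ?_ ?_
    · exact Finset.sum_le_sum_of_subset_of_nonneg (Finset.subset_univ _) fun i _ _ => hlog i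
    -- Different intervals of level one have different predecessors, so a contact set is charged at
    -- most once by its own interval and at most once by the interval of which it is the
    -- predecessor.
    · have hinj : Set.InjOn a (os.toFinset.filter fun i => level R i = 1) := by
        intro i hi j hj hij
        simp only [Finset.coe_filter, List.mem_toFinset, Set.mem_ofPred_eq] at hi hj
        have h1 := (ha i hi.1).1 hi.2
        have h2 := (ha j hj.1).1 hj.2
        rw [hij] at h1
        exact π.injective (Fin.ext (h1.symm.trans h2))
      rw [← Finset.sum_image (f := fun j => Real.logb 2 ((contactSet R π j).card : ℝ)) hinj]
      exact Finset.sum_le_sum_of_subset_of_nonneg (Finset.subset_univ _) fun i _ _ => hlog i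
  · have h1 : (os.length : ℝ) = ∑ i ∈ os.toFinset, (1 : ℝ) := by
      simp [List.toFinset_card_of_nodup hos]
    rw [h1]
    refine (Finset.sum_le_sum (g := fun i => Real.logb 2 ((contactSet R π i).card : ℝ))
      fun i hi => ?_).trans (Finset.sum_le_sum_of_subset_of_nonneg (Finset.subset_univ _)
        fun i _ _ => hlog i)
    -- A non-bottom interval adds at least `log₂ 2 = 1` to the ambiguity.
    have h2 := two_le_card_contactSet (hb i (List.mem_toFinset.1 hi))
    rw [Real.le_logb_iff_rpow_le (by norm_num) (by positivity)]
    simpa using (by exact_mod_cast h2 : (2 : ℝ) ≤ (contactSet R π i).card)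

end Distance

/-! ### Reconstruction -/

section Reconstruction

variable {κ : IntervalKind} {n : ℕ}

/-- The dummy label satisfies the flag, hence the cut between `L₁` and `L₂` never lies inside the
block of dummies, and the dummies stay at the end. -/
theorem exists_insert_labels {r : Fin n → Fin n → Prop} {fl : ℕ → Prop} {ps : List (Fin n)} {d : ℕ}
    {i : Fin n} {L₁ L₂ : List ℕ} (hps : ps.Pairwise r)
    (h : ps.map Fin.val ++ List.replicate d n = L₁ ++ L₂) (h₁ : ∀ a ∈ L₁, ¬ fl a)
    (h₂ : ∀ a ∈ L₂, fl a) (hn : fl n) (hr₁ : ∀ j ∈ ps, ¬ fl j → r j i)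
    (hr₂ : ∀ j ∈ ps, fl j → r i j) :
    ∃ ps' : List (Fin n), L₁ ++ (i : ℕ) :: L₂ = ps'.map Fin.val ++ List.replicate d n ∧
      ps'.Perm (i :: ps) ∧ ps'.Pairwise r := by
  have key : ∃ p₁ p₂ : List (Fin n), ps = p₁ ++ p₂ ∧ L₁ = p₁.map Fin.val ∧
      L₂ = p₂.map Fin.val ++ List.replicate d n := by
    rcases List.append_eq_append_iff.1 h with ⟨C, hC, hd⟩ | ⟨C, hC, hd⟩
    · have hC' : C = [] := by
        rcases C with _ | ⟨c, C⟩
        · rfl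
        · exfalso
          have h3 : c ∈ List.replicate d n := by rw [hd]; simp
          rw [List.eq_of_mem_replicate h3] at hC
          exact h₁ n (by rw [hC]; simp) hn
      subst hC'
      exact ⟨ps, [], by simp, by simpa using hC, by simpa using hd.symm⟩
    · obtain ⟨p₁, p₂, h3, h4, h5⟩ := List.map_eq_append_iff.1 hC
      exact ⟨p₁, p₂, h3, h4.symm, by rw [h5, hd]⟩
  obtain ⟨p₁, p₂, rfl, rfl, rfl⟩ := key
  refine ⟨p₁ ++ i :: p₂, by simp, List.perm_middle, ?_⟩
  rw [List.pairwise_append] at hps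
  rw [List.pairwise_append, List.pairwise_cons]
  refine ⟨hps.1, ⟨fun j hj => hr₂ j (by simp [hj]) (h₂ _ ?_), hps.2.1⟩, fun j hj k hk => ?_⟩
  · exact List.mem_append_left _ (List.mem_map_of_mem hj)
  · rcases List.mem_cons.1 hk with rfl | hk
    · exact hr₁ j (by simp [hj]) (h₁ _ (List.mem_map_of_mem hj))
    · exact hps.2.2 j hj k hk

/-- Compares the point of the label in variable `7` with that of the label in variable `8`. -/
def comparePoints : Cmd :=
  .ite (.le v#0 v#8) (9 ≔ 1) (.ite (.less .point v#7 .point v#8) (9 ≔ 1) (9 ≔ 0))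

/-- A label from `n` on stands for `∞` and lies above every point. Ties are resolved by inserting a
point after those equal to it. -/
def PointLess (x : Fin n → ℝ) (i a : ℕ) : Prop := n ≤ a ∨ toArray x i < toArray x a

theorem compares_comparePoints (R : IntervalSet κ n) (x : Fin n → ℝ) (i : ℕ) :
    Compares (R.fullInput x) comparePoints n i (PointLess x i) := by
  intro σ h0 h7
  refine Runs.eval (by simp [comparePoints]) (by decide) ?_
  by_cases h : n ≤ σ.var 8
  · simp [comparePoints, PointLess, h0, h]
  · by_cases h' : toArray x i < toArray x (σ.var 8)
    · simp [comparePoints, PointLess, h0, h7, h, h', IntervalSet.fullInput]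
    · simp [comparePoints, PointLess, h0, h7, h, h', IntervalSet.fullInput]

theorem toArray_val (x : Fin n → ℝ) (i : Fin n) : toArray x i = x i := by
  simp [toArray]

theorem pointLess_val (x : Fin n → ℝ) (i j : Fin n) : PointLess x i j ↔ x i < x j := by
  simp [PointLess, toArray_val]

/-- Inserts the point whose label is the entry at `v#31` of the list at `v#4`. -/
def insertNext : Cmd :=
  7 ≔ M[v#4 + v#31] ;; 11 ≔ M[v#2 + M[v#3 + v#7]] ;; PTree.fingerInsert comparePoints ;;
  31 ≔ v#31 + 1

def reconstruct : Cmd := 31 ≔ 0 ;; .loop (.le (v#31 + 1) v#5) insertNext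

/-- The leaves are the points `ps` in sorted order and `d` dummies. -/
structure SortedLeaves (x : Fin n → ℝ) (T : PTree) (ps : List (Fin n)) (d : ℕ) : Prop where
  labels : T.leafEntries.map Prod.snd = ps.map Fin.val ++ List.replicate d n
  sorted : ps.Pairwise fun i j => x i ≤ x j
  nodup : ps.Nodup

theorem SortedLeaves.pairwise {x : Fin n → ℝ} {T : PTree} {ps : List (Fin n)} {d : ℕ}
    (h : SortedLeaves x T ps d) : (T.leafEntries).Pairwise fun e e' =>
      n ≤ e'.2 ∨ e.2 < n ∧ toArray x e.2 ≤ toArray x e'.2 := by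
  have : (T.leafEntries.map Prod.snd).Pairwise fun a b =>
      n ≤ b ∨ a < n ∧ toArray x a ≤ toArray x b := by
    rw [h.labels, List.pairwise_append, List.pairwise_map]
    refine ⟨h.sorted.imp fun {i j} hij => .inr ⟨i.2, by simpa [toArray_val] using hij⟩, ?_, ?_⟩
    · exact List.pairwise_replicate.2 (.inr (.inl le_rfl))
    · intro a _ b hb
      exact .inl (List.eq_of_mem_replicate hb).ge
  exact List.pairwise_map.1 this

/-- Leaves other than dummies have distinct labels, so distances in the tree can be counted by sets
of intervals, and in particular by contact sets. -/
theorem SortedLeaves.length_le {x : Fin n → ℝ} {T : PTree} {ps : List (Fin n)} {d : ℕ}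
    (h : SortedLeaves x T ps d) {l : List (ℕ × ℕ)} (hl : l.Sublist T.leafEntries)
    (S : Finset (Fin n)) (hS : ∀ e ∈ l, ∃ j : Fin n, (j : ℕ) = e.2 ∧ (j ∈ ps → j ∈ S)) :
    l.length ≤ S.card := by
  have h1 : (l.map Prod.snd).Sublist (ps.map Fin.val) := by
    have h2 := (hl.map Prod.snd).filter (fun a => decide (a < n))
    have h3 : (l.map Prod.snd).filter (fun a => decide (a < n)) = l.map Prod.snd := by
      rw [List.filter_eq_self]
      intro a ha
      obtain ⟨e, he, rfl⟩ := List.mem_map.1 ha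
      obtain ⟨j, hj, -⟩ := hS e he
      simp [← hj]
    have h4 : (ps.map Fin.val ++ List.replicate d n).filter (fun a => decide (a < n)) =
        ps.map Fin.val := by
      rw [List.filter_append, List.filter_eq_self.2, List.filter_eq_nil_iff.2, List.append_nil]
      · intro a ha
        rw [List.eq_of_mem_replicate ha]; simp
      · intro a ha
        obtain ⟨j, -, rfl⟩ := List.mem_map.1 ha
        simp
    rwa [h3, h.labels, h4] at h2
  have hnd : (l.map Prod.snd).Nodup :=
    h1.nodup (h.nodup.map Fin.val_injective)
  have h5 : (l.map Prod.snd).toFinset ⊆ S.map Fin.valEmbedding := by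
    intro a ha
    rw [List.mem_toFinset] at ha
    obtain ⟨k, hk, hk'⟩ := List.mem_map.1 (h1.subset ha)
    obtain ⟨e, he, rfl⟩ := List.mem_map.1 ha
    obtain ⟨j, hj, hj'⟩ := hS e he
    have hkj : k = j := Fin.ext (hk'.trans hj.symm)
    subst hkj
    exact Finset.mem_map.2 ⟨k, hj' hk, hj⟩
  have := Finset.card_le_card h5
  rwa [Finset.card_map, List.toFinset_card_of_nodup hnd, List.length_map] at this

/-- The state of the reconstruction when the points `ps` have been inserted. -/
structure ReconState (R : IntervalSet κ n) (x : Fin n → ℝ) (os : List (Fin n)) (a : Fin n → Fin n)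
    (d : ℕ) (σ : Store) (T : PTree) (ps : List (Fin n)) : Prop where
  var0 : σ.var 0 = n
  root : σ.var 1 = T.addr
  treeIn : PTree.TreeIn σ.mem (σ.var 2) n (σ.var 6) T
  sorted : SortedLeaves x T ps d
  anchors : ∀ i ∈ os, σ.mem (σ.var 3 + i) = a i
  length : σ.var 5 = os.length
  list : ∀ (k : ℕ) (h : k < os.length), σ.mem (σ.var 4 + k) = os[k]
  frame : ∀ z, (∃ i ∈ os, z = σ.var 3 + i) ∨ (∃ k < os.length, z = σ.var 4 + k) →
    z < σ.var 6 ∧ ¬ PTree.InCells T.addrs z ∧ (z < σ.var 2 ∨ σ.var 2 + n ≤ z)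

/-- All leaves between the anchor's leaf and the place of the new point belong to the single contact
set `G`, whichever direction the search takes. The distance exponent is `Nat.log 2 G.card + 1`, the
least convenient power of two above the cardinality of `G`. -/
theorem insertNext_runs {R : IntervalSet κ n} {π : Equiv.Perm (Fin n)}
    (hπ : IsLevelPermutation R π) {x : Fin n → ℝ} (hx : R.Realizes x) {os : List (Fin n)}
    {a : Fin n → Fin n} {d : ℕ} {σ : Store} {T : PTree} {ps : List (Fin n)}
    (hs : ReconState R x os a d σ T ps) {k : ℕ} (hk : k < os.length) (h31 : σ.var 31 = k)
    (hi : ¬ IsBottom R π os[k]) (ha : IsAnchor R π os[k] (a os[k])) (hips : os[k] ∉ ps)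
    (haps : a os[k] ∈ ps) (hps : ∀ j ∈ ps, π j < π os[k] ∨ IsBottom R π j) :
    ∃ T' ps' j, ps'.Perm (os[k] :: ps) ∧ j + T'.potential ≤ T.potential + 5 ∧
      Runs (R.fullInput x) insertNext σ (152 * j + (6100 + 3000 *
        Nat.log 2 (contactSet R π (if level R os[k] = 1 then a os[k] else os[k])).card)) fun σ' =>
        ReconState R x os a d σ' T' ps' ∧ σ'.var 31 = k + 1 := by
  set i := os[k] with hi_def
  set G := contactSet R π (if level R i = 1 then a i else i) with hG
  have hios : i ∈ os := List.getElem_mem hk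
  set P := σ.var 2 with hP
  set f := σ.var 6 with hf
  -- the leaf of the anchor
  have hptr := hs.treeIn.ptr (a i) (a i).2 (by
    rw [hs.sorted.labels]
    exact List.mem_append_left _ (List.mem_map_of_mem haps))
  obtain ⟨A, B, hAB⟩ := List.append_of_mem hptr
  set p := σ.mem (P + a i) with hp
  obtain ⟨σ₁, t₁, hx₁, ht₁, ⟨h7, h11⟩, hv, hm⟩ :
      Runs (R.fullInput x) (7 ≔ M[v#4 + v#31] ;; 11 ≔ M[v#2 + M[v#3 + v#7]]) σ 10 fun σ' =>
        (σ'.var 7 = i ∧ σ'.var 11 = p) ∧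
        (∀ v, v ∉ (7 ≔ M[v#4 + v#31] ;; 11 ≔ M[v#2 + M[v#3 + v#7]]).assigned →
          σ'.var v = σ.var v) ∧ σ'.mem = σ.mem := by
    refine Runs.frame_mem (Runs.eval (by simp) (by decide) ?_) (by simp [Cmd.ReadOnly])
    have h1 := hs.list k hk
    have h2 := hs.anchors i hios
    simp [h31, h1, ← hi_def, h2, hp, hP]
  have hpw := hs.sorted.pairwise
  have hmono : (T.leafEntries).Pairwise fun e e' => PointLess x i e.2 → PointLess x i e'.2 := by
    refine hpw.imp fun {e e'} h h' => ?_
    rcases h with h | h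
    · exact .inl h
    · exact .inr ((h'.resolve_left (by omega)).trans_le h.2)
  rw [hAB, List.pairwise_append, List.pairwise_cons] at hpw
  have hmem : ∀ e ∈ T.leafEntries, e.2 < n → ∃ j : Fin n, (j : ℕ) = e.2 ∧ j ∈ ps := by
    intro e he hen
    have h1 := List.mem_map_of_mem (f := Prod.snd) he
    rw [hs.sorted.labels, List.mem_append] at h1
    rcases h1 with h1 | h1
    · obtain ⟨j, hj, hj'⟩ := List.mem_map.1 h1
      exact ⟨j, hj', hj⟩
    · have := List.eq_of_mem_replicate h1
      omega
  have hβ : ∀ l : List (ℕ × ℕ), l.length ≤ G.card → l.length < 2 ^ (Nat.log 2 G.card + 1) :=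
    fun l h => h.trans_lt (Nat.lt_pow_succ_log_self (by omega) _)
  obtain ⟨T', j, hj, σ₂, t₂, hx₂, ht₂, hins⟩ := PTree.fingerInsert_runs (σ := σ₁) (P := P) (f := f)
    (β := Nat.log 2 G.card + 1)
    (compares_comparePoints R x i) (by rw [hv 0 (by decide), hs.var0])
    (hv 2 (by decide)) (hv 6 (by decide)) h7 h11 (by rw [hm]; exact hs.treeIn)
    (by
      rw [hs.sorted.labels, List.mem_append]
      rintro (h | h)
      · obtain ⟨j, hj, hj'⟩ := List.mem_map.1 h
        exact hips (Fin.ext hj' ▸ hj)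
      · have := List.eq_of_mem_replicate h
        omega)
    hmono hAB
    (by
      intro l hl hl'
      refine hβ l (hs.sorted.length_le (l := l) ?_ G fun e he => ?_)
      · rw [hAB]; exact hl.trans (List.sublist_append_right _ _)
      · have h1 := hl' e he
        simp only [PointLess, not_or, not_le, not_lt] at h1
        refine ⟨⟨e.2, h1.1⟩, rfl, fun hjps => ?_⟩
        refine mem_contactSet_of_between hπ hx hi ha (hps _ hjps) (.inl ⟨?_, ?_⟩)
        · rcases List.mem_cons.1 (hl.subset he) with h2 | h2
          · exact le_of_eq (congrArg x (Fin.ext (congrArg Prod.snd h2).symm))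
          · have h3 := hpw.2.1.1 e h2
            have h4 := h3.resolve_left (by omega)
            have h5 := h4.2
            rw [toArray_val] at h5
            simpa [toArray, h1.1] using h5
        · simpa [toArray, h1.1] using h1.2)
    (by
      intro l hl hl'
      refine hβ l (hs.sorted.length_le (l := l) ?_ G fun e he => ?_)
      · rw [hAB]
        exact hl.trans ((List.Sublist.cons_cons _ (List.nil_sublist B)).append_left A)
      · have h1 := hl' e he
        have h3 : e.2 < n ∧ toArray x e.2 ≤ x (a i) := by
          rcases List.mem_append.1 (hl.subset he) with h2 | h2
          · have h3 := (hpw.2.2 e h2 (p, (a i : ℕ)) (by simp)).resolve_left (by simp)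
            rwa [toArray_val] at h3
          · rw [List.mem_singleton.1 h2]
            exact ⟨(a i).2, (toArray_val x _).le⟩
        refine ⟨⟨e.2, h3.1⟩, rfl, fun hjps => ?_⟩
        refine mem_contactSet_of_between hπ hx hi ha (hps _ hjps) (.inr ⟨?_, ?_⟩)
        · have h4 := h1.resolve_left (by omega)
          rw [toArray_val] at h4
          simpa [toArray, h3.1] using h4
        · simpa [toArray, h3.1] using h3.2)
  obtain ⟨L₁, L₂, g1, g2, g3, g4⟩ := hins.labels
  obtain ⟨ps', e1, e2, e3⟩ := exists_insert_labels (i := i) (fl := PointLess x i) hs.sorted.sorted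
    (hs.sorted.labels.symm.trans g1) g3 g4 (.inl le_rfl)
    (fun j _ h => by rw [pointLess_val, not_lt] at h; exact h)
    (fun j _ h => by rw [pointLess_val] at h; exact h.le)
  have hv₂ : ∀ v, v ∉ (PTree.fingerInsert comparePoints).assigned → σ₂.var v = σ₁.var v :=
    fun v h => hx₂.var_eq v h
  have hvar : ∀ v, v = 0 ∨ v = 1 ∨ v = 2 ∨ v = 3 ∨ v = 4 ∨ v = 5 ∨ v = 31 →
      σ₂.var v = σ.var v := by
    rintro v (rfl | rfl | rfl | rfl | rfl | rfl | rfl) <;>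
    exact (hv₂ _ (by decide)).trans (hv _ (by decide))
  have hfr : ∀ z, (∃ i ∈ os, z = σ.var 3 + i) ∨ (∃ k < os.length, z = σ.var 4 + k) →
      σ₂.mem z = σ.mem z := by
    intro z hz
    have h1 := hs.frame z hz
    rw [hins.frame z h1.1 h1.2.1 h1.2.2, hm]
  obtain ⟨σ₃, hx₃, hv₃, h31', h6', hm₃⟩ : ∃ σ₃, Exec (R.fullInput x) (31 ≔ v#31 + 1) σ₂ σ₃ 2 ∧
      (∀ v, v = 0 ∨ v = 1 ∨ v = 2 ∨ v = 3 ∨ v = 4 ∨ v = 5 → σ₃.var v = σ.var v) ∧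
      σ₃.var 31 = k + 1 ∧ σ₃.var 6 = f + 12 ∧ σ₃.mem = σ₂.mem := by
    refine ⟨_, Exec.assign 31 (v#31 + 1) σ₂, ?_, ?_, ?_, rfl⟩
    · intro v hv'
      rw [← hvar v (by tauto)]
      exact Function.update_of_ne (by omega) _ _
    · simp [hvar 31 (by simp), h31]
    · simp [hins.top]
  refine ⟨T', ps', j, e2, hj, σ₃, t₁ + (t₂ + 2), ?_, ?_, ⟨?_, ?_, ?_, ?_, ?_, ?_, ?_, ?_⟩, h31'⟩
  · cases hx₁ with
    | seq ha hb =>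
      rw [add_assoc]
      exact Exec.seq ha (.seq hb (.seq hx₂ hx₃))
  · omega
  · rw [hv₃ 0 (by simp), hs.var0]
  · rw [hv₃ 1 (by simp), hs.root, hins.addr]
  · rw [hv₃ 2 (by simp), hm₃, h6']; exact hins.treeIn
  · refine ⟨by rw [g2, e1], e3, ?_⟩
    exact e2.nodup_iff.2 (List.nodup_cons.2 ⟨hips, hs.sorted.nodup⟩)
  · intro i' hi'
    rw [hv₃ 3 (by simp), hm₃, hfr _ (.inl ⟨i', hi', rfl⟩)]
    exact hs.anchors i' hi'
  · rw [hv₃ 5 (by simp)]; exact hs.length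
  · intro k' hk'
    rw [hv₃ 4 (by simp), hm₃, hfr _ (.inr ⟨k', hk', rfl⟩)]
    exact hs.list k' hk'
  · intro z hz
    rw [hv₃ 3 (by simp), hv₃ 4 (by simp)] at hz
    rw [hv₃ 2 (by simp), h6']
    have h1 := hs.frame z hz
    refine ⟨by omega, ?_, h1.2.2⟩
    rintro ⟨q, hq, hq1, hq2⟩
    rcases hins.addrs q hq with h | h
    · exact h1.2.1 ⟨q, h, hq1, hq2⟩
    · omega

/-- The state at the start of the reconstruction. -/
theorem HoldsXi.exists_reconState {R : IntervalSet κ n} {π : Equiv.Perm (Fin n)}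
    {σ : Store} (h : HoldsXi R π σ) {x : Fin n → ℝ} (hx : R.Realizes x) :
    ∃ (T : PTree) (bs os : List (Fin n)) (a : Fin n → Fin n) (d : ℕ),
      ReconState R x os a d σ T bs ∧ T.potential = 0 ∧ d ≤ n ∧ (∀ i, i ∈ bs ↔ IsBottom R π i) ∧
      (∀ i, i ∈ os ↔ ¬ IsBottom R π i) ∧ os.Pairwise (fun i j => π i < π j) ∧
      ∀ i ∈ os, IsAnchor R π i (a i) := by
  classical
  obtain ⟨T, bs, os, d, hbs, hbsp, hos, hosp, hfib, hlab, hd, h0, h1, hst, hpar, hlink, hptr, hanc,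
    h5, hlist, hdisj, hpos⟩ := h
  have hanc' : ∀ i, ∃ a, i ∈ os → IsAnchor R π i a ∧ σ.mem (σ.var 3 + i) = a := by
    intro i
    by_cases hi : i ∈ os
    · obtain ⟨a, ha⟩ := hanc i hi
      exact ⟨a, fun _ => ha⟩
    · exact ⟨i, fun h => absurd h hi⟩
  choose a ha using hanc'
  have hlen : bs.length ≤ n := by
    have hnd : bs.Nodup := hbsp.imp fun h e => by simp [e] at h
    have := List.toFinset_card_of_nodup hnd
    have h2 := Finset.card_le_univ bs.toFinset
    simp only [Fintype.card_fin] at h2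
    omega
  rw [List.pairwise_append] at hdisj
  obtain ⟨hd1, hd2, hd3⟩ := hdisj
  have hblk : ∀ q ∈ T.addrs, (q, 6) ∈ T.blocks := fun q hq => List.mem_map.2 ⟨q, hq, rfl⟩
  refine ⟨T, bs, os, a, d, ⟨h0, h1, ?_, ⟨?_, ?_, ?_⟩, fun i hi => (ha i hi).2, h5, hlist, ?_⟩,
    hfib.potential_eq_zero, hd.trans hlen, hbs, hos, hosp, fun i hi => (ha i hi).1⟩
  · refine ⟨(PTree.rep_iff _ _).2 ⟨hst, hpar⟩, ?_, ?_, (PTree.sep_iff_blocks T).1 hd1, ?_,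
      hfib.isAVL, ?_⟩
    · rw [← PTree.leafAddrs_eq]
      exact (linkedLeaves_iff _ _ _).1 hlink
    · intro b hb hmem
      rw [← PTree.labels_eq, hlab, List.mem_append] at hmem
      rcases hmem with hmem | hmem
      · obtain ⟨i, hi, rfl⟩ := List.mem_map.1 hmem
        exact hptr i hi
      · have := List.eq_of_mem_replicate hmem
        omega
    · intro q hq
      have g1 := hpos _ (List.mem_append_left _ (hblk q hq))
      have g2 := hd3 _ (hblk q hq) (σ.var 2, n) (by simp)
      exact ⟨g1.1, g1.2, g2⟩
    · exact (hpos (σ.var 2, n) (by simp)).2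
  · rw [← PTree.labels_eq, hlab]
  · exact hbsp.imp_of_mem fun {i j} hi hj hij => le_of_isBottom hx ((hbs i).1 hi) ((hbs j).1 hj) hij
  · exact hbsp.imp fun h e => by simp [e] at h
  · have hP : ∀ i ∈ os, (i : ℕ) < n := fun i _ => i.2
    simp only [List.pairwise_cons, List.mem_cons, List.not_mem_nil, or_false] at hd2
    obtain ⟨hPA, hAO, -⟩ := hd2
    have hPA' := hPA _ (.inl rfl)
    have hPO' := hPA _ (.inr rfl)
    have hA := hpos (σ.var 3, n) (by simp)
    have hO := hpos (σ.var 4, os.length) (by simp)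
    simp only [DisjointBlocks] at hPA' hPO' hA hO hd3
    rintro z (⟨i, hi, rfl⟩ | ⟨k, hk, rfl⟩)
    · have := i.2
      refine ⟨by omega, ?_, by omega⟩
      rintro ⟨q, hq, hq1, hq2⟩
      have := hd3 _ (hblk q hq) (σ.var 3, n) (by simp)
      omega
    · refine ⟨by omega, ?_, by omega⟩
      rintro ⟨q, hq, hq1, hq2⟩
      have := hd3 _ (hblk q hq) (σ.var 4, os.length) (by simp)
      omega

/-- The potentials telescope over the insertions. The `6900` per insertion covers its fixed cost of
`6100`, five units of potential at cost `152` each, and the loop test. -/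
theorem reconstruct_loop_runs {R : IntervalSet κ n} {π : Equiv.Perm (Fin n)}
    (hπ : IsLevelPermutation R π) {x : Fin n → ℝ} (hx : R.Realizes x) {bs os : List (Fin n)}
    {a : Fin n → Fin n} {d : ℕ} (hbs : ∀ i, i ∈ bs ↔ IsBottom R π i)
    (hos : ∀ i, i ∈ os ↔ ¬ IsBottom R π i) (hosp : os.Pairwise fun i j => π i < π j)
    (ha : ∀ i ∈ os, IsAnchor R π i (a i)) (todo : List (Fin n)) (ps : List (Fin n)) (T : PTree)
    (σ : Store) (don : List (Fin n)) (hd : os = don ++ todo) (h31 : σ.var 31 = don.length)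
    (hps : ps.Perm (bs ++ don)) (hs : ReconState R x os a d σ T ps) :
    ∃ T' ps', Runs (R.fullInput x) (.loop (.le (v#31 + 1) v#5) insertNext) σ
      (152 * T.potential + 6900 * todo.length + 3000 * (todo.map fun i =>
        Nat.log 2 (contactSet R π (if level R i = 1 then a i else i)).card).sum + 2) fun σ' =>
        ReconState R x os a d σ' T' ps' ∧ ps'.Perm (bs ++ os) := by
  induction todo generalizing ps T σ don with
  | nil =>
    refine ⟨T, ps, .loop_done ?_ ?_ ⟨hs, by rw [hd]; simpa using hps⟩⟩
    · simp [h31, hs.length, hd]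
    · simp [Test.cost, Expr.cost]
  | cons i todo ih =>
    have hk : don.length < os.length := by rw [hd]; simp
    have hki : os[don.length] = i := by simp [hd]
    have hios : i ∈ os := by rw [hd]; simp
    have hib : ¬ IsBottom R π i := (hos i).1 hios
    have hosp' := hosp
    rw [hd, List.pairwise_append, List.pairwise_cons] at hosp'
    have hmem : ∀ j, j ∈ ps ↔ IsBottom R π j ∨ j ∈ don := fun j => by
      rw [hps.mem_iff, List.mem_append, hbs]
    have hdon : ∀ j ∈ don, π j < π i := fun j hj => hosp'.2.2 j hj i (by simp)
    have hips : i ∉ ps := by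
      rw [hmem]
      rintro (h | h)
      · exact hib h
      · exact (hdon i h).ne rfl
    -- The anchor precedes `i` in `π`, so its point either belongs to the initial tree or has
    -- already been inserted.
    have haps : a i ∈ ps := by
      rw [hmem]
      by_cases hb : IsBottom R π (a i)
      · exact .inl hb
      · right
        have h1 := (hos (a i)).2 hb
        rw [hd] at h1
        rcases List.mem_append.1 h1 with h1 | h1
        · exact h1
        · have hlt := (ha i hios).lt hπ
          rcases List.mem_cons.1 h1 with h1 | h1
          · exact absurd (congrArg π h1) hlt.ne
          · exact absurd (hosp'.2.1.1 _ h1) hlt.asymm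
    obtain ⟨T₁, ps₁, j, e1, e2, σ₁, t₁, hx₁, ht₁, e3, e4⟩ :=
      insertNext_runs hπ hx hs hk h31 (by rw [hki]; exact hib) (by rw [hki]; exact ha i hios)
        (by rw [hki]; exact hips) (by rw [hki]; exact haps) (fun j hj => by
          rw [hki]
          rcases (hmem j).1 hj with h | h
          · exact .inr h
          · exact .inl (hdon j h))
    rw [hki] at e1 ht₁
    obtain ⟨T₂, ps₂, hr⟩ := ih ps₁ T₁ σ₁ (don ++ [i]) (by simp [hd]) (by simp [e4]) (by
      refine e1.trans ?_
      refine (hps.cons i).trans ?_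
      rw [← List.append_assoc]
      exact (List.perm_append_singleton i (bs ++ don)).symm) e3
    refine ⟨T₂, ps₂, .loop_step (t₁ := t₁) ?_ ⟨σ₁, t₁, hx₁, le_rfl, hr⟩ ?_⟩
    · simp [h31, hs.length, hd]
    · simp only [Test.cost, Expr.cost_plus, Expr.cost_ofNat, Expr.cost, List.length_cons,
        List.map_cons, List.sum_cons]
      omega

/-- The constant is `12900 = 6900 + 2 * 3000`: the number of insertions is at most the ambiguity,
and the logarithms of the charged contact sets sum to at most twice the ambiguity. The initial tree
has potential zero. -/
theorem reconstruct_runs {R : IntervalSet κ n} {π : Equiv.Perm (Fin n)}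
    (hπ : IsLevelPermutation R π) {σ : Store} (h : HoldsXi R π σ) {x : Fin n → ℝ}
    (hx : R.Realizes x) : ∃ (σ' : Store) (t : ℕ), Exec (R.fullInput x) reconstruct σ σ' t ∧
      HoldsAVLTree x σ' ∧ (t : ℝ) ≤ 12900 * (ambiguity R π + 1) := by
  obtain ⟨T, bs, os, a, d, hs, hpot, hd, hbs, hos, hosp, ha⟩ := h.exists_reconState hx
  have hs₁ : ReconState R x os a d ⟨Function.update σ.var 31 0, σ.mem⟩ T bs := by
    refine ⟨?_, ?_, ?_, hs.sorted, ?_, ?_, ?_, ?_⟩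
    · simpa using hs.var0
    · simpa using hs.root
    · simpa using hs.treeIn
    · simpa using hs.anchors
    · simpa using hs.length
    · simpa using hs.list
    · simpa using hs.frame
  obtain ⟨T', ps, σ', t, hx', ht, hs', hps⟩ := reconstruct_loop_runs hπ hx hbs hos hosp ha os bs T
    _ [] (by simp) (by simp) (by simp) hs₁
  refine ⟨σ', _, .seq (.assign 31 0 σ) hx', ⟨T', ps, d, hs'.root, ?_, ?_, hs'.treeIn.avl, ?_, ?_,
    hs'.sorted.sorted, hd⟩, ?_⟩
  · exact ((PTree.rep_iff _ _).1 hs'.treeIn.rep).1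
  · exact (PTree.sep_iff_blocks T').2 hs'.treeIn.sep
  · rw [PTree.labels_eq, hs'.sorted.labels]
  · refine (List.perm_ext_iff_of_nodup hs'.sorted.nodup (List.nodup_finRange n)).2 fun j => ?_
    rw [hps.mem_iff, List.mem_append, hbs, hos]
    simp [em]
  · have hnd : os.Nodup := hosp.imp fun h e => by simp [e] at h
    obtain ⟨h1, h2⟩ := sum_log_card_le hnd (fun i hi => (hos i).1 hi) a ha
    have h3 : (t : ℝ) ≤ ((152 * T.potential + 6900 * os.length + 3000 * (os.map fun i =>
        Nat.log 2 (contactSet R π (if level R i = 1 then a i else i)).card).sum + 2 : ℕ) : ℝ) := by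
      exact_mod_cast ht
    rw [hpot] at h3
    push_cast at h3 h1 ⊢
    simp only [Expr.cost_ofNat]
    push_cast
    linarith

end Reconstruction

/-! ### Sorting the intervals -/

section Sorting

variable {κ : IntervalKind} {n : ℕ}

/-- By increasing left endpoint, and by decreasing right endpoint among equal left endpoints. -/
def IntervalSet.Before (R : IntervalSet κ n) (i j : Fin n) : Prop :=
  R.left i < R.left j ∨ R.left i = R.left j ∧ R.right j ≤ R.right i

/-- Compares the intervals in the variables `7` and `8`. -/
def compareIntervals : Cmd :=
  .ite (.le v#0 v#8) (9 ≔ 1)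
    (.ite (.less .left v#7 .left v#8) (9 ≔ 1)
      (.ite (.less .left v#8 .left v#7) (9 ≔ 0)
        (.ite (.less .right v#8 .right v#7) (9 ≔ 1) (9 ≔ 0))))

def IntervalSet.Less (R : IntervalSet κ n) (i a : ℕ) : Prop :=
  n ≤ a ∨ toArray R.left i < toArray R.left a ∨
    toArray R.left i = toArray R.left a ∧ toArray R.right a < toArray R.right i

theorem compares_compareIntervals (R : IntervalSet κ n) (i : ℕ) :
    Compares R.preInput compareIntervals n i (R.Less i) := by
  intro σ h0 h7
  refine Runs.eval (by simp [compareIntervals]) (by decide) ?_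
  by_cases h : n ≤ σ.var 8
  · simp [compareIntervals, IntervalSet.Less, h0, h]
  · rcases lt_trichotomy (toArray R.left i) (toArray R.left (σ.var 8)) with h' | h' | h'
    · simp [compareIntervals, IntervalSet.Less, h0, h7, h, h', IntervalSet.fullInput,
        IntervalSet.preInput]
    · by_cases h'' : toArray R.right (σ.var 8) < toArray R.right i
      · simp [compareIntervals, IntervalSet.Less, h0, h7, h, h', h'', IntervalSet.fullInput,
          IntervalSet.preInput]
      · simp [compareIntervals, IntervalSet.Less, h0, h7, h, h', h'', IntervalSet.fullInput,
          IntervalSet.preInput]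
    · simp [compareIntervals, IntervalSet.Less, h0, h7, h, h', h'.asymm, h'.ne',
        IntervalSet.fullInput, IntervalSet.preInput]

theorem IntervalSet.less_val (R : IntervalSet κ n) (i j : Fin n) :
    R.Less i j ↔ R.left i < R.left j ∨ R.left i = R.left j ∧ R.right j < R.right i := by
  simp [IntervalSet.Less, toArray_val]

/-- The `n + 1` leaves allow for the single dummy in the sorting tree. -/
theorem PTree.height_le_log {T : PTree} (h : T.IsAVL) {n : ℕ}
    (hT : T.leafEntries.length ≤ n + 1) : T.height ≤ 2 * Nat.log 2 n + 3 := by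
  have h1 := (two_pow_half_height_le T h).trans hT
  have h2 : n < 2 ^ (Nat.log 2 n + 1) := Nat.lt_pow_succ_log_self (by omega) _
  have h3 : 2 ^ (T.height / 2) ≤ 2 ^ (Nat.log 2 n + 1) := h1.trans (by omega)
  have := (Nat.pow_le_pow_iff_right (by omega : 1 < 2)).1 h3
  omega

def insertInterval : Cmd :=
  7 ≔ v#31 ;; 10 ≔ v#1 ;; PTree.descend compareIntervals ;;
  PTree.insertLabel compareIntervals ;; 31 ≔ v#31 + 1

theorem insertInterval_runs {R : IntervalSet κ n} {σ : Store} {T : PTree} {ps : List (Fin n)}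
    {f : ℕ} (i : Fin n) (h0 : σ.var 0 = n) (h1 : σ.var 1 = T.addr) (h2 : σ.var 2 = 1)
    (h6 : σ.var 6 = f) (h31 : σ.var 31 = i) (hT : PTree.TreeIn σ.mem 1 n f T)
    (hlab : T.leafEntries.map Prod.snd = ps.map Fin.val ++ List.replicate 1 n)
    (hps : ps.Pairwise R.Before) (hnd : ps.Nodup) (hi : i ∉ ps) :
    ∃ (T' : PTree) (ps' : List (Fin n)) (j : ℕ), ps'.Perm (i :: ps) ∧ j + T'.potential ≤ T.potential + 5 ∧
      Runs R.preInput insertInterval σ (152 * j + 90 * Nat.log 2 n + 600) fun σ' =>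
        PTree.TreeIn σ'.mem 1 n (f + 12) T' ∧ σ'.var 1 = T'.addr ∧
        T'.leafEntries.map Prod.snd = ps'.map Fin.val ++ List.replicate 1 n ∧
        ps'.Pairwise R.Before ∧ σ'.var 6 = f + 12 ∧ σ'.var 31 = i + 1 ∧
        (∀ q ∈ T'.addrs, q ∈ T.addrs ∨ f ≤ q) ∧
        (∀ v, v < 6 ∨ 31 < v → σ'.var v = σ.var v) := by
  have hcmp := compares_compareIntervals R i
  have hlen : T.leafEntries.length ≤ n + 1 := by
    have h := congrArg List.length hlab
    have h3 := List.toFinset_card_of_nodup hnd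
    have h4 := Finset.card_le_univ ps.toFinset
    simp only [Fintype.card_fin, List.length_map, List.length_append, List.length_replicate]
      at h h4
    omega
  have hheight := PTree.height_le_log hT.avl hlen
  obtain ⟨σ₁, t₁, hx₁, ht₁, ⟨g7, g10⟩, hv₁, hm₁⟩ :
      Runs R.preInput (7 ≔ v#31 ;; 10 ≔ v#1) σ 2 fun σ' => (σ'.var 7 = i ∧ σ'.var 10 = T.addr) ∧
        (∀ v, v ∉ (7 ≔ v#31 ;; 10 ≔ v#1).assigned → σ'.var v = σ.var v) ∧ σ'.mem = σ.mem :=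
    Runs.frame_mem (Runs.eval (by simp) (by decide) (by simp [h31, h1])) (by simp [Cmd.ReadOnly])
  have hmono : (T.leafEntries.map Prod.snd).Pairwise fun a b => R.Less i a → R.Less i b := by
    rw [hlab, List.pairwise_append, List.pairwise_map]
    refine ⟨hps.imp fun {a b} hab h => ?_, by simp, fun a _ b hb _ => .inl ?_⟩
    · rw [R.less_val] at h ⊢
      rcases h with h | h <;> rcases hab with hab | hab
      · exact .inl (h.trans hab)
      · exact .inl (h.trans_eq hab.1)
      · exact .inl (h.1.trans_lt hab)
      · exact .inr ⟨h.1.trans hab.1, hab.2.trans_lt h.2⟩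
    · exact (List.eq_of_mem_replicate hb).ge
  obtain ⟨σ₂, t₂, hx₂, ht₂, hm₂, hv₂, A, p, b, B, e1, e2, e3, e4⟩ :=
    PTree.descend_runs hcmp T 0 σ₁ (by rw [hv₁ 0 (by decide), h0]) g7 g10
      (by rw [hm₁]; exact hT.rep) hmono
  obtain ⟨T', j, hj, σ₃, t₃, hx₃, ht₃, hins⟩ := PTree.insertLabel_runs hcmp (σ := σ₂) (T := T)
    (P := 1) (f := f)
    (by rw [hv₂ 0 (by decide) (by decide) (by decide), hv₁ 0 (by decide), h0])
    (by rw [hv₂ 2 (by decide) (by decide) (by decide), hv₁ 2 (by decide), h2])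
    (by rw [hv₂ 6 (by decide) (by decide) (by decide), hv₁ 6 (by decide), h6])
    (by rw [hv₂ 7 (by decide) (by decide) (by decide), g7]) e2 (by rw [hm₂, hm₁]; exact hT)
    (by
      rw [hlab, List.mem_append]
      rintro (h | h)
      · obtain ⟨j, hj, hj'⟩ := List.mem_map.1 h
        exact hi (Fin.ext hj' ▸ hj)
      · have := List.eq_of_mem_replicate h
        omega) e1 e3 e4
  obtain ⟨L₁, L₂, k1, k2, k3, k4⟩ := hins.labels
  obtain ⟨ps', f1, f2, f3⟩ := exists_insert_labels (i := i) (fl := R.Less i) hps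
    (hlab.symm.trans k1) k3 k4 (.inl le_rfl)
    (fun j _ h => by
      rw [R.less_val, not_or, not_lt, not_and, not_lt] at h
      rcases h.1.lt_or_eq with h' | h'
      · exact .inl h'
      · exact .inr ⟨h', h.2 h'.symm⟩)
    (fun j _ h => by
      rw [R.less_val] at h
      exact h.imp_right fun h => ⟨h.1, h.2.le⟩)
  have hv₃ : ∀ v, v < 6 ∨ 30 < v → σ₃.var v = σ.var v := by
    intro v hv
    rw [hx₃.var_eq v, hv₂ v (by omega) (by omega) (by omega), hv₁ v]
    · simp [Cmd.assigned]; omega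
    · simp [PTree.insertLabel, PTree.chooseSplit, PTree.loadCompare, compareIntervals,
        PTree.insertLeaf, PTree.splitLeaf, PTree.rebalance, PTree.rebalanceStep,
        PTree.rotateSingle, PTree.rotateDouble, Cmd.writeUnless, Cmd.assigned]
      omega
  refine ⟨T', ps', j, f2, hj, ⟨Function.update σ₃.var 31 (i + 1), σ₃.mem⟩,
    t₁ + (t₂ + (t₃ + 2)), ?_, ?_, hins.treeIn, ?_, k2.trans f1, f3, ?_, by simp, hins.addrs, ?_⟩
  · have h3 := Exec.assign (inp := R.preInput) 31 (v#31 + 1) σ₃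
    have h4 : (v#31 + 1 : Expr).eval σ₃ = i + 1 := by simp [hv₃ 31, h31]
    rw [h4] at h3
    cases hx₁ with
    | seq ha hb =>
      rw [add_assoc]
      exact Exec.seq ha (.seq hb (.seq hx₂ (.seq hx₃ h3)))
  · omega
  · simp [hv₃ 1, h1, hins.addr]
  · simpa using hins.top
  · intro v hv
    rw [← hv₃ v (by omega)]
    exact Function.update_of_ne (by omega) _ _

theorem sort_loop_runs {R : IntervalSet κ n} (k : ℕ) (σ : Store) (T : PTree) (ps : List (Fin n))
    (f i : ℕ) (hk : i + k = n) (h0 : σ.var 0 = n) (h1 : σ.var 1 = T.addr) (h2 : σ.var 2 = 1)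
    (h6 : σ.var 6 = f) (h31 : σ.var 31 = i) (hT : PTree.TreeIn σ.mem 1 n f T)
    (hlab : T.leafEntries.map Prod.snd = ps.map Fin.val ++ List.replicate 1 n)
    (hps : ps.Pairwise R.Before) (hnd : ps.Nodup) (hi : ∀ j : Fin n, j ∈ ps ↔ (j : ℕ) < i) :
    ∃ (T' : PTree) (ps' : List (Fin n)), ps'.Perm (List.finRange n) ∧
      Runs R.preInput (.loop (.le (v#31 + 1) v#0) insertInterval) σ
        (152 * T.potential + (90 * Nat.log 2 n + 1400) * k + 2) fun σ' =>
        PTree.TreeIn σ'.mem 1 n (f + 12 * k) T' ∧ σ'.var 1 = T'.addr ∧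
        T'.leafEntries.map Prod.snd = ps'.map Fin.val ++ List.replicate 1 n ∧
        ps'.Pairwise R.Before ∧ σ'.var 6 = f + 12 * k ∧
        (∀ q ∈ T'.addrs, q ∈ T.addrs ∨ f ≤ q) ∧
        (∀ v, v < 6 ∨ 31 < v → σ'.var v = σ.var v) := by
  induction k generalizing σ T ps f i with
  | zero =>
    refine ⟨T, ps, (List.perm_ext_iff_of_nodup hnd (List.nodup_finRange n)).2 fun j => ?_,
      .loop_done ?_ ?_ ⟨by simpa using hT, h1, hlab, hps, by simpa using h6, fun q hq => .inl hq,
        fun _ _ => rfl⟩⟩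
    · have := j.2
      simp only [hi, List.mem_finRange, iff_true]
      omega
    · simp [h31, h0]; omega
    · simp [Test.cost, Expr.cost]
  | succ k ih =>
    obtain ⟨T₁, ps₁, j, e1, e2, σ₁, t₁, hx₁, ht₁, g1, g2, g3, g4, g5, g6, g8, g7⟩ :=
      insertInterval_runs ⟨i, by omega⟩ h0 h1 h2 h6 h31 hT hlab hps hnd (by simp [hi])
    obtain ⟨T₂, ps₂, e3, hr⟩ := ih σ₁ T₁ ps₁ (f + 12) (i + 1) (by omega)
      (by rw [g7 0 (by omega), h0]) g2 (by rw [g7 2 (by omega), h2]) g5 g6 g1 g3 g4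
      (e1.nodup_iff.2 (List.nodup_cons.2 ⟨by simp [hi], hnd⟩)) (fun j => by
        rw [e1.mem_iff, List.mem_cons, hi, Fin.ext_iff]
        simp only
        omega)
    refine ⟨T₂, ps₂, e3, .loop_step (t₁ := t₁) ?_ ⟨σ₁, t₁, hx₁, le_rfl, hr.imp ?_⟩ ?_⟩
    · simp [h31, h0]; omega
    · rintro σ' ⟨a1, a2, a3, a4, a5, a7, a6⟩
      rw [show f + 12 + 12 * k = f + 12 * (k + 1) by ring] at a1 a5
      refine ⟨a1, a2, a3, a4, a5, fun q hq => ?_, fun v hv => (a6 v hv).trans (g7 v hv)⟩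
      rcases a7 q hq with h | h
      · exact g8 q h
      · exact .inr (by omega)
    · simp only [Test.cost, Expr.cost_plus, Expr.cost_ofNat, Expr.cost, Nat.mul_succ]
      omega

/-- Copies the leaves to the array at `v#40`. -/
def copyLeaves : Cmd :=
  10 ≔ v#1 ;; 12 ≔ 0 ;; PTree.walk ;; 31 ≔ 0 ;;
  .loop (.le (v#31 + 1) v#0)
    ((v#40 + v#31) ⇐ M[v#15 + 1] ;; 15 ≔ M[v#15 + 3] ;; 31 ≔ v#31 + 1)

theorem copy_loop_runs {inp : Input} (todo : List (ℕ × ℕ)) (σ : Store) (S i last q : ℕ)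
    (h0 : σ.var 0 = i + todo.length) (h31 : σ.var 31 = i) (h40 : σ.var 40 = S)
    (h15 : σ.var 15 = ((todo.map Prod.fst).headD last))
    (hlink : LinkSeg σ.mem q last (todo.map Prod.fst))
    (hlab : ∀ e ∈ todo, σ.mem (e.1 + 1) = e.2 ∧ S + σ.var 0 ≤ e.1) :
    Runs inp (.loop (.le (v#31 + 1) v#0)
      ((v#40 + v#31) ⇐ M[v#15 + 1] ;; 15 ≔ M[v#15 + 3] ;; 31 ≔ v#31 + 1)) σ
      (14 * todo.length + 2) fun σ' =>
      (∀ (k : ℕ) (h : k < todo.length), σ'.mem (S + i + k) = (todo[k]).2) ∧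
      (∀ z, z < S + i → σ'.mem z = σ.mem z) ∧ ∀ v, v ≠ 15 → v ≠ 31 → σ'.var v = σ.var v := by
  induction todo generalizing σ i q with
  | nil =>
    refine .loop_done ?_ ?_ ⟨by simp, fun _ _ => rfl, fun _ _ _ => rfl⟩
    · simp [h31, h0]
    · simp [Test.cost, Expr.cost]
  | cons e todo ih =>
    obtain ⟨l1, l2, l3⟩ := hlink
    have he := hlab e (by simp)
    simp only [List.length_cons] at h0
    simp only [List.map_cons, List.headD_cons] at h15
    refine .loop_step (t₁ := 10) (t₂ := 14 * todo.length + 2) (by simp [h31, h0])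
      (Runs.eval (by simp) (by decide) ?_)
      (by simp [Test.cost, Expr.cost]; omega)
    have hne : ∀ z, S + σ.var 0 ≤ z → z ≠ S + i := fun z hz => by omega
    have h3 : e.1 + 3 ≠ S + i := hne _ (by omega)
    refine (ih _ (i + 1) e.1 ?_ ?_ ?_ ?_ ?_ ?_).imp ?_
    · simp [h0]; omega
    · simp [h31]
    · simp [h40]
    · simp [h15, h40, h31, h3, l2]
    · refine LinkSeg.congr (m := σ.mem) l3 fun y hy => ?_
      obtain ⟨e', he', rfl⟩ := List.mem_map.1 hy
      have := (hlab e' (by simp [he'])).2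
      simp only [Cmd.eval, Expr.eval, Expr.eval_plus, h40, h31]
      exact ⟨Function.update_of_ne (hne _ (by omega)) _ _,
        Function.update_of_ne (hne _ (by omega)) _ _⟩
    · intro e' he'
      have := hlab e' (by simp [he'])
      simp only [Cmd.eval, Expr.eval, Expr.eval_plus, h40, h31]
      refine ⟨?_, by simpa using this.2⟩
      rw [Function.update_of_ne (hne _ (by omega))]
      exact this.1
    · rintro σ' ⟨a1, a2, a3⟩
      refine ⟨?_, ?_, ?_⟩
      · intro k hk
        cases k with
        | zero =>
          rw [a2 _ (by omega)]
          simp [h40, h31, h15, he.1]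
        | succ k =>
          have := a1 k (by simpa using hk)
          rw [show S + i + (k + 1) = S + (i + 1) + k by ring]
          simpa using this
      · intro z hz
        rw [a2 z (by omega)]
        simp [h40, h31, show z ≠ S + i by omega]
      · intro v h1 h2
        rw [a3 v h1 h2]
        simp [h1, h2]

/-- Eight arrays of `n` cells from address `1` on: leaf pointers, anchors, the list of non-bottom
intervals, the sorted order, containment-leaf flags, links and heads of the depth lists, and bottom
intervals. The sorting tree follows, starting as one dummy leaf because a leaf-based tree cannot be
empty; at six cells for that leaf and twelve per insertion it ends at `20 * n + 7`. -/
def layoutArrays : Cmd :=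
  2 ≔ 1 ;; 3 ≔ v#0 + 1 ;; 4 ≔ v#3 + v#0 ;; 40 ≔ v#4 + v#0 ;; 41 ≔ v#40 + v#0 ;;
  42 ≔ v#41 + v#0 ;; 43 ≔ v#42 + v#0 ;; 44 ≔ v#43 + v#0 ;; 1 ≔ v#44 + v#0 ;;
  (v#1 + 1) ⇐ v#0 ;; 6 ≔ v#1 + 6 ;; 31 ≔ 0

def sortIntervals : Cmd :=
  layoutArrays ;; .loop (.le (v#31 + 1) v#0) insertInterval ;; copyLeaves

/-- The layout of the arrays that are used in the preprocessing phase. -/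
structure Layout (n : ℕ) (σ : Store) : Prop where
  var0 : σ.var 0 = n
  var2 : σ.var 2 = 1
  var3 : σ.var 3 = n + 1
  var4 : σ.var 4 = 2 * n + 1
  var40 : σ.var 40 = 3 * n + 1
  var41 : σ.var 41 = 4 * n + 1
  var42 : σ.var 42 = 5 * n + 1
  var43 : σ.var 43 = 6 * n + 1
  var44 : σ.var 44 = 7 * n + 1
  var6 : σ.var 6 = 20 * n + 7

theorem Layout.congr {σ σ' : Store} (h : Layout n σ)
    (hv : ∀ v, v = 0 ∨ v = 2 ∨ v = 3 ∨ v = 4 ∨ v = 6 ∨ (40 ≤ v ∧ v ≤ 44) →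
      σ'.var v = σ.var v) : Layout n σ' :=
  ⟨(hv 0 (by simp)).trans h.var0, (hv 2 (by simp)).trans h.var2, (hv 3 (by simp)).trans h.var3,
    (hv 4 (by simp)).trans h.var4, (hv 40 (by simp)).trans h.var40, (hv 41 (by simp)).trans h.var41,
    (hv 42 (by simp)).trans h.var42, (hv 43 (by simp)).trans h.var43,
    (hv 44 (by simp)).trans h.var44, (hv 6 (by simp)).trans h.var6⟩

theorem sortIntervals_runs (R : IntervalSet κ n) :
    ∃ ps : List (Fin n), ps.Perm (List.finRange n) ∧ ps.Pairwise R.Before ∧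
      Runs R.preInput sortIntervals (initStore n) (90 * (n * Nat.log 2 n) + 1500 * n + 500)
        fun σ' => Layout n σ' ∧
          ∀ (k : ℕ) (h : k < ps.length), σ'.mem (3 * n + 1 + k) = ps[k] := by
  set r := 8 * n + 1 with hr
  obtain ⟨σ₁, t₁, hx₁, ht₁, b0, b1, b2, b3, b4, b40, b41, b42, b43, b44, b6, b31, bm⟩ :
      Runs R.preInput layoutArrays (initStore n) 30 fun σ' => σ'.var 0 = n ∧ σ'.var 1 = r ∧
        σ'.var 2 = 1 ∧ σ'.var 3 = n + 1 ∧ σ'.var 4 = 2 * n + 1 ∧ σ'.var 40 = 3 * n + 1 ∧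
        σ'.var 41 = 4 * n + 1 ∧ σ'.var 42 = 5 * n + 1 ∧ σ'.var 43 = 6 * n + 1 ∧
        σ'.var 44 = 7 * n + 1 ∧ σ'.var 6 = r + 6 ∧ σ'.var 31 = 0 ∧
        σ'.mem = Function.update (fun _ => 0) (r + 1) n := by
    refine Runs.eval (by simp [layoutArrays]) (by decide) ?_
    have hr' : n + 1 + n + n + n + n + n + n + n = r := by omega
    simp [layoutArrays, initStore, hr']
    omega
  have hleaf : PTree.TreeIn σ₁.mem 1 n (r + 6) (.leaf r n) := by
    refine ⟨?_, ?_, ?_, by simp [PTree.Sep, PTree.addrs], ?_, trivial, by omega⟩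
    · simp [PTree.Rep, bm]
    · simp [PTree.leafEntries, LinkSeg, bm]
    · intro a ha h
      simp [PTree.leafEntries] at h
      omega
    · intro p hp
      simp only [PTree.addrs, List.mem_singleton] at hp
      omega
  obtain ⟨T, ps, e1, σ₂, t₂, hx₂, ht₂, c1, c2, c3, c4, c5, c7, c6⟩ := sort_loop_runs (R := R) n σ₁
    (.leaf r n) [] (r + 6) 0 (by omega) b0 b1 b2 b6 b31 hleaf
    (by simp [PTree.leafEntries]) (by simp) (by simp) (by simp)
  have hlenps : ps.length = n := by simpa using e1.length_eq
  refine ⟨ps, e1, c4, ?_⟩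
  have hlen : T.leafEntries.length = n + 1 := by
    have h := congrArg List.length c3
    simpa [hlenps] using h
  have hheight := PTree.height_le_log c1.avl hlen.le
  obtain ⟨σ₃, t₃, hx₃, ht₃, ⟨d10, d12⟩, d0, d1⟩ :
      Runs R.preInput (10 ≔ v#1 ;; 12 ≔ 0) σ₂ 2 fun σ' =>
        (σ'.var 10 = T.addr ∧ σ'.var 12 = PTree.sideCode true) ∧
        (∀ v, v ∉ (10 ≔ v#1 ;; 12 ≔ 0).assigned → σ'.var v = σ₂.var v) ∧ σ'.mem = σ₂.mem :=
    Runs.frame_mem (Runs.eval (by simp) (by decide) (by simp [c2, PTree.sideCode]))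
      (by simp [Cmd.ReadOnly])
  have hwalk : Runs R.preInput PTree.walk σ₃ (12 * Nat.log 2 n + 22) fun σ' =>
      ∃ L e, PTree.towards true T = L ++ [e] ∧ σ'.var 15 = e.1 := by
    refine Runs.seq' (t₁ := 1) (t₂ := 6 * (2 * Nat.log 2 n + 3) + 2)
      (Runs.eval (by simp) (by decide) ?_) (by omega)
    exact PTree.walk_loop_runs true _ T 0 _ hheight (by simp [d10]) (by simp [d12])
      (by simpa [d1] using c1.rep)
  obtain ⟨σ₄, t₄, hx₄, ht₄, ⟨⟨L, e, k0, k1⟩, k2, k3⟩⟩ :=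
    hwalk.frame_mem (by simp [PTree.walk, Cmd.ReadOnly])
  have hent : T.leafEntries = e :: L.reverse := by
    rw [← List.reverse_reverse T.leafEntries]
    simp only [PTree.towards, if_true] at k0
    rw [k0]; simp
  have hv₄ : ∀ v, v ≠ 10 → v ≠ 12 → v ≠ 15 → σ₄.var v = σ₂.var v := by
    intro v h1 h2 h3
    rw [k2 v (by simp [PTree.walk, Cmd.assigned]; omega), d0 v (by simp [Cmd.assigned]; omega)]
  have hm₄ : σ₄.mem = σ₂.mem := k3.trans d1
  -- all leaves but the last one
  obtain ⟨todo, last, hsplit⟩ : ∃ todo last, T.leafEntries = todo ++ [last] := by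
    rcases List.eq_nil_or_concat T.leafEntries with h | ⟨A, a, h⟩
    · exact absurd h (PTree.leafEntries_ne_nil T)
    · exact ⟨A, a, by rw [h, List.concat_eq_append]⟩
  have htodo : todo.length = n := by rw [hsplit] at hlen; simpa using hlen
  have hps : todo.map Prod.snd = ps.map Fin.val := by
    rw [hsplit, List.map_append] at c3
    exact List.append_inj_left c3 (by simp [htodo, hlenps])
  have haddr : ∀ q ∈ T.addrs, 8 * n + 1 ≤ q := by
    intro q hq
    rcases c7 q hq with h | h
    · simp only [PTree.addrs, List.mem_singleton] at h
      omega
    · omega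
  have hcopy := copy_loop_runs (inp := R.preInput) todo ⟨Function.update σ₄.var 31 0, σ₄.mem⟩
    (3 * n + 1) 0 last.1 0
    (by simp [hv₄ 0, c6 0, b0, htodo]) (by simp) (by simp [hv₄ 40, c6 40, b40])
    (by
      have h' : (todo.map Prod.fst).headD last.1 = e.1 := by
        have h := hsplit.symm.trans hent
        cases todo with
        | nil => simp at h; simp [h]
        | cons a todo => simp at h; simp [h]
      rw [h']
      simpa using k1)
    (by
      have h := c1.links
      rw [hsplit, List.map_append, linkSeg_append] at h
      simpa [hm₄] using h.1)
    (by
      intro e' he'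
      have hmem : e' ∈ T.leafEntries := by rw [hsplit]; simp [he']
      have h1 := haddr e'.1 (PTree.fst_mem_addrs hmem)
      refine ⟨by simpa [hm₄] using (PTree.stored_of_mem_leafEntries c1.rep hmem).2, ?_⟩
      simp [hv₄ 0, c6 0, b0]
      omega)
  obtain ⟨σ₅, t₅, hx₅, ht₅, m1, -, m3⟩ := hcopy
  have hvar : ∀ v, v < 6 ∨ 31 < v → σ₅.var v = σ₁.var v := by
    intro v hv
    rw [m3 v (by omega) (by omega), ← c6 v hv, ← hv₄ v (by omega) (by omega) (by omega)]
    exact Function.update_of_ne (by omega) _ _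
  refine ⟨σ₅, t₁ + (t₂ + (t₃ + (t₄ + (1 + t₅)))), ?_, ?_, ⟨?_, ?_, ?_, ?_, ?_, ?_, ?_, ?_, ?_, ?_⟩,
    ?_⟩
  · refine .seq hx₁ (.seq hx₂ ?_)
    cases hx₃ with
    | seq h1 h2 =>
      rw [add_assoc]
      exact .seq h1 (.seq h2 (.seq hx₄ (.seq (.assign 31 0 σ₄) hx₅)))
  · have h1 : (PTree.leaf r n).potential = 0 := rfl
    rw [h1] at ht₂
    rw [htodo] at ht₅
    have h2 : (90 * Nat.log 2 n + 1400) * n = 90 * (n * Nat.log 2 n) + 1400 * n := by ring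
    have h3 : Nat.log 2 n ≤ n := Nat.log_le_self _ _
    omega
  · rw [hvar 0 (by omega), b0]
  · rw [hvar 2 (by omega), b2]
  · rw [hvar 3 (by omega), b3]
  · rw [hvar 4 (by omega), b4]
  · rw [hvar 40 (by omega), b40]
  · rw [hvar 41 (by omega), b41]
  · rw [hvar 42 (by omega), b42]
  · rw [hvar 43 (by omega), b43]
  · rw [hvar 44 (by omega), b44]
  · rw [m3 6 (by omega) (by omega)]
    simp [hv₄ 6, c5]
    omega
  · intro k hk
    have h1 := m1 k (by omega)
    have h2 : (todo.map Prod.snd)[k]'(by simp; omega) = (ps.map Fin.val)[k]'(by simpa using hk) := by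
      simp only [hps]
    simp only [List.getElem_map] at h2
    rw [← h2, ← h1]

end Sorting

/-! ### Bottom intervals and anchors -/

/-- The left endpoint of one interval does not exceed the right endpoint of another one (and is
smaller for open intervals). -/
def IntervalSet.Meets {κ : IntervalKind} {n : ℕ} (R : IntervalSet κ n) (m i : Fin n) : Prop :=
  match κ with
  | .isOpen => R.left m < R.right i
  | .isClosed => R.left m ≤ R.right i

section Classification

variable {κ : IntervalKind} {n : ℕ} {R : IntervalSet κ n} {π : Equiv.Perm (Fin n)}

namespace IntervalSet

theorem Before.left_le {i j : Fin n} (h : R.Before i j) : R.left i ≤ R.left j :=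
  h.elim le_of_lt fun h => h.1.le

theorem ssubset_iff_of_before {i j : Fin n} (h : R.Before i j) (hij : i ≠ j) :
    R.region j ⊂ R.region i ↔ R.right j ≤ R.right i := by
  rw [R.region_ssubset_iff]
  exact ⟨fun h => h.2.2, fun h' => ⟨hij.symm, h.left_le, h'⟩⟩

theorem not_ssubset_of_before {i j : Fin n} (h : R.Before i j) : ¬ R.region i ⊂ R.region j := by
  rw [R.region_ssubset_iff]
  rintro ⟨h1, h2, h3⟩
  rcases h with h | h
  · exact h2.not_gt h
  · exact h1 (R.eq_of_endpoints h.1 (le_antisymm h3 h.2))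

theorem nonempty_inter_of_meets {m i : Fin n} (hl : R.left i ≤ R.left m)
    (hr : R.right i < R.right m) (h : R.Meets m i) : (R.region m ∩ R.region i).Nonempty := by
  cases κ
  · obtain ⟨z, h1, h2⟩ := exists_between (show R.left m < R.right i from h)
    exact ⟨z, ⟨h1, h2.trans hr⟩, ⟨hl.trans_lt h1, h2⟩⟩
  · exact ⟨R.right i, ⟨h, hr.le⟩, ⟨R.left_le_right i, le_rfl⟩⟩

theorem meets_of_nonempty_inter {m i j : Fin n} (hl : R.left m ≤ R.left j)
    (h : (R.region j ∩ R.region i).Nonempty) : R.Meets m i := by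
  obtain ⟨z, h1, h2⟩ := h
  cases κ
  · exact hl.trans_lt (h1.1.trans h2.2)
  · exact hl.trans (h1.1.trans h2.2)

end IntervalSet

/-- The interval at `m` is the last leaf among the intervals `don`. -/
structure LastLeaf (R : IntervalSet κ n) (don : List (Fin n)) (m : Fin n) : Prop where
  mem : m ∈ don
  leaf : IsContainmentLeaf R m
  right_le : ∀ j ∈ don, R.right m ≤ R.right j
  left_le : ∀ j ∈ don, IsContainmentLeaf R j → R.left m ≤ R.left j

section Step

variable {todo don : List (Fin n)} {i m : Fin n} (hps : (todo ++ i :: don).Pairwise R.Before)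
  (hnd : (todo ++ i :: don).Nodup) (hall : ∀ j, j ∈ todo ++ i :: don)

include hps hnd

/-- The interval `i` starts no later than `m`, so it contains `m` unless it ends before `m`. -/
theorem not_isContainmentLeaf_of_lastLeaf (hm : LastLeaf R don m) (h : ¬ R.right i < R.right m) :
    ¬ IsContainmentLeaf R i := by
  rw [List.pairwise_append, List.pairwise_cons] at hps
  rw [List.nodup_append, List.nodup_cons] at hnd
  have hne : i ≠ m := fun e => hnd.2.1.1 (e ▸ hm.mem)
  exact fun hl => hl m
    ((IntervalSet.ssubset_iff_of_before (hps.2.1.1 m hm.mem) hne).2 (not_lt.1 h))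

include hall

/-- Intervals that come earlier in the sorted order cannot be contained in `i`, and those that come
later all end to its right. -/
theorem isContainmentLeaf_of_forall (h : ∀ j ∈ don, R.right i < R.right j) :
    IsContainmentLeaf R i := by
  intro j hj
  rw [List.pairwise_append, List.pairwise_cons] at hps
  rcases List.mem_append.1 (hall j) with hj' | hj'
  · exact IntervalSet.not_ssubset_of_before (hps.2.2 j hj' i (by simp)) hj
  · rcases List.mem_cons.1 hj' with rfl | hj'
    · exact hj.ne rfl
    · exact (h j hj').not_ge ((R.region_ssubset_iff j i).1 hj).2.2

/-- The predecessors of a containment leaf in `π` are leaves further to the right. The scan from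
right to left has therefore already met all of them. -/
theorem mem_of_leaf_of_lt (hπ : IsLevelPermutation R π) (hi : IsContainmentLeaf R i) {j : Fin n}
    (hj : π j < π i) : j ∈ don ∧ IsContainmentLeaf R j ∧ R.right i < R.right j := by
  rw [← level_eq_one_iff] at hi
  have h1 := one_le_level R j
  have hjl : level R j = 1 ∧ R.right i < R.right j := by
    rcases (hπ.lt_iff j i).1 hj with h | h
    · omega
    · exact ⟨h.1.trans hi, h.2⟩
  have hjl' := (level_eq_one_iff R j).1 hjl.1
  rw [List.pairwise_append, List.pairwise_cons] at hps
  rcases List.mem_append.1 (hall j) with hj' | hj'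
  · have hb := hps.2.2 j hj' i (by simp)
    exact absurd ((R.region_ssubset_iff i j).2 ⟨fun e => hj.ne (by rw [e]), hb.left_le, hjl.2.le⟩)
      (hjl' i)
  · rcases List.mem_cons.1 hj' with rfl | hj'
    · exact absurd rfl hj.ne
    · exact ⟨hj', hjl', hjl.2⟩

/-- One comparison suffices: the last leaf has the smallest left endpoint among the leaves already
met, so if it does not meet `i`, no predecessor of `i` does. -/
theorem isBottom_of_leaf (hπ : IsLevelPermutation R π) (hi : IsContainmentLeaf R i)
    (h : don = [] ∨ LastLeaf R don m ∧ ¬ R.Meets m i) : IsBottom R π i := by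
  refine Finset.eq_singleton_iff_unique_mem.2 ⟨self_mem_contactSet R π i, fun j hj => ?_⟩
  obtain ⟨h1, h2⟩ := mem_contactSet.1 hj
  by_contra hne
  have hlt : π j < π i := lt_of_le_of_ne h1 fun e => hne (π.injective e)
  obtain ⟨h3, h4, -⟩ := mem_of_leaf_of_lt hps hnd hall hπ hi hlt
  rcases h with h | ⟨hm, h⟩
  · simp [h] at h3
  · exact h (IntervalSet.meets_of_nonempty_inter (hm.left_le j h3 h4) h2)

/-- The last leaf is the immediate predecessor of `i` in `π`, since an interval between them would
be a leaf already met with a smaller right endpoint. -/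
theorem not_isBottom_of_leaf (hπ : IsLevelPermutation R π) (hi : IsContainmentLeaf R i)
    (hm : LastLeaf R don m) (hr : R.right i < R.right m) (h : R.Meets m i) :
    ¬ IsBottom R π i ∧ IsAnchor R π i m := by
  have hli := (level_eq_one_iff R i).2 hi
  have hlm := (level_eq_one_iff R m).2 hm.leaf
  have hlt : π m < π i := hπ m i (.inr ⟨hlm.trans hli.symm, hr⟩)
  have hb : R.Before i m := by
    rw [List.pairwise_append, List.pairwise_cons] at hps
    exact hps.2.1.1 m hm.mem
  refine ⟨fun hbot => hbot.not_nonempty_inter hlt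
    (IntervalSet.nonempty_inter_of_meets hb.left_le hr h), fun _ => ?_, fun h => absurd hli h⟩
  by_contra hne
  have hlt' := Fin.lt_def.1 hlt
  have hj : (π m : ℕ) + 1 < n := by have := (π i).2; omega
  set j := π.symm ⟨(π m : ℕ) + 1, hj⟩ with hjdef
  have hπj : (π j : ℕ) = π m + 1 := by simp [hjdef]
  obtain ⟨h1, h2, h3⟩ := mem_of_leaf_of_lt hps hnd hall hπ hi (j := j)
    (Fin.lt_def.2 (by omega))
  have hmj : π m < π j := Fin.lt_def.2 (by omega)
  rcases (hπ.lt_iff m j).1 hmj with h4 | h4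
  · have := (level_eq_one_iff R j).2 h2
    omega
  · exact (hm.right_le j h1).not_gt h4.2

end Step

/-- Only strict comparisons of reals are available, so for closed intervals the negation is tested
and the branches are exchanged. -/
def ifMeets (κ : IntervalKind) (c d : Cmd) : Cmd :=
  match κ with
  | .isOpen => .ite (.less .left v#45 .right v#7) c d
  | .isClosed => .ite (.less .right v#7 .left v#45) d c

/-- Bottom intervals are found from right to left; filling their array from its upper end downwards
leaves them in increasing order. -/
def markBottom : Cmd :=
  46 ≔ v#46 - 1 ;; (v#44 + v#46) ⇐ v#7 ;; (v#41 + v#7) ⇐ 1 ;; 45 ≔ v#7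

/-- Within level one, `π` runs from right to left just as the scan does, so the non-bottom leaves
can be appended directly to the list of non-bottom intervals. -/
def markLeaf : Cmd :=
  (v#4 + v#5) ⇐ v#7 ;; 5 ≔ v#5 + 1 ;; (v#41 + v#7) ⇐ 1 ;; 45 ≔ v#7

/-- Processes the next interval in the sorted order from right to left. -/
def classifyNext (κ : IntervalKind) : Cmd :=
  31 ≔ v#31 - 1 ;; 7 ≔ M[v#40 + v#31] ;; (v#3 + v#7) ⇐ v#45 ;;
  .ite (.le v#0 v#45) markBottom
    (.ite (.less .right v#7 .right v#45) (ifMeets κ markLeaf markBottom) ((v#41 + v#7) ⇐ 0))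

def classify (κ : IntervalKind) : Cmd :=
  5 ≔ 0 ;; 45 ≔ v#0 ;; 46 ≔ v#0 ;; 31 ≔ v#0 ;; .loop (.le 1 v#31) (classifyNext κ)

open Classical in
theorem classifyNext_eval (σ : Store) (hL : Layout n σ) (i : Fin n) (k : ℕ)
    (h31 : σ.var 31 = k + 1) (hi : σ.mem (3 * n + 1 + k) = i) (m : Fin n) :
    Runs R.preInput (classifyNext κ) σ 40 fun σ' =>
      (∀ v, v ≠ 5 → v ≠ 7 → v ≠ 31 → v ≠ 45 → v ≠ 46 → σ'.var v = σ.var v) ∧ σ'.var 31 = k ∧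
      (σ.var 45 = n → σ'.var 45 = i ∧ σ'.var 5 = σ.var 5 ∧ σ'.var 46 = σ.var 46 - 1 ∧
        σ'.mem = Function.update (Function.update (Function.update σ.mem (n + 1 + i) (σ.var 45))
          (7 * n + 1 + (σ.var 46 - 1)) i) (4 * n + 1 + i) 1) ∧
      (σ.var 45 = m → R.right i < R.right m → ¬ R.Meets m i →
        σ'.var 45 = i ∧ σ'.var 5 = σ.var 5 ∧ σ'.var 46 = σ.var 46 - 1 ∧
        σ'.mem = Function.update (Function.update (Function.update σ.mem (n + 1 + i) (σ.var 45))
          (7 * n + 1 + (σ.var 46 - 1)) i) (4 * n + 1 + i) 1) ∧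
      (σ.var 45 = m → R.right i < R.right m → R.Meets m i →
        σ'.var 45 = i ∧ σ'.var 5 = σ.var 5 + 1 ∧ σ'.var 46 = σ.var 46 ∧
        σ'.mem = Function.update (Function.update (Function.update σ.mem (n + 1 + i) (σ.var 45))
          (2 * n + 1 + σ.var 5) i) (4 * n + 1 + i) 1) ∧
      (σ.var 45 = m → ¬ R.right i < R.right m →
        σ'.var 45 = m ∧ σ'.var 5 = σ.var 5 ∧ σ'.var 46 = σ.var 46 ∧
        σ'.mem = Function.update (Function.update σ.mem (n + 1 + i) (σ.var 45))
          (4 * n + 1 + i) 0) := by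
  obtain ⟨l0, l2, l3, l4, l40, l41, l42, l43, l44, l6⟩ := hL
  have hval : ∀ i, toArray R.right (i : Fin n) = R.right i := fun i => toArray_val _ i
  have hval' : ∀ i, toArray R.left (i : Fin n) = R.left i := fun i => toArray_val _ i
  refine Runs.eval ?_ ?_ ?_
  · cases κ <;> simp [classifyNext, ifMeets, markLeaf, markBottom]
  · cases κ <;> decide
  · refine ⟨?_, ?_, ?_, ?_, ?_, ?_⟩
    · intro v h1 h2 h3 h4 h5
      cases κ <;> simp [classifyNext, ifMeets, markLeaf, markBottom] <;> split_ifs <;>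
        simp only [Function.update_of_ne, h1, h2, h3, h4, h5, ne_eq, not_false_eq_true]
    · cases κ <;> simp [classifyNext, ifMeets, markLeaf, markBottom, h31] <;> split_ifs <;> simp
    · intro h
      cases κ <;> simp [classifyNext, ifMeets, markLeaf, markBottom, h31, h, l0, l3, l40, l41,
        l44, hi]
    · intro h h1 h2
      have hm : ¬ n ≤ (m : ℕ) := m.2.not_ge
      cases κ <;> simp only [IntervalSet.Meets, not_lt, not_le] at h2 <;>
      simp [classifyNext, ifMeets, markLeaf, markBottom, h31, h, l0, l3, l40, l41, l44, hi, hval,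
        hval', h1, h2, IntervalSet.preInput, IntervalSet.fullInput, hm, h2.not_gt]
    · intro h h1 h2
      have hm : ¬ n ≤ (m : ℕ) := m.2.not_ge
      cases κ <;> simp only [IntervalSet.Meets] at h2 <;>
      simp [classifyNext, ifMeets, markLeaf, markBottom, h31, h, l0, l3, l4, l40, l41, l44, hi, hval,
        hval', h1, h2, IntervalSet.preInput, IntervalSet.fullInput, hm, h2.not_gt]
    · intro h h1
      have hm : ¬ n ≤ (m : ℕ) := m.2.not_ge
      cases κ <;>
      simp [classifyNext, ifMeets, markLeaf, markBottom, h31, h, l0, l3, l4, l40, l41, l44, hi, hval,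
        hval', h1, IntervalSet.preInput, IntervalSet.fullInput, hm]

end Classification

/-! ### The invariant of the classification scan -/

section Classification

variable {κ : IntervalKind} {n : ℕ} {R : IntervalSet κ n} {π : Equiv.Perm (Fin n)}

open Classical in
/-- The intervals in `don` have been classified; `ol` are those leaves among them that are not
bottom intervals, and `bl` the bottom intervals. -/
structure Classified (R : IntervalSet κ n) (π : Equiv.Perm (Fin n)) (don ol bl : List (Fin n))
    (σ : Store) : Prop where
  last : don = [] ∧ σ.var 45 = n ∨ ∃ m, LastLeaf R don m ∧ σ.var 45 = m
  count : σ.var 5 = ol.length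
  cursor : σ.var 46 + bl.length = n
  flag : ∀ j ∈ don, σ.mem (4 * n + 1 + j) = if IsContainmentLeaf R j then 1 else 0
  anchor : ∀ j ∈ don, ¬ IsBottom R π j → ∃ a, IsAnchor R π j a ∧ σ.mem (n + 1 + j) = a
  others : ∀ (k : ℕ) (h : k < ol.length), σ.mem (2 * n + 1 + k) = ol[k]
  others_sorted : ol.Pairwise fun i j => π i < π j
  mem_others : ∀ j, j ∈ ol ↔ j ∈ don ∧ IsContainmentLeaf R j ∧ ¬ IsBottom R π j
  bottoms : ∀ (k : ℕ) (h : k < bl.length), σ.mem (7 * n + 1 + σ.var 46 + k) = bl[k]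
  bottoms_sorted : bl.Pairwise fun i j => R.left i < R.left j
  mem_bottoms : ∀ j, j ∈ bl ↔ j ∈ don ∧ IsBottom R π j

theorem IsBottom.isContainmentLeaf (hπ : IsLevelPermutation R π) {i : Fin n}
    (h : IsBottom R π i) : IsContainmentLeaf R i :=
  (level_eq_one_iff R i).1 (h.level_eq_one hπ)

section Step

variable {todo don ol bl : List (Fin n)} {i m : Fin n} {σ σ' : Store}

theorem Classified.length_lt (hC : Classified R π don ol bl σ) (hnd : (i :: don).Nodup) :
    ol.length < n ∧ bl.length < n := by
  have h1 := hnd.length_le_card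
  simp only [List.length_cons, Fintype.card_fin] at h1
  have h2 : ol.Nodup := hC.others_sorted.imp fun h => fun e => h.ne (by rw [e])
  have h3 : bl.Nodup := hC.bottoms_sorted.imp fun h => fun e => h.ne (by rw [e])
  have h4 := (h2.subperm fun j hj => ((hC.mem_others j).1 hj).1).length_le
  have h5 := (h3.subperm fun j hj => ((hC.mem_bottoms j).1 hj).1).length_le
  omega

variable (hps : (todo ++ i :: don).Pairwise R.Before) (hnd : (todo ++ i :: don).Nodup)

include hps hnd

theorem right_lt_of_leaf (hi : IsContainmentLeaf R i) {j : Fin n} (hj : j ∈ don) :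
    R.right i < R.right j := by
  rw [List.pairwise_append, List.pairwise_cons] at hps
  rw [List.nodup_append, List.nodup_cons] at hnd
  by_contra h
  exact hi j ((IntervalSet.ssubset_iff_of_before (hps.2.1.1 j hj)
    fun e => hnd.2.1.1 (e ▸ hj)).2 (not_lt.1 h))

theorem before_of_mem {j : Fin n} (hj : j ∈ don) : R.Before i j ∧ i ≠ j := by
  rw [List.pairwise_append, List.pairwise_cons] at hps
  rw [List.nodup_append, List.nodup_cons] at hnd
  exact ⟨hps.2.1.1 j hj, fun e => hnd.2.1.1 (e ▸ hj)⟩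

theorem lastLeaf_of_leaf (hi : IsContainmentLeaf R i) : LastLeaf R (i :: don) i := by
  refine ⟨by simp, hi, fun j hj => ?_, fun j hj _ => ?_⟩
  · rcases List.mem_cons.1 hj with rfl | hj
    · exact le_rfl
    · exact (right_lt_of_leaf hps hnd hi hj).le
  · rcases List.mem_cons.1 hj with rfl | hj
    · exact le_rfl
    · exact (before_of_mem hps hnd hj).1.left_le

theorem LastLeaf.cons (hm : LastLeaf R don m) (h : ¬ R.right i < R.right m) :
    LastLeaf R (i :: don) m := by
  refine ⟨by simp [hm.mem], hm.leaf, fun j hj => ?_, fun j hj hl => ?_⟩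
  · rcases List.mem_cons.1 hj with rfl | hj
    · exact not_lt.1 h
    · exact hm.right_le j hj
  · rcases List.mem_cons.1 hj with rfl | hj
    · exact absurd hl (not_isContainmentLeaf_of_lastLeaf hps hnd hm h)
    · exact hm.left_le j hj hl

theorem Classified.cons_bottom (hπ : IsLevelPermutation R π) (hC : Classified R π don ol bl σ)
    (hi : IsBottom R π i) (h5 : σ'.var 5 = σ.var 5) (h45 : σ'.var 45 = i)
    (h46 : σ'.var 46 = σ.var 46 - 1) (x : ℕ)
    (hm : σ'.mem = Function.update (Function.update (Function.update σ.mem (n + 1 + i) x)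
      (7 * n + 1 + (σ.var 46 - 1)) i) (4 * n + 1 + i) 1) :
    Classified R π (i :: don) ol (i :: bl) σ' := by
  have hl := hi.isContainmentLeaf hπ
  obtain ⟨l1, l2⟩ := hC.length_lt (List.nodup_append.1 hnd).2.1
  have hcur := hC.cursor
  have hin := i.2
  refine ⟨.inr ⟨i, lastLeaf_of_leaf hps hnd hl, h45⟩, h5.trans hC.count, ?_, ?_, ?_, ?_,
    hC.others_sorted, ?_, ?_, ?_, ?_⟩
  · rw [h46, List.length_cons]; omega
  · intro j hj
    rcases List.mem_cons.1 hj with rfl | hj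
    · simp [hm, hl]
    · have hne := Fin.val_ne_of_ne (before_of_mem hps hnd hj).2
      have := j.2
      rw [hm, ← hC.flag j hj]
      simp (disch := omega) only [Function.update_of_ne]
  · intro j hj hb
    rcases List.mem_cons.1 hj with rfl | hj
    · exact absurd hi hb
    · have hne := Fin.val_ne_of_ne (before_of_mem hps hnd hj).2
      have := j.2
      obtain ⟨a, ha, ha'⟩ := hC.anchor j hj hb
      refine ⟨a, ha, ?_⟩
      rw [hm, ← ha']
      simp (disch := omega) only [Function.update_of_ne]
  · intro k hk
    rw [hm, ← hC.others k hk]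
    simp (disch := omega) only [Function.update_of_ne]
  · intro j
    rw [hC.mem_others, List.mem_cons]
    constructor
    · exact fun h => ⟨.inr h.1, h.2⟩
    · rintro ⟨rfl | h, h'⟩
      · exact absurd hi h'.2
      · exact ⟨h, h'⟩
  · intro k hk
    rw [hm, h46]
    cases k with
    | zero => 
      simp (disch := omega) only [Function.update_of_ne, Function.update_self, add_zero,
        List.getElem_cons_zero]
    | succ k =>
      simp only [List.length_cons] at hk
      rw [List.getElem_cons_succ, ← hC.bottoms k (by omega),
        show 7 * n + 1 + (σ.var 46 - 1) + (k + 1) = 7 * n + 1 + σ.var 46 + k by omega]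
      simp (disch := omega) only [Function.update_of_ne]
  · refine List.pairwise_cons.2 ⟨fun j hj => ?_, hC.bottoms_sorted⟩
    have hj := ((hC.mem_bottoms j).1 hj).1
    have h1 := right_lt_of_leaf hps hnd hl hj
    rcases (before_of_mem hps hnd hj).1 with h | h
    · exact h
    · exact absurd h1 h.2.not_gt
  · intro j
    rw [List.mem_cons, List.mem_cons, hC.mem_bottoms]
    constructor
    · rintro (rfl | h)
      · exact ⟨.inl rfl, hi⟩
      · exact ⟨.inr h.1, h.2⟩
    · rintro ⟨h | h, h'⟩
      · exact .inl h
      · exact .inr ⟨h, h'⟩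

theorem Classified.cons_leaf (hπ : IsLevelPermutation R π) (hC : Classified R π don ol bl σ)
    (hl : IsContainmentLeaf R i) (hi : ¬ IsBottom R π i) (ha : IsAnchor R π i m)
    (h5 : σ'.var 5 = σ.var 5 + 1) (h45 : σ'.var 45 = i) (h46 : σ'.var 46 = σ.var 46)
    (hm : σ'.mem = Function.update (Function.update (Function.update σ.mem (n + 1 + i) m)
      (2 * n + 1 + σ.var 5) i) (4 * n + 1 + i) 1) :
    Classified R π (i :: don) (ol ++ [i]) bl σ' := by
  obtain ⟨l1, l2⟩ := hC.length_lt (List.nodup_append.1 hnd).2.1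
  have hcur := hC.cursor
  have hcnt := hC.count
  have hin := i.2
  refine ⟨.inr ⟨i, lastLeaf_of_leaf hps hnd hl, h45⟩, by rw [h5, hcnt]; simp, by rw [h46, hcur],
    ?_, ?_, ?_, ?_, ?_, ?_, hC.bottoms_sorted, ?_⟩
  · intro j hj
    rcases List.mem_cons.1 hj with rfl | hj
    · simp [hm, hl]
    · have hne := Fin.val_ne_of_ne (before_of_mem hps hnd hj).2
      have := j.2
      rw [hm, ← hC.flag j hj]
      simp (disch := omega) only [Function.update_of_ne]
  · intro j hj hb
    rcases List.mem_cons.1 hj with rfl | hj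
    · refine ⟨m, ha, ?_⟩
      rw [hm]
      simp (disch := omega) only [Function.update_of_ne, Function.update_self]
    · have hne := Fin.val_ne_of_ne (before_of_mem hps hnd hj).2
      have := j.2
      obtain ⟨a, ha, ha'⟩ := hC.anchor j hj hb
      refine ⟨a, ha, ?_⟩
      rw [hm, ← ha']
      simp (disch := omega) only [Function.update_of_ne]
  · intro k hk
    rw [List.length_append, List.length_singleton] at hk
    rw [hm, hcnt]
    rcases (Nat.lt_succ_iff_lt_or_eq.1 hk) with hk | rfl
    · rw [List.getElem_append_left hk, ← hC.others k hk]
      simp (disch := omega) only [Function.update_of_ne]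
    · rw [List.getElem_concat_length rfl]
      simp (disch := omega) only [Function.update_of_ne, Function.update_self]
  · rw [List.pairwise_append]
    refine ⟨hC.others_sorted, by simp, fun j hj k hk => ?_⟩
    obtain rfl := List.mem_singleton.1 hk
    obtain ⟨h1, h2, -⟩ := (hC.mem_others j).1 hj
    exact hπ j k (.inr ⟨((level_eq_one_iff R j).2 h2).trans ((level_eq_one_iff R k).2 hl).symm,
      right_lt_of_leaf hps hnd hl h1⟩)
  · intro j
    rw [List.mem_append, List.mem_singleton, hC.mem_others, List.mem_cons]
    constructor
    · rintro (h | rfl)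
      · exact ⟨.inr h.1, h.2⟩
      · exact ⟨.inl rfl, hl, hi⟩
    · rintro ⟨h | h, h'⟩
      · exact .inr h
      · exact .inl ⟨h, h'⟩
  · intro k hk
    rw [hm, h46, ← hC.bottoms k hk]
    simp (disch := omega) only [Function.update_of_ne]
  · intro j
    rw [List.mem_cons, hC.mem_bottoms]
    constructor
    · exact fun h => ⟨.inr h.1, h.2⟩
    · rintro ⟨rfl | h, h'⟩
      · exact absurd h' hi
      · exact ⟨h, h'⟩

/-- An interval that is not a containment leaf contains the last leaf, which thus serves as its
anchor and remains the last leaf. Its place in the list of non-bottom intervals is determined later,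
from its depth. -/
theorem Classified.cons_other (hπ : IsLevelPermutation R π) (hC : Classified R π don ol bl σ)
    (hlast : LastLeaf R don m) (hr : ¬ R.right i < R.right m)
    (h5 : σ'.var 5 = σ.var 5) (h45 : σ'.var 45 = m) (h46 : σ'.var 46 = σ.var 46)
    (hm : σ'.mem = Function.update (Function.update σ.mem (n + 1 + i) m) (4 * n + 1 + i) 0) :
    Classified R π (i :: don) ol bl σ' := by
  have hl := not_isContainmentLeaf_of_lastLeaf hps hnd hlast hr
  have hi : ¬ IsBottom R π i := fun h => hl (h.isContainmentLeaf hπ)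
  have ha : IsAnchor R π i m := by
    refine ⟨fun h => absurd ((level_eq_one_iff R i).1 h) hl, fun _ => ?_⟩
    have := before_of_mem hps hnd hlast.mem
    exact (IntervalSet.ssubset_iff_of_before this.1 this.2).2 (not_lt.1 hr)
  obtain ⟨l1, l2⟩ := hC.length_lt (List.nodup_append.1 hnd).2.1
  have hcur := hC.cursor
  have hin := i.2
  refine ⟨.inr ⟨m, hlast.cons hps hnd hr, h45⟩, by rw [h5, hC.count], by rw [h46, hcur],
    ?_, ?_, ?_, hC.others_sorted, ?_, ?_, hC.bottoms_sorted, ?_⟩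
  · intro j hj
    rcases List.mem_cons.1 hj with rfl | hj
    · simp [hm, hl]
    · have hne := Fin.val_ne_of_ne (before_of_mem hps hnd hj).2
      have := j.2
      rw [hm, ← hC.flag j hj]
      simp (disch := omega) only [Function.update_of_ne]
  · intro j hj hb
    rcases List.mem_cons.1 hj with rfl | hj
    · refine ⟨m, ha, ?_⟩
      rw [hm]
      simp (disch := omega) only [Function.update_of_ne, Function.update_self]
    · have hne := Fin.val_ne_of_ne (before_of_mem hps hnd hj).2
      have := j.2
      obtain ⟨a, ha, ha'⟩ := hC.anchor j hj hb
      refine ⟨a, ha, ?_⟩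
      rw [hm, ← ha']
      simp (disch := omega) only [Function.update_of_ne]
  · intro k hk
    rw [hm, ← hC.others k hk]
    simp (disch := omega) only [Function.update_of_ne]
  · intro j
    rw [hC.mem_others, List.mem_cons]
    constructor
    · exact fun h => ⟨.inr h.1, h.2⟩
    · rintro ⟨rfl | h, h'⟩
      · exact absurd h'.1 hl
      · exact ⟨h, h'⟩
  · intro k hk
    rw [hm, h46, ← hC.bottoms k hk]
    simp (disch := omega) only [Function.update_of_ne]
  · intro j
    rw [List.mem_cons, hC.mem_bottoms]
    constructor
    · exact fun h => ⟨.inr h.1, h.2⟩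
    · rintro ⟨rfl | h, h'⟩
      · exact absurd h' hi
      · exact ⟨h, h'⟩

end Step

theorem classifyNext_runs (hπ : IsLevelPermutation R π) {todo don ol bl : List (Fin n)} {i : Fin n}
    {σ : Store} (hps : (todo ++ i :: don).Pairwise R.Before) (hnd : (todo ++ i :: don).Nodup)
    (hall : ∀ j, j ∈ todo ++ i :: don) (hL : Layout n σ) (hC : Classified R π don ol bl σ)
    (h31 : σ.var 31 = todo.length + 1) (hi : σ.mem (3 * n + 1 + todo.length) = i) :
    Runs R.preInput (classifyNext κ) σ 40 fun σ' => Layout n σ' ∧ σ'.var 31 = todo.length ∧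
      (∀ k < n, σ'.mem (3 * n + 1 + k) = σ.mem (3 * n + 1 + k)) ∧
      ∃ ol' bl' : List (Fin n), Classified R π (i :: don) ol' bl' σ' := by
  obtain ⟨l1, l2⟩ := hC.length_lt (List.nodup_append.1 hnd).2.1
  have hin := i.2
  have hcnt := hC.count
  have hcur := hC.cursor
  rcases hC.last with ⟨hd, h45⟩ | ⟨m, hm, h45⟩
  · refine (classifyNext_eval σ hL i _ h31 hi i).imp ?_
    rintro σ' ⟨g1, g2, g3, -⟩
    obtain ⟨e45, e5, e46, em⟩ := g3 h45
    refine ⟨hL.congr fun v hv => g1 v (by omega) (by omega) (by omega) (by omega) (by omega), g2,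
      fun k hk => ?_, ol, i :: bl, ?_⟩
    · rw [em]; simp (disch := omega) only [Function.update_of_ne]
    · have hl : IsContainmentLeaf R i := isContainmentLeaf_of_forall hps hnd hall (by simp [hd])
      exact hC.cons_bottom hps hnd hπ (isBottom_of_leaf (m := i) hps hnd hall hπ hl (.inl hd)) e5
        e45 e46 _ em
  · refine (classifyNext_eval σ hL i _ h31 hi m).imp ?_
    rintro σ' ⟨g1, g2, -, g3, g4, g5⟩
    refine ⟨hL.congr fun v hv => g1 v (by omega) (by omega) (by omega) (by omega) (by omega), g2, ?_⟩
    by_cases hr : R.right i < R.right m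
    · have hl : IsContainmentLeaf R i := isContainmentLeaf_of_forall hps hnd hall
        fun j hj => hr.trans_le (hm.right_le j hj)
      by_cases hmeet : R.Meets m i
      · obtain ⟨e45, e5, e46, em⟩ := g4 h45 hr hmeet
        obtain ⟨hb, ha⟩ := not_isBottom_of_leaf hps hnd hall hπ hl hm hr hmeet
        refine ⟨fun k hk => ?_, ol ++ [i], bl, ?_⟩
        · rw [em]; simp (disch := omega) only [Function.update_of_ne]
        · exact hC.cons_leaf hps hnd hπ hl hb ha e5 e45 e46 (h45 ▸ em)
      · obtain ⟨e45, e5, e46, em⟩ := g3 h45 hr hmeet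
        refine ⟨fun k hk => ?_, ol, i :: bl, ?_⟩
        · rw [em]; simp (disch := omega) only [Function.update_of_ne]
        · exact hC.cons_bottom hps hnd hπ
            (isBottom_of_leaf hps hnd hall hπ hl (.inr ⟨hm, hmeet⟩)) e5 e45 e46 _ em
    · obtain ⟨e45, e5, e46, em⟩ := g5 h45 hr
      refine ⟨fun k hk => ?_, ol, bl, ?_⟩
      · rw [em]; simp (disch := omega) only [Function.update_of_ne]
      · exact hC.cons_other hps hnd hπ hm hr e5 e45 e46 (h45 ▸ em)

theorem classify_loop_runs (hπ : IsLevelPermutation R π) (todo don ol bl : List (Fin n))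
    {ps : List (Fin n)} (σ : Store) (hpseq : ps = todo ++ don) (hps : ps.Pairwise R.Before)
    (hnd : ps.Nodup) (hall : ∀ j, j ∈ ps) (hL : Layout n σ) (hC : Classified R π don ol bl σ)
    (h31 : σ.var 31 = todo.length)
    (harr : ∀ (k : ℕ) (h : k < ps.length), σ.mem (3 * n + 1 + k) = ps[k]) :
    Runs R.preInput (.loop (.le 1 v#31) (classifyNext κ)) σ (41 * todo.length + 1)
      fun σ' => Layout n σ' ∧ (∀ (k : ℕ) (h : k < ps.length), σ'.mem (3 * n + 1 + k) = ps[k]) ∧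
        ∃ ol' bl' : List (Fin n), Classified R π ps ol' bl' σ' := by
  induction todo using List.reverseRecOn generalizing don ol bl σ with
  | nil =>
    refine .loop_done (by simp [h31]) (by simp [Test.cost, Expr.cost]) ⟨hL, harr, ol, bl, ?_⟩
    rw [hpseq]
    exact hC
  | append_singleton todo i ih =>
    have hpseq' : ps = todo ++ i :: don := by simpa using hpseq
    have hlen : ps.length = n := by
      have h1 := hnd.length_le_card
      have h2 := (List.nodup_finRange n).subperm (l₂ := ps) fun j _ => hall j
      have := h2.length_le
      simp at h1 this
      omega
    have hk : todo.length < ps.length := by simp [hpseq']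
    refine .loop_step (t₁ := 40) (t₂ := 41 * todo.length + 1) (by simp [h31])
      ((classifyNext_runs (todo := todo) (don := don) hπ (by rwa [← hpseq']) (by rwa [← hpseq'])
        (by rwa [← hpseq']) hL hC (by simpa using h31) ?_).imp ?_)
      (by simp [Test.cost, Expr.cost]; omega)
    · rw [harr _ hk]
      simp [hpseq']
    · rintro σ' ⟨g1, g2, g3, ol', bl', g4⟩
      refine ih _ ol' bl' σ' hpseq' g1 g4 g2 fun k h => ?_
      rw [g3 k (by omega), harr k h]

theorem classify_runs (hπ : IsLevelPermutation R π) {ps : List (Fin n)} (σ : Store)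
    (hps : ps.Pairwise R.Before) (hperm : ps.Perm (List.finRange n)) (hL : Layout n σ)
    (harr : ∀ (k : ℕ) (h : k < ps.length), σ.mem (3 * n + 1 + k) = ps[k]) :
    Runs R.preInput (classify κ) σ (41 * n + 10)
      fun σ' => Layout n σ' ∧ (∀ (k : ℕ) (h : k < ps.length), σ'.mem (3 * n + 1 + k) = ps[k]) ∧
        ∃ ol bl : List (Fin n), Classified R π ps ol bl σ' := by
  have hlen : ps.length = n := by simpa using hperm.length_eq
  refine .seq' (t₁ := 1) (t₂ := 41 * n + 4) (.eval (by simp) (by decide) ?_) (by omega)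
  refine .seq' (t₁ := 1) (t₂ := 41 * n + 3) (.eval (by simp) (by decide) ?_) (by omega)
  refine .seq' (t₁ := 1) (t₂ := 41 * n + 2) (.eval (by simp) (by decide) ?_) (by omega)
  refine .seq' (t₁ := 1) (t₂ := 41 * n + 1) (.eval (by simp) (by decide) ?_) (by omega)
  have h0 := hL.var0
  refine (classify_loop_runs (ps := ps) hπ ps [] [] [] _ (by simp) hps
    (hperm.nodup_iff.2 (List.nodup_finRange n)) (fun j => hperm.mem_iff.2 (by simp)) ?_ ?_ ?_
    ?_).mono (by omega) fun _ => id
  · refine hL.congr fun v hv => ?_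
    simp (disch := omega) only [Cmd.eval, Function.update_of_ne]
  · exact ⟨.inl ⟨rfl, by simp [h0]⟩, by simp, by simp [h0], by simp, by simp, by simp, by simp,
      by simp, by simp, by simp, by simp⟩
  · simp [h0, hlen]
  · simpa using harr

end Classification

/-! ### Depths -/

section Depths

variable {κ : IntervalKind} {n : ℕ} {R : IntervalSet κ n}

theorem depth_lt (i : Fin n) : depth R i < n := by
  classical
  have hn : 0 < n := i.pos
  refine (Finset.sup_lt_iff (by simpa using hn)).2 fun C hC => ?_
  simp only [Finset.mem_filter, Finset.mem_univ, true_and] at hC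
  have hi : i ∉ C := fun h => (hC.1 i h).ne rfl
  simpa using Finset.card_lt_univ_of_notMem hi

/-- The memory holds the linked list `l`, which starts in `a`; pointers to the next element are
in the array at `s`, and `n` marks the end. -/
def ListAt (m : ℕ → ℕ) (s : ℕ) (a : ℕ) : List (Fin n) → Prop
  | [] => a = n
  | j :: l => a = j ∧ ListAt m s (m (s + j)) l

theorem ListAt.congr {m m' : ℕ → ℕ} {s a : ℕ} {l : List (Fin n)} (h : ListAt m s a l)
    (hm : ∀ j ∈ l, m' (s + j) = m (s + j)) : ListAt m' s a l := by
  induction l generalizing a with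
  | nil => exact h
  | cons j l ih =>
    refine ⟨h.1, ?_⟩
    rw [hm j (by simp)]
    exact ih h.2 fun k hk => hm k (by simp [hk])

/-- The intervals of depth `d` in `don`, in reverse order. -/
noncomputable def bucket (R : IntervalSet κ n) (don : List (Fin n)) (d : ℕ) : List (Fin n) :=
  (don.filter fun j => depth R j = d).reverse

theorem mem_bucket {don : List (Fin n)} {d : ℕ} {j : Fin n} :
    j ∈ bucket R don d ↔ j ∈ don ∧ depth R j = d := by
  simp [bucket]

theorem bucket_append_singleton (don : List (Fin n)) (i : Fin n) (d : ℕ) :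
    bucket R (don ++ [i]) d = if depth R i = d then i :: bucket R don d else bucket R don d := by
  unfold bucket
  split_ifs with h <;> simp [List.filter_append, List.filter_cons, h]

/-- Intervals of equal depth are not nested, so their order by left endpoints is also the order by
right endpoints. Reversed, it is the order that `π` prescribes within a level. -/
theorem bucket_pairwise {don : List (Fin n)} (hps : don.Pairwise R.Before) (hnd : don.Nodup)
    (d : ℕ) : (bucket R don d).Pairwise fun i j => R.right j < R.right i := by
  refine List.pairwise_reverse.2 ?_
  have h := (hps.and hnd).filter fun j => depth R j = d
  refine List.Pairwise.imp_of_mem ?_ h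
  intro a b ha hb hab
  simp only [List.mem_filter, decide_eq_true_eq] at ha hb
  by_contra hlt
  have := depth_lt_of_ssubset R ((IntervalSet.ssubset_iff_of_before hab.1 hab.2).2 (not_lt.1 hlt))
  omega

/-- The intervals in `don` are kept in a linked list for each depth. -/
structure Bucketed (R : IntervalSet κ n) (don : List (Fin n)) (σ : Store) : Prop where
  depth_lt : ∀ j ∈ don, depth R j < σ.var 47
  exists_depth : ∀ d < σ.var 47, ∃ j ∈ don, depth R j = d
  listAt : ∀ d < σ.var 47, ListAt σ.mem (5 * n + 1) (σ.mem (6 * n + 1 + d)) (bucket R don d)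

theorem Bucketed.var_le {don : List (Fin n)} {σ : Store} (h : Bucketed R don σ) :
    σ.var 47 ≤ n := by
  by_contra hlt
  obtain ⟨j, -, hj⟩ := h.exists_depth n (by omega)
  exact (ImpreciseSort.depth_lt j).ne hj

/-- The head of a depth list has the largest right endpoint in its list, being the most recent
entry. An interval of positive depth is contained in one of depth one less, so these maxima do not
increase with the depth and can be searched by bisection. -/
theorem exists_heads {don : List (Fin n)} {σ : Store} (h : Bucketed R don σ)
    (hps : don.Pairwise R.Before) (hnd : don.Nodup)
    (hcl : ∀ i ∈ don, ∀ j, R.region i ⊂ R.region j → j ∈ don) :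
    ∃ head : ℕ → ℕ, ∀ d < σ.var 47, σ.mem (6 * n + 1 + d) = head d ∧
      ∃ j ∈ don, head d = j ∧ depth R j = d ∧ (∀ k ∈ don, depth R k = d → R.right k ≤ R.right j) ∧
      ∀ e ≤ d, R.right j ≤ toArray R.right (head e) := by
  have key : ∀ d < σ.var 47, ∃ j ∈ don, σ.mem (6 * n + 1 + d) = j ∧ depth R j = d ∧
      ∀ k ∈ don, depth R k = d → R.right k ≤ R.right j := by
    intro d hd
    have h1 := h.listAt d hd
    have h2 := bucket_pairwise hps hnd d
    obtain ⟨j, hj⟩ := h.exists_depth d hd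
    rw [← mem_bucket] at hj
    have hmem : ∀ k, k ∈ bucket R don d ↔ k ∈ don ∧ depth R k = d := fun k => mem_bucket
    revert hj h1 h2 hmem
    generalize bucket R don d = l
    intro h1 h2 hj hmem
    cases l with
    | nil => simp at hj
    | cons a l =>
      have ha := (hmem a).1 (by simp)
      refine ⟨a, ha.1, h1.1, ha.2, fun k hk hkd => ?_⟩
      rcases List.mem_cons.1 ((hmem k).2 ⟨hk, hkd⟩) with rfl | hk
      · exact le_rfl
      · exact ((List.pairwise_cons.1 h2).1 k hk).le
  refine ⟨fun d => σ.mem (6 * n + 1 + d), fun d hd => ⟨rfl, ?_⟩⟩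
  obtain ⟨j, h1, h2, h3, h4⟩ := key d hd
  refine ⟨j, h1, h2, h3, h4, ?_⟩
  clear h2 h4
  induction d generalizing j with
  | zero =>
    intro e he
    obtain rfl : e = 0 := by omega
    obtain ⟨k, k1, k2, k3, k4⟩ := key 0 hd
    beta_reduce
    rw [k2, toArray_val]
    exact k4 j h1 h3
  | succ d ih =>
    intro e he
    obtain ⟨a, a1, a2⟩ := exists_depth_of_depth_eq_succ R h3
    have ha := hcl j h1 a a1
    have hja := ((R.region_ssubset_iff _ _).1 a1).2.2
    rcases he.lt_or_eq with he | rfl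
    · exact hja.trans (ih (by omega) a ha a2 e (by omega))
    · obtain ⟨k, k1, k2, k3, k4⟩ := key _ hd
      beta_reduce
      rw [k2, toArray_val]
      exact k4 j h1 h3

/-- Binary search for the first list whose head does not contain the interval `v#7`. -/
def searchBucket : Cmd :=
  .loop (.le (v#20 + 1) v#21)
    (22 ≔ .half (v#20 + v#21) ;; 8 ≔ M[v#43 + v#22] ;;
     .ite (.less .right v#8 .right v#7) (21 ≔ v#22) (20 ≔ v#22 + 1))

theorem searchBucket_runs (head : ℕ → ℕ) (i : Fin n) (k : ℕ) (σ : Store) (D lo hi : ℕ)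
    (h20 : σ.var 20 = lo) (h21 : σ.var 21 = hi) (h43 : σ.var 43 = 6 * n + 1) (h7 : σ.var 7 = i)
    (hhead : ∀ d < D, σ.mem (6 * n + 1 + d) = head d)
    (hanti : ∀ d < D, ∀ e ≤ d, toArray R.right (head d) ≤ toArray R.right (head e))
    (hk : hi - lo < 2 ^ k) (hle : lo ≤ hi) (hD : hi ≤ D)
    (hlo : ∀ d < lo, R.right i ≤ toArray R.right (head d))
    (hhi : ∀ d, hi ≤ d → d < D → toArray R.right (head d) < R.right i) :
    Runs R.preInput searchBucket σ (14 * k + 2) fun σ' =>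
      σ'.var 20 ≤ D ∧ (∀ d < σ'.var 20, R.right i ≤ toArray R.right (head d)) ∧
      (∀ d, σ'.var 20 ≤ d → d < D → toArray R.right (head d) < R.right i) := by
  induction k generalizing σ lo hi with
  | zero =>
    obtain rfl : lo = hi := by simp at hk; omega
    refine .loop_done (by simp [h20, h21]) (by simp [Test.cost, Expr.cost]) ?_
    rw [h20]
    exact ⟨hD, hlo, hhi⟩
  | succ k ih =>
    rcases hle.lt_or_eq with hlt | rfl
    swap
    · refine .loop_done (by simp [h20, h21]) (by simp [Test.cost, Expr.cost]) ?_
      rw [h20]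
      exact ⟨hD, hlo, hhi⟩
    have hmid : (lo + hi) / 2 < D := by omega
    have hh := hhead _ hmid
    rw [pow_succ] at hk
    refine .loop_step (t₁ := 12) (t₂ := 14 * k + 2) (by simp [h20, h21]; omega)
      (Runs.eval (by simp) (by decide) ?_) (by simp [Test.cost, Expr.cost]; omega)
    have hval : toArray R.right (i : Fin n) = R.right i := toArray_val _ i
    by_cases hc : toArray R.right (head ((lo + hi) / 2)) < R.right i
    · refine ih _ lo ((lo + hi) / 2) ?_ ?_ ?_ ?_ ?_ (by omega) (by omega) (by omega) hlo
        fun d h1 h2 => (hanti d h2 _ h1).trans_lt hc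
      all_goals simp [h20, h21, h43, h7, hh, hc, hval, IntervalSet.preInput, IntervalSet.fullInput,
        hhead]
      exact hhead
    · refine ih _ ((lo + hi) / 2 + 1) hi ?_ ?_ ?_ ?_ ?_ (by omega) (by omega) hD
        (fun d h1 => (not_lt.1 hc).trans (hanti _ hmid d (by omega)))
        fun d h1 h2 => hhi d h1 h2
      all_goals simp [h20, h21, h43, h7, hh, hc, hval, IntervalSet.preInput, IntervalSet.fullInput,
        hhead]
      exact hhead

/-- Inserts the interval `v#7` into the list `v#20`. -/
def pushBucket : Cmd :=
  .ite (.le v#47 v#20) ((v#42 + v#7) ⇐ v#0 ;; 47 ≔ v#47 + 1)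
    ((v#42 + v#7) ⇐ M[v#43 + v#20]) ;;
  (v#43 + v#20) ⇐ v#7 ;; 31 ≔ v#31 + 1

/-- Processes the next interval in the sorted order from left to right. -/
def depthNext : Cmd :=
  (7 ≔ M[v#40 + v#31] ;; 20 ≔ 0 ;; 21 ≔ v#47) ;; searchBucket ;; pushBucket

def computeDepths : Cmd :=
  47 ≔ 0 ;; 31 ≔ 0 ;; .loop (.le (v#31 + 1) v#0) depthNext

theorem Bucketed.push {don : List (Fin n)} {i : Fin n} {σ σ' : Store} (hB : Bucketed R don σ)
    (hnd : (i :: don).Nodup) (hD : depth R i ≤ σ.var 47)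
    (h47 : σ'.var 47 = max (σ.var 47) (depth R i + 1)) (x : ℕ)
    (hx : depth R i < σ.var 47 → x = σ.mem (6 * n + 1 + depth R i))
    (hx' : depth R i = σ.var 47 → x = n)
    (hm : σ'.mem = Function.update (Function.update σ.mem (5 * n + 1 + i) x)
      (6 * n + 1 + depth R i) i) : Bucketed R (don ++ [i]) σ' := by
  have hle := hB.var_le
  have hi := i.2
  refine ⟨fun j hj => ?_, fun d hd => ?_, fun d hd => ?_⟩
  · rcases List.mem_append.1 hj with hj | hj
    · have := hB.depth_lt j hj
      omega
    · obtain rfl := List.mem_singleton.1 hj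
      omega
  · by_cases h : d < σ.var 47
    · obtain ⟨j, h1, h2⟩ := hB.exists_depth d h
      exact ⟨j, by simp [h1], h2⟩
    · exact ⟨i, by simp, by omega⟩
  · have hold : ∀ (d' a : ℕ), ListAt σ.mem (5 * n + 1) a (bucket R don d') →
        ListAt σ'.mem (5 * n + 1) a (bucket R don d') := by
      intro d' a h
      refine h.congr fun j hj => ?_
      have hne : j ≠ i := fun e => (List.nodup_cons.1 hnd).1 (e ▸ (mem_bucket.1 hj).1)
      have hne' := Fin.val_ne_of_ne hne
      have hj := j.2
      rw [hm]
      simp (disch := omega) only [Function.update_of_ne]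
    rw [bucket_append_singleton]
    split_ifs with hd'
    · subst hd'
      refine ⟨by rw [hm, Function.update_self], ?_⟩
      have e : σ'.mem (5 * n + 1 + i) = x := by
        rw [hm]
        simp (disch := omega) only [Function.update_of_ne, Function.update_self]
      rw [e]
      rcases hD.lt_or_eq with h | h
      · rw [hx h]
        exact hold _ _ (hB.listAt _ h)
      · have hnil : bucket R don (depth R i) = [] := by
          refine List.eq_nil_iff_forall_not_mem.2 fun j hj => ?_
          obtain ⟨h1, h2⟩ := mem_bucket.1 hj
          have := hB.depth_lt j h1
          omega
        rw [hnil, hx' h]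
        rfl
    · have e : σ'.mem (6 * n + 1 + d) = σ.mem (6 * n + 1 + d) := by
        rw [hm]
        simp (disch := omega) only [Function.update_of_ne]
      rw [e]
      exact hold _ _ (hB.listAt d (by omega))

theorem depthNext_runs {don todo : List (Fin n)} {i : Fin n} {σ : Store}
    (hps : (don ++ i :: todo).Pairwise R.Before) (hnd : (don ++ i :: todo).Nodup)
    (hall : ∀ j, j ∈ don ++ i :: todo) (hL : Layout n σ) (hB : Bucketed R don σ)
    (h31 : σ.var 31 = don.length) (hi : σ.mem (3 * n + 1 + don.length) = i) :
    Runs R.preInput depthNext σ (14 * Nat.log 2 n + 50) fun σ' =>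
      Bucketed R (don ++ [i]) σ' ∧ σ'.var 31 = don.length + 1 ∧
      (∀ z, z < 5 * n + 1 ∨ 7 * n + 1 ≤ z → σ'.mem z = σ.mem z) ∧
      ∀ v, v ∉ [7, 8, 20, 21, 22, 31, 47] → σ'.var v = σ.var v := by
  rw [List.pairwise_append, List.pairwise_cons] at hps
  rw [List.nodup_append, List.nodup_cons] at hnd
  have hnd' : (i :: don).Nodup :=
    List.nodup_cons.2 ⟨fun h => hnd.2.2 i h i (by simp) rfl, hnd.1⟩
  have hbef : ∀ a ∈ don, ∀ j, R.region a ⊂ R.region j → j ∈ don := by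
    intro a ha j hj
    rcases List.mem_append.1 (hall j) with h | h
    · exact h
    · exact absurd hj (IntervalSet.not_ssubset_of_before (hps.2.2 a ha j h))
  have hbefi : ∀ j, R.region i ⊂ R.region j → j ∈ don := by
    intro j hj
    rcases List.mem_append.1 (hall j) with h | h
    · exact h
    · rcases List.mem_cons.1 h with rfl | h
      · exact absurd rfl hj.ne
      · exact absurd hj (IntervalSet.not_ssubset_of_before (hps.2.1.1 j h))
  obtain ⟨head, hhead⟩ := exists_heads hB hps.1 hnd.1 hbef
  have hle := hB.var_le
  obtain ⟨σ₁, t₁, hx₁, ht₁, ⟨e7, e20, e21⟩, hv₁, hm₁⟩ :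
      Runs R.preInput (7 ≔ M[v#40 + v#31] ;; 20 ≔ 0 ;; 21 ≔ v#47) σ 5 fun σ' =>
        (σ'.var 7 = i ∧ σ'.var 20 = 0 ∧ σ'.var 21 = σ.var 47) ∧
        (∀ v, v ∉ (7 ≔ M[v#40 + v#31] ;; 20 ≔ 0 ;; 21 ≔ v#47).assigned → σ'.var v = σ.var v) ∧
        σ'.mem = σ.mem :=
    Runs.frame_mem (Runs.eval (by simp) (by decide) (by simp [hL.var40, h31, hi]))
      (by simp [Cmd.ReadOnly])
  have hlog : σ.var 47 - 0 < 2 ^ (Nat.log 2 n + 1) := by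
    have := Nat.lt_pow_succ_log_self (by omega : 1 < 2) n
    omega
  have hsearch := (searchBucket_runs (R := R) head i (Nat.log 2 n + 1) σ₁ (σ.var 47) 0 (σ.var 47)
    e20 e21 (by rw [hv₁ 43 (by decide), hL.var43]) e7
    (fun d hd => by rw [hm₁]; exact (hhead d hd).1)
    (fun d hd e he => by
      obtain ⟨j, -, h2, -, -, h5⟩ := (hhead d hd).2
      rw [h2, toArray_val]
      exact h5 e he) hlog (by omega) le_rfl (by simp) (by omega)).frame_mem
    (by simp [searchBucket, Cmd.ReadOnly])
  obtain ⟨σ₂, t₂, hx₂, ht₂, ⟨f1, f2, f3⟩, hv₂, hm₂⟩ := hsearch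
  have hdepth : σ₂.var 20 = depth R i := by
    refine le_antisymm ?_ ?_
    -- If the search passed the list of depth `depth R i`, its head would start before `i` and end
    -- no earlier than `i`, hence contain it, although both have the same depth.
    · by_contra hlt
      obtain ⟨j, h1, h2, h3, -⟩ := (hhead (depth R i) (by omega)).2
      have h4 := f2 _ (not_le.1 hlt)
      rw [h2, toArray_val] at h4
      have hb : R.Before j i := hps.2.2 j h1 i (by simp)
      have hne : j ≠ i := fun e => (List.nodup_cons.1 hnd').1 (e ▸ h1)
      have := depth_lt_of_ssubset R ((IntervalSet.ssubset_iff_of_before hb hne).2 h4)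
      omega
    -- Conversely, `i` is contained in an interval of depth one less, already in a list; the head of
    -- that list ends at least as far to the right, so the search cannot stop before it.
    · by_contra hlt
      obtain ⟨e, he⟩ : ∃ e, depth R i = e + 1 := ⟨depth R i - 1, by omega⟩
      obtain ⟨a, a1, a2⟩ := exists_depth_of_depth_eq_succ R he
      have ha := hbefi a a1
      have hlt' : e < σ.var 47 := a2 ▸ hB.depth_lt a ha
      have h4 := f3 e (by omega) hlt'
      obtain ⟨j, -, h2, -, h3, -⟩ := (hhead e hlt').2
      rw [h2, toArray_val] at h4
      have h5 := h3 a ha a2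
      have h6 := ((R.region_ssubset_iff _ _).1 a1).2.2
      linarith
  have hvar : ∀ v, v ∉ [7, 8, 20, 21, 22, 31, 47] → σ₂.var v = σ.var v := by
    intro v hv
    simp only [List.mem_cons, List.not_mem_nil, not_or] at hv
    rw [hv₂ v (by simp [searchBucket, Cmd.assigned]; omega),
      hv₁ v (by simp [Cmd.assigned]; omega)]
  have hmem : σ₂.mem = σ.mem := hm₂.trans hm₁
  have g7 : σ₂.var 7 = i := by rw [hv₂ 7 (by decide), e7]
  have g47 : σ₂.var 47 = σ.var 47 := by rw [hv₂ 47 (by decide), hv₁ 47 (by decide)]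
  have g31 : σ₂.var 31 = don.length := by rw [hv₂ 31 (by decide), hv₁ 31 (by decide), h31]
  have g42 : σ₂.var 42 = 5 * n + 1 := by rw [hvar 42 (by decide), hL.var42]
  have g43 : σ₂.var 43 = 6 * n + 1 := by rw [hvar 43 (by decide), hL.var43]
  have g0 : σ₂.var 0 = n := by rw [hvar 0 (by decide), hL.var0]
  have hdn := depth_lt (R := R) i
  have hin := i.2
  have hpush : Runs R.preInput pushBucket σ₂ 20 fun σ' =>
      σ'.var 47 = max (σ.var 47) (depth R i + 1) ∧ σ'.var 31 = don.length + 1 ∧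
      σ'.mem = Function.update (Function.update σ.mem (5 * n + 1 + i)
        (if depth R i < σ.var 47 then σ.mem (6 * n + 1 + depth R i) else n))
        (6 * n + 1 + depth R i) i := by
    refine Runs.eval (by simp [pushBucket]) (by decide) ?_
    by_cases h : σ.var 47 ≤ depth R i
    · have h1 : σ.var 47 = depth R i := by omega
      simp [pushBucket, g7, g47, g31, g42, g43, g0, hdepth, h1, hmem]
    · simp [pushBucket, g7, g47, g31, g42, g43, g0, hdepth, h, hmem, not_le.1 h]
  obtain ⟨σ₃, t₃, hx₃, ht₃, ⟨k1, k2, k3⟩, hv₃⟩ := hpush.frame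
  refine ⟨σ₃, t₁ + (t₂ + t₃), .seq hx₁ (.seq hx₂ hx₃), by omega, ?_, k2, ?_, ?_⟩
  · exact hB.push hnd' (by omega) k1 _ (fun h => if_pos h) (fun h => if_neg (by omega)) k3
  · intro z hz
    rw [k3]
    simp (disch := omega) only [Function.update_of_ne]
  · intro v hv
    rw [← hvar v hv]
    simp only [List.mem_cons, List.not_mem_nil, not_or] at hv
    exact hv₃ v (by simp [pushBucket, Cmd.assigned]; omega)

theorem depth_loop_runs (todo don : List (Fin n)) {ps : List (Fin n)} (σ : Store)
    (hpseq : ps = don ++ todo) (hps : ps.Pairwise R.Before) (hperm : ps.Perm (List.finRange n))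
    (hL : Layout n σ) (hB : Bucketed R don σ) (h31 : σ.var 31 = don.length)
    (harr : ∀ (k : ℕ) (h : k < ps.length), σ.mem (3 * n + 1 + k) = ps[k]) :
    Runs R.preInput (.loop (.le (v#31 + 1) v#0) depthNext) σ
      ((14 * Nat.log 2 n + 52) * todo.length + 2) fun σ' => Bucketed R ps σ' ∧
        (∀ z, z < 5 * n + 1 ∨ 7 * n + 1 ≤ z → σ'.mem z = σ.mem z) ∧
        ∀ v, v ∉ [7, 8, 20, 21, 22, 31, 47] → σ'.var v = σ.var v := by
  have hlen : ps.length = n := by simpa using hperm.length_eq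
  induction todo generalizing don σ with
  | nil =>
    have hl : don.length = n := by simpa [hpseq] using hlen
    refine .loop_done (by simp [h31, hL.var0, hl]) (by simp [Test.cost, Expr.cost])
      ⟨?_, fun _ _ => rfl, fun _ _ => rfl⟩
    rw [hpseq, List.append_nil]
    exact hB
  | cons i todo ih =>
    have hk : don.length < ps.length := by simp [hpseq]
    refine .loop_step (t₁ := 14 * Nat.log 2 n + 50)
      (t₂ := (14 * Nat.log 2 n + 52) * todo.length + 2) (by simp [h31, hL.var0]; omega)
      ((depthNext_runs (i := i) (todo := todo) (don := don) (by rwa [← hpseq])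
        (hpseq ▸ hperm.nodup_iff.2 (List.nodup_finRange n))
        (fun j => hpseq ▸ hperm.mem_iff.2 (by simp)) hL hB h31 ?_).imp ?_)
      (by simp [Test.cost, Expr.cost, Nat.mul_succ]; omega)
    · rw [harr _ hk]
      simp [hpseq]
    · rintro σ' ⟨g1, g2, g3, g4⟩
      refine (ih (don ++ [i]) σ' (by simpa using hpseq) (hL.congr fun v hv => g4 v ?_) g1
        (by simpa using g2) fun k h => ?_).imp ?_
      · simp; omega
      · rw [g3 _ (by omega), harr k h]
      · rintro σ'' ⟨a1, a2, a3⟩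
        exact ⟨a1, fun z hz => (a2 z hz).trans (g3 z hz), fun v hv => (a3 v hv).trans (g4 v hv)⟩

theorem computeDepths_runs {ps : List (Fin n)} (σ : Store) (hps : ps.Pairwise R.Before)
    (hperm : ps.Perm (List.finRange n)) (hL : Layout n σ)
    (harr : ∀ (k : ℕ) (h : k < ps.length), σ.mem (3 * n + 1 + k) = ps[k]) :
    Runs R.preInput computeDepths σ (14 * (n * Nat.log 2 n) + 52 * n + 4) fun σ' =>
      Bucketed R ps σ' ∧ (∀ z, z < 5 * n + 1 ∨ 7 * n + 1 ≤ z → σ'.mem z = σ.mem z) ∧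
        ∀ v, v ∉ [7, 8, 20, 21, 22, 31, 47] → σ'.var v = σ.var v := by
  have hlen : ps.length = n := by simpa using hperm.length_eq
  refine .seq' (t₁ := 1) (t₂ := 14 * (n * Nat.log 2 n) + 52 * n + 3)
    (.eval (by simp) (by decide) ?_) (by omega)
  refine .seq' (t₁ := 1) (t₂ := 14 * (n * Nat.log 2 n) + 52 * n + 2)
    (.eval (by simp) (by decide) ?_) (by omega)
  refine (depth_loop_runs ps [] _ (by simp) hps hperm ?_ ?_ ?_ ?_).mono ?_ ?_
  · refine hL.congr fun v hv => ?_
    simp (disch := omega) only [Cmd.eval, Function.update_of_ne]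
  · exact ⟨by simp, by simp, by simp⟩
  · simp
  · simpa using harr
  · rw [hlen]
    exact le_of_eq (by ring)
  · rintro σ' ⟨a1, a2, a3⟩
    refine ⟨a1, a2, fun v hv => ?_⟩
    rw [a3 v hv]
    simp only [List.mem_cons, List.not_mem_nil, not_or] at hv
    simp (disch := omega) only [Cmd.eval, Function.update_of_ne]

end Depths

/-! ### Listing the intervals by level -/

section Flatten

variable {κ : IntervalKind} {n : ℕ} {R : IntervalSet κ n} {π : Equiv.Perm (Fin n)}

/-- Appends the non-leaves in the linked list that starts in `v#7` to the array at `v#4`. -/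
def flattenBucket : Cmd :=
  .loop (.le (v#7 + 1) v#0)
    (.ite (.le 1 M[v#41 + v#7]) .skip ((v#4 + v#5) ⇐ v#7 ;; 5 ≔ v#5 + 1) ;; 7 ≔ M[v#42 + v#7])

/-- The depths are processed in decreasing order, which is the order of increasing levels for
intervals that contain other ones. Containment leaves are skipped: the non-bottom ones among them
were listed during classification, and they come first in `π`. -/
def flatten : Cmd :=
  .loop (.le 1 v#47) (47 ≔ v#47 - 1 ;; 7 ≔ M[v#43 + v#47] ;; flattenBucket)

open Classical in
/-- The intervals in the list that contain other intervals. -/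
noncomputable def nonLeaves (R : IntervalSet κ n) (l : List (Fin n)) : List (Fin n) :=
  l.filter fun j => ¬ IsContainmentLeaf R j

theorem mem_nonLeaves {l : List (Fin n)} {j : Fin n} :
    j ∈ nonLeaves R l ↔ j ∈ l ∧ ¬ IsContainmentLeaf R j := by
  simp [nonLeaves]

open Classical in
theorem flattenBucket_runs (l os : List (Fin n)) (σ : Store) (hL : Layout n σ)
    (hlist : ListAt σ.mem (5 * n + 1) (σ.var 7) l)
    (hflag : ∀ j : Fin n, σ.mem (4 * n + 1 + j) = if IsContainmentLeaf R j then 1 else 0)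
    (h5 : σ.var 5 = os.length) (hos : ∀ (k : ℕ) (h : k < os.length), σ.mem (2 * n + 1 + k) = os[k])
    (hlen : (os ++ nonLeaves R l).length ≤ n) :
    Runs R.preInput flattenBucket σ (14 * l.length + 2) fun σ' =>
      σ'.var 5 = (os ++ nonLeaves R l).length ∧
      (∀ (k : ℕ) (h : k < (os ++ nonLeaves R l).length),
        σ'.mem (2 * n + 1 + k) = (os ++ nonLeaves R l)[k]) ∧
      (∀ z, z < 2 * n + 1 ∨ 3 * n + 1 ≤ z → σ'.mem z = σ.mem z) ∧
      ∀ v, v ≠ 5 → v ≠ 7 → σ'.var v = σ.var v := by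
  induction l generalizing os σ with
  | nil =>
    have h7 : σ.var 7 = n := hlist
    refine .loop_done (by simp [h7, hL.var0]) (by simp [Test.cost, Expr.cost]) ?_
    simpa [nonLeaves, h5] using hos
  | cons j l ih =>
    obtain ⟨h7, hlist⟩ := hlist
    have hj := j.2
    obtain ⟨l0, l2, l3, l4, l40, l41, l42, l43, l44, l6⟩ := id hL
    have hf := hflag j
    by_cases hl : IsContainmentLeaf R j
    · rw [if_pos hl] at hf
      have e : nonLeaves R (j :: l) = nonLeaves R l := by simp [nonLeaves, hl]
      rw [e] at hlen ⊢
      refine .loop_step (t₁ := 12) (t₂ := 14 * l.length + 2) (by simp [h7, l0])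
        (Runs.eval (by simp) (by decide) ?_) (by simp [Test.cost, Expr.cost]; omega)
      refine (ih os _ ?_ ?_ ?_ ?_ ?_ hlen).imp ?_
      · refine hL.congr fun v hv => ?_
        have : v ≠ 7 := by omega
        simp [h7, l41, hf, this]
      · simpa [h7, l41, hf, l42] using hlist
      · simpa [h7, l41, hf] using hflag
      · simpa [h7, l41, hf] using h5
      · simpa [h7, l41, hf] using hos
      · rintro σ' ⟨a1, a2, a3, a4⟩
        refine ⟨a1, a2, fun z hz => (a3 z hz).trans ?_, fun v h1 h2 => (a4 v h1 h2).trans ?_⟩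
        · simp [h7, l41, hf]
        · simp [h7, l41, hf, h2]
    · rw [if_neg hl] at hf
      have e : os ++ nonLeaves R (j :: l) = (os ++ [j]) ++ nonLeaves R l := by
        simp [nonLeaves, hl]
      rw [e] at hlen ⊢
      have hlt : os.length < n := by
        simp only [List.length_append, List.length_singleton] at hlen
        omega
      have hne : 5 * n + 1 + (j : ℕ) ≠ 2 * n + 1 + os.length := by omega
      refine .loop_step (t₁ := 12) (t₂ := 14 * l.length + 2) (by simp [h7, l0])
        (Runs.eval (by simp) (by decide) ?_) (by simp [Test.cost, Expr.cost]; omega)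
      refine (ih (os ++ [j]) _ ?_ ?_ ?_ ?_ ?_ hlen).imp ?_
      · refine hL.congr fun v hv => ?_
        have h1 : v ≠ 7 := by omega
        have h2 : v ≠ 5 := by omega
        simp [h7, l41, hf, h1, h2]
      · have := hlist.congr (m' := Function.update σ.mem (2 * n + 1 + os.length) j) fun k _ => by
          have := k.2
          simp (disch := omega) only [Function.update_of_ne]
        simpa [h7, l4, h5, l41, hf, l42, hne] using this
      · intro k
        have hk := k.2
        have hne' : 4 * n + 1 + (k : ℕ) ≠ 2 * n + 1 + os.length := by omega
        simpa [h7, l41, hf, l4, h5, hne'] using hflag k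
      · simp [h7, l41, hf, h5]
      · intro k hk
        rw [List.length_append, List.length_singleton] at hk
        rcases (Nat.lt_succ_iff_lt_or_eq.1 hk) with hk | rfl
        · rw [List.getElem_append_left hk, ← hos k hk]
          have hne' : 2 * n + 1 + k ≠ 2 * n + 1 + os.length := by omega
          simp [h7, l41, hf, l4, h5, hk.ne]
        · rw [List.getElem_concat_length rfl]
          simp [h7, l41, hf, l4, h5]
      · rintro σ' ⟨a1, a2, a3, a4⟩
        refine ⟨a1, a2, fun z hz => (a3 z hz).trans ?_, fun v h1 h2 => (a4 v h1 h2).trans ?_⟩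
        · have : z ≠ 2 * n + 1 + os.length := by omega
          simp [h7, l41, hf, l4, h5, this]
        · simp [h7, l41, hf, h2, h1]

/-- The arrays of bottom intervals, of other intervals, and of anchors have been computed. -/
structure Prepared (R : IntervalSet κ n) (π : Equiv.Perm (Fin n)) (bs os : List (Fin n))
    (σ : Store) : Prop where
  layout : Layout n σ
  cursor : σ.var 46 + bs.length = n
  bottoms : ∀ (k : ℕ) (h : k < bs.length), σ.mem (7 * n + 1 + σ.var 46 + k) = bs[k]
  bottoms_sorted : bs.Pairwise fun i j => R.left i < R.left j
  mem_bottoms : ∀ j, j ∈ bs ↔ IsBottom R π j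
  count : σ.var 5 = os.length
  others : ∀ (k : ℕ) (h : k < os.length), σ.mem (2 * n + 1 + k) = os[k]
  others_sorted : os.Pairwise fun i j => π i < π j
  mem_others : ∀ j, j ∈ os ↔ ¬ IsBottom R π j
  anchor : ∀ j, ¬ IsBottom R π j → ∃ a, IsAnchor R π j a ∧ σ.mem (n + 1 + j) = a

theorem bucket_length_add (ps : List (Fin n)) (d : ℕ) :
    (ps.filter fun j => depth R j < d).length + (bucket R ps d).length =
      (ps.filter fun j => depth R j < d + 1).length := by
  unfold bucket
  rw [List.length_reverse]
  induction ps with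
  | nil => rfl
  | cons j ps ih =>
    simp only [List.filter_cons, decide_eq_true_eq]
    split_ifs <;> (try simp only [List.length_cons]) <;> omega

/-- Entries already listed are of level one or strictly deeper than `d`, hence of smaller level; the
new entries share a level and have decreasing right endpoints. -/
theorem pairwise_append_bucket (hπ : IsLevelPermutation R π) {ps os : List (Fin n)} {d : ℕ}
    (hps : ps.Pairwise R.Before) (hnd : ps.Nodup) (hos : os.Pairwise fun i j => π i < π j)
    (hmem : ∀ j ∈ os, IsContainmentLeaf R j ∨ d < depth R j) :
    (os ++ nonLeaves R (bucket R ps d)).Pairwise fun i j => π i < π j := by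
  rw [List.pairwise_append]
  refine ⟨hos, ?_, fun i hi j hj => ?_⟩
  · have h := (bucket_pairwise hps hnd d).sublist (List.filter_sublist (p := fun j =>
      open Classical in decide (¬ IsContainmentLeaf R j)))
    refine List.Pairwise.imp_of_mem ?_ h
    intro a b ha hb hab
    obtain ⟨a1, a2⟩ := mem_nonLeaves.1 ha
    obtain ⟨b1, b2⟩ := mem_nonLeaves.1 hb
    refine hπ a b (.inr ⟨?_, hab⟩)
    rw [level_eq_of_not_leaf R a2, level_eq_of_not_leaf R b2, (mem_bucket.1 a1).2,
      (mem_bucket.1 b1).2]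
  · obtain ⟨h1, h2⟩ := mem_nonLeaves.1 hj
    have hd := (mem_bucket.1 h1).2
    refine hπ i j (.inl ?_)
    have h3 := one_le_level R j
    have h4 := mt (level_eq_one_iff R j).1 h2
    rcases em (IsContainmentLeaf R i) with h | h
    · rw [(level_eq_one_iff R i).2 h]
      omega
    · have h5 := (hmem i hi).resolve_left h
      have h6 := depth_lt_numLevels R i
      rw [level_eq_of_not_leaf R h, level_eq_of_not_leaf R h2]
      omega

open Classical in
theorem flatten_runs (hπ : IsLevelPermutation R π) {ps : List (Fin n)}
    (hps : ps.Pairwise R.Before) (hperm : ps.Perm (List.finRange n)) (d : ℕ) (os : List (Fin n))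
    (σ : Store) (hL : Layout n σ) (h47 : σ.var 47 = d)
    (hlist : ∀ e < d, ListAt σ.mem (5 * n + 1) (σ.mem (6 * n + 1 + e)) (bucket R ps e))
    (hflag : ∀ j : Fin n, σ.mem (4 * n + 1 + j) = if IsContainmentLeaf R j then 1 else 0)
    (h5 : σ.var 5 = os.length) (hos : ∀ (k : ℕ) (h : k < os.length), σ.mem (2 * n + 1 + k) = os[k])
    (hsorted : os.Pairwise fun i j => π i < π j)
    (hmem : ∀ j, j ∈ os ↔ ¬ IsBottom R π j ∧ (IsContainmentLeaf R j ∨ d ≤ depth R j)) :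
    Runs R.preInput flatten σ
      (14 * (ps.filter fun j => depth R j < d).length + 10 * d + 1) fun σ' =>
      ∃ os' : List (Fin n), σ'.var 5 = os'.length ∧
      (∀ (k : ℕ) (h : k < os'.length), σ'.mem (2 * n + 1 + k) = os'[k]) ∧
      (os'.Pairwise fun i j => π i < π j) ∧ (∀ j, j ∈ os' ↔ ¬ IsBottom R π j) ∧
      (∀ z, z < 2 * n + 1 ∨ 3 * n + 1 ≤ z → σ'.mem z = σ.mem z) ∧
      ∀ v, v ≠ 5 → v ≠ 7 → v ≠ 47 → σ'.var v = σ.var v := by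
  have hnd : ps.Nodup := hperm.nodup_iff.2 (List.nodup_finRange n)
  induction d generalizing os σ with
  | zero =>
    refine .loop_done (by simp [h47]) (by simp [Test.cost, Expr.cost]) ⟨os, h5, hos, hsorted, ?_,
      fun _ _ => rfl, fun _ _ _ _ => rfl⟩
    simpa using hmem
  | succ d ih =>
    have hadd := bucket_length_add (R := R) ps d
    have hpw := pairwise_append_bucket (d := d) hπ hps hnd hsorted
      fun j hj => ((hmem j).1 hj).2
    have hlen : (os ++ nonLeaves R (bucket R ps d)).length ≤ n := by
      have h : (os ++ nonLeaves R (bucket R ps d)).Nodup :=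
        hpw.imp fun h => fun e => h.ne (by rw [e])
      simpa using h.length_le_card
    refine .loop_step (t₁ := 14 * (bucket R ps d).length + 7)
      (t₂ := 14 * (ps.filter fun j => depth R j < d).length + 10 * d + 1) (by simp [h47]) ?_
      (by simp only [Test.cost, Expr.cost, Expr.cost_ofNat]; omega)
    refine .seq' (t₁ := 2) (t₂ := 14 * (bucket R ps d).length + 5) (.eval (by simp) (by decide) ?_)
      (by omega)
    refine .seq' (t₁ := 3) (t₂ := 14 * (bucket R ps d).length + 2) (.eval (by simp) (by decide) ?_)
      (by omega)
    have h43 := hL.var43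
    refine (flattenBucket_runs (R := R) (bucket R ps d) os _ ?_ ?_ ?_ ?_ ?_ hlen).imp ?_
    · refine hL.congr fun v hv => ?_
      simp (disch := omega) only [Cmd.eval, Function.update_of_ne]
    · simpa [h47, h43] using hlist d (by omega)
    · simpa using hflag
    · simpa using h5
    · simpa using hos
    · rintro σ₁ ⟨a1, a2, a3, a4⟩
      have hv : ∀ v, v ≠ 5 → v ≠ 7 → v ≠ 47 → σ₁.var v = σ.var v := by
        intro v h1 h2 h3
        rw [a4 v h1 h2]
        simp [h2, h3]
      have hm : ∀ z, z < 2 * n + 1 ∨ 3 * n + 1 ≤ z → σ₁.mem z = σ.mem z := a3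
      refine (ih _ σ₁ (hL.congr fun v hv' => hv v (by omega) (by omega) (by omega)) ?_ ?_ ?_ a1 a2
        hpw ?_).imp ?_
      · rw [a4 47 (by decide) (by decide)]
        simp [h47]
      · intro e he
        rw [hm _ (by omega)]
        exact (hlist e (by omega)).congr fun j _ => hm _ (by omega)
      · intro j
        rw [hm _ (by omega)]
        exact hflag j
      · intro j
        rw [List.mem_append, hmem, mem_nonLeaves, mem_bucket]
        constructor
        · rintro (⟨h1, h2 | h2⟩ | ⟨⟨h1, h2⟩, h3⟩)
          · exact ⟨h1, .inl h2⟩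
          · exact ⟨h1, .inr (by omega)⟩
          · exact ⟨fun hb => h3 (hb.isContainmentLeaf hπ), .inr h2.ge⟩
        · rintro ⟨h1, h2⟩
          by_cases h3 : IsContainmentLeaf R j
          · exact .inl ⟨h1, .inl h3⟩
          · rcases (h2.resolve_left h3).lt_or_eq with h4 | h4
            · exact .inl ⟨h1, .inr h4⟩
            · exact .inr ⟨⟨hperm.mem_iff.2 (by simp), h4.symm⟩, h3⟩
      · rintro σ₂ ⟨os', b1, b2, b3, b4, b5, b6⟩
        exact ⟨os', b1, b2, b3, b4, fun z hz => (b5 z hz).trans (hm z hz),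
          fun v h1 h2 h3 => (b6 v h1 h2 h3).trans (hv v h1 h2 h3)⟩

def prepare (κ : IntervalKind) : Cmd :=
  sortIntervals ;; classify κ ;; computeDepths ;; flatten

theorem prepare_runs (hπ : IsLevelPermutation R π) :
    Runs R.preInput (prepare κ) (initStore n) (104 * (n * Nat.log 2 n) + 1620 * n + 520) fun σ' =>
      ∃ bs os : List (Fin n), Prepared R π bs os σ' := by
  obtain ⟨ps, hperm, hps, hsort⟩ := sortIntervals_runs R
  have hlen : ps.length = n := by simpa using hperm.length_eq
  refine .seq' (t₂ := 14 * (n * Nat.log 2 n) + 120 * n + 20) (hsort.imp ?_) (by omega)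
  rintro σ₁ ⟨hL₁, harr₁⟩
  refine .seq' (t₂ := 14 * (n * Nat.log 2 n) + 79 * n + 10)
    ((classify_runs hπ σ₁ hps hperm hL₁ harr₁).imp ?_) (by omega)
  rintro σ₂ ⟨hL₂, harr₂, ol, bl, hC⟩
  refine .seq' (t₂ := 24 * n + 1)
    ((computeDepths_runs σ₂ hps hperm hL₂ harr₂).imp ?_) (by omega)
  rintro σ₃ ⟨hB, hm₃, hv₃⟩
  have hL₃ : Layout n σ₃ := hL₂.congr fun v hv => hv₃ v (by simp; omega)
  have hall : ∀ j, j ∈ ps := fun j => hperm.mem_iff.2 (by simp)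
  have hC46 := hC.cursor
  have hl : ol.length ≤ n := by
    have h : ol.Nodup := hC.others_sorted.imp fun h => fun e => h.ne (by rw [e])
    simpa using h.length_le_card
  have hD := hB.var_le
  refine (flatten_runs hπ hps hperm (σ₃.var 47) ol σ₃ hL₃ rfl hB.listAt ?_ ?_ ?_
    hC.others_sorted ?_).mono ?_ ?_
  · intro j
    have := j.2
    rw [hm₃ _ (by omega)]
    exact hC.flag j (hall j)
  · rw [hv₃ 5 (by decide), hC.count]
  · intro k hk
    rw [hm₃ _ (by omega)]
    exact hC.others k hk
  · intro j
    have := hB.depth_lt j (hall j)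
    rw [hC.mem_others]
    constructor
    · exact fun h => ⟨h.2.2, .inl h.2.1⟩
    · exact fun h => ⟨hall j, h.2.resolve_right (by omega), h.1⟩
  · have := List.length_filter_le (fun j => decide (depth R j < σ₃.var 47)) ps
    omega
  · rintro σ₄ ⟨os, b1, b2, b3, b4, b5, b6⟩
    have h46 : σ₄.var 46 = σ₂.var 46 := by
      rw [b6 46 (by decide) (by decide) (by decide), hv₃ 46 (by decide)]
    refine ⟨bl, os, ⟨hL₃.congr fun v hv => b6 v (by omega) (by omega) (by omega), by rw [h46, hC46],
      fun k hk => ?_, hC.bottoms_sorted, fun j => ?_, b1, b2, b3, b4, fun j hj => ?_⟩⟩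
    · rw [h46, b5 _ (by omega), hm₃ _ (by omega), hC.bottoms k hk]
    · rw [hC.mem_bottoms]
      exact ⟨fun h => h.2, fun h => ⟨hall j, h⟩⟩
    · obtain ⟨a, ha, ha'⟩ := hC.anchor j (hall j) hj
      exact ⟨a, ha, by rw [b5 _ (by omega), hm₃ _ (by omega), ha']⟩

end Flatten

/-! ### Building a Fibonacci tree -/

/-- The loop, started in `σ`, reaches the store `σ'` within `t` units of time. -/
def Reaches (inp : Input) (b : Test) (c : Cmd) (σ : Store) (t : ℕ) (σ' : Store) : Prop :=
  ∀ (t' : ℕ) (Q : Store → Prop), Runs inp (.loop b c) σ' t' Q → Runs inp (.loop b c) σ (t + t') Q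

/-- The tree is written by a single loop, while the argument is recursive in the tree. Partial runs
of the loop that can be composed let the runs for the two subtrees be glued together. -/
theorem Reaches.trans {inp : Input} {b : Test} {c : Cmd} {σ σ₁ σ₂ : Store} {t₁ t₂ : ℕ}
    (h₁ : Reaches inp b c σ t₁ σ₁) (h₂ : Reaches inp b c σ₁ t₂ σ₂) :
    Reaches inp b c σ (t₁ + t₂) σ₂ := fun t' Q h => by
  rw [add_assoc]
  exact h₁ _ Q (h₂ _ Q h)

theorem Runs.reaches {inp : Input} {b : Test} {c : Cmd} {σ : Store} {t : ℕ} {Q : Store → Prop}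
    (hb : b.Holds inp σ) (h : Runs inp c σ t Q) :
    ∃ σ', Reaches inp b c σ (b.cost + t) σ' ∧ Q σ' := by
  obtain ⟨σ', t', h1, h2, h3⟩ := h
  exact ⟨σ', fun t'' Q' h => Runs.loop_step hb ⟨σ', t', h1, h2, h⟩ le_rfl, h3⟩

theorem Reaches.mono {inp : Input} {b : Test} {c : Cmd} {σ σ₁ : Store} {t₁ t₂ : ℕ}
    (h : Reaches inp b c σ t₁ σ₁) (ht : t₁ ≤ t₂) : Reaches inp b c σ t₂ σ₁ :=
  fun t' Q h' => (h t' Q h').mono (by omega) fun _ => id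

namespace PTree

/-- Starts an inner node of height `v#32` below `v#33`; pending nodes form a stack. -/
def pushNode : Cmd :=
  v#6 ⇐ 1 ;; (v#6 + 1) ⇐ v#32 ;; (v#6 + 2) ⇐ (v#6 + 6) ;; (v#6 + 3) ⇐ v#36 ;;
  (v#6 + 4) ⇐ v#33 ;; .ite (.le v#32 1) ((v#6 + 5) ⇐ 0) ((v#6 + 5) ⇐ 1) ;;
  36 ≔ v#6 ;; 33 ≔ v#6 ;; 32 ≔ v#32 - 1 ;; 6 ≔ v#6 + 6

/-- Appends a leaf with the next bottom interval, or a dummy. -/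
def placeLeaf : Cmd :=
  .ite (.le v#0 (v#46 + v#35)) (38 ≔ v#0) (38 ≔ M[v#44 + v#46 + v#35] ;; (v#2 + v#38) ⇐ v#6) ;;
  v#6 ⇐ 0 ;; (v#6 + 1) ⇐ v#38 ;; (v#6 + 2) ⇐ v#37 ;; (v#6 + 3) ⇐ 0 ;; (v#6 + 4) ⇐ v#33 ;;
  .ite (.le 1 v#37) ((v#37 + 3) ⇐ v#6) .skip ;;
  37 ≔ v#6 ;; 35 ≔ v#35 + 1 ;; 6 ≔ v#6 + 6 ;; 34 ≔ 2

/-- Completes the left subtree of the pending node. -/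
def popNode : Cmd :=
  .ite (.le 1 v#36)
    -- While a node is pending, its key field holds its height and its right child field the stack
    -- link; both are overwritten here. The right subtree has height two less, and truncated
    -- subtraction gives `0` for a node of height one.
    (33 ≔ v#36 ;; 32 ≔ M[v#33 + 1] - 2 ;; 36 ≔ M[v#33 + 3] ;; (v#33 + 1) ⇐ v#38 ;;
      (v#33 + 3) ⇐ v#6 ;; 34 ≔ 1)
    (34 ≔ 0)

def buildStep : Cmd :=
  .ite (.le v#34 1) (.ite (.le 1 v#32) pushNode placeLeaf) popNode

/-- The labels `lab j` with `j < nb` are in the array of the bottom intervals; the other ones are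
dummies. -/
structure BuildEnv (n nb : ℕ) (lab : ℕ → ℕ) (σ : Store) : Prop where
  var0 : σ.var 0 = n
  var2 : σ.var 2 = 1
  var44 : σ.var 44 = 7 * n + 1
  var46 : σ.var 46 + nb = n
  mem : ∀ j < nb, σ.mem (7 * n + 1 + σ.var 46 + j) = lab j
  lab_lt : ∀ j < nb, lab j < n
  lab_eq : ∀ j, nb ≤ j → lab j = n
  lab_inj : ∀ i j, i < j → j < nb → lab i ≠ lab j

theorem BuildEnv.congr {n nb : ℕ} {lab : ℕ → ℕ} {σ σ' : Store} (h : BuildEnv n nb lab σ)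
    (hv : ∀ v, v < 6 ∨ 39 ≤ v → σ'.var v = σ.var v)
    (hm : ∀ z, 7 * n + 1 ≤ z → z < 8 * n + 1 → σ'.mem z = σ.mem z) : BuildEnv n nb lab σ' := by
  have h46 := h.var46
  have e46 := hv 46 (by omega)
  refine ⟨(hv 0 (by omega)).trans h.var0, (hv 2 (by omega)).trans h.var2,
    (hv 44 (by omega)).trans h.var44, by rw [e46, h46], fun j hj => ?_, h.lab_lt, h.lab_eq,
    h.lab_inj⟩
  rw [e46, hm _ (by omega) (by omega)]
  exact h.mem j hj

structure BuildState (mode h q f k s l : ℕ) (σ : Store) : Prop where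
  mode : σ.var 34 = mode
  height : σ.var 32 = h
  parent : σ.var 33 = q
  free : σ.var 6 = f
  index : σ.var 35 = k
  stack : σ.var 36 = s
  last : σ.var 37 = l

theorem pushNode_reaches {inp : Input} {h q f k s l : ℕ} {σ : Store}
    (hs : BuildState 1 (h + 1) q f k s l σ) :
    ∃ σ', Reaches inp (.le 1 v#34) buildStep σ 40 σ' ∧ BuildState 1 h f (f + 6) k f l σ' ∧
      (∀ v, v < 6 ∨ 39 ≤ v → σ'.var v = σ.var v) ∧
      (σ'.mem f = 1 ∧ σ'.mem (f + 1) = h + 1 ∧ σ'.mem (f + 2) = f + 6 ∧ σ'.mem (f + 3) = s ∧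
        σ'.mem (f + 4) = q ∧ σ'.mem (f + 5) = if h = 0 then 0 else 1) ∧
      ∀ z, z < f ∨ f + 6 ≤ z → σ'.mem z = σ.mem z := by
  obtain ⟨h34, h32, h33, h6, h35, h36, h37⟩ := hs
  have key : Runs inp buildStep σ 38 fun σ' => BuildState 1 h f (f + 6) k f l σ' ∧
      (∀ v, v < 6 ∨ 39 ≤ v → σ'.var v = σ.var v) ∧
      (σ'.mem f = 1 ∧ σ'.mem (f + 1) = h + 1 ∧ σ'.mem (f + 2) = f + 6 ∧ σ'.mem (f + 3) = s ∧
        σ'.mem (f + 4) = q ∧ σ'.mem (f + 5) = if h = 0 then 0 else 1) ∧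
      ∀ z, z < f ∨ f + 6 ≤ z → σ'.mem z = σ.mem z := by
    refine Runs.eval (by simp [buildStep, pushNode, placeLeaf, popNode]) (by decide) ?_
    refine ⟨⟨?_, ?_, ?_, ?_, ?_, ?_, ?_⟩, ?_, ?_, ?_⟩
    iterate 7
      by_cases h0 : h = 0 <;> simp [buildStep, pushNode, h34, h32, h33, h6, h35, h36, h37, h0]
    · intro v hv
      have h1 : v ≠ 6 := by omega
      have h2 : v ≠ 32 := by omega
      have h3 : v ≠ 33 := by omega
      have h4 : v ≠ 36 := by omega
      by_cases h0 : h = 0 <;> simp [buildStep, pushNode, h34, h32, h33, h6, h36, h0, h1, h2, h3, h4]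
    · by_cases h0 : h = 0 <;> simp [buildStep, pushNode, h34, h32, h33, h6, h36, h0]
    · intro z hz
      have h0 : z ≠ f := by omega
      have h1 : z ≠ f + 1 := by omega
      have h2 : z ≠ f + 2 := by omega
      have h3 : z ≠ f + 3 := by omega
      have h4 : z ≠ f + 4 := by omega
      have h5 : z ≠ f + 5 := by omega
      by_cases hh : h = 0 <;>
        simp [buildStep, pushNode, h34, h32, h33, h6, h36, hh, h0, h1, h2, h3, h4, h5]
  obtain ⟨σ', h1, h2⟩ := key.reaches (b := .le 1 v#34) (by simp [h34])
  exact ⟨σ', h1.mono (by decide), h2⟩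

theorem popNode_reaches {inp : Input} {h q f k s l : ℕ} {σ : Store} (hs0 : 0 < s)
    (hs : BuildState 2 h q f k s l σ) :
    ∃ σ', Reaches inp (.le 1 v#34) buildStep σ 40 σ' ∧
      BuildState 1 (σ.mem (s + 1) - 2) s f k (σ.mem (s + 3)) l σ' ∧
      (∀ v, v < 6 ∨ 38 ≤ v → σ'.var v = σ.var v) ∧
      σ'.mem = Function.update (Function.update σ.mem (s + 1) (σ.var 38)) (s + 3) f := by
  obtain ⟨h34, h32, h33, h6, h35, h36, h37⟩ := hs
  have hs0' : 1 ≤ s := hs0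
  have key : Runs inp buildStep σ 38 fun σ' =>
      BuildState 1 (σ.mem (s + 1) - 2) s f k (σ.mem (s + 3)) l σ' ∧
      (∀ v, v < 6 ∨ 38 ≤ v → σ'.var v = σ.var v) ∧
      σ'.mem = Function.update (Function.update σ.mem (s + 1) (σ.var 38)) (s + 3) f := by
    refine Runs.eval (by simp [buildStep, pushNode, placeLeaf, popNode]) (by decide) ?_
    refine ⟨⟨?_, ?_, ?_, ?_, ?_, ?_, ?_⟩, ?_, ?_⟩
    iterate 7
      simp [buildStep, popNode, h34, h6, h35, h36, h37, hs0']
    · intro v hv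
      have h1 : v ≠ 34 := by omega
      have h2 : v ≠ 32 := by omega
      have h3 : v ≠ 33 := by omega
      have h4 : v ≠ 36 := by omega
      simp [buildStep, popNode, h34, h36, hs0', h1, h2, h3, h4]
    · simp [buildStep, popNode, h34, h36, hs0', h6]
  obtain ⟨σ', h1, h2⟩ := key.reaches (b := .le 1 v#34) (by simp [h34])
  exact ⟨σ', h1.mono (by decide), h2⟩

theorem placeLeaf_reaches {inp : Input} {n nb : ℕ} {lab : ℕ → ℕ} {q f k s l : ℕ} {σ : Store}
    (he : BuildEnv n nb lab σ) (hs : BuildState 1 0 q f k s l σ) (hf : 8 * n + 1 ≤ f)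
    (hl : l = 0 ∨ 8 * n + 1 ≤ l ∧ l + 6 ≤ f) :
    ∃ σ', Reaches inp (.le 1 v#34) buildStep σ 40 σ' ∧ BuildState 2 0 q (f + 6) (k + 1) s f σ' ∧
      (∀ v, v < 6 ∨ 39 ≤ v → σ'.var v = σ.var v) ∧ σ'.var 38 = lab k ∧
      (σ'.mem f = 0 ∧ σ'.mem (f + 1) = lab k ∧ σ'.mem (f + 2) = l ∧ σ'.mem (f + 3) = 0 ∧
        σ'.mem (f + 4) = q) ∧ (0 < l → σ'.mem (l + 3) = f) ∧ (k < nb → σ'.mem (1 + lab k) = f) ∧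
      ∀ z, z < f → (0 < l → z ≠ l + 3) → (k < nb → z ≠ 1 + lab k) → σ'.mem z = σ.mem z := by
  obtain ⟨h34, h32, h33, h6, h35, h36, h37⟩ := hs
  obtain ⟨l0, l2, l44, l46, lm, llt, leq, -⟩ := he
  have key : Runs inp buildStep σ 38 fun σ' => BuildState 2 0 q (f + 6) (k + 1) s f σ' ∧
      (∀ v, v < 6 ∨ 39 ≤ v → σ'.var v = σ.var v) ∧ σ'.var 38 = lab k ∧
      σ'.mem = (fun m => if 1 ≤ l then Function.update m (l + 3) f else m)
        (Function.update (Function.update (Function.update (Function.update (Function.update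
        ((fun m => if n ≤ σ.var 46 + k then m else Function.update m (1 + lab k) f) σ.mem)
        f 0) (f + 1) (lab k)) (f + 2) l) (f + 3) 0) (f + 4) q) := by
    refine Runs.eval (by simp [buildStep, pushNode, placeLeaf, popNode]) (by decide) ?_
    by_cases hk : n ≤ σ.var 46 + k
    · have h1 := leq k (by omega)
      refine ⟨⟨?_, ?_, ?_, ?_, ?_, ?_, ?_⟩, ?_, ?_, ?_⟩
      iterate 7
        by_cases hl0 : 1 ≤ l <;>
          simp [buildStep, placeLeaf, h34, h32, h33, h6, h35, h36, h37, l0, hk, hl0]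
      · intro v hv
        have h1 : v ≠ 6 := by omega
        have h2 : v ≠ 34 := by omega
        have h3 : v ≠ 35 := by omega
        have h4 : v ≠ 37 := by omega
        have h5 : v ≠ 38 := by omega
        by_cases hl0 : 1 ≤ l <;>
          simp [buildStep, placeLeaf, h34, h32, h35, h37, l0, hk, hl0, h1, h2, h3, h4, h5]
      · by_cases hl0 : 1 ≤ l <;>
          simp [buildStep, placeLeaf, h34, h32, h35, h37, l0, hk, hl0, h1]
      · by_cases hl0 : 1 ≤ l <;>
          simp [buildStep, placeLeaf, h34, h32, h33, h6, h35, h37, l0, hk, hl0, h1]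
    · have h1 := lm k (by omega)
      refine ⟨⟨?_, ?_, ?_, ?_, ?_, ?_, ?_⟩, ?_, ?_, ?_⟩
      iterate 7
        by_cases hl0 : 1 ≤ l <;>
          simp [buildStep, placeLeaf, h34, h32, h33, h6, h35, h36, h37, l0, hk, hl0]
      · intro v hv
        have h1 : v ≠ 6 := by omega
        have h2 : v ≠ 34 := by omega
        have h3 : v ≠ 35 := by omega
        have h4 : v ≠ 37 := by omega
        have h5 : v ≠ 38 := by omega
        by_cases hl0 : 1 ≤ l <;>
          simp [buildStep, placeLeaf, h34, h32, h35, h37, l0, hk, hl0, h1, h2, h3, h4, h5]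
      · by_cases hl0 : 1 ≤ l <;>
          simp [buildStep, placeLeaf, h34, h32, h35, h37, l0, l44, hk, hl0, h1]
      · by_cases hl0 : 1 ≤ l <;>
          simp [buildStep, placeLeaf, h34, h32, h33, h6, h35, h37, l0, l2, l44, hk, hl0, h1]
  obtain ⟨σ', h1, h2, h3, h4, h5⟩ := key.reaches (b := .le 1 v#34) (by simp [h34])
  refine ⟨σ', h1.mono (by decide), h2, h3, h4, ?_, ?_, ?_, ?_⟩
  · rw [h5]
    split_ifs <;> (refine ⟨?_, ?_, ?_, ?_, ?_⟩) <;>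
      simp (disch := omega) only [Function.update_of_ne, Function.update_self]
  · intro hl0
    rw [h5]
    simp only [show 1 ≤ l from hl0, if_true, Function.update_self]
  · intro hk
    have := llt k hk
    rw [h5]
    simp only [show ¬ n ≤ σ.var 46 + k by omega, if_false]
    split_ifs <;> simp (disch := omega) only [Function.update_of_ne, Function.update_self]
  · intro z hz hzl hzk
    rw [h5]
    split_ifs with c1 c2 c2
    · have := hzl c1
      simp (disch := omega) only [Function.update_of_ne]
    · have := hzl c1
      have := hzk (by omega)
      simp (disch := omega) only [Function.update_of_ne]
    · simp (disch := omega) only [Function.update_of_ne]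
    · have := hzk (by omega)
      simp (disch := omega) only [Function.update_of_ne]

end PTree

/-! ### Correctness of the construction of Fibonacci trees -/

section Build

namespace PTree

/-- The number of leaves of a Fibonacci tree. -/
def fibLeaves (h : ℕ) : ℕ := Nat.fib (h + 2)

theorem fibLeaves_zero : fibLeaves 0 = 1 := rfl

/-- Truncation makes the recursion valid also for height one, where both children are leaves. -/
theorem fibLeaves_succ (h : ℕ) : fibLeaves (h + 1) = fibLeaves h + fibLeaves (h - 1) := by
  cases h with
  | zero => rfl
  | succ h =>
    simp only [fibLeaves, Nat.add_sub_cancel]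
    rw [Nat.fib_add_two (n := h + 2), add_comm]

theorem fibLeaves_pos (h : ℕ) : 0 < fibLeaves h := Nat.fib_pos.2 (by omega)

/-- The number of leaves at most doubles with the height, so the smallest Fibonacci tree with room
for the bottom intervals needs at most as many dummies as there are bottom intervals. -/
theorem fibLeaves_succ_le (h : ℕ) : fibLeaves (h + 1) ≤ 2 * fibLeaves h := by
  have : fibLeaves (h - 1) ≤ fibLeaves h := Nat.fib_mono (by omega)
  rw [fibLeaves_succ]
  omega

theorem _root_.ImpreciseSort.LinkSeg.change_last {m m' : ℕ → ℕ} {q r r' : ℕ} {l : List ℕ}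
    (h : LinkSeg m q r l)
    (hnd : l.Nodup) (hne : l ≠ [])
    (hm : ∀ x ∈ l, m' (x + 2) = m (x + 2) ∧ (x ≠ l.getLastD 0 → m' (x + 3) = m (x + 3)))
    (hr : m' (l.getLastD 0 + 3) = r') : LinkSeg m' q r' l := by
  induction l generalizing q with
  | nil => exact absurd rfl hne
  | cons x l ih =>
    obtain ⟨h1, h2, h3⟩ := h
    obtain ⟨g1, g2⟩ := hm x (by simp)
    cases l with
    | nil => exact ⟨g1.trans h1, by simpa using hr, trivial⟩
    | cons y l =>
      have hlast : (x :: y :: l).getLastD 0 = (y :: l).getLastD 0 := by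
        simp only [List.getLastD_cons]
      have hxl : x ≠ (y :: l).getLastD 0 := by
        intro e
        refine (List.nodup_cons.1 hnd).1 ?_
        rw [e, List.getLastD_eq_getLast?, List.getLast?_eq_getLast_of_ne_nil (by simp)]
        exact List.getLast_mem _
      rw [hlast] at hm hr g2
      exact ⟨g1.trans h1, (g2 hxl).trans h2, ih h3 (List.nodup_cons.1 hnd).2 (by simp)
        (fun z hz => hm z (by simp [hz])) hr⟩

/-- A Fibonacci tree of height `h` with labels `lab k, lab (k + 1), …` has been built at the
addresses from `f` on. -/
structure Built (nb : ℕ) (lab : ℕ → ℕ) (h q f k l : ℕ) (m m' : ℕ → ℕ) (T : PTree) : Prop where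
  height : T.height = h
  fib : T.IsFibonacci
  addr : T.addr = f
  -- With `F` leaves there are `2 * F - 1` records of six cells, which fit below `f + 12 * F - 6`.
  bounds : ∀ p ∈ T.addrs, f ≤ p ∧ p + 12 ≤ f + 12 * fibLeaves h
  sep : Sep T.addrs
  labels : T.labels = (List.range (fibLeaves h)).map fun j => lab (k + j)
  rep : T.Rep m' q
  links : LinkSeg m' l 0 T.leafAddrs
  head : 0 < l → m' (l + 3) = T.leafAddrs.headD 0
  ptr : ∀ j < fibLeaves h, k + j < nb → (m' (1 + lab (k + j)), lab (k + j)) ∈ T.leafEntries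
  frame : ∀ z < f, (0 < l → z ≠ l + 3) → (∀ j < fibLeaves h, k + j < nb → z ≠ 1 + lab (k + j)) →
    m' z = m z

theorem leafAddrs_ne_nil (T : PTree) : T.leafAddrs ≠ [] := by
  rw [leafAddrs_eq]
  simpa using T.leafEntries_ne_nil

theorem getLastD_leafAddrs (T : PTree) (q : ℕ) :
    T.leafAddrs.getLastD q = T.leafAddrs.getLastD 0 := by
  have := T.leafAddrs_ne_nil
  cases h : T.leafAddrs with
  | nil => exact absurd h this
  | cons x l => simp only [List.getLastD_cons]

theorem getLastD_leafAddrs_mem (T : PTree) : T.leafAddrs.getLastD 0 ∈ T.leafAddrs := by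
  rw [List.getLastD_eq_getLast?, List.getLast?_eq_getLast_of_ne_nil T.leafAddrs_ne_nil]
  exact List.getLast_mem _

/-- The memories are those after pushing the node (`m₁`), after the left subtree (`m₂`), after
popping the node (`m₃`) and after the right subtree (`m₄`). The right subtree hooks its first leaf
to the last leaf of the left one, the only interaction between the two apart from disjoint leaf
pointers. -/
theorem Built.node {n nb : ℕ} {lab : ℕ → ℕ} {h q f k l s : ℕ} {m m₁ m₂ m₃ m₄ : ℕ → ℕ}
    {T₁ T₂ : PTree} (hlab : ∀ j < nb, lab j < n) (hinj : ∀ i j, i < j → j < nb → lab i ≠ lab j)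
    (hf : 8 * n + 1 ≤ f) (hl : l = 0 ∨ 8 * n + 1 ≤ l ∧ l + 6 ≤ f)
    (hm₁ : m₁ f = 1 ∧ m₁ (f + 1) = h + 1 ∧ m₁ (f + 2) = f + 6 ∧ m₁ (f + 3) = s ∧
        m₁ (f + 4) = q ∧ m₁ (f + 5) = if h = 0 then 0 else 1)
    (hm₁' : ∀ z, z < f ∨ f + 6 ≤ z → m₁ z = m z)
    (h₁ : Built nb lab h f (f + 6) k l m₁ m₂ T₁)
    (hm₃ : m₃ = Function.update (Function.update m₂ (f + 1) T₁.lastLabel) (f + 3)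
      (f + 12 * fibLeaves h))
    (h₂ : Built nb lab (h - 1) f (f + 12 * fibLeaves h) (k + fibLeaves h)
      (T₁.leafAddrs.getLastD 0) m₃ m₄ T₂) :
    Built nb lab (h + 1) q f k l m m₄ (.node f T₁ T₂) := by
  have hF := fibLeaves_pos h
  have hF2 := fibLeaves_pos (h - 1)
  have hF' := fibLeaves_succ h
  obtain ⟨a, ha⟩ : ∃ a, a = T₁.leafAddrs.getLastD 0 := ⟨_, rfl⟩
  have hmema : a ∈ T₁.leafAddrs := ha ▸ T₁.getLastD_leafAddrs_mem
  have hab := h₁.bounds a (T₁.leafAddrs_subset_addrs hmema)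
  rw [← ha] at h₂
  have fr₂ : ∀ z < f, (0 < l → z ≠ l + 3) →
      (∀ j < fibLeaves h, k + j < nb → z ≠ 1 + lab (k + j)) → m₂ z = m z := by
    intro z hz h1 h2
    rw [h₁.frame z (by omega) h1 h2, hm₁' z (.inl hz)]
  have fr₁ : ∀ z, f ≤ z → z < f + 6 → m₂ z = m₁ z := by
    intro z hz hz'
    refine h₁.frame z hz' (fun _ => by omega) fun j _ hj => ?_
    have := hlab _ hj
    omega
  have fr₃ : ∀ z, z ≠ f + 1 → z ≠ f + 3 → m₃ z = m₂ z := by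
    intro z h1 h2
    rw [hm₃, Function.update_of_ne h2, Function.update_of_ne h1]
  -- Above the array of leaf pointers, the only cell below its own records that the right subtree
  -- changes is the successor link of the last leaf `a` of the left subtree.
  have fr₄ : ∀ z, n < z → z < f + 12 * fibLeaves h → z ≠ a + 3 → m₄ z = m₃ z := by
    intro z h1 h2 h3
    refine h₂.frame z h2 (fun _ => h3) fun j _ hj => ?_
    have := hlab _ hj
    omega
  have e1 : m₄ (f + 1) = T₁.lastLabel := by
    rw [fr₄ _ (by omega) (by omega) (by omega), hm₃]
    simp (disch := omega) only [Function.update_of_ne, Function.update_self]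
  have e3 : m₄ (f + 3) = f + 12 * fibLeaves h := by
    rw [fr₄ _ (by omega) (by omega) (by omega), hm₃, Function.update_self]
  have ecell : ∀ z, f ≤ z → z < f + 6 → z ≠ f + 1 → z ≠ f + 3 → m₄ z = m₁ z := by
    intro z h1 h2 h3 h4
    rw [fr₄ z (by omega) (by omega) (by omega), fr₃ z h3 h4, fr₁ z h1 h2]
  have hT₁ : ∀ z, f + 6 ≤ z → z < f + 12 * fibLeaves h → z ≠ a + 3 → m₄ z = m₂ z := by
    intro z h1 h2 h3
    rw [fr₄ z (by omega) h2 h3, fr₃ z (by omega) (by omega)]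
  refine ⟨?_, ?_, rfl, ?_, ?_, ?_, ?_, ?_, ?_, ?_, ?_⟩
  · simp only [PTree.height, h₁.height, h₂.height]
    omega
  · refine ⟨?_, h₁.fib, h₂.fib⟩
    rw [h₁.height, h₂.height]
    omega
  · intro p hp
    simp only [addrs, List.mem_cons, List.mem_append] at hp
    rcases hp with rfl | hp | hp
    · omega
    · have := h₁.bounds p hp
      omega
    · have := h₂.bounds p hp
      omega
  · simp only [addrs]
    rw [sep_cons, sep_append]
    refine ⟨fun p hp => ?_, h₁.sep, h₂.sep, fun p hp p' hp' => ?_⟩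
    · rcases List.mem_append.1 hp with hp | hp
      · have := h₁.bounds p hp
        omega
      · have := h₂.bounds p hp
        omega
    · have := h₁.bounds p hp
      have := h₂.bounds p' hp'
      omega
  · rw [PTree.labels, h₁.labels, h₂.labels, hF', List.range_add, List.map_append, List.map_map]
    simp [Function.comp_def, add_assoc]
  · refine ⟨?_, e1, ?_, ?_, ?_, ?_, ?_, h₂.rep⟩
    · rw [ecell _ (by omega) (by omega) (by omega) (by omega), hm₁.1]
    · rw [ecell _ (by omega) (by omega) (by omega) (by omega), hm₁.2.2.1, h₁.addr]
    · rw [e3, h₂.addr]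
    · rw [ecell _ (by omega) (by omega) (by omega) (by omega), hm₁.2.2.2.2.1]
    · rw [ecell _ (by omega) (by omega) (by omega) (by omega), hm₁.2.2.2.2.2]
      simp only [balanceCode, h₁.height, h₂.height]
      split_ifs <;> omega
    · refine h₁.rep.congr_links h₁.sep fun z ⟨p, hp, hp1, hp2⟩ hz => ?_
      have := h₁.bounds p hp
      refine hT₁ z (by omega) (by omega) ?_
      rw [leafAddrs_eq, List.mem_map] at hmema
      obtain ⟨e, he, rfl⟩ := hmema
      exact (hz e he).2
  · rw [PTree.leafAddrs, linkSeg_append, getLastD_leafAddrs, ← ha]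
    refine ⟨?_, h₂.links⟩
    have hnd : T₁.leafAddrs.Nodup := nodup_leafAddrs h₁.sep
    refine h₁.links.change_last hnd T₁.leafAddrs_ne_nil (fun x hx => ?_) ?_
    · have hxb := h₁.bounds x (T₁.leafAddrs_subset_addrs hx)
      have hxa : x = a ∨ x + 6 ≤ a ∨ a + 6 ≤ x := by
        by_contra hcon
        push Not at hcon
        have : Std.Symm fun p q : ℕ => p + 6 ≤ q ∨ q + 6 ≤ p := ⟨fun _ _ h => h.symm⟩
        have := List.Pairwise.forall h₁.sep (T₁.leafAddrs_subset_addrs hx)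
          (T₁.leafAddrs_subset_addrs hmema) hcon.1
        omega
      rw [← ha]
      exact ⟨hT₁ _ (by omega) (by omega) (by omega),
        fun hne => hT₁ _ (by omega) (by omega) (by omega)⟩
    · rw [← ha, h₂.head (by omega)]
  · intro hl0
    rw [fr₄ _ (by omega) (by omega) (by omega), fr₃ _ (by omega) (by omega), h₁.head hl0]
    have := T₁.leafAddrs_ne_nil
    rw [PTree.leafAddrs]
    cases hT : T₁.leafAddrs with
    | nil => exact absurd hT this
    | cons x L => rfl
  · intro j hj hjn
    rw [leafEntries, List.mem_append]
    by_cases hj' : j < fibLeaves h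
    · left
      have h3 : m₄ (1 + lab (k + j)) = m₂ (1 + lab (k + j)) := by
        have := hlab _ hjn
        rw [← fr₃ _ (by omega) (by omega)]
        refine h₂.frame _ (by omega) (fun _ => by omega) fun i _ hi => ?_
        have := hinj (k + j) (k + fibLeaves h + i) (by omega) hi
        omega
      rw [h3]
      exact h₁.ptr j hj' hjn
    · right
      obtain ⟨i, rfl⟩ : ∃ i, j = fibLeaves h + i := ⟨j - fibLeaves h, by omega⟩
      rw [← add_assoc] at hjn ⊢
      exact h₂.ptr i (by omega) hjn
  · intro z hz h1 h2
    have h3 : m₄ z = m₃ z := by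
      refine h₂.frame z (by omega) (fun _ => by omega) fun i hi hin => ?_
      rw [add_assoc]
      exact h2 _ (by omega) (by rwa [← add_assoc])
    rw [h3, fr₃ z (by omega) (by omega), fr₂ z hz h1 fun j hj => h2 j (by omega)]

/-- Strong induction, since the right subtree is two lower than the node. The time `120 * F - 80`
for `F` leaves is exactly additive: `40` for a leaf, and `40` each for pushing and popping an inner
node. -/
theorem build_reaches {inp : Input} {n nb : ℕ} {lab : ℕ → ℕ} (h : ℕ) (q f k s l : ℕ) (σ : Store)
    (he : BuildEnv n nb lab σ) (hs : BuildState 1 h q f k s l σ) (hf : 8 * n + 1 ≤ f)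
    (hl : l = 0 ∨ 8 * n + 1 ≤ l ∧ l + 6 ≤ f) :
    ∃ (T : PTree) (σ' : Store), Reaches inp (.le 1 v#34) buildStep σ (120 * fibLeaves h - 80) σ' ∧
      (∃ h' q', BuildState 2 h' q' (f + 12 * fibLeaves h - 6) (k + fibLeaves h) s
        (T.leafAddrs.getLastD 0) σ') ∧
      σ'.var 38 = T.lastLabel ∧ (∀ v, v < 6 ∨ 39 ≤ v → σ'.var v = σ.var v) ∧
      Built nb lab h q f k l σ.mem σ'.mem T := by
  induction h using Nat.strong_induction_on generalizing q f k s l σ with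
  | _ h ih =>
  have hlab := he.lab_lt
  cases h with
  | zero =>
    obtain ⟨σ', h1, h2, h3, h4, h5, h6, h7, h8⟩ := placeLeaf_reaches (inp := inp) he hs hf hl
    refine ⟨.leaf f (lab k), σ', h1.mono (by simp [fibLeaves_zero]), ⟨0, q, ?_⟩, h4, h3, ?_⟩
    · simpa [fibLeaves_zero, leafAddrs] using h2
    · refine ⟨rfl, trivial, rfl, ?_, ?_, ?_, ⟨h5.1, h5.2.1, h5.2.2.2.2⟩,
        ⟨h5.2.2.1, h5.2.2.2.1, trivial⟩, h6, ?_, ?_⟩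
      · simp [addrs, fibLeaves_zero]
      · simp [addrs, Sep]
      · simp [PTree.labels, fibLeaves_zero]
      · intro j hj hjn
        obtain rfl : j = 0 := by rw [fibLeaves_zero] at hj; omega
        simp only [add_zero] at hjn ⊢
        simp [leafEntries, h7 hjn]
      · intro z hz hz1 hz2
        exact h8 z hz hz1 fun hk => by simpa using hz2 0 (by simp [fibLeaves_zero]) (by simpa using hk)
  | succ h =>
    have hF := fibLeaves_pos h
    have hF2 := fibLeaves_pos (h - 1)
    have hF' := fibLeaves_succ h
    obtain ⟨σ₁, r1, s1, v1, c1, z1⟩ := pushNode_reaches (inp := inp) hs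
    have he1 : BuildEnv n nb lab σ₁ := he.congr v1 fun z _ hz => z1 z (by omega)
    obtain ⟨T₁, σ₂, r2, ⟨h', q', s2⟩, l2, v2, b2⟩ :=
      ih h (by omega) f (f + 6) k f l σ₁ he1 s1 (by omega) (by omega)
    have hmema := T₁.getLastD_leafAddrs_mem
    have hab := b2.bounds _ (T₁.leafAddrs_subset_addrs hmema)
    have he2 : BuildEnv n nb lab σ₂ := he1.congr v2 fun z hz hz' => by
      refine b2.frame z (by omega) (fun _ => by omega) fun j _ hj => ?_
      have := hlab _ hj
      omega
    rw [show f + 6 + 12 * fibLeaves h - 6 = f + 12 * fibLeaves h by omega] at s2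
    obtain ⟨σ₃, r3, s3, v3, m3⟩ := popNode_reaches (inp := inp) (by omega) s2
    have hcell : ∀ z, f ≤ z → z < f + 6 → σ₂.mem z = σ₁.mem z := by
      intro z hz hz'
      refine b2.frame z hz' (fun _ => by omega) fun j _ hj => ?_
      have := hlab _ hj
      omega
    rw [hcell (f + 1) (by omega) (by omega), hcell (f + 3) (by omega) (by omega), c1.2.1,
      c1.2.2.2.1, show h + 1 - 2 = h - 1 by omega] at s3
    rw [l2] at m3
    have he3 : BuildEnv n nb lab σ₃ := he2.congr (fun v hv => v3 v (by omega)) fun z hz hz' => by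
      rw [m3]
      simp (disch := omega) only [Function.update_of_ne]
    obtain ⟨T₂, σ₄, r4, ⟨h'', q'', s4⟩, l4, v4, b4⟩ :=
      ih (h - 1) (by omega) f (f + 12 * fibLeaves h) (k + fibLeaves h) s
        (T₁.leafAddrs.getLastD 0) σ₃ he3 s3 (by omega) (by omega)
    refine ⟨.node f T₁ T₂, σ₄, (((r1.trans r2).trans r3).trans r4).mono (by omega), ⟨h'', q'', ?_⟩,
      l4, fun v hv => ?_, Built.node hlab he.lab_inj hf hl c1 z1 b2 m3 b4⟩
    · have e1 : f + 12 * fibLeaves h + 12 * fibLeaves (h - 1) - 6 =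
          f + 12 * fibLeaves (h + 1) - 6 := by omega
      have e2 : k + fibLeaves h + fibLeaves (h - 1) = k + fibLeaves (h + 1) := by omega
      have e3 : (PTree.node f T₁ T₂).leafAddrs.getLastD 0 = T₂.leafAddrs.getLastD 0 := by
        have := T₂.leafAddrs_ne_nil
        rw [PTree.leafAddrs, List.getLastD_eq_getLast?, List.getLastD_eq_getLast?,
          List.getLast?_append_of_ne_nil _ this]
      rw [e1, e2] at s4
      rw [e3]
      exact s4
    · rw [v4 v hv, v3 v (by omega), v2 v hv, v1 v hv]

end PTree

end Build

/-! ### Assembling the structure in the preprocessing phase -/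

section Preprocessing

variable {κ : IntervalKind} {n : ℕ} {R : IntervalSet κ n} {π : Equiv.Perm (Fin n)}

open PTree

/-- Computes the height of the smallest Fibonacci tree with a leaf for each bottom interval. -/
def chooseHeight : Cmd :=
  20 ≔ 1 ;; 21 ≔ 1 ;; 32 ≔ 0 ;;
  .loop (.le (v#20 + 1) (v#0 - v#46))
    (22 ≔ v#20 + v#21 ;; 21 ≔ v#20 ;; 20 ≔ v#22 ;; 32 ≔ v#32 + 1)

/-- The loop ends at the first height with enough leaves. Each continued iteration starts with fewer
than `nb` leaves, so after the at most doubling increase there are at most `2 * nb`. -/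
theorem height_loop_runs {inp : Input} {nb : ℕ} (k h : ℕ) (σ : Store) (h20 : σ.var 20 = fibLeaves h)
    (h21 : σ.var 21 = fibLeaves (h - 1)) (h32 : σ.var 32 = h) (hnb : σ.var 0 - σ.var 46 = nb)
    (hk : nb ≤ fibLeaves h + k) (hle : fibLeaves h ≤ 2 * nb) :
    Runs inp (.loop (.le (v#20 + 1) (v#0 - v#46))
      (22 ≔ v#20 + v#21 ;; 21 ≔ v#20 ;; 20 ≔ v#22 ;; 32 ≔ v#32 + 1)) σ (9 * k + 3) fun σ' =>
      nb ≤ fibLeaves (σ'.var 32) ∧ fibLeaves (σ'.var 32) ≤ 2 * nb := by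
  by_cases hlt : fibLeaves h < nb
  swap
  · refine .loop_done (by simp [h20, hnb]; omega) (by simp [Test.cost, Expr.cost]) ?_
    rw [h32]
    exact ⟨by omega, hle⟩
  have hpos := fibLeaves_pos (h - 1)
  have hsucc := fibLeaves_succ h
  have hle' := fibLeaves_succ_le h
  induction k generalizing h σ with
  | zero => omega
  | succ k ih =>
    refine .loop_step (t₁ := 6) (t₂ := 9 * k + 3) (by simp [h20, hnb]; omega)
      (Runs.eval (by simp) (by decide) ?_) (by simp [Test.cost, Expr.cost]; omega)
    by_cases hlt' : fibLeaves (h + 1) < nb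
    · refine ih (h + 1) _ ?_ ?_ ?_ ?_ (by omega) (by omega) hlt' (fibLeaves_pos _)
        (fibLeaves_succ _) (fibLeaves_succ_le _)
      · simp [h20, h21, hsucc]
      · simp [h20]
      · simp [h32]
      · simpa using hnb
    · refine .loop_done ?_ (by simp [Test.cost, Expr.cost]) ?_
      · simp [h20, h21, hnb]
        omega
      · simp [h32]
        omega

/-- The first interval in `π` has nothing before it. Its existence is needed because a leaf-based
tree has at least one leaf, and dummies may not outnumber bottom intervals. -/
theorem exists_isBottom (π : Equiv.Perm (Fin n)) (hn : 0 < n) : ∃ i, IsBottom R π i := by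
  refine ⟨π.symm ⟨0, hn⟩, Finset.eq_singleton_iff_unique_mem.2
    ⟨self_mem_contactSet R π _, fun j hj => ?_⟩⟩
  have h := (mem_contactSet.1 hj).1
  rw [Equiv.apply_symm_apply, Fin.le_def] at h
  rw [Equiv.eq_symm_apply, Fin.ext_iff]
  exact Nat.le_zero.1 h

def initBuild : Cmd :=
  33 ≔ 0 ;; 34 ≔ 1 ;; 35 ≔ 0 ;; 36 ≔ 0 ;; 37 ≔ 0 ;; 1 ≔ v#6

def buildTree : Cmd :=
  chooseHeight ;; initBuild ;; .loop (.le 1 v#34) buildStep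

/-- Labels of the leaves: the given intervals, followed by dummies. -/
def padLabels (bs : List (Fin n)) (j : ℕ) : ℕ := (bs.map Fin.val).getD j n

theorem padLabels_of_lt {bs : List (Fin n)} {j : ℕ} (h : j < bs.length) :
    padLabels bs j = bs[j] := by
  simp [padLabels, List.getD, h]

theorem padLabels_of_le {bs : List (Fin n)} {j : ℕ} (h : bs.length ≤ j) : padLabels bs j = n := by
  simp [padLabels, List.getD, h]

theorem map_padLabels (bs : List (Fin n)) {F : ℕ} (hF : bs.length ≤ F) :
    (List.range F).map (fun j => padLabels bs (0 + j)) =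
      bs.map Fin.val ++ List.replicate (F - bs.length) n := by
  refine List.ext_getElem (by simp; omega) fun j h1 h2 => ?_
  rw [List.getElem_map, List.getElem_range, zero_add]
  by_cases hj : j < bs.length
  · rw [List.getElem_append_left (by simpa using hj), padLabels_of_lt hj, List.getElem_map]
  · rw [List.getElem_append_right (by simpa using hj), padLabels_of_le (by omega),
      List.getElem_replicate]

theorem Prepared.buildEnv {bs os : List (Fin n)} {σ : Store} (h : Prepared R π bs os σ) :
    BuildEnv n bs.length (padLabels bs) σ := by
  refine ⟨h.layout.var0, h.layout.var2, h.layout.var44, h.cursor, fun j hj => ?_, fun j hj => ?_,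
    fun j hj => padLabels_of_le hj, fun i j hij hj => ?_⟩
  · rw [h.bottoms j hj, padLabels_of_lt hj]
  · rw [padLabels_of_lt hj]
    exact Fin.is_lt _
  · rw [padLabels_of_lt hj, padLabels_of_lt (hij.trans hj)]
    have := List.pairwise_iff_getElem.1 h.bottoms_sorted i j (hij.trans hj) hj hij
    intro e
    rw [Fin.ext e] at this
    exact this.ne rfl

/-- The tree lies above all arrays, and below its own records its construction writes only leaf
pointers, so anchors and the list of non-bottom intervals are preserved. -/
theorem Prepared.holdsXi {bs os : List (Fin n)} {σ σ' : Store} {T : PTree} {h : ℕ}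
    (hP : Prepared R π bs os σ) (hv : ∀ v, v ≠ 1 → v < 6 → σ'.var v = σ.var v)
    (h1 : σ'.var 1 = 20 * n + 7) (h6 : σ'.var 6 + 6 = 20 * n + 7 + 12 * fibLeaves h)
    (hh : bs.length ≤ fibLeaves h) (hh' : fibLeaves h ≤ 2 * bs.length)
    (hB : Built bs.length (padLabels bs) h 0 (20 * n + 7) 0 0 σ.mem σ'.mem T) :
    HoldsXi R π σ' := by
  obtain ⟨l0, l2, l3, l4, -⟩ := hP.layout
  have hlt := hP.buildEnv.lab_lt
  have hos : os.length ≤ n := by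
    have h : os.Nodup := hP.others_sorted.imp fun h => fun e => h.ne (by rw [e])
    simpa using h.length_le_card
  have hpos := fibLeaves_pos h
  have fr : ∀ z, n < z → z < 20 * n + 7 → σ'.mem z = σ.mem z := by
    intro z hz hz'
    refine hB.frame z hz' (fun h => absurd h (lt_irrefl 0)) fun j _ hj => ?_
    have := hlt _ hj
    omega
  obtain ⟨hst, hpar⟩ := (rep_iff 0 T).1 hB.rep
  refine ⟨T, bs, os, fibLeaves h - bs.length, hP.mem_bottoms, hP.bottoms_sorted, hP.mem_others,
    hP.others_sorted, hB.fib, hB.labels.trans (map_padLabels bs hh), by omega,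
    (hv 0 (by omega) (by omega)).trans l0, h1.trans hB.addr.symm, hst, hpar,
    (linkedLeaves_iff _ _ _).2 hB.links, ?_, ?_, (hv 5 (by omega) (by omega)).trans hP.count, ?_,
    ?_, ?_⟩
  · intro i hi
    obtain ⟨j, hj, rfl⟩ := List.mem_iff_getElem.1 hi
    have := hB.ptr j (by omega) (by omega)
    rw [zero_add, padLabels_of_lt hj] at this
    rwa [hv 2 (by omega) (by omega), l2]
  · intro i hi
    obtain ⟨a, ha, ha'⟩ := hP.anchor i ((hP.mem_others i).1 hi)
    have := i.2
    refine ⟨a, ha, ?_⟩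
    rw [hv 3 (by omega) (by omega), l3, fr _ (by omega) (by omega), ha']
  · intro k hk
    rw [hv 4 (by omega) (by omega), l4, fr _ (by omega) (by omega), hP.others k hk]
  · rw [hv 2 (by omega) (by omega), hv 3 (by omega) (by omega), hv 4 (by omega) (by omega), l2, l3,
      l4, List.pairwise_append]
    refine ⟨(sep_iff_blocks T).2 hB.sep, ?_, ?_⟩
    · simp [DisjointBlocks]
      omega
    · intro b hb c hc
      obtain ⟨p, hp, rfl⟩ := List.mem_map.1 hb
      have := hB.bounds p hp
      right
      simp only [List.mem_cons, List.not_mem_nil, or_false] at hc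
      rcases hc with rfl | rfl | rfl <;> (simp only; omega)
  · rw [hv 2 (by omega) (by omega), hv 3 (by omega) (by omega), hv 4 (by omega) (by omega), l2, l3,
      l4]
    intro b hb
    rcases List.mem_append.1 hb with hb | hb
    · obtain ⟨p, hp, rfl⟩ := List.mem_map.1 hb
      have := hB.bounds p hp
      simp only
      omega
    · simp only [List.mem_cons, List.not_mem_nil, or_false] at hb
      rcases hb with rfl | rfl | rfl <;> (simp only; omega)

theorem buildTree_runs {inp : Input} (hn : 0 < n) {bs os : List (Fin n)} {σ : Store}
    (hP : Prepared R π bs os σ) :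
    Runs inp buildTree σ (260 * n) fun σ' => HoldsXi R π σ' ∧ σ'.var 6 ≤ 51 * n := by
  have hcur := hP.cursor
  have h0 := hP.layout.var0
  have hbs : 0 < bs.length := by
    obtain ⟨i, hi⟩ := exists_isBottom (R := R) π hn
    exact List.length_pos_of_mem ((hP.mem_bottoms i).2 hi)
  have hchoose : Runs inp chooseHeight σ (9 * n + 3) fun σ' =>
      bs.length ≤ fibLeaves (σ'.var 32) ∧ fibLeaves (σ'.var 32) ≤ 2 * bs.length := by
    refine .seq' (t₁ := 1) (t₂ := 9 * (bs.length - 1) + 5) (.eval (by simp) (by decide) ?_) (by omega)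
    refine .seq' (t₁ := 1) (t₂ := 9 * (bs.length - 1) + 4) (.eval (by simp) (by decide) ?_) (by omega)
    refine .seq' (t₁ := 1) (t₂ := 9 * (bs.length - 1) + 3) (.eval (by simp) (by decide) ?_) (by omega)
    refine height_loop_runs (bs.length - 1) 0 _ ?_ ?_ ?_ ?_ ?_ ?_
    · simp [fibLeaves_zero]
    · simp [fibLeaves_zero]
    · simp
    · simp [h0]
      omega
    · rw [fibLeaves_zero]
      omega
    · rw [fibLeaves_zero]
      omega
  obtain ⟨σ₁, t₁, hx₁, ht₁, ⟨a1, a2⟩, v1, m1⟩ :=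
    hchoose.frame_mem (by simp [chooseHeight, Cmd.ReadOnly])
  obtain ⟨σ₂, t₂, hx₂, ht₂, ⟨b33, b34, b35, b36, b37, b1, b6, b32⟩, v2, m2⟩ :
      Runs inp initBuild σ₁ 6 fun σ' => (σ'.var 33 = 0 ∧ σ'.var 34 = 1 ∧ σ'.var 35 = 0 ∧
        σ'.var 36 = 0 ∧ σ'.var 37 = 0 ∧ σ'.var 1 = σ₁.var 6 ∧ σ'.var 6 = σ₁.var 6 ∧
        σ'.var 32 = σ₁.var 32) ∧
        (∀ v, v ∉ initBuild.assigned → σ'.var v = σ₁.var v) ∧ σ'.mem = σ₁.mem :=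
    Runs.frame_mem (Runs.eval (by simp [initBuild]) (by decide) (by simp [initBuild]))
      (by simp [initBuild, Cmd.ReadOnly])
  have hv : ∀ v, v ∉ [1, 20, 21, 22, 32, 33, 34, 35, 36, 37] → σ₂.var v = σ.var v := by
    intro v hv
    simp only [List.mem_cons, List.not_mem_nil, not_or] at hv
    rw [v2 v (by simp [initBuild, Cmd.assigned]; omega),
      v1 v (by simp [chooseHeight, Cmd.assigned]; omega)]
  have hm : σ₂.mem = σ.mem := m2.trans m1
  have e6 : σ₂.var 6 = 20 * n + 7 := by rw [hv 6 (by decide), hP.layout.var6]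
  have henv : BuildEnv n bs.length (padLabels bs) σ₂ := by
    obtain ⟨c0, c2, c44, c46, cm, clt, ceq, cinj⟩ := hP.buildEnv
    have e46 := hv 46 (by decide)
    refine ⟨by rw [hv 0 (by decide), c0], by rw [hv 2 (by decide), c2],
      by rw [hv 44 (by decide), c44], by rw [e46, c46], ?_, clt, ceq, cinj⟩
    rw [e46, hm]
    exact cm
  obtain ⟨T, σ₃, r3, ⟨h', q', s3⟩, -, v3, hB⟩ := build_reaches (inp := inp) (σ₁.var 32) 0
    (20 * n + 7) 0 0 0 σ₂ henv ⟨b34, b32, b33, e6, b35, b36, b37⟩ (by omega) (.inl rfl)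
  -- When the whole tree is complete, one more pop meets the empty stack and stops the loop.
  have hpop : Runs inp (.loop (.le 1 v#34) buildStep) σ₃ 40 fun σ' =>
      σ'.mem = σ₃.mem ∧ ∀ v, v ≠ 34 → σ'.var v = σ₃.var v := by
    have g34 := s3.mode
    have g36 := s3.stack
    refine .loop_step (t₁ := 36) (t₂ := 1) (by simp [g34])
      (.eval (by simp [buildStep, pushNode, placeLeaf, popNode]) (by decide)
        (.loop_done ?_ (by decide) ⟨?_, ?_⟩)) (by decide)
    · simp [buildStep, popNode, g34, g36]
    · simp [buildStep, popNode, g34, g36]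
    · intro v h
      simp [buildStep, popNode, g34, g36, h]
  obtain ⟨σ₄, t₄, hx₄, ht₄, m4, v4⟩ := r3 _ _ hpop
  refine ⟨σ₄, t₁ + (t₂ + t₄), .seq hx₁ (.seq hx₂ hx₄), by omega, ?_, ?_⟩
  · refine hP.holdsXi (T := T) (h := σ₁.var 32) ?_ ?_ ?_ a1 a2 ?_
    · intro v h1 h2
      rw [v4 v (by omega), v3 v (by omega), hv v (by simp; omega)]
    · rw [v4 1 (by omega), v3 1 (by omega), b1, ← b6, e6]
    · rw [v4 6 (by omega), s3.free]
      omega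
    · rw [m4, ← hm]
      exact hB
  · rw [v4 6 (by omega), s3.free]
    omega

def preprocess (κ : IntervalKind) : Cmd :=
  prepare κ ;; buildTree

theorem preprocess_runs (hn : 0 < n) (hπ : IsLevelPermutation R π) :
    ∃ (σ : Store) (t : ℕ), Exec R.preInput (preprocess κ) (initStore n) σ t ∧ HoldsXi R π σ ∧
      (σ.var 6 : ℝ) ≤ 51 * n ∧ (t : ℝ) ≤ 2600 * (n * Real.logb 2 n + 1) := by
  obtain ⟨σ, t, hx, ht, hXi, h6⟩ : Runs R.preInput (preprocess κ) (initStore n)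
      (104 * (n * Nat.log 2 n) + 1880 * n + 520) fun σ' => HoldsXi R π σ' ∧ σ'.var 6 ≤ 51 * n := by
    refine .seq' (t₂ := 260 * n) ((prepare_runs hπ).imp ?_) (by omega)
    rintro σ' ⟨bs, os, hP⟩
    exact buildTree_runs hn hP
  refine ⟨σ, t, hx, hXi, by exact_mod_cast h6, ?_⟩
  have hlog : (Nat.log 2 n : ℝ) ≤ Real.logb 2 n := by
    simpa using Real.natLog_le_logb n 2
  have ht' : (t : ℝ) ≤ 104 * (n * Nat.log 2 n) + 1880 * n + 520 := by exact_mod_cast ht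
  have h1 : (n : ℝ) * Nat.log 2 n ≤ n * Real.logb 2 n := by gcongr
  -- Absorbs the linear terms; the summand `1` is needed for `n = 1`, where the logarithm vanishes.
  have h2 : (n : ℝ) ≤ n * Real.logb 2 n + 1 := by
    rcases Nat.lt_or_ge n 2 with h | h
    · obtain rfl : n = 1 := by omega
      simp
    · have h3 : (1 : ℝ) ≤ Real.logb 2 n := by
        rw [Real.le_logb_iff_rpow_le (by norm_num) (by positivity)]
        exact_mod_cast (by simpa using h)
      nlinarith [(Nat.cast_nonneg n : (0 : ℝ) ≤ n)]
  have h4 : (0 : ℝ) ≤ n * Nat.log 2 n := by positivity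
  linarith

end Preprocessing

end ImpreciseSort

theorem mainTheorem4 (κ : ImpreciseSort.IntervalKind) :
    -- the level permutation is well defined
    (∀ (n : ℕ) (R : ImpreciseSort.IntervalSet κ n),
      ∃! π : Equiv.Perm (Fin n), ImpreciseSort.IsLevelPermutation R π) ∧
    -- preprocessing and reconstruction
    (∃ (prep recon : ImpreciseSort.Cmd) (C : ℝ),
      ∀ (n : ℕ), 0 < n → ∀ (R : ImpreciseSort.IntervalSet κ n) (π : Equiv.Perm (Fin n)),
        ImpreciseSort.IsLevelPermutation R π →
          (∃ (σ : ImpreciseSort.Store) (t : ℕ),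
            ImpreciseSort.Exec R.preInput prep (ImpreciseSort.initStore n) σ t ∧
            ImpreciseSort.HoldsXi R π σ ∧
            (σ.var 6 : ℝ) ≤ C * n ∧
            (t : ℝ) ≤ C * (n * Real.logb 2 n + 1)) ∧
          (∀ σ : ImpreciseSort.Store, ImpreciseSort.HoldsXi R π σ →
            ∀ x : Fin n → ℝ, R.Realizes x →
              ∃ (σ' : ImpreciseSort.Store) (t : ℕ),
                ImpreciseSort.Exec (R.fullInput x) recon σ σ' t ∧
                ImpreciseSort.HoldsAVLTree x σ' ∧
                (t : ℝ) ≤ C * (ImpreciseSort.ambiguity R π + 1))) ∧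
    -- tightness, for every program and every auxiliary structure that does not depend on the points
    (∃ c : ℝ, 0 < c ∧
      ∀ (n : ℕ), 0 < n → ∀ (R : ImpreciseSort.IntervalSet κ n), R.NoTouching →
        ∀ π : Equiv.Perm (Fin n), ImpreciseSort.IsLevelPermutation R π →
          ∀ (alg : ImpreciseSort.Cmd) (σ : ImpreciseSort.Store),
            (∀ x : Fin n → ℝ, R.Realizes x →
              ∃ (σ' : ImpreciseSort.Store) (t : ℕ),
                ImpreciseSort.Exec (R.fullInput x) alg σ σ' t ∧
                ImpreciseSort.HoldsAVLTree x σ') →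
            ∃ x : Fin n → ℝ, R.Realizes x ∧
              ∀ (σ' : ImpreciseSort.Store) (t : ℕ),
                ImpreciseSort.Exec (R.fullInput x) alg σ σ' t →
                  c * ImpreciseSort.ambiguity R π ≤ (t : ℝ)) := by
  -- The reconstruction constant `12900` also dominates the size constant `51` and the time constant
  -- `2600` of the preprocessing phase.
  refine ⟨fun n R => ImpreciseSort.existsUnique_isLevelPermutation R,
    ⟨ImpreciseSort.preprocess κ, ImpreciseSort.reconstruct, 12900, fun n hn R π hπ => ⟨?_, ?_⟩⟩,
    1 / 18, by norm_num, fun n _ R hR π hπ alg σ halg =>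
      ImpreciseSort.exists_slow_input R hR π hπ alg σ halg⟩
  · obtain ⟨σ, t, h1, h2, h3, h4⟩ := ImpreciseSort.preprocess_runs hn hπ
    have hn1 : (1 : ℝ) ≤ n := by exact_mod_cast hn
    have hlog : 0 ≤ (n : ℝ) * Real.logb 2 n :=
      mul_nonneg (by linarith) (Real.logb_nonneg (by norm_num) hn1)
    exact ⟨σ, t, h1, h2, by linarith, by linarith⟩
  · exact fun σ h x hx => ImpreciseSort.reconstruct_runs hπ h hx
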